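/- Fix an integer $m\ge 1$. Let $R=\begin{pmatrix}0&-1&0\\1&0&0\\0&0&0\end{pmatrix}$, $\vec k={}^t(0,0,1)$, $\mathbb T^1=\mathbb R/2\pi\mathbb Z$ (with the quotient distance), and let $(r,\theta)$ be polar coordinates on $\mathbb R^2$. Let $\Sigma_m$ be the set of maps $u=e^{m\theta R}v(r):\mathbb R^2\to\mathbb S^2\subset\mathbb R^3$ in $\dot H^1(\mathbb R^2)$ (taken in their continuous representative) with $v(0)=-\vec k$, $v(\infty)=\vec k$, with metric $\|u-\tilde u\|_{\dot H^1}=\|\nabla(u-\tilde u)\|_{L^2}$. Put $\mathcal E(u)=\frac12\int_{\mathbb R^2}|\nabla u|^2dx$ and $\delta(u)=\sqrt{\mathcal E(u)-4\pi m}$. Let $h_1=\frac{2r^m}{r^{2m}+1}$, $h_3=\frac{r^{2m}-1}{r^{2m}+1}$, $h={}^t(h_1,0,h_3)$, $Q=e^{m\theta R}h(r)$, and $\mathcal O_m=\{e^{\alpha R}Q(\cdot/s): s>0,\ \alpha\in\mathbb T^1\}$. We say that $(s_*,\alpha_*)\in(0,\infty)\times\mathbb T^1$ are closest parameters for $u$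 if $\operatorname{dist}_{\dot H^1}(u,\mathcal O_m)=\|u-e^{\alpha_*R}Q(\cdot/s_*)\|_{\dot H^1}$. For $u\in\Sigma_m$, $s>0$, $\alpha\in\mathbb T^1$ write $e^{-\alpha R}v(s\,\cdot)=z_1\boldsymbol j+z_2J^h\boldsymbol j+(1+\gamma)h$ with $\boldsymbol j={}^t(0,1,0)$, $J^h\boldsymbol j={}^t(-h_3,0,h_1)$, and $z=z_1+iz_2$. Let $\dot H^1_e$ be the space of functions $(0,\infty)\to\mathbb C$ of finite norm for the inner product $\langle f,g\rangle_{\dot H^1_e}=\int_0^\infty\big(f_r\overline{g_r}+\frac{m^2}{r^2}f\overline g\big)r\,dr$. There exist $\delta_0>0$ and $C>0$, and for each $u\in\Sigma_m$ with $\delta=\delta(u)<\delta_0$ a pair $(s(u),\alpha(u))\in(0,\infty)\times\mathbb T^1$, such that the following hold. (i) For each $u\in\Sigma_m$ with $\delta=\delta(u)<\delta_0$, closest parameters exist; with $(s,\alpha)=(s(u),\alpha(u))$ one has $z\in\dot H^1_e$ and $\langle z,h_1\rangle_{\dot H^1_e}=0$; and $\left|\frac{s}{s_*}-1\right|+|\alpha-\alpha_*|\le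 C\delta$ for all closest parameters $(s_*,\alpha_*)$ for $u$. (ii) For such $u$, if $(\tilde s,\tilde\alpha)\in(0,\infty)\times\mathbb T^1$ satisfies $\langle z,h_1\rangle_{\dot H^1_e}=0$ (with $z$ defined by $\tilde s,\tilde\alpha$) and $\left|\frac{\tilde s}{s_*}-1\right|+|\tilde\alpha-\alpha_*|\le C\delta_0$ for some closest parameters $(s_*,\alpha_*)$ for $u$, then $(\tilde s,\tilde\alpha)=(s(u),\alpha(u))$. (iii) Let $I\subset\mathbb R$ be an open interval and $u\in C(I;\Sigma_m)$ with $\delta(u(t))<\delta_0$ for all $t\in I$. Since maps into the sphere are not in $L^2(\mathbb R^2)$, $u\in C^1(I;L^2)$, resp. $u\in W^{1,\infty}(I;L^2)$, means that $t\mapsto u(t)-w$ is in $C^1(I;L^2(\mathbb R^2))$, resp. $W^{1,\infty}(I;L^2(\mathbb R^2))$, for some map $w$ on $\mathbb R^2$ independent of $t$. If $u\in C^1(I;L^2)$, then $s(u(t))$ and $\alpha(u(t))$ are $C^1$ on $I$ (for $\alpha$: it has a $C^1$ real-valued lift). If $u\in W^{1,\infty}(I;L^2)$, then $s(u(t))$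 is continuous and belongs to $W^{1,\infty}(I;\mathbb R)$, and $\alpha(u(t))$ has a continuous lift $a:I\to\mathbb R$ such that, on every open interval $J\subset I$ with $\inf_{t\in J}s(u(t))>0$ (in particular on every open interval $J$ whose closure is a compact subset of $I$), $a$ has a weak derivative in $L^\infty(J)$, and $a\in W^{1,\infty}(J;\mathbb R)$ if $J$ is bounded. -/

import Mathlib

open MeasureTheory Filter Topology Set
open scoped ContDiff ENNReal

namespace EquivariantMaps

noncomputable section

/-- The Euclidean plane. -/
abbrev Plane : Type := EuclideanSpace ℝ (Fin 2)

/-- Euclidean three-space. -/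
abbrev Space : Type := EuclideanSpace ℝ (Fin 3)

/-! ### Weak derivatives, the homogeneous Sobolev distance and the energy -/

/-- `g` is the weak partial derivative of `u` in the `j`-th coordinate direction. -/
def IsWeakPartial (j : Fin 2) (u g : Plane → Space) : Prop :=
  ∀ φ : Plane → ℝ, ContDiff ℝ ∞ φ → HasCompactSupport φ →
    ∫ x, (fderiv ℝ φ x (EuclideanSpace.single j 1)) • u x = -∫ x, φ x • g x

/-- `G` is a square-integrable weak gradient of `u`. -/
def IsWeakGradient (u : Plane → Space) (G : Fin 2 → Plane → Space) : Prop :=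
  ∀ j, MemLp (G j) 2 volume ∧ IsWeakPartial j u (G j)

/-- Membership in the homogeneous Sobolev space of the plane, with values in three-space. -/
def MemHdot (u : Plane → Space) : Prop :=
  LocallyIntegrable u volume ∧ ∃ G, IsWeakGradient u G

open Classical in
/-- The weak gradient (unique up to null sets); zero if there is none in `L²`. -/
def weakGrad (u : Plane → Space) : Fin 2 → Plane → Space :=
  if h : ∃ G, IsWeakGradient u G then h.choose else 0

/-- The integral of `|∇u|²`. -/
def dirichlet (u : Plane → Space) : ℝ := ∫ x, ∑ j, ‖weakGrad u j x‖ ^ 2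

/-- The energy, one half of the integral of `|∇u|²`. -/
def energy (u : Plane → Space) : ℝ := (1 / 2) * dirichlet u

/-- The distance `‖u - w‖` in the homogeneous Sobolev space. -/
def hdist (u w : Plane → Space) : ℝ := Real.sqrt (dirichlet (u - w))

/-! ### Equivariant maps -/

/-- The rotation `e^{αR}` by the angle `α` about the third axis. -/
def rot (α : Real.Angle) (y : Space) : Space :=
  !₂[α.cos * y 0 - α.sin * y 1, α.sin * y 0 + α.cos * y 1, y 2]

/-- The polar angle of a point of the plane. -/
def polarAngle (x : Plane) : Real.Angle := ((Complex.arg ⟨x 0, x 1⟩ : ℝ) : Real.Angle)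

/-- The map `e^{mθR} v(r)`, in polar coordinates `(r, θ)`. -/
def equivariantMap (m : ℕ) (v : ℝ → Space) (x : Plane) : Space :=
  rot (m • polarAngle x) (v ‖x‖)

/-- The profile of a map: its restriction to the ray `θ = 0`. If `u = e^{mθR} v(r)` this is
the function `v` on `[0, ∞)`. -/
def profile (u : Plane → Space) (r : ℝ) : Space := u !₂[r, 0]

/-- The third unit vector. -/
def kVec : Space := !₂[0, 0, 1]

/-- The class of `m`-equivariant maps `u = e^{mθR} v(r)` from the plane to the unit sphere, with
square-integrable weak gradient, `v(0) = -k` and `v(∞) = k`. An `m`-equivariant map of finite energy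
has a continuous representative, and it is this representative which is meant. -/
structure IsSigma (m : ℕ) (u : Plane → Space) : Prop where
  sphere : ∀ x, ‖u x‖ = 1
  equivariant : u = equivariantMap m (profile u)
  continuous : Continuous u
  memHdot : MemHdot u
  limit_zero : Tendsto (profile u) (𝓝[>] 0) (𝓝 (-kVec))
  limit_infty : Tendsto (profile u) atTop (𝓝 kVec)

/-- `δ = √(E(u) - 4πm)`. -/
def excess (m : ℕ) (u : Plane → Space) : ℝ := Real.sqrt (energy u - 4 * Real.pi * m)

/-! ### The harmonic maps -/

/-- `h₁(r) = 2 r^m / (r^{2m} + 1)`. -/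
def h₁ (m : ℕ) (r : ℝ) : ℝ := 2 * r ^ m / (r ^ (2 * m) + 1)

/-- `h₃(r) = (r^{2m} - 1) / (r^{2m} + 1)`. -/
def h₃ (m : ℕ) (r : ℝ) : ℝ := (r ^ (2 * m) - 1) / (r ^ (2 * m) + 1)

/-- The profile `h = (h₁, 0, h₃)`. -/
def hProfile (m : ℕ) (r : ℝ) : Space := !₂[h₁ m r, 0, h₃ m r]

/-- The harmonic map `e^{αR} Q(x / s)`, where `Q = e^{mθR} h(r)`. -/
def harmonicMap (m : ℕ) (s : ℝ) (α : Real.Angle) (x : Plane) : Space :=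
  rot α (equivariantMap m (hProfile m) (s⁻¹ • x))

/-- The distance from `u` to the family of harmonic maps. -/
def distHarmonic (m : ℕ) (u : Plane → Space) : ℝ :=
  sInf {d : ℝ | ∃ s > 0, ∃ α : Real.Angle, d = hdist u (harmonicMap m s α)}

/-- `(s, α)` are parameters of a closest harmonic map to `u`. -/
def IsClosest (m : ℕ) (u : Plane → Space) (s : ℝ) (α : Real.Angle) : Prop :=
  0 < s ∧ distHarmonic m u = hdist u (harmonicMap m s α)

/-! ### The modulation condition -/

/-- The vector `j = (0, 1, 0)`. -/
def jVec : Space := !₂[0, 1, 0]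

/-- The vector `J^h j = h × j = (-h₃, 0, h₁)`. -/
def JhjVec (m : ℕ) (r : ℝ) : Space := !₂[-h₃ m r, 0, h₁ m r]

/-- The function `z = z₁ + i z₂`, where `z₁`, `z₂` are the coefficients of `j`, `J^h j` in the
expansion `e^{-αR} v(s r) = z₁ j + z₂ J^h j + (1 + γ) h` in the orthonormal basis `{j, J^h j, h}`. -/
def zCoord (m : ℕ) (u : Plane → Space) (s : ℝ) (α : Real.Angle) (r : ℝ) : ℂ :=
  ⟨inner ℝ (rot (-α) (profile u (s * r))) jVec,
    inner ℝ (rot (-α) (profile u (s * r))) (JhjVec m r)⟩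

/-- `∫₀^∞ (f_r \bar g_r + (m²/r²) f \bar g) r dr`, the inner product of the weighted space of
functions on the half-line. -/
def innerHe (m : ℕ) (f g : ℝ → ℂ) : ℂ :=
  ∫ r in Ioi (0 : ℝ), (deriv f r * (starRingEnd ℂ) (deriv g r)
    + ((m : ℂ) ^ 2 / (r : ℂ) ^ 2) * (f r * (starRingEnd ℂ) (g r))) * (r : ℂ)

/-- `⟨z, h₁⟩ = 0`. -/
def Orthogonal (m : ℕ) (u : Plane → Space) (s : ℝ) (α : Real.Angle) : Prop :=
  innerHe m (zCoord m u s α) (fun r => (h₁ m r : ℂ)) = 0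

/-! ### Functions of one real variable with values in a Banach space -/

section Time

variable {E : Type*} [NormedAddCommGroup E] [NormedSpace ℝ E]

/-- `g` is the weak derivative of `f` on the open set `I`. -/
def HasWeakDerivOn (I : Set ℝ) (f g : ℝ → E) : Prop :=
  ∀ φ : ℝ → ℝ, ContDiff ℝ ∞ φ → HasCompactSupport φ → tsupport φ ⊆ I →
    ∫ t in I, deriv φ t • f t = -∫ t in I, φ t • g t

/-- `f` has an essentially bounded weak derivative on `I`. -/
def HasBoundedWeakDeriv (I : Set ℝ) (f : ℝ → E) : Prop :=
  ∃ g : ℝ → E, MemLp g ∞ (volume.restrict I) ∧ HasWeakDerivOn I f g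

/-- The Sobolev space `W^{1,∞}(I; E)`. -/
def MemW1Inf (I : Set ℝ) (f : ℝ → E) : Prop :=
  MemLp f ∞ (volume.restrict I) ∧ HasBoundedWeakDeriv I f

end Time

/-- `f` lies in the weighted space with inner product `innerHe`: it is continuous, its pointwise
derivative is its weak derivative, and both terms of its squared norm are finite. -/
structure MemHe (f : ℝ → ℂ) : Prop where
  continuousOn : ContinuousOn f (Ioi 0)
  weakDeriv : HasWeakDerivOn (Ioi 0) f (deriv f)
  integrable_deriv : IntegrableOn (fun r => ‖deriv f r‖ ^ 2 * r) (Ioi 0)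
  integrable_div : IntegrableOn (fun r => ‖f r‖ ^ 2 / r ^ 2 * r) (Ioi 0)

/-- `u ∈ C(I; Σ_m)`, for the distance `hdist`. -/
def ContInSigma (m : ℕ) (I : Set ℝ) (u : ℝ → Plane → Space) : Prop :=
  (∀ t ∈ I, IsSigma m (u t)) ∧
    ∀ t₀ ∈ I, Tendsto (fun t => hdist (u t) (u t₀)) (𝓝[I] t₀) (𝓝 0)

/-- The curve `u` is `F` as an `L²`-valued curve on `I`, up to a map `w` independent of time.
(A map with values in the sphere is not itself in `L²` of the plane.) -/
def RepresentsL2 (I : Set ℝ) (u : ℝ → Plane → Space) (w : Plane → Space)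
    (F : ℝ → Lp Space 2 (volume : Measure Plane)) : Prop :=
  ∀ t ∈ I, (fun x => u t x - w x) =ᵐ[volume] F t

/-- `u ∈ C¹(I; L²)`. -/
def IsC1L2 (I : Set ℝ) (u : ℝ → Plane → Space) : Prop :=
  ∃ w F, RepresentsL2 I u w F ∧ ContDiffOn ℝ 1 F I

/-- `u ∈ W^{1,∞}(I; L²)`. -/
def IsW1InfL2 (I : Set ℝ) (u : ℝ → Plane → Space) : Prop :=
  ∃ w F, RepresentsL2 I u w F ∧ MemW1Inf I F

end

end EquivariantMaps

open EquivariantMaps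

/-! In the variable τ = log r an equivariant map becomes a curve V from the line to the sphere
(`logProfile`), scaling becomes translation, and the energy is π∫(|V'|² + m²(V₀² + V₁²))dτ. The weak
gradient on the plane is reduced to V' by averaging over circles (`exists_isLogDeriv`).

Coercivity. Put E = V' − m(k − V₂V), which vanishes for the harmonic profiles. Completing the square
(`norm_sq_defect`) leaves the total derivative 2mV₂', whose integral is 4m, so δ² controls π∫|E|².
At a point σ where V₂ = 0 there is an angle α for which the harmonic profile e^{αR}h(· − σ) agrees
with V. A Grönwall argument started there (`IsDefect.exists_deviation_le`) bounds 1 − ⟨V, e^{αR}h(·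
− σ)⟩ by e^{m|τ−σ|} times a multiple of ∫|E|². Hence the weighted distance `gap`, the integral of
h₁²|V − e^{αR}h(· − σ)|², is O(δ²) for some (σ, α). By the harmonic map equation the squared
distance from u to a harmonic map is exactly 2δ² + 4πm² `gap` (`hdist_sq_eq_gap`). Closest
parameters are therefore the minimizers of `gap`, that is, the maximizers of `overlap`. They exist
because the overlap tends to zero as σ → ±∞ uniformly in the angle, and the distance there is O(δ).

Modulation. Integration by parts turns ⟨z, h₁⟩ = 0 into two scalar equations ∫h₁³z₁ = ∫h₁³z₂ = 0
(`orthogonal_iff`), hence into the zeros of a map `modul` of (σ, α), linear in V and with derivative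
the identity at a harmonic profile (`hasStrictFDerivAt_modul_lh`). Its Lipschitz constant in (σ, α)
is controlled by ∫h₁³|V|, so for u near a harmonic map it differs from the identity by a contraction
of constant 1/2 on a ball of fixed radius. This yields one zero, at a distance bounded by a multiple
of the distance from u to the harmonic map, and its uniqueness in the ball. Harmonic maps close to
each other have close parameters (`exists_separation`), so the zero does not depend on the harmonic
map chosen as the centre (`IsModulScale.exists_isModulParam`).

Regularity in time. For a continuous curve in the class the coefficients of `modul` converge, and
the contraction inequality makes (σ, α) continuous; the angle is then lifted to the line. The
difference of the coefficients for two maps is an L² pairing on the plane with a vector field of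
norm O(e^{−σ}) (`corr_sub_eq_inner`, `norm_kernelLp_le`). If the curve is C¹ in L², `modul` is
jointly strictly differentiable and the implicit function theorem applies. If it is W^{1,∞}, then
|dσ| + |dα| is O(e^{−σ})|dt|: the scale s = e^σ is globally Lipschitz, while the angle is Lipschitz
only where s is bounded below. Boundedness of s holds because the equations of a fixed map have no
approximate solutions at large scales (`exists_le_norm_modul`). -/

namespace EquivariantMaps

/-! ### Locally absolutely continuous functions -/

/-- `f` is a primitive of the locally integrable function `g`. -/
structure IsPrimitive (f g : ℝ → ℝ) : Prop where
  locInt : LocallyIntegrable g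
  sub_eq : ∀ a b, f b - f a = ∫ x in a..b, g x

theorem intervalIntegrable_of_locInt {E : Type*} [NormedAddCommGroup E] {g : ℝ → E}
    (h : LocallyIntegrable g) (a b : ℝ) : IntervalIntegrable g volume a b :=
  intervalIntegrable_iff.mpr <|
    (h.integrableOn_isCompact isCompact_uIcc).mono_set uIoc_subset_uIcc

theorem locInt_of_intervalIntegrable {g : ℝ → ℝ}
    (h : ∀ a b, IntervalIntegrable g volume a b) : LocallyIntegrable g := by
  intro x
  refine ⟨Icc (x - 1) (x + 1), Icc_mem_nhds (by linarith) (by linarith), ?_⟩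
  have := (h (x - 1) (x + 1)).1
  rwa [integrableOn_Icc_iff_integrableOn_Ioc]

namespace IsPrimitive

variable {f g f' g' : ℝ → ℝ}

theorem intervalIntegrable (h : IsPrimitive f g) (a b : ℝ) : IntervalIntegrable g volume a b :=
  intervalIntegrable_of_locInt h.locInt a b

theorem eq_add (h : IsPrimitive f g) (a : ℝ) : f = fun x => f a + ∫ t in a..x, g t := by
  funext x; rw [← h.sub_eq]; ring

theorem ac (h : IsPrimitive f g) (a b : ℝ) : AbsolutelyContinuousOnInterval f a b := by
  have h1 := (h.intervalIntegrable a b).absolutelyContinuousOnInterval_intervalIntegral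
    (c := a) (by simp)
  have h2 : AbsolutelyContinuousOnInterval (fun _ : ℝ => f a) a b :=
    (LipschitzWith.const (f a)).lipschitzOnWith.absolutelyContinuousOnInterval
  rw [h.eq_add a]
  exact h2.add h1

theorem ae_hasDerivAt (h : IsPrimitive f g) : ∀ᵐ x, HasDerivAt f (g x) x := by
  filter_upwards [_root_.LocallyIntegrable.ae_hasDerivAt_integral h.locInt] with x hx
  rw [h.eq_add 0]
  exact (hx 0).const_add _

theorem continuous (h : IsPrimitive f g) : Continuous f := by
  rw [h.eq_add 0]
  exact continuous_const.add
    (intervalIntegral.continuous_primitive (fun a b => h.intervalIntegrable a b) 0)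

/-- The fundamental theorem of calculus for absolutely continuous functions. Together with
`IsPrimitive.ac` it makes being a primitive equivalent to local absolute continuity, which is the
class closed under products. -/
theorem of_ac (h : ∀ a b, AbsolutelyContinuousOnInterval f a b)
    (hd : ∀ᵐ x, HasDerivAt f (g x) x) : IsPrimitive f g := by
  have hg : (fun x => deriv f x) =ᵐ[volume] g := by
    filter_upwards [hd] with x hx using hx.deriv
  refine ⟨locInt_of_intervalIntegrable fun a b => ?_, fun a b => ?_⟩
  · exact (h a b).intervalIntegrable_deriv.congr_ae (ae_restrict_of_ae hg)
  · rw [← (h a b).integral_deriv_eq_sub]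
    exact intervalIntegral.integral_congr_ae (by filter_upwards [hg] with x hx _ using hx)

theorem of_hasDerivAt (h : ∀ x, HasDerivAt f (g x) x) (hg : Continuous g) : IsPrimitive f g :=
  ⟨hg.locallyIntegrable, fun a b => (intervalIntegral.integral_eq_sub_of_hasDerivAt
    (fun x _ => h x) (hg.intervalIntegrable a b)).symm⟩

theorem mul (h : IsPrimitive f g) (h' : IsPrimitive f' g') :
    IsPrimitive (fun x => f x * f' x) (fun x => g x * f' x + f x * g' x) := by
  refine of_ac (fun a b => (h.ac a b).fun_mul (h'.ac a b)) ?_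
  filter_upwards [h.ae_hasDerivAt, h'.ae_hasDerivAt] with x hx hx' using hx.mul hx'

theorem add (h : IsPrimitive f g) (h' : IsPrimitive f' g') :
    IsPrimitive (fun x => f x + f' x) (fun x => g x + g' x) := by
  refine ⟨h.locInt.add h'.locInt, fun a b => ?_⟩
  rw [intervalIntegral.integral_add (h.intervalIntegrable a b) (h'.intervalIntegrable a b),
    ← h.sub_eq, ← h'.sub_eq]; ring

theorem const_mul (h : IsPrimitive f g) (c : ℝ) :
    IsPrimitive (fun x => c * f x) (fun x => c * g x) := by
  refine ⟨h.locInt.smul c, fun a b => ?_⟩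
  rw [intervalIntegral.integral_const_mul, ← h.sub_eq]; ring

theorem neg (h : IsPrimitive f g) : IsPrimitive (fun x => -f x) (fun x => -g x) := by
  simpa using h.const_mul (-1)

theorem sub (h : IsPrimitive f g) (h' : IsPrimitive f' g') :
    IsPrimitive (fun x => f x - f' x) (fun x => g x - g' x) := by
  simpa [sub_eq_add_neg] using h.add h'.neg

theorem const (c : ℝ) : IsPrimitive (fun _ => c) (fun _ => 0) :=
  of_hasDerivAt (fun x => hasDerivAt_const x c) continuous_const

theorem shift (h : IsPrimitive f g) (c : ℝ) :
    IsPrimitive (fun x => f (x + c)) (fun x => g (x + c)) := by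
  refine ⟨locInt_of_intervalIntegrable fun a b => ?_, fun a b => ?_⟩
  · simpa using (h.intervalIntegrable (a + c) (b + c)).comp_add_right c
  · rw [intervalIntegral.integral_comp_add_right, h.sub_eq]

/-- The form in which differential inequalities are integrated: the inequality is only needed almost
everywhere on the interval in question. -/
theorem sub_le (h : IsPrimitive f g) {a b : ℝ} (hab : a ≤ b) {k : ℝ → ℝ} (hk : Integrable k)
    (hle : ∀ᵐ x, x ∈ Icc a b → g x ≤ k x) : f b - f a ≤ ∫ x in a..b, k x := by
  rw [h.sub_eq]
  refine intervalIntegral.integral_mono_ae_restrict hab (h.intervalIntegrable a b)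
    (hk.intervalIntegrable) ?_
  rw [EventuallyLE, ae_restrict_iff' measurableSet_Icc]
  exact hle

theorem integral_eq (h : IsPrimitive f g) (hg : Integrable g) {l₁ l₂ : ℝ}
    (h₁ : Tendsto f atBot (𝓝 l₁)) (h₂ : Tendsto f atTop (𝓝 l₂)) : ∫ x, g x = l₂ - l₁ := by
  have h3 := intervalIntegral_tendsto_integral (l := atTop) hg tendsto_neg_atTop_atBot tendsto_id
  refine tendsto_nhds_unique h3 ?_
  simp_rw [← h.sub_eq]
  exact h₂.sub (h₁.comp tendsto_neg_atTop_atBot)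

end IsPrimitive

/-! ### Functions with a bounded weak derivative -/

section Weak

open scoped Convolution

variable {E : Type*} [NormedAddCommGroup E] [NormedSpace ℝ E] [CompleteSpace E]

/-- Mollification: the derivative of the mollified `F` is the mollification of `G`, hence bounded by
`K`, so the mollified functions are `K`-Lipschitz on compact subintervals. They converge to `F` at
almost every point. -/
theorem lipschitz_ae_of_hasWeakDerivOn {I : Set ℝ} (hI : IsOpen I) (hc : I.OrdConnected)
    {F G : ℝ → E} (hF : LocallyIntegrable (I.indicator F)) {K : ℝ}
    (hG : ∀ᵐ t ∂(volume.restrict I), ‖G t‖ ≤ K) (hw : HasWeakDerivOn I F G) :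
    ∃ N : Set ℝ, volume N = 0 ∧ ∀ t ∈ I, t ∉ N → ∀ t' ∈ I, t' ∉ N → ‖F t - F t'‖ ≤ K * |t - t'| := by
  -- Almost everywhere convergence of the mollifications needs the outer radius to be at most a
  -- fixed multiple, here 2, of the inner one.
  let φ : ℕ → ContDiffBump (0 : ℝ) := fun n =>
    ⟨1 / ((n : ℝ) + 1), 2 * (1 / ((n : ℝ) + 1)), by positivity, by
      have : 0 < 1 / ((n : ℝ) + 1) := by positivity
      linarith⟩
  have hφ : Tendsto (fun n => (φ n).rOut) atTop (𝓝 0) := by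
    have := (tendsto_one_div_add_atTop_nhds_zero_nat (𝕜 := ℝ)).const_mul 2
    simpa [φ] using this
  have hae := ContDiffBump.ae_convolution_tendsto_right_of_locallyIntegrable (μ := volume)
    (l := atTop) (φ := φ) (K := 2) hφ (Eventually.of_forall fun n => le_rfl) hF
  refine ⟨{t | ¬ Tendsto (fun n => ((φ n).normed volume ⋆[ContinuousLinearMap.lsmul ℝ ℝ, volume]
    (I.indicator F)) t) atTop (𝓝 (I.indicator F t))}, hae, ?_⟩
  suffices H : ∀ t ∈ I, ∀ t' ∈ I, t ≤ t' →
      Tendsto (fun n => ((φ n).normed volume ⋆[ContinuousLinearMap.lsmul ℝ ℝ, volume]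
        (I.indicator F)) t) atTop (𝓝 (I.indicator F t)) →
      Tendsto (fun n => ((φ n).normed volume ⋆[ContinuousLinearMap.lsmul ℝ ℝ, volume]
        (I.indicator F)) t') atTop (𝓝 (I.indicator F t')) → ‖F t - F t'‖ ≤ K * |t - t'| by
    intro t ht htN t' ht' htN'
    simp only [mem_ofPred_eq, not_not] at htN htN'
    rcases le_total t t' with h | h
    · exact H t ht t' ht' h htN htN'
    · rw [norm_sub_rev, abs_sub_comm]; exact H t' ht' t ht h htN' htN
  intro t ht t' ht' htt hl hl'
  -- Once the outer radius is below `ε`, every translated bump centred in `[t, t']` is an admissible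
  -- test function on `I`.
  obtain ⟨ε, hε, hsub⟩ := (isCompact_Icc (a := t) (b := t')).exists_cthickening_subset_open hI
    (hc.out ht ht')
  have key : ∀ᶠ n in atTop, ‖((φ n).normed volume ⋆[ContinuousLinearMap.lsmul ℝ ℝ, volume]
        (I.indicator F)) t - ((φ n).normed volume ⋆[ContinuousLinearMap.lsmul ℝ ℝ, volume]
        (I.indicator F)) t'‖ ≤ K * |t - t'| := by
    filter_upwards [hφ.eventually (gt_mem_nhds hε)] with n hn
    have hder : ∀ x, HasDerivAt ((φ n).normed volume ⋆[ContinuousLinearMap.lsmul ℝ ℝ, volume]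
        (I.indicator F)) ((deriv ((φ n).normed volume) ⋆[ContinuousLinearMap.lsmul ℝ ℝ, volume]
        (I.indicator F)) x) x := fun x =>
      (φ n).hasCompactSupport_normed.hasDerivAt_convolution_left _ (φ n).contDiff_normed hF x
    have hb : ∀ x ∈ Icc t t', ‖(deriv ((φ n).normed volume) ⋆[ContinuousLinearMap.lsmul ℝ ℝ, volume]
        (I.indicator F)) x‖ ≤ K := by
      intro x hx
      have hsm : ContDiff ℝ ∞ (fun y => (φ n).normed volume (x - y)) :=
        (φ n).contDiff_normed.comp (contDiff_const.sub contDiff_id)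
      have hcs : HasCompactSupport (fun y => (φ n).normed volume (x - y)) :=
        (φ n).hasCompactSupport_normed.comp_homeomorph (Homeomorph.subLeft x)
      have hts : tsupport (fun y => (φ n).normed volume (x - y)) ⊆ I := by
        refine (closure_minimal (t := Metric.closedBall x (φ n).rOut) ?_
          Metric.isClosed_closedBall).trans ?_
        · intro y hy
          have : x - y ∈ Function.support ((φ n).normed volume) := hy
          rw [(φ n).support_normed_eq, mem_ball_zero_iff] at this
          rw [Metric.mem_closedBall, dist_comm, dist_eq_norm]
          exact this.le
        · refine Subset.trans ?_ hsub
          intro y hy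
          exact Metric.mem_cthickening_of_dist_le y x _ _ hx
            ((Metric.mem_closedBall.1 hy).trans hn.le)
      have h1 := hw _ hsm hcs hts
      have h2 : (deriv ((φ n).normed volume) ⋆[ContinuousLinearMap.lsmul ℝ ℝ, volume]
          (I.indicator F)) x = ∫ y in I, (φ n).normed volume (x - y) • G y := by
        rw [convolution_eq_swap, ← neg_inj, ← h1, ← integral_indicator hI.measurableSet,
          ← integral_neg]
        refine integral_congr_ae (Eventually.of_forall fun y => ?_)
        have hd : deriv (fun y => (φ n).normed volume (x - y)) y
            = -deriv ((φ n).normed volume) (x - y) := deriv_comp_const_sub _ _ _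
        by_cases hy : y ∈ I
        · simp only [ContinuousLinearMap.lsmul_apply, indicator_of_mem hy, hd, neg_smul]
        · simp [indicator_of_notMem hy]
      rw [h2]
      have hint : Integrable (fun y => (φ n).normed volume (x - y)) :=
        hsm.continuous.integrable_of_hasCompactSupport hcs
      calc ‖∫ y in I, (φ n).normed volume (x - y) • G y‖
          ≤ ∫ y in I, (φ n).normed volume (x - y) * K := by
            refine norm_integral_le_of_norm_le (hint.mul_const K).integrableOn ?_
            filter_upwards [hG] with y hy
            rw [norm_smul, Real.norm_of_nonneg ((φ n).nonneg_normed _)]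
            exact mul_le_mul_of_nonneg_left hy ((φ n).nonneg_normed _)
        _ = ∫ y, (φ n).normed volume (x - y) * K := by
            refine setIntegral_eq_integral_of_forall_compl_eq_zero fun y hy => ?_
            rw [image_eq_zero_of_notMem_tsupport (fun h => hy (hts h)), zero_mul]
        _ = K := by
            rw [integral_mul_const,
              integral_sub_left_eq_self (fun y => (φ n).normed volume y) volume x,
              (φ n).integral_normed, one_mul]
    have := (convex_Icc t t').norm_image_sub_le_of_norm_hasDerivWithin_le
      (fun x _ => (hder x).hasDerivWithinAt) hb (right_mem_Icc.2 htt) (left_mem_Icc.2 htt)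
    rwa [Real.norm_eq_abs] at this
  have hlim := (hl.sub hl').norm
  rw [indicator_of_mem ht, indicator_of_mem ht'] at hlim
  exact le_of_tendsto hlim key

end Weak

/-- The lemma of du Bois-Reymond: a vanishing weak derivative is the case `K = 0` of the preceding
lemma, and continuity removes the null set. -/
theorem eq_of_forall_integral_deriv_mul_eq_zero {f : ℝ → ℝ} (hf : Continuous f)
    (h : ∀ ψ : ℝ → ℝ, ContDiff ℝ ∞ ψ → HasCompactSupport ψ → ∫ t, deriv ψ t * f t = 0) (a b : ℝ) :
    f a = f b := by
  obtain ⟨N, hN, hl⟩ := lipschitz_ae_of_hasWeakDerivOn (I := univ) isOpen_univ ordConnected_univ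
    (F := f) (G := 0) (K := 0) (by simpa using hf.locallyIntegrable) (by simp)
    (by intro φ h1 h2 _; simpa using h φ h1 h2)
  have hd : Dense Nᶜ := by
    refine Measure.dense_of_ae (μ := (volume : Measure ℝ)) ?_
    rw [← compl_mem_ae_iff] at hN
    exact hN
  obtain ⟨c, hc⟩ := hd.nonempty
  have h1 : f = fun _ => f c := by
    refine Continuous.ext_on hd hf continuous_const fun x hx => ?_
    have := hl x (mem_univ _) hx c (mem_univ _) hc
    simpa [sub_eq_zero] using this
  rw [h1]

end EquivariantMaps

namespace EquivariantMaps

/-! ### Rotations of three-space -/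

/-- The projection to the first two coordinates. -/
noncomputable def horiz : Space →L[ℝ] Space :=
  LinearMap.toContinuousLinearMap
    { toFun := fun y => !₂[y 0, y 1, 0]
      map_add' := fun x y => by ext i; fin_cases i <;> simp
      map_smul' := fun c y => by ext i; fin_cases i <;> simp }

/-- The infinitesimal rotation about the third axis. -/
noncomputable def rotGen : Space →L[ℝ] Space :=
  LinearMap.toContinuousLinearMap
    { toFun := fun y => !₂[-y 1, y 0, 0]
      map_add' := fun x y => by ext i; fin_cases i <;> simp; ring
      map_smul' := fun c y => by ext i; fin_cases i <;> simp }

/-- The projection to the third coordinate. -/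
noncomputable def vert : Space →L[ℝ] Space :=
  LinearMap.toContinuousLinearMap
    { toFun := fun y => !₂[0, 0, y 2]
      map_add' := fun x y => by ext i; fin_cases i <;> simp
      map_smul' := fun c y => by ext i; fin_cases i <;> simp }

theorem horiz_apply (y : Space) : horiz y = !₂[y 0, y 1, 0] := rfl
theorem rotGen_apply (y : Space) : rotGen y = !₂[-y 1, y 0, 0] := rfl
theorem vert_apply (y : Space) : vert y = !₂[0, 0, y 2] := rfl

/-- `rot` as a continuous linear map. -/
noncomputable def rotL (α : Real.Angle) : Space →L[ℝ] Space :=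
  α.cos • horiz + α.sin • rotGen + vert

theorem rotL_apply (α : Real.Angle) (y : Space) : rotL α y = rot α y := by
  ext i; fin_cases i <;> simp [rotL, horiz_apply, rotGen_apply, vert_apply, rot] <;> ring

@[simp] theorem rot_apply_zero (α : Real.Angle) (y : Space) :
    rot α y 0 = α.cos * y 0 - α.sin * y 1 := rfl
@[simp] theorem rot_apply_one (α : Real.Angle) (y : Space) :
    rot α y 1 = α.sin * y 0 + α.cos * y 1 := rfl
@[simp] theorem rot_apply_two (α : Real.Angle) (y : Space) : rot α y 2 = y 2 := rfl

theorem inner_space (x y : Space) : inner ℝ x y = x 0 * y 0 + x 1 * y 1 + x 2 * y 2 := by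
  simp [PiLp.inner_apply, Fin.sum_univ_three]; ring

theorem norm_sq_space (x : Space) : ‖x‖ ^ 2 = x 0 ^ 2 + x 1 ^ 2 + x 2 ^ 2 := by
  rw [← real_inner_self_eq_norm_sq, inner_space]; ring

theorem norm_sq_plane (x : Plane) : ‖x‖ ^ 2 = x 0 ^ 2 + x 1 ^ 2 := by
  rw [EuclideanSpace.norm_sq_eq]; simp [Fin.sum_univ_two]

theorem rot_inner (α : Real.Angle) (x y : Space) :
    inner ℝ (rot α x) (rot α y) = inner ℝ x y := by
  simp only [inner_space, rot_apply_zero, rot_apply_one, rot_apply_two]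
  linear_combination (x 0 * y 0 + x 1 * y 1) * α.cos_sq_add_sin_sq

theorem rot_norm (α : Real.Angle) (x : Space) : ‖rot α x‖ = ‖x‖ := by
  have : ‖rot α x‖ ^ 2 = ‖x‖ ^ 2 := by
    rw [← real_inner_self_eq_norm_sq, rot_inner, real_inner_self_eq_norm_sq]
  exact (sq_eq_sq₀ (norm_nonneg _) (norm_nonneg _)).1 this

theorem rot_rot (α β : Real.Angle) (x : Space) : rot α (rot β x) = rot (α + β) x := by
  ext i; fin_cases i <;> simp [Real.Angle.cos_add, Real.Angle.sin_add] <;> ring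

@[simp] theorem rot_zero (x : Space) : rot 0 x = x := by
  ext i; fin_cases i <;> simp

theorem rot_neg_rot (α : Real.Angle) (x : Space) : rot (-α) (rot α x) = x := by
  rw [rot_rot]; simp

theorem rot_rot_neg (α : Real.Angle) (x : Space) : rot α (rot (-α) x) = x := by
  rw [rot_rot]; simp

theorem rot_sub (α : Real.Angle) (x y : Space) : rot α (x - y) = rot α x - rot α y := by
  simp only [← rotL_apply, map_sub]

/-! ### Logarithmic polar coordinates -/

/-- The point of the plane with polar coordinates `(exp τ, θ)`. -/
noncomputable def polarPt (p : ℝ × ℝ) : Plane := !₂[Real.exp p.1 * Real.cos p.2, Real.exp p.1 * Real.sin p.2]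

/-- The product of Lebesgue measure on the line and on the interval `(-π, π)`. -/
noncomputable def stripMeasure : Measure (ℝ × ℝ) :=
  (volume : Measure ℝ).prod (volume.restrict (Ioo (-Real.pi) Real.pi))

@[simp] theorem polarPt_zero (p : ℝ × ℝ) : polarPt p 0 = Real.exp p.1 * Real.cos p.2 := rfl
@[simp] theorem polarPt_one (p : ℝ × ℝ) : polarPt p 1 = Real.exp p.1 * Real.sin p.2 := rfl

theorem norm_polarPt (p : ℝ × ℝ) : ‖polarPt p‖ = Real.exp p.1 := by
  have : ‖polarPt p‖ ^ 2 = Real.exp p.1 ^ 2 := by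
    rw [norm_sq_plane, polarPt_zero, polarPt_one]
    linear_combination Real.exp p.1 ^ 2 * Real.sin_sq_add_cos_sq p.2
  exact (sq_eq_sq₀ (norm_nonneg _) (Real.exp_pos _).le).1 this

theorem continuous_polarPt : Continuous polarPt := by
  unfold polarPt
  refine (PiLp.continuous_toLp 2 _).comp (continuous_pi fun i => ?_)
  fin_cases i <;> simp <;> fun_prop

theorem polarAngle_polarPt {p : ℝ × ℝ} (h : p.2 ∈ Ioo (-Real.pi) Real.pi) :
    polarAngle (polarPt p) = (p.2 : Real.Angle) := by
  unfold polarAngle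
  congr 1
  have := Complex.arg_mul_cos_add_sin_mul_I (Real.exp_pos p.1) (θ := p.2) ⟨h.1, h.2.le⟩
  rw [← this]
  congr 1
  apply Complex.ext <;> simp [Complex.cos_ofReal_re, Complex.sin_ofReal_re, Complex.exp_ofReal_re]

theorem lintegral_Ioi_eq (f : ℝ → ℝ≥0∞) :
    ∫⁻ r in Ioi (0 : ℝ), f r = ∫⁻ τ : ℝ, ENNReal.ofReal (Real.exp τ) * f (Real.exp τ) := by
  have := lintegral_image_eq_lintegral_abs_deriv_mul (s := univ) MeasurableSet.univ
    (f := Real.exp) (f' := Real.exp) (fun x _ => (Real.hasDerivAt_exp x).hasDerivWithinAt)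
    Real.exp_injective.injOn f
  rw [image_univ, Real.range_exp] at this
  rw [this, Measure.restrict_univ]
  simp [abs_of_pos (Real.exp_pos _)]

/-- The weight is e^{2τ} because the area element is r dr dθ and dr = e^τ dτ. -/
theorem lintegral_plane {f : Plane → ℝ≥0∞} (hf : Measurable f) :
    ∫⁻ x, f x = ∫⁻ p, ENNReal.ofReal (Real.exp (2 * p.1)) * f (polarPt p) ∂stripMeasure := by
  have e1 := (EuclideanSpace.volume_preserving_symm_measurableEquiv_toLp (Fin 2))
  have e2 := (volume_preserving_finTwoArrow ℝ)
  have e := (e2.comp e1)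
  have hf2 : ∀ x : Plane, f x = (fun q : ℝ × ℝ => f !₂[q.1, q.2])
      ((MeasurableEquiv.finTwoArrow ∘ (MeasurableEquiv.toLp 2 (Fin 2 → ℝ)).symm) x) := by
    intro x
    simp only [Function.comp]
    congr 1
    ext i; fin_cases i <;> rfl
  have hm : Measurable (fun q : ℝ × ℝ => f !₂[q.1, q.2]) := by
    refine hf.comp ?_
    refine ((PiLp.continuous_toLp 2 _).comp (continuous_pi fun i => ?_)).measurable
    fin_cases i <;> simp <;> fun_prop
  rw [lintegral_congr hf2, e.lintegral_comp hm, ← lintegral_comp_polarCoord_symm]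
  rw [show polarCoord.target = Ioi (0 : ℝ) ×ˢ Ioo (-Real.pi) Real.pi from rfl]
  rw [Measure.volume_eq_prod, ← Measure.prod_restrict, stripMeasure]
  have hm2 : Measurable fun p : ℝ × ℝ => f !₂[p.1 * Real.cos p.2, p.1 * Real.sin p.2] :=
    hm.comp (g := fun q : ℝ × ℝ => f !₂[q.1, q.2])
      (f := fun p : ℝ × ℝ => (p.1 * Real.cos p.2, p.1 * Real.sin p.2)) (by fun_prop)
  have hm3 : Measurable fun p : ℝ × ℝ => ENNReal.ofReal p.1 *
      f !₂[p.1 * Real.cos p.2, p.1 * Real.sin p.2] := by fun_prop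
  have hm4 : Measurable fun p : ℝ × ℝ => ENNReal.ofReal (Real.exp (2 * p.1)) * f (polarPt p) := by
    have := hf.comp continuous_polarPt.measurable
    have h5 : Measurable fun p : ℝ × ℝ => ENNReal.ofReal (Real.exp (2 * p.1)) := by fun_prop
    exact h5.mul this
  simp only [polarCoord_symm_apply, smul_eq_mul]
  rw [lintegral_prod _ hm3.aemeasurable, lintegral_prod _ hm4.aemeasurable, lintegral_Ioi_eq]
  refine lintegral_congr fun τ => ?_
  rw [← lintegral_const_mul]
  · refine lintegral_congr fun θ => ?_
    rw [← mul_assoc, ← ENNReal.ofReal_mul (Real.exp_pos _).le, ← Real.exp_add, two_mul]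
    rfl
  · exact hm3.comp (g := fun p : ℝ × ℝ => ENNReal.ofReal p.1 *
      f !₂[p.1 * Real.cos p.2, p.1 * Real.sin p.2]) (f := fun θ : ℝ => (Real.exp τ, θ)) (by fun_prop)

theorem measurable_weight : Measurable fun p : ℝ × ℝ => ENNReal.ofReal (Real.exp (2 * p.1)) := by
  fun_prop

theorem measurePreserving_polarPt : MeasurePreserving polarPt
    (stripMeasure.withDensity fun p => ENNReal.ofReal (Real.exp (2 * p.1))) volume := by
  refine ⟨continuous_polarPt.measurable, ?_⟩
  refine Measure.ext_of_lintegral _ fun f hf => ?_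
  rw [lintegral_map hf continuous_polarPt.measurable, lintegral_plane hf]
  exact lintegral_withDensity_eq_lintegral_mul _ measurable_weight
    (hf.comp continuous_polarPt.measurable)

section

variable {E : Type*} [NormedAddCommGroup E]

theorem aestronglyMeasurable_comp_polarPt {f : Plane → E} (hf : AEStronglyMeasurable f volume) :
    AEStronglyMeasurable (fun p => f (polarPt p)) stripMeasure := by
  have h1 := hf.comp_measurePreserving measurePreserving_polarPt
  refine h1.mono_ac ?_
  refine withDensity_absolutelyContinuous' measurable_weight.aemeasurable ?_
  exact Eventually.of_forall fun p => by simp [Real.exp_pos]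

variable [NormedSpace ℝ E]

theorem integrable_plane_iff {f : Plane → E} (hf : AEStronglyMeasurable f volume) :
    Integrable f ↔ Integrable (fun p => Real.exp (2 * p.1) • f (polarPt p)) stripMeasure := by
  rw [← measurePreserving_polarPt.integrable_comp hf,
    integrable_withDensity_iff_integrable_smul' measurable_weight (by simp)]
  simp [ENNReal.toReal_ofReal (Real.exp_pos _).le]

theorem integral_plane {f : Plane → E} (hf : AEStronglyMeasurable f volume) :
    ∫ x, f x = ∫ p, Real.exp (2 * p.1) • f (polarPt p) ∂stripMeasure := by
  rw [← measurePreserving_polarPt.map_eq, integral_map continuous_polarPt.aemeasurable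
    (by rwa [measurePreserving_polarPt.map_eq]),
    integral_withDensity_eq_integral_toReal_smul measurable_weight (by simp)]
  simp [ENNReal.toReal_ofReal (Real.exp_pos _).le]

/-- The weight e^{2τ} is positive, so the strip measure has no more null sets than the weighted one.
-/
theorem ae_comp_polarPt {P : Plane → Prop} (h : ∀ᵐ x, P x) : ∀ᵐ p ∂stripMeasure, P (polarPt p) := by
  have h1 := measurePreserving_polarPt.quasiMeasurePreserving.ae h
  refine (withDensity_absolutelyContinuous' measurable_weight.aemeasurable ?_).ae_le h1
  exact Eventually.of_forall fun p => by simp [Real.exp_pos]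

theorem ae_strip_mem : ∀ᵐ p ∂stripMeasure, p.2 ∈ Ioo (-Real.pi) Real.pi := by
  have h : ∀ᵐ θ ∂(volume.restrict (Ioo (-Real.pi) Real.pi)), θ ∈ Ioo (-Real.pi) Real.pi :=
    ae_restrict_mem measurableSet_Ioo
  exact Measure.quasiMeasurePreserving_snd.ae h

/-- Cauchy–Schwarz on an interval of length 2π, read off from the nonnegativity of the variance of
`‖K‖`. -/
theorem sq_norm_integral_le_circle {K : ℝ → E}
    (h1 : AEStronglyMeasurable K (volume.restrict (Ioo (-Real.pi) Real.pi)))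
    (h2 : Integrable (fun θ => ‖K θ‖ ^ 2) (volume.restrict (Ioo (-Real.pi) Real.pi))) :
    ‖∫ θ in Ioo (-Real.pi) Real.pi, K θ‖ ^ 2
      ≤ 2 * Real.pi * ∫ θ in Ioo (-Real.pi) Real.pi, ‖K θ‖ ^ 2 := by
  have hK : MemLp K 2 (volume.restrict (Ioo (-Real.pi) Real.pi)) :=
    (memLp_two_iff_integrable_sq_norm h1).2 h2
  have hi : Integrable K (volume.restrict (Ioo (-Real.pi) Real.pi)) := hK.integrable (by norm_num)
  set c := (∫ θ in Ioo (-Real.pi) Real.pi, ‖K θ‖) with hc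
  have hpi := Real.pi_pos
  have h3 : 0 ≤ ∫ θ in Ioo (-Real.pi) Real.pi, (‖K θ‖ - c / (2 * Real.pi)) ^ 2 :=
    integral_nonneg fun θ => sq_nonneg _
  have h4 : ∫ θ in Ioo (-Real.pi) Real.pi, (‖K θ‖ - c / (2 * Real.pi)) ^ 2
      = (∫ θ in Ioo (-Real.pi) Real.pi, ‖K θ‖ ^ 2) - 2 * (c / (2 * Real.pi)) * c
        + 2 * Real.pi * (c / (2 * Real.pi)) ^ 2 := by
    have : ∀ θ, (‖K θ‖ - c / (2 * Real.pi)) ^ 2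
        = ‖K θ‖ ^ 2 - 2 * (c / (2 * Real.pi)) * ‖K θ‖ + (c / (2 * Real.pi)) ^ 2 := fun θ => by ring
    simp_rw [this]
    have hi2 : Integrable (fun θ => ‖K θ‖ ^ 2 - 2 * (c / (2 * Real.pi)) * ‖K θ‖)
        (volume.restrict (Ioo (-Real.pi) Real.pi)) := h2.sub (hi.norm.const_mul _)
    rw [integral_add hi2 (integrable_const _),
      integral_sub h2 (hi.norm.const_mul _), integral_const_mul, integral_const]
    have hv : (volume.restrict (Ioo (-Real.pi) Real.pi)).real univ = 2 * Real.pi := by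
      rw [measureReal_restrict_apply_univ, Real.volume_real_Ioo_of_le (by linarith)]; ring
    rw [hv, smul_eq_mul]
  have h5 : ‖∫ θ in Ioo (-Real.pi) Real.pi, K θ‖ ≤ c := norm_integral_le_integral_norm _
  have h6 : ‖∫ θ in Ioo (-Real.pi) Real.pi, K θ‖ ^ 2 ≤ c ^ 2 :=
    pow_le_pow_left₀ (norm_nonneg _) h5 2
  refine h6.trans ?_
  rw [h4] at h3
  have h7 : 2 * (c / (2 * Real.pi)) * c - 2 * Real.pi * (c / (2 * Real.pi)) ^ 2
      = c ^ 2 / (2 * Real.pi) := by field_simp; ring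
  have h8 : c ^ 2 / (2 * Real.pi) ≤ ∫ θ in Ioo (-Real.pi) Real.pi, ‖K θ‖ ^ 2 := by linarith
  rw [div_le_iff₀ (by positivity)] at h8
  linarith

end

end EquivariantMaps

namespace EquivariantMaps

/-! ### Weak derivatives against vector fields -/

theorem plane_eq (x : Plane) :
    x = x 0 • EuclideanSpace.single 0 (1 : ℝ) + x 1 • EuclideanSpace.single 1 (1 : ℝ) := by
  ext i; fin_cases i <;> simp

/-- The rotation of the plane by a right angle. -/
noncomputable def perp : Plane →L[ℝ] Plane :=
  LinearMap.toContinuousLinearMap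
    { toFun := fun y => !₂[-y 1, y 0]
      map_add' := fun x y => by ext i; fin_cases i <;> simp; ring
      map_smul' := fun c y => by ext i; fin_cases i <;> simp }

theorem perp_apply (y : Plane) : perp y = !₂[-y 1, y 0] := rfl
@[simp] theorem perp_apply_zero (y : Plane) : perp y 0 = -y 1 := rfl
@[simp] theorem perp_apply_one (y : Plane) : perp y 1 = y 0 := rfl

/-- The derivative along the linear field `L` of a function with gradient `G`. -/
noncomputable def fieldDeriv (L : Plane →L[ℝ] Plane) (G : Fin 2 → Plane → Space) (x : Plane) :
    Space := L x 0 • G 0 x + L x 1 • G 1 x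

/-- The weak partial derivatives are tested with the components of `L` times `χ` and added; `d` is
the divergence of the linear field `L`. Used for the radial field (divergence 2) and the angular
field (divergence 0). -/
theorem integral_fieldDeriv {u : Plane → Space} {G : Fin 2 → Plane → Space}
    (hu : LocallyIntegrable u volume) (hG : IsWeakGradient u G) (L : Plane →L[ℝ] Plane) {d : ℝ}
    (hd : L (EuclideanSpace.single 0 1) 0 + L (EuclideanSpace.single 1 1) 1 = d)
    {χ : Plane → ℝ} (h1 : ContDiff ℝ ∞ χ) (h2 : HasCompactSupport χ) :
    ∫ x, (d * χ x + fderiv ℝ χ x (L x)) • u x = -∫ x, χ x • fieldDeriv L G x := by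
  have hl : ∀ j : Fin 2, ContDiff ℝ ∞ fun x : Plane => L x j := fun j => by fun_prop
  have hs : ∀ j : Fin 2, ContDiff ℝ ∞ fun x : Plane => L x j * χ x := fun j => (hl j).mul h1
  have hc : ∀ j : Fin 2, HasCompactSupport fun x : Plane => L x j * χ x := fun j => h2.mul_left
  have hi : ∀ j : Fin 2, Integrable fun x =>
      (fderiv ℝ (fun x : Plane => L x j * χ x) x (EuclideanSpace.single j 1)) • u x := fun j => by
    refine hu.integrable_smul_left_of_hasCompactSupport ?_ ?_
    · exact ((hs j).continuous_fderiv (by simp)).clm_apply continuous_const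
    · exact ((hc j).fderiv (𝕜 := ℝ)).comp_left (g := fun l : Plane →L[ℝ] ℝ =>
        l (EuclideanSpace.single j 1)) (by simp)
  have hi2 : ∀ j : Fin 2, Integrable fun x => (L x j * χ x) • G j x := fun j =>
    ((hG j).1.locallyIntegrable (by norm_num)).integrable_smul_left_of_hasCompactSupport
      (hs j).continuous (hc j)
  have e0 := (hG 0).2 _ (hs 0) (hc 0)
  have e1 := (hG 1).2 _ (hs 1) (hc 1)
  have hf : ∀ (j : Fin 2) (x v : Plane), fderiv ℝ (fun x : Plane => L x j * χ x) x v
      = L v j * χ x + L x j * fderiv ℝ χ x v := fun j x v => by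
    have ha : HasFDerivAt (fun x : Plane => L x j)
        ((EuclideanSpace.proj j : Plane →L[ℝ] ℝ).comp L) x :=
      ((EuclideanSpace.proj j : Plane →L[ℝ] ℝ).comp L).hasFDerivAt
    have hb := (h1.differentiable (by simp) x).hasFDerivAt
    rw [(ha.fun_mul hb).fderiv]
    simp; ring
  have lhs : ∫ x, (d * χ x + fderiv ℝ χ x (L x)) • u x
      = (∫ x, (fderiv ℝ (fun x : Plane => L x 0 * χ x) x (EuclideanSpace.single 0 1)) • u x)
        + ∫ x, (fderiv ℝ (fun x : Plane => L x 1 * χ x) x (EuclideanSpace.single 1 1)) • u x := by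
    rw [← integral_add (hi 0) (hi 1)]
    refine integral_congr_ae (Eventually.of_forall fun x => ?_)
    simp only [hf, ← add_smul]
    congr 1
    conv_lhs => rw [plane_eq (L x)]
    rw [map_add, map_smul, map_smul, smul_eq_mul, smul_eq_mul, ← hd]
    ring
  rw [lhs, e0, e1, ← neg_add, ← integral_add (hi2 0) (hi2 1)]
  congr 1
  refine integral_congr_ae (Eventually.of_forall fun x => ?_)
  simp only [fieldDeriv, smul_add, smul_smul, mul_comm (χ x)]

/-! ### Test functions in polar coordinates -/

/-- The test function `ψ(log r) r^{-k} p(x)`. -/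
noncomputable def polarTest (ψ : ℝ → ℝ) (k : ℕ) (p : Plane → ℝ) (x : Plane) : ℝ :=
  ψ (Real.log ‖x‖) * (‖x‖ ^ k)⁻¹ * p x

theorem exists_bound_of_hasCompactSupport {ψ : ℝ → ℝ} (h : HasCompactSupport ψ) :
    ∃ N : ℝ, ∀ t, N < |t| → ψ t = 0 := by
  obtain ⟨N, hN⟩ := h.isCompact.isBounded.subset_closedBall 0
  refine ⟨N, fun t ht => image_eq_zero_of_notMem_tsupport fun hm => ?_⟩
  have := hN hm
  rw [mem_closedBall_zero_iff, Real.norm_eq_abs] at this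
  linarith

/-- Only the origin is in question, and there the function vanishes in a neighbourhood, since log r
leaves the support of `ψ`. -/
theorem contDiff_polarTest {ψ : ℝ → ℝ} (h1 : ContDiff ℝ ∞ ψ) (h2 : HasCompactSupport ψ) {k : ℕ}
    (hk : k ≠ 0) {p : Plane → ℝ} (hp : ContDiff ℝ ∞ p) : ContDiff ℝ ∞ (polarTest ψ k p) := by
  obtain ⟨N, hN⟩ := exists_bound_of_hasCompactSupport h2
  rw [contDiff_iff_contDiffAt]
  intro x
  by_cases hx : x = 0
  · subst hx
    have : polarTest ψ k p =ᶠ[𝓝 0] fun _ => 0 := by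
      filter_upwards [Metric.ball_mem_nhds (0 : Plane) (Real.exp_pos (-|N| - 1))] with x hx
      rw [mem_ball_zero_iff] at hx
      unfold polarTest
      rcases eq_or_ne x 0 with rfl | h0
      -- At the origin itself `Real.log 0 = 0`, so `ψ` need not vanish; the factor `(0 ^ k)⁻¹ = 0`
      -- does it, which is where `k ≠ 0` enters.
      · simp [hk]
      · have hl : Real.log ‖x‖ < -|N| - 1 := by
          exact (Real.log_lt_iff_lt_exp (norm_pos_iff.2 h0)).2 hx
        rw [hN, zero_mul, zero_mul]
        have := neg_abs_le (Real.log ‖x‖)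
        have := le_abs_self N
        rw [abs_of_neg (by have := abs_nonneg N; linarith)]
        linarith
    exact contDiffAt_const.congr_of_eventuallyEq this
  · have hn : ContDiffAt ℝ ∞ (fun x : Plane => ‖x‖) x := contDiffAt_norm ℝ hx
    have h0 : ‖x‖ ≠ 0 := norm_ne_zero_iff.2 hx
    unfold polarTest
    exact ((h1.contDiffAt.comp x (hn.log h0)).mul ((hn.pow k).inv (pow_ne_zero _ h0))).mul
      hp.contDiffAt

theorem hasCompactSupport_polarTest {ψ : ℝ → ℝ} (h2 : HasCompactSupport ψ) {k : ℕ}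
    {p : Plane → ℝ} : HasCompactSupport (polarTest ψ k p) := by
  obtain ⟨N, hN⟩ := exists_bound_of_hasCompactSupport h2
  refine HasCompactSupport.intro (isCompact_closedBall 0 (Real.exp (|N| + 1))) fun x hx => ?_
  rw [mem_closedBall_zero_iff, not_le] at hx
  unfold polarTest
  have hpos : 0 < ‖x‖ := (Real.exp_pos _).trans hx
  have hl : |N| + 1 < Real.log ‖x‖ := (Real.lt_log_iff_exp_lt hpos).2 hx
  rw [hN, zero_mul, zero_mul]
  have := le_abs_self N
  have := le_abs_self (Real.log ‖x‖)
  linarith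

theorem hasDerivAt_toLp_two {f g : ℝ → ℝ} {f' g' t : ℝ} (hf : HasDerivAt f f' t)
    (hg : HasDerivAt g g' t) : HasDerivAt (fun t => (!₂[f t, g t] : Plane)) !₂[f', g'] t := by
  have h : HasDerivAt (fun t => (![f t, g t] : Fin 2 → ℝ)) ![f', g'] t := by
    rw [hasDerivAt_pi]; intro i; fin_cases i <;> simpa
  exact ((PiLp.continuousLinearEquiv 2 ℝ (fun _ : Fin 2 => ℝ)).symm.hasFDerivAt.comp_hasDerivAt t h)

theorem hasDerivAt_polarPt_fst (τ θ : ℝ) :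
    HasDerivAt (fun t => polarPt (t, θ)) (polarPt (τ, θ)) τ :=
  hasDerivAt_toLp_two ((Real.hasDerivAt_exp τ).mul_const (Real.cos θ))
    ((Real.hasDerivAt_exp τ).mul_const (Real.sin θ))

theorem hasDerivAt_polarPt_snd (τ θ : ℝ) :
    HasDerivAt (fun t => polarPt (τ, t)) (perp (polarPt (τ, θ))) θ := by
  have := hasDerivAt_toLp_two ((Real.hasDerivAt_cos θ).const_mul (Real.exp τ))
    ((Real.hasDerivAt_sin θ).const_mul (Real.exp τ))
  simpa [perp_apply, polarPt] using this

section

variable {ψ : ℝ → ℝ} {n : ℕ} {p : Plane → ℝ} {T T' : ℝ → ℝ}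

/-- The exponent is chosen so that r^{-n} removes the growth of the homogeneous polynomial `p` and
r^{-2} removes the area weight e^{2τ}. What is left in the strip is a product of a function of τ and
a function of θ. -/
theorem polarTest_polarPt (hT : ∀ q : ℝ × ℝ, p (polarPt q) = Real.exp q.1 ^ n * T q.2)
    (q : ℝ × ℝ) : polarTest ψ (n + 2) p (polarPt q) = ψ q.1 * Real.exp (-(2 * q.1)) * T q.2 := by
  unfold polarTest
  rw [norm_polarPt, Real.log_exp, hT, Real.exp_neg, two_mul, Real.exp_add, pow_add]
  have := (Real.exp_pos q.1).ne'
  field_simp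

theorem fderiv_polarTest_radial (h1 : ContDiff ℝ ∞ ψ) (h2 : HasCompactSupport ψ)
    (hp : ContDiff ℝ ∞ p) (hT : ∀ q : ℝ × ℝ, p (polarPt q) = Real.exp q.1 ^ n * T q.2)
    (q : ℝ × ℝ) : fderiv ℝ (polarTest ψ (n + 2) p) (polarPt q) (polarPt q)
      = (deriv ψ q.1 - 2 * ψ q.1) * Real.exp (-(2 * q.1)) * T q.2 := by
  have ha := ((contDiff_polarTest h1 h2 (k := n + 2) (by omega) hp).differentiable (by simp)
    (polarPt (q.1, q.2))).hasFDerivAt.comp_hasDerivAt q.1 (hasDerivAt_polarPt_fst q.1 q.2)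
  have hb : HasDerivAt (fun t => ψ t * Real.exp (-(2 * t)) * T q.2)
      ((deriv ψ q.1 * Real.exp (-(2 * q.1)) + ψ q.1 * (Real.exp (-(2 * q.1)) * (-(2 * 1)))) * T q.2)
      q.1 :=
    (((h1.differentiable (by simp) q.1).hasDerivAt).mul
      ((((hasDerivAt_id q.1).const_mul 2).neg).exp)).mul_const _
  have hc : (polarTest ψ (n + 2) p ∘ fun t => polarPt (t, q.2))
      = fun t => ψ t * Real.exp (-(2 * t)) * T q.2 := by
    funext t; exact polarTest_polarPt hT (t, q.2)
  rw [hc] at ha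
  rw [show q = (q.1, q.2) from rfl, ha.unique hb]
  ring

theorem fderiv_polarTest_angular (h1 : ContDiff ℝ ∞ ψ) (h2 : HasCompactSupport ψ)
    (hp : ContDiff ℝ ∞ p) (hT : ∀ q : ℝ × ℝ, p (polarPt q) = Real.exp q.1 ^ n * T q.2)
    (hT' : ∀ θ, HasDerivAt T (T' θ) θ)
    (q : ℝ × ℝ) : fderiv ℝ (polarTest ψ (n + 2) p) (polarPt q) (perp (polarPt q))
      = ψ q.1 * Real.exp (-(2 * q.1)) * T' q.2 := by
  have ha := ((contDiff_polarTest h1 h2 (k := n + 2) (by omega) hp).differentiable (by simp)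
    (polarPt (q.1, q.2))).hasFDerivAt.comp_hasDerivAt q.2 (hasDerivAt_polarPt_snd q.1 q.2)
  have hb := (hT' q.2).const_mul (ψ q.1 * Real.exp (-(2 * q.1)))
  have hc : (polarTest ψ (n + 2) p ∘ fun t => polarPt (q.1, t))
      = fun t => ψ q.1 * Real.exp (-(2 * q.1)) * T t := by
    funext t; exact polarTest_polarPt hT (q.1, t)
  rw [hc] at ha
  rw [show q = (q.1, q.2) from rfl, ha.unique hb]

variable {u : Plane → Space} {G : Fin 2 → Plane → Space}

theorem aestronglyMeasurable_fieldDeriv (hG : IsWeakGradient u G) (L : Plane →L[ℝ] Plane) :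
    AEStronglyMeasurable (fieldDeriv L G) volume := by
  have h0 : Continuous fun x : Plane => L x 0 := by fun_prop
  have h1 : Continuous fun x : Plane => L x 1 := by fun_prop
  exact (h0.aestronglyMeasurable.smul (hG 0).1.1).add (h1.aestronglyMeasurable.smul (hG 1).1.1)

theorem integrable_smul_fieldDeriv (hG : IsWeakGradient u G) (L : Plane →L[ℝ] Plane)
    {χ : Plane → ℝ} (h1 : Continuous χ) (h2 : HasCompactSupport χ) :
    Integrable fun x => χ x • fieldDeriv L G x := by
  have hc : ∀ j : Fin 2, Continuous fun x : Plane => χ x * L x j := fun j => by fun_prop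
  have hi2 : ∀ j : Fin 2, Integrable fun x => (χ x * L x j) • G j x := fun j =>
    ((hG j).1.locallyIntegrable (by norm_num)).integrable_smul_left_of_hasCompactSupport
      (hc j) h2.mul_right
  refine ((hi2 0).add (hi2 1)).congr (Eventually.of_forall fun x => ?_)
  simp [fieldDeriv, smul_add, smul_smul]

theorem integrable_strip_fieldDeriv (hG : IsWeakGradient u G) (L : Plane →L[ℝ] Plane)
    (h1 : ContDiff ℝ ∞ ψ) (h2 : HasCompactSupport ψ)
    (hp : ContDiff ℝ ∞ p) (hT : ∀ q : ℝ × ℝ, p (polarPt q) = Real.exp q.1 ^ n * T q.2) :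
    Integrable (fun q : ℝ × ℝ => (ψ q.1 * T q.2) • fieldDeriv L G (polarPt q)) stripMeasure := by
  have hχ := contDiff_polarTest h1 h2 (k := n + 2) (by omega) hp
  have hi := integrable_smul_fieldDeriv hG L hχ.continuous
    (hasCompactSupport_polarTest (p := p) (k := n + 2) h2)
  rw [integrable_plane_iff hi.aestronglyMeasurable] at hi
  refine hi.congr (Eventually.of_forall fun q => ?_)
  simp only [polarTest_polarPt hT, smul_smul]
  congr 1
  rw [Real.exp_neg]
  have := (Real.exp_pos (2 * q.1)).ne'
  field_simp

/-- The divergence 2 of the radial field cancels the derivative of the factor r^{-2} in the test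
function, leaving the bare derivative of `ψ`. -/
theorem integral_strip_radial (hu : Continuous u) (hG : IsWeakGradient u G)
    (h1 : ContDiff ℝ ∞ ψ) (h2 : HasCompactSupport ψ)
    (hp : ContDiff ℝ ∞ p) (hT : ∀ q : ℝ × ℝ, p (polarPt q) = Real.exp q.1 ^ n * T q.2) :
    ∫ q, (deriv ψ q.1 * T q.2) • u (polarPt q) ∂stripMeasure
      = -∫ q, (ψ q.1 * T q.2) •
          fieldDeriv (ContinuousLinearMap.id ℝ Plane) G (polarPt q) ∂stripMeasure := by
  have hχ := contDiff_polarTest h1 h2 (k := n + 2) (by omega) hp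
  have hcs := hasCompactSupport_polarTest (p := p) (k := n + 2) h2
  have key := integral_fieldDeriv hu.locallyIntegrable hG (ContinuousLinearMap.id ℝ Plane)
    (d := 2) (by simp; norm_num) hχ hcs
  have hd : Continuous fun x : Plane => fderiv ℝ (polarTest ψ (n + 2) p) x
      (ContinuousLinearMap.id ℝ Plane x) :=
    (hχ.continuous_fderiv (by simp)).clm_apply (ContinuousLinearMap.continuous _)
  have hχc := hχ.continuous
  rw [integral_plane (Continuous.aestronglyMeasurable (by fun_prop)),
    integral_plane (integrable_smul_fieldDeriv hG _ hχc hcs).aestronglyMeasurable] at key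
  refine Eq.trans ?_ (key.trans ?_)
  · refine integral_congr_ae (Eventually.of_forall fun q => ?_)
    simp only [ContinuousLinearMap.id_apply, fderiv_polarTest_radial h1 h2 hp hT,
      polarTest_polarPt hT, smul_smul]
    congr 1
    rw [Real.exp_neg]
    have := (Real.exp_pos (2 * q.1)).ne'
    field_simp
    ring
  · congr 1
    refine integral_congr_ae (Eventually.of_forall fun q => ?_)
    simp only [polarTest_polarPt hT, smul_smul]
    congr 1
    rw [Real.exp_neg]
    have := (Real.exp_pos (2 * q.1)).ne'
    field_simp

/-- The angular field is divergence free and tangent to circles, so the derivative falls on the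
trigonometric factor alone. -/
theorem integral_strip_angular (hu : Continuous u) (hG : IsWeakGradient u G)
    (h1 : ContDiff ℝ ∞ ψ) (h2 : HasCompactSupport ψ)
    (hp : ContDiff ℝ ∞ p) (hT : ∀ q : ℝ × ℝ, p (polarPt q) = Real.exp q.1 ^ n * T q.2)
    (hT' : ∀ θ, HasDerivAt T (T' θ) θ) :
    ∫ q, (ψ q.1 * T' q.2) • u (polarPt q) ∂stripMeasure
      = -∫ q, (ψ q.1 * T q.2) • fieldDeriv perp G (polarPt q) ∂stripMeasure := by
  have hχ := contDiff_polarTest h1 h2 (k := n + 2) (by omega) hp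
  have hcs := hasCompactSupport_polarTest (p := p) (k := n + 2) h2
  have key := integral_fieldDeriv hu.locallyIntegrable hG perp (d := 0) (by simp) hχ hcs
  have hd : Continuous fun x : Plane => fderiv ℝ (polarTest ψ (n + 2) p) x (perp x) :=
    (hχ.continuous_fderiv (by simp)).clm_apply (ContinuousLinearMap.continuous _)
  have hχc := hχ.continuous
  rw [integral_plane (Continuous.aestronglyMeasurable (by fun_prop)),
    integral_plane (integrable_smul_fieldDeriv hG _ hχc hcs).aestronglyMeasurable] at key
  refine Eq.trans ?_ (key.trans ?_)
  · refine integral_congr_ae (Eventually.of_forall fun q => ?_)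
    simp only [fderiv_polarTest_angular h1 h2 hp hT hT',
      polarTest_polarPt hT, smul_smul]
    congr 1
    rw [Real.exp_neg]
    have := (Real.exp_pos (2 * q.1)).ne'
    field_simp
    ring
  · congr 1
    refine integral_congr_ae (Eventually.of_forall fun q => ?_)
    simp only [polarTest_polarPt hT, smul_smul]
    congr 1
    rw [Real.exp_neg]
    have := (Real.exp_pos (2 * q.1)).ne'
    field_simp

end

end EquivariantMaps

namespace EquivariantMaps

/-! ### Profiles of equivariant maps -/

/-- Continuous equivariant maps of finite energy (with values in the whole space). -/
structure IsEquivariantHdot (m : ℕ) (u : Plane → Space) : Prop where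
  equivariant : u = equivariantMap m (profile u)
  continuous : Continuous u
  memHdot : MemHdot u

/-- The profile as a function of `log r`. -/
noncomputable def logProfile (u : Plane → Space) (τ : ℝ) : Space := profile u (Real.exp τ)

theorem continuous_logProfile {u : Plane → Space} (hu : Continuous u) :
    Continuous (logProfile u) := by
  refine hu.comp ((PiLp.continuous_toLp 2 _).comp (continuous_pi fun i => ?_))
  fin_cases i <;> simp <;> fun_prop

theorem apply_polarPt {m : ℕ} {u : Plane → Space} (h : u = equivariantMap m (profile u)) {q : ℝ × ℝ}
    (hq : q.2 ∈ Ioo (-Real.pi) Real.pi) :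
    u (polarPt q) = rot (m • (q.2 : Real.Angle)) (logProfile u q.1) := by
  conv_lhs => rw [h]
  rw [equivariantMap, polarAngle_polarPt hq, norm_polarPt]
  rfl

theorem cos_nsmul (m : ℕ) (θ : ℝ) : (m • (θ : Real.Angle)).cos = Real.cos (m * θ) := by
  rw [← Real.Angle.coe_nsmul, Real.Angle.cos_coe, nsmul_eq_mul]

theorem sin_nsmul (m : ℕ) (θ : ℝ) : (m • (θ : Real.Angle)).sin = Real.sin (m * θ) := by
  rw [← Real.Angle.coe_nsmul, Real.Angle.sin_coe, nsmul_eq_mul]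

/-- The real part of `(x + iy)^m`. -/
noncomputable def rePow (m : ℕ) (x : Plane) : ℝ := (((x 0 : ℂ) + x 1 * Complex.I) ^ m).re

/-- The imaginary part of `(x + iy)^m`. -/
noncomputable def imPow (m : ℕ) (x : Plane) : ℝ := (((x 0 : ℂ) + x 1 * Complex.I) ^ m).im

theorem contDiff_cpow (m : ℕ) :
    ContDiff ℝ ∞ fun x : Plane => ((x 0 : ℂ) + x 1 * Complex.I) ^ m := by
  have h : ∀ j : Fin 2, ContDiff ℝ ∞ fun x : Plane => ((x j : ℝ) : ℂ) := fun j =>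
    Complex.ofRealCLM.contDiff.comp (by fun_prop)
  exact ((h 0).add ((h 1).mul contDiff_const)).pow m

theorem contDiff_rePow (m : ℕ) : ContDiff ℝ ∞ (rePow m) :=
  Complex.reCLM.contDiff.comp (contDiff_cpow m)

theorem contDiff_imPow (m : ℕ) : ContDiff ℝ ∞ (imPow m) :=
  Complex.imCLM.contDiff.comp (contDiff_cpow m)

theorem cpow_polarPt (m : ℕ) (q : ℝ × ℝ) :
    (((polarPt q 0 : ℝ) : ℂ) + (polarPt q 1 : ℝ) * Complex.I) ^ m
      = ((Real.exp q.1 ^ m : ℝ) : ℂ) * (Real.cos (m * q.2) + Real.sin (m * q.2) * Complex.I) := by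
  rw [polarPt_zero, polarPt_one]
  have := Complex.cos_add_sin_mul_I_pow m (q.2 : ℂ)
  push_cast
  rw [← this, ← mul_pow]
  ring

theorem rePow_polarPt (m : ℕ) (q : ℝ × ℝ) :
    rePow m (polarPt q) = Real.exp q.1 ^ m * Real.cos (m * q.2) := by
  rw [rePow, cpow_polarPt, Complex.re_ofReal_mul]
  simp [-Complex.ofReal_cos, -Complex.ofReal_sin]

theorem imPow_polarPt (m : ℕ) (q : ℝ × ℝ) :
    imPow m (polarPt q) = Real.exp q.1 ^ m * Real.sin (m * q.2) := by
  rw [imPow, cpow_polarPt, Complex.im_ofReal_mul]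
  simp [-Complex.ofReal_cos, -Complex.ofReal_sin]

/-- The derivative along the field `L`, rotated back to the ray `θ = 0`. -/
noncomputable def unrotated (m : ℕ) (L : Plane →L[ℝ] Plane) (G : Fin 2 → Plane → Space)
    (q : ℝ × ℝ) : Space := rot (-(m • (q.2 : Real.Angle))) (fieldDeriv L G (polarPt q))

theorem rot_neg_nsmul (m : ℕ) (θ : ℝ) (y : Space) : rot (-(m • (θ : Real.Angle))) y
    = Real.cos (m * θ) • horiz y - Real.sin (m * θ) • rotGen y + vert y := by
  rw [← rotL_apply, rotL]
  simp [cos_nsmul, sin_nsmul, sub_eq_add_neg]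

section

variable {m : ℕ} {u : Plane → Space} {G : Fin 2 → Plane → Space} {ψ : ℝ → ℝ}

theorem aestronglyMeasurable_unrotated (hG : IsWeakGradient u G) (L : Plane →L[ℝ] Plane) :
    AEStronglyMeasurable (unrotated m L G) stripMeasure := by
  have h := aestronglyMeasurable_comp_polarPt (aestronglyMeasurable_fieldDeriv hG L)
  have hc : Continuous fun q : ℝ × ℝ => Real.cos (m * q.2) := by fun_prop
  have hs : Continuous fun q : ℝ × ℝ => Real.sin (m * q.2) := by fun_prop
  have : unrotated m L G = fun q => Real.cos (m * q.2) • horiz (fieldDeriv L G (polarPt q))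
      - Real.sin (m * q.2) • rotGen (fieldDeriv L G (polarPt q))
      + vert (fieldDeriv L G (polarPt q)) := by
    funext q; exact rot_neg_nsmul m q.2 _
  rw [this]
  exact ((hc.aestronglyMeasurable.smul (horiz.continuous.comp_aestronglyMeasurable h)).sub
    (hs.aestronglyMeasurable.smul (rotGen.continuous.comp_aestronglyMeasurable h))).add
    (vert.continuous.comp_aestronglyMeasurable h)

/-- At each point the radial and the angular field are orthogonal of length `‖x‖`, so together they
compute the full gradient form up to the factor `‖x‖ ^ 2`. -/
theorem fieldDeriv_inner (G H : Fin 2 → Plane → Space) (x : Plane) :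
    inner ℝ (fieldDeriv (ContinuousLinearMap.id ℝ Plane) G x)
        (fieldDeriv (ContinuousLinearMap.id ℝ Plane) H x)
      + inner ℝ (fieldDeriv perp G x) (fieldDeriv perp H x)
      = ‖x‖ ^ 2 * ∑ j, inner ℝ (G j x) (H j x) := by
  simp only [fieldDeriv, inner_add_left, inner_add_right, real_inner_smul_left,
    real_inner_smul_right, Fin.sum_univ_two, norm_sq_plane, perp_apply_zero, perp_apply_one,
    ContinuousLinearMap.id_apply]
  ring

theorem unrotated_inner (G H : Fin 2 → Plane → Space) (q : ℝ × ℝ) :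
    inner ℝ (unrotated m (ContinuousLinearMap.id ℝ Plane) G q)
        (unrotated m (ContinuousLinearMap.id ℝ Plane) H q)
      + inner ℝ (unrotated m perp G q) (unrotated m perp H q)
      = Real.exp (2 * q.1) * ∑ j, inner ℝ (G j (polarPt q)) (H j (polarPt q)) := by
  rw [unrotated, unrotated, unrotated, unrotated, rot_inner, rot_inner, fieldDeriv_inner,
    norm_polarPt, ← Real.exp_nat_mul]
  norm_num

theorem integrable_inner_of_memLp {α : Type*} [MeasurableSpace α] {μ : Measure α} {f g : α → Space}
    (hf : MemLp f 2 μ) (hg : MemLp g 2 μ) : Integrable (fun x => inner ℝ (f x) (g x)) μ := by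
  have h : Integrable (fun x => ‖f x‖ * ‖g x‖) μ := hf.norm.integrable_mul hg.norm
  refine h.mono (hf.1.inner hg.1) (Eventually.of_forall fun x => ?_)
  rw [Real.norm_of_nonneg (by positivity : 0 ≤ ‖f x‖ * ‖g x‖)]
  exact norm_inner_le_norm _ _

theorem integrable_sum_inner {G H : Fin 2 → Plane → Space} (hG : ∀ j, MemLp (G j) 2 volume)
    (hH : ∀ j, MemLp (H j) 2 volume) : Integrable fun x => ∑ j, inner ℝ (G j x) (H j x) :=
  integrable_finsetSum _ fun j _ => integrable_inner_of_memLp (hG j) (hH j)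

theorem integrable_unrotated_sq (hG : IsWeakGradient u G) :
    Integrable (fun q => ‖unrotated m (ContinuousLinearMap.id ℝ Plane) G q‖ ^ 2) stripMeasure ∧
    Integrable (fun q => ‖unrotated m perp G q‖ ^ 2) stripMeasure := by
  have h := integrable_sum_inner (fun j => (hG j).1) (fun j => (hG j).1)
  rw [integrable_plane_iff h.aestronglyMeasurable] at h
  have e : ∀ q, ‖unrotated m (ContinuousLinearMap.id ℝ Plane) G q‖ ^ 2
      + ‖unrotated m perp G q‖ ^ 2
      = Real.exp (2 * q.1) • ∑ j, inner ℝ (G j (polarPt q)) (G j (polarPt q)) := fun q => by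
    rw [smul_eq_mul, ← unrotated_inner (m := m), real_inner_self_eq_norm_sq,
      real_inner_self_eq_norm_sq]
  constructor
  · refine h.mono ((aestronglyMeasurable_unrotated hG _).norm.pow 2)
      (Eventually.of_forall fun q => ?_)
    rw [← e, Real.norm_of_nonneg (by positivity), Real.norm_of_nonneg (by positivity)]
    linarith [sq_nonneg ‖unrotated m perp G q‖]
  · refine h.mono ((aestronglyMeasurable_unrotated hG _).norm.pow 2)
      (Eventually.of_forall fun q => ?_)
    rw [← e, Real.norm_of_nonneg (by positivity), Real.norm_of_nonneg (by positivity)]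
    linarith [sq_nonneg ‖unrotated m (ContinuousLinearMap.id ℝ Plane) G q‖]

theorem integrable_strip_map (hu : Continuous u) {n : ℕ} {p : Plane → ℝ} {T : ℝ → ℝ}
    (h1 : ContDiff ℝ ∞ ψ) (h2 : HasCompactSupport ψ)
    (hp : ContDiff ℝ ∞ p) (hT : ∀ q : ℝ × ℝ, p (polarPt q) = Real.exp q.1 ^ n * T q.2) :
    Integrable (fun q : ℝ × ℝ => (ψ q.1 * T q.2) • u (polarPt q)) stripMeasure := by
  have hχ := contDiff_polarTest h1 h2 (k := n + 2) (by omega) hp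
  have hi := hu.locallyIntegrable.integrable_smul_left_of_hasCompactSupport (μ := volume)
    hχ.continuous (hasCompactSupport_polarTest (p := p) (k := n + 2) h2)
  rw [integrable_plane_iff hi.aestronglyMeasurable] at hi
  refine hi.congr (Eventually.of_forall fun q => ?_)
  simp only [polarTest_polarPt hT, smul_smul]
  congr 1
  rw [Real.exp_neg]
  have := (Real.exp_pos (2 * q.1)).ne'
  field_simp

theorem hT_one (q : ℝ × ℝ) : (fun _ : Plane => (1 : ℝ)) (polarPt q)
    = Real.exp q.1 ^ 0 * (fun _ => (1 : ℝ)) q.2 := by simp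

theorem deriv_test {ψ : ℝ → ℝ} (h1 : ContDiff ℝ ∞ ψ) : ContDiff ℝ ∞ (deriv ψ) :=
  (contDiff_infty_iff_deriv.1 h1).2

/-- Pairing of a family of vector-valued integrals against the three trigonometric weights. -/
theorem integral_combine {F : ℝ × ℝ → Space} {ψ : ℝ → ℝ}
    (hc : Integrable (fun q : ℝ × ℝ => (ψ q.1 * Real.cos (m * q.2)) • F q) stripMeasure)
    (hs : Integrable (fun q : ℝ × ℝ => (ψ q.1 * Real.sin (m * q.2)) • F q) stripMeasure)
    (h1 : Integrable (fun q : ℝ × ℝ => (ψ q.1 * 1) • F q) stripMeasure) :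
    Integrable (fun q : ℝ × ℝ => ψ q.1 • rot (-(m • (q.2 : Real.Angle))) (F q)) stripMeasure ∧
    ∫ q, ψ q.1 • rot (-(m • (q.2 : Real.Angle))) (F q) ∂stripMeasure
      = horiz (∫ q, (ψ q.1 * Real.cos (m * q.2)) • F q ∂stripMeasure)
        - rotGen (∫ q, (ψ q.1 * Real.sin (m * q.2)) • F q ∂stripMeasure)
        + vert (∫ q, (ψ q.1 * 1) • F q ∂stripMeasure) := by
  have e : ∀ q : ℝ × ℝ, ψ q.1 • rot (-(m • (q.2 : Real.Angle))) (F q)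
      = horiz ((ψ q.1 * Real.cos (m * q.2)) • F q) - rotGen ((ψ q.1 * Real.sin (m * q.2)) • F q)
        + vert ((ψ q.1 * 1) • F q) := fun q => by
    rw [rot_neg_nsmul, map_smul, map_smul, map_smul, smul_add, smul_sub, smul_smul, smul_smul,
      mul_one]
  have i1 := horiz.integrable_comp hc
  have i2 := rotGen.integrable_comp hs
  have i3 := vert.integrable_comp h1
  have i4 : Integrable (fun q : ℝ × ℝ => horiz ((ψ q.1 * Real.cos (m * q.2)) • F q)
    - rotGen ((ψ q.1 * Real.sin (m * q.2)) • F q)) stripMeasure := i1.sub i2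
  simp_rw [e]
  refine ⟨i4.add i3, ?_⟩
  rw [integral_add i4 i3, integral_sub i1 i2, horiz.integral_comp_comm hc,
    rotGen.integral_comp_comm hs, vert.integral_comp_comm h1]

theorem rotGen_rot_neg (m : ℕ) (θ : ℝ) (y : Space) :
    horiz (Real.sin (m * θ) • y) + rotGen (Real.cos (m * θ) • y)
      = rotGen (rot (-(m • (θ : Real.Angle))) y) := by
  rw [rot_neg_nsmul]
  ext i; fin_cases i <;> simp [horiz_apply, rotGen_apply, vert_apply] <;> ring

theorem integrable_strip_unrotated
    (hG : IsWeakGradient u G) (L : Plane →L[ℝ] Plane)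
    (h1 : ContDiff ℝ ∞ ψ) (h2 : HasCompactSupport ψ) :
    Integrable (fun q : ℝ × ℝ => ψ q.1 • unrotated m L G q) stripMeasure :=
  (integral_combine (integrable_strip_fieldDeriv hG L h1 h2 (T := fun θ => Real.cos (m * θ)) (n := m)
      (contDiff_rePow m) (rePow_polarPt m))
    (integrable_strip_fieldDeriv hG L h1 h2 (T := fun θ => Real.sin (m * θ)) (n := m)
      (contDiff_imPow m) (imPow_polarPt m))
    (integrable_strip_fieldDeriv hG L h1 h2 (p := fun _ => 1) (n := 0) (T := fun _ => 1)
      contDiff_const hT_one)).1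

/-- The rotation by −mθ is not itself a scalar test function; it is a combination of the weights cos
mθ, sin mθ and 1. These come from the smooth functions Re zᵐ, Im zᵐ and 1 on the plane, and each is
tested separately. -/
theorem strip_radial (hu : IsEquivariantHdot m u) (hG : IsWeakGradient u G)
    (h1 : ContDiff ℝ ∞ ψ) (h2 : HasCompactSupport ψ) :
    Integrable (fun q : ℝ × ℝ => deriv ψ q.1 • logProfile u q.1) stripMeasure ∧
    ∫ q, deriv ψ q.1 • logProfile u q.1 ∂stripMeasure
      = -∫ q, ψ q.1 • unrotated m (ContinuousLinearMap.id ℝ Plane) G q ∂stripMeasure := by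
  set L := ContinuousLinearMap.id ℝ Plane
  have hd1 := deriv_test h1
  have hd2 : HasCompactSupport (deriv ψ) := h2.deriv
  have A := integral_combine
    (integrable_strip_map hu.continuous hd1 hd2 (T := fun θ => Real.cos (m * θ)) (n := m)
      (contDiff_rePow m) (rePow_polarPt m))
    (integrable_strip_map hu.continuous hd1 hd2 (T := fun θ => Real.sin (m * θ)) (n := m)
      (contDiff_imPow m) (imPow_polarPt m))
    (integrable_strip_map hu.continuous hd1 hd2 (p := fun _ => 1) (n := 0) (T := fun _ => 1)
      contDiff_const hT_one)
  have B := integral_combine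
    (integrable_strip_fieldDeriv hG L h1 h2 (T := fun θ => Real.cos (m * θ)) (n := m)
      (contDiff_rePow m) (rePow_polarPt m))
    (integrable_strip_fieldDeriv hG L h1 h2 (T := fun θ => Real.sin (m * θ)) (n := m)
      (contDiff_imPow m) (imPow_polarPt m))
    (integrable_strip_fieldDeriv hG L h1 h2 (p := fun _ => 1) (n := 0) (T := fun _ => 1)
      contDiff_const hT_one)
  have e : (fun q : ℝ × ℝ => deriv ψ q.1 • rot (-(m • (q.2 : Real.Angle))) (u (polarPt q)))
      =ᵐ[stripMeasure] fun q => deriv ψ q.1 • logProfile u q.1 := by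
    filter_upwards [ae_strip_mem] with q hq
    rw [apply_polarPt hu.equivariant hq, rot_neg_rot]
  refine ⟨A.1.congr e, ?_⟩
  rw [← integral_congr_ae e, A.2]
  unfold unrotated
  rw [B.2, integral_strip_radial hu.continuous hG h1 h2 (T := fun θ => Real.cos (m * θ)) (n := m)
      (contDiff_rePow m) (rePow_polarPt m),
    integral_strip_radial hu.continuous hG h1 h2 (T := fun θ => Real.sin (m * θ)) (n := m)
      (contDiff_imPow m) (imPow_polarPt m),
    integral_strip_radial hu.continuous hG h1 h2 (p := fun _ => 1) (n := 0) (T := fun _ => 1)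
      contDiff_const hT_one]
  simp only [map_neg]
  abel

/-- After undoing the rotation the map no longer depends on θ, so differentiation in θ acts on the
weights only: it exchanges cos mθ and sin mθ with a factor m, which is m times the infinitesimal
rotation. -/
theorem strip_angular (hu : IsEquivariantHdot m u) (hG : IsWeakGradient u G)
    (h1 : ContDiff ℝ ∞ ψ) (h2 : HasCompactSupport ψ) :
    Integrable (fun q : ℝ × ℝ => ψ q.1 • ((m : ℝ) • rotGen (logProfile u q.1))) stripMeasure ∧
    ∫ q, ψ q.1 • ((m : ℝ) • rotGen (logProfile u q.1)) ∂stripMeasure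
      = ∫ q, ψ q.1 • unrotated m perp G q ∂stripMeasure := by
  have ic := integrable_strip_map hu.continuous h1 h2 (T := fun θ => Real.cos (m * θ)) (n := m)
      (contDiff_rePow m) (rePow_polarPt m)
  have is := integrable_strip_map hu.continuous h1 h2 (T := fun θ => Real.sin (m * θ)) (n := m)
      (contDiff_imPow m) (imPow_polarPt m)
  have B := integral_combine
    (integrable_strip_fieldDeriv hG perp h1 h2 (T := fun θ => Real.cos (m * θ)) (n := m)
      (contDiff_rePow m) (rePow_polarPt m))
    (integrable_strip_fieldDeriv hG perp h1 h2 (T := fun θ => Real.sin (m * θ)) (n := m)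
      (contDiff_imPow m) (imPow_polarPt m))
    (integrable_strip_fieldDeriv hG perp h1 h2 (p := fun _ => 1) (n := 0) (T := fun _ => 1)
      contDiff_const hT_one)
  have dc : ∀ θ : ℝ, HasDerivAt (fun θ : ℝ => Real.cos (m * θ)) (-Real.sin (m * θ) * m) θ :=
    fun θ => by simpa using ((hasDerivAt_id θ).const_mul (m : ℝ)).cos
  have ds : ∀ θ : ℝ, HasDerivAt (fun θ : ℝ => Real.sin (m * θ)) (Real.cos (m * θ) * m) θ :=
    fun θ => by simpa using ((hasDerivAt_id θ).const_mul (m : ℝ)).sin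
  have ec := integral_strip_angular hu.continuous hG h1 h2 (T := fun θ => Real.cos (m * θ)) (n := m)
      (contDiff_rePow m) (rePow_polarPt m) dc
  have es := integral_strip_angular hu.continuous hG h1 h2 (T := fun θ => Real.sin (m * θ)) (n := m)
      (contDiff_imPow m) (imPow_polarPt m) ds
  have e1 := integral_strip_angular hu.continuous hG h1 h2 (p := fun _ => 1) (n := 0)
    (T := fun _ => 1) contDiff_const hT_one (fun θ => hasDerivAt_const θ (1 : ℝ))
  have i1 := (horiz.integrable_comp is).fun_smul (m : ℝ)
  have i2 := (rotGen.integrable_comp ic).fun_smul (m : ℝ)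
  have e : (fun q : ℝ × ℝ => (m : ℝ) • horiz ((ψ q.1 * Real.sin (m * q.2)) • u (polarPt q))
        + (m : ℝ) • rotGen ((ψ q.1 * Real.cos (m * q.2)) • u (polarPt q)))
      =ᵐ[stripMeasure] fun q => ψ q.1 • ((m : ℝ) • rotGen (logProfile u q.1)) := by
    filter_upwards [ae_strip_mem] with q hq
    have := rotGen_rot_neg m q.2 (u (polarPt q))
    rw [apply_polarPt hu.equivariant hq, rot_neg_rot] at this
    rw [apply_polarPt hu.equivariant hq, ← this]
    simp only [map_smul, smul_add, smul_smul]
    congr 2 <;> ring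
  refine ⟨(i1.add i2).congr e, ?_⟩
  rw [← integral_congr_ae e]
  unfold unrotated
  rw [B.2, integral_add i1 i2, integral_smul, integral_smul, horiz.integral_comp_comm is,
    rotGen.integral_comp_comm ic]
  have hc' : ∫ q : ℝ × ℝ, (ψ q.1 * (-Real.sin (m * q.2) * m)) • u (polarPt q) ∂stripMeasure
      = -((m : ℝ) • ∫ q : ℝ × ℝ, (ψ q.1 * Real.sin (m * q.2)) • u (polarPt q) ∂stripMeasure) := by
    rw [← integral_smul, ← integral_neg]
    congr 1; funext q; rw [smul_smul, ← neg_smul]; congr 1; ring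
  have hs' : ∫ q : ℝ × ℝ, (ψ q.1 * (Real.cos (m * q.2) * m)) • u (polarPt q) ∂stripMeasure
      = ((m : ℝ) • ∫ q : ℝ × ℝ, (ψ q.1 * Real.cos (m * q.2)) • u (polarPt q) ∂stripMeasure) := by
    rw [← integral_smul]
    congr 1; funext q; rw [smul_smul]; congr 1; ring
  rw [hc'] at ec
  rw [hs'] at es
  have ec2 := neg_injective ec
  have e12 : ∫ q : ℝ × ℝ, (ψ q.1 * 1) • fieldDeriv perp G (polarPt q) ∂stripMeasure = 0 := by
    simpa using e1
  rw [e12, ← ec2, map_smul, map_zero, add_zero]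
  have es2 : ∫ q : ℝ × ℝ, (ψ q.1 * Real.sin (m * q.2)) • fieldDeriv perp G (polarPt q)
      ∂stripMeasure = -((m : ℝ) • ∫ q : ℝ × ℝ, (ψ q.1 * Real.cos (m * q.2)) • u (polarPt q)
      ∂stripMeasure) := by rw [es, neg_neg]
  rw [es2, map_neg, map_smul]
  abel

end

end EquivariantMaps

/-! ### From weak gradients on the plane to the derivative of the profile. -/

namespace EquivariantMaps

theorem tendsto_zero_of_hasCompactSupport {ψ : ℝ → ℝ} (h : HasCompactSupport ψ) (k : ℝ → ℝ) :
    Tendsto (fun x => ψ x * k x) atBot (𝓝 0) ∧ Tendsto (fun x => ψ x * k x) atTop (𝓝 0) := by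
  obtain ⟨N, hN⟩ := exists_bound_of_hasCompactSupport h
  constructor
  · refine tendsto_const_nhds.congr' ?_
    filter_upwards [eventually_lt_atBot (-|N|)] with x hx
    have h1 : N < |x| := by
      have := neg_le_abs x
      have := le_abs_self N
      linarith
    rw [hN x h1, zero_mul]
  · refine tendsto_const_nhds.congr' ?_
    filter_upwards [eventually_gt_atTop |N|] with x hx
    have h1 : N < |x| := by
      have := le_abs_self x
      have := le_abs_self N
      linarith
    rw [hN x h1, zero_mul]

/-- Integration by parts of a locally absolutely continuous function against a test function. -/
theorem IsPrimitive.integral_test {k g ψ : ℝ → ℝ} (hk : IsPrimitive k g) (h1 : ContDiff ℝ ∞ ψ)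
    (h2 : HasCompactSupport ψ) :
    Integrable (fun x => deriv ψ x * k x) ∧ Integrable (fun x => ψ x * g x) ∧
    ∫ x, deriv ψ x * k x = -∫ x, ψ x * g x := by
  have i1 : Integrable (fun x => deriv ψ x * k x) :=
    Continuous.integrable_of_hasCompactSupport ((deriv_test h1).continuous.mul hk.continuous)
      h2.deriv.mul_right
  have i2 : Integrable (fun x => ψ x * g x) := by
    simpa using hk.locInt.integrable_smul_left_of_hasCompactSupport h1.continuous h2
  have hψ : IsPrimitive ψ (deriv ψ) :=
    IsPrimitive.of_hasDerivAt (fun x => (h1.differentiable (by simp) x).hasDerivAt)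
      (deriv_test h1).continuous
  have := (hψ.mul hk).integral_eq (i1.add i2) (tendsto_zero_of_hasCompactSupport h2 k).1
    (tendsto_zero_of_hasCompactSupport h2 k).2
  rw [integral_add i1 i2] at this
  exact ⟨i1, i2, by linarith⟩

theorem isPrimitive_integral {g : ℝ → ℝ} (hg : LocallyIntegrable g) :
    IsPrimitive (fun x => ∫ t in (0 : ℝ)..x, g t) g :=
  ⟨hg, fun _ _ => intervalIntegral.integral_interval_sub_left
    (intervalIntegrable_of_locInt hg _ _) (intervalIntegrable_of_locInt hg _ _)⟩

/-- The difference of `f` and the indefinite integral of `g` has zero weak derivative, hence is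
constant. -/
theorem isPrimitive_of_weak {f g : ℝ → ℝ} (hf : Continuous f) (hg : LocallyIntegrable g)
    (h : ∀ ψ : ℝ → ℝ, ContDiff ℝ ∞ ψ → HasCompactSupport ψ →
      ∫ t, deriv ψ t * f t = -∫ t, ψ t * g t) : IsPrimitive f g := by
  have hk := isPrimitive_integral hg
  have hc : ∀ a b, f a - (∫ t in (0 : ℝ)..a, g t) = f b - ∫ t in (0 : ℝ)..b, g t := by
    refine eq_of_forall_integral_deriv_mul_eq_zero (f := fun x => f x - ∫ t in (0 : ℝ)..x, g t)
      (hf.sub hk.continuous) fun ψ h1 h2 => ?_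
    obtain ⟨i1, i2, e⟩ := hk.integral_test h1 h2
    have i3 : Integrable (fun x => deriv ψ x * f x) :=
      Continuous.integrable_of_hasCompactSupport ((deriv_test h1).continuous.mul hf)
        h2.deriv.mul_right
    simp_rw [mul_sub]
    rw [integral_sub i3 i1, e, h ψ h1 h2, sub_self]
  refine ⟨hg, fun a b => ?_⟩
  have := hc a b
  have h2 := hk.sub_eq a b
  simp only at h2
  linarith

section

variable {m : ℕ} {u : Plane → Space} {G : Fin 2 → Plane → Space}

/-- The average over circles of a square-integrable function on the strip is square integrable in τ,
by Cauchy–Schwarz on almost every circle. -/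
theorem circle_integral_props {K : ℝ × ℝ → Space} (h1 : AEStronglyMeasurable K stripMeasure)
    (h2 : Integrable (fun q => ‖K q‖ ^ 2) stripMeasure) :
    AEStronglyMeasurable (fun τ => ∫ θ in Ioo (-Real.pi) Real.pi, K (τ, θ)) volume ∧
    (∀ᵐ τ, Integrable (fun θ => K (τ, θ)) (volume.restrict (Ioo (-Real.pi) Real.pi)) ∧
      ‖∫ θ in Ioo (-Real.pi) Real.pi, K (τ, θ)‖ ^ 2
        ≤ 2 * Real.pi * ∫ θ in Ioo (-Real.pi) Real.pi, ‖K (τ, θ)‖ ^ 2) ∧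
    Integrable (fun τ => ‖∫ θ in Ioo (-Real.pi) Real.pi, K (τ, θ)‖ ^ 2) := by
  have hm : AEStronglyMeasurable (fun τ => ∫ θ in Ioo (-Real.pi) Real.pi, K (τ, θ)) volume :=
    h1.integral_prod_right'
  have hae : ∀ᵐ τ, Integrable (fun θ => K (τ, θ)) (volume.restrict (Ioo (-Real.pi) Real.pi)) ∧
      ‖∫ θ in Ioo (-Real.pi) Real.pi, K (τ, θ)‖ ^ 2
        ≤ 2 * Real.pi * ∫ θ in Ioo (-Real.pi) Real.pi, ‖K (τ, θ)‖ ^ 2 := by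
    filter_upwards [h1.prodMk_left, h2.prod_right_ae] with τ ha hb
    exact ⟨((memLp_two_iff_integrable_sq_norm ha).2 hb).integrable (by norm_num),
      sq_norm_integral_le_circle ha hb⟩
  refine ⟨hm, hae, ?_⟩
  refine (h2.integral_prod_left.const_mul (2 * Real.pi)).mono (hm.norm.pow 2) ?_
  filter_upwards [hae] with τ hτ
  rw [Real.norm_of_nonneg (by positivity)]
  exact hτ.2.trans (le_abs_self _)

theorem integral_strip {F : ℝ × ℝ → ℝ} (h : Integrable F stripMeasure) :
    ∫ q, F q ∂stripMeasure = ∫ τ, ∫ θ in Ioo (-Real.pi) Real.pi, F (τ, θ) :=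
  integral_prod F h

theorem volume_real_circle :
    (volume.restrict (Ioo (-Real.pi) Real.pi)).real univ = 2 * Real.pi := by
  rw [measureReal_restrict_apply_univ, Real.volume_real_Ioo_of_le (by linarith [Real.pi_pos])]
  ring

theorem integral_strip_fst {f : ℝ → ℝ} (h : Integrable (fun q : ℝ × ℝ => f q.1) stripMeasure) :
    ∫ q : ℝ × ℝ, f q.1 ∂stripMeasure = 2 * Real.pi * ∫ τ, f τ := by
  rw [integral_strip h, ← integral_const_mul]
  refine integral_congr_ae (Eventually.of_forall fun τ => ?_)
  simp only [integral_const, volume_real_circle, smul_eq_mul]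

theorem integral_circle_coord {K : ℝ → Space} (i : Fin 3)
    (h : Integrable K (volume.restrict (Ioo (-Real.pi) Real.pi))) :
    ∫ θ in Ioo (-Real.pi) Real.pi, K θ i = (∫ θ in Ioo (-Real.pi) Real.pi, K θ) i :=
  (EuclideanSpace.proj i : Space →L[ℝ] ℝ).integral_comp_comm h

theorem strip_coord {K : ℝ × ℝ → Space} (h1 : AEStronglyMeasurable K stripMeasure)
    (h2 : Integrable (fun q => ‖K q‖ ^ 2) stripMeasure) {ψ : ℝ → ℝ} (i : Fin 3)
    (h3 : Integrable (fun q : ℝ × ℝ => ψ q.1 • K q) stripMeasure) :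
    (∫ q, ψ q.1 • K q ∂stripMeasure) i
      = ∫ τ, ψ τ * (∫ θ in Ioo (-Real.pi) Real.pi, K (τ, θ)) i := by
  have e1 : (∫ q, ψ q.1 • K q ∂stripMeasure) i = ∫ q, ψ q.1 * K q i ∂stripMeasure :=
    ((EuclideanSpace.proj i : Space →L[ℝ] ℝ).integral_comp_comm h3).symm
  have h4 : Integrable (fun q => ψ q.1 * K q i) stripMeasure :=
    (EuclideanSpace.proj i : Space →L[ℝ] ℝ).integrable_comp h3
  rw [e1, integral_strip h4]
  refine integral_congr_ae ?_
  filter_upwards [(circle_integral_props h1 h2).2.1] with τ hτ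
  simp only [integral_const_mul, integral_circle_coord i hτ.1]

theorem strip_coord_fst {f : ℝ → Space} (i : Fin 3)
    (h3 : Integrable (fun q : ℝ × ℝ => f q.1) stripMeasure) :
    (∫ q : ℝ × ℝ, f q.1 ∂stripMeasure) i = 2 * Real.pi * ∫ τ, f τ i := by
  have e1 : (∫ q : ℝ × ℝ, f q.1 ∂stripMeasure) i = ∫ q : ℝ × ℝ, f q.1 i ∂stripMeasure :=
    ((EuclideanSpace.proj i : Space →L[ℝ] ℝ).integral_comp_comm h3).symm
  have h4 : Integrable (fun q : ℝ × ℝ => f q.1 i) stripMeasure :=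
    (EuclideanSpace.proj i : Space →L[ℝ] ℝ).integrable_comp h3
  rw [e1, integral_strip_fst (f := fun τ => f τ i) h4]

theorem coord_sq_le (x : Space) (i : Fin 3) : x i ^ 2 ≤ ‖x‖ ^ 2 := by
  rw [norm_sq_space]
  fin_cases i <;> simp <;> nlinarith [sq_nonneg (x 0), sq_nonneg (x 1), sq_nonneg (x 2)]

theorem memLp_coord {f : ℝ → Space} (h1 : AEStronglyMeasurable f volume)
    (h2 : Integrable (fun τ => ‖f τ‖ ^ 2)) (i : Fin 3) : MemLp (fun τ => f τ i) 2 volume :=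
  ((memLp_two_iff_integrable_sq_norm h1).2 h2).continuousLinearMap_comp
    (EuclideanSpace.proj i : Space →L[ℝ] ℝ)

/-- The derivative of the profile of an equivariant map of finite energy with respect to `log r`. -/
structure IsLogDeriv (m : ℕ) (u : Plane → Space) (G : Fin 2 → Plane → Space) (g : ℝ → Space) :
    Prop where
  meas : AEStronglyMeasurable g volume
  primitive : ∀ i, IsPrimitive (fun τ => logProfile u τ i) (fun τ => g τ i)
  integrable_sq : Integrable (fun τ => ‖g τ‖ ^ 2)
  integrable_rotGen : Integrable (fun τ => ‖(m : ℝ) • rotGen (logProfile u τ)‖ ^ 2)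
  le : 2 * Real.pi * ∫ τ, (‖g τ‖ ^ 2 + ‖(m : ℝ) • rotGen (logProfile u τ)‖ ^ 2)
    ≤ ∫ x, ∑ j, ‖G j x‖ ^ 2
  pairing : ∀ (H : Fin 2 → Plane → Space) (a b : ℝ → Space), (∀ j, MemLp (H j) 2 volume) →
    (∀ q : ℝ × ℝ, q.2 ∈ Ioo (-Real.pi) Real.pi →
      unrotated m (ContinuousLinearMap.id ℝ Plane) H q = a q.1 ∧ unrotated m perp H q = b q.1) →
    ∫ x, ∑ j, inner ℝ (G j x) (H j x) = 2 * Real.pi *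
      ∫ τ, (inner ℝ (g τ) (a τ) + inner ℝ ((m : ℝ) • rotGen (logProfile u τ)) (b τ))

/-- The derivative of the profile is the circle average of the unrotated radial derivative, which
avoids proving that the weak gradient is itself equivariant. Averaging can only decrease the energy,
hence the inequality in `le`; this is the direction that the lower energy bound needs. Pairings with
a gradient whose unrotated components depend on τ alone see only the averages, so `pairing` is an
equality. -/
theorem exists_isLogDeriv (hu : IsEquivariantHdot m u) (hG : IsWeakGradient u G) :
    ∃ g, IsLogDeriv m u G g := by
  set L := ContinuousLinearMap.id ℝ Plane with hL
  have hpi := Real.pi_pos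
  obtain ⟨sX, sY⟩ := integrable_unrotated_sq (m := m) hG
  have mX := aestronglyMeasurable_unrotated (m := m) hG L
  have mY := aestronglyMeasurable_unrotated (m := m) hG perp
  set X := unrotated m L G with hX
  set Y := unrotated m perp G with hY
  obtain ⟨X1, X2, X3⟩ := circle_integral_props mX sX
  obtain ⟨Y1, Y2, Y3⟩ := circle_integral_props mY sY
  set kX : ℝ → Space := fun τ => ∫ θ in Ioo (-Real.pi) Real.pi, X (τ, θ) with hkX
  set kY : ℝ → Space := fun τ => ∫ θ in Ioo (-Real.pi) Real.pi, Y (τ, θ) with hkY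
  set g : ℝ → Space := fun τ => (2 * Real.pi)⁻¹ • kX τ with hg
  have gm : AEStronglyMeasurable g volume := X1.const_smul ((2 * Real.pi)⁻¹)
  have gn : ∀ τ, ‖g τ‖ ^ 2 = (2 * Real.pi)⁻¹ ^ 2 * ‖kX τ‖ ^ 2 := fun τ => by
    rw [hg, norm_smul, mul_pow, Real.norm_of_nonneg (by positivity)]
  have gs : Integrable (fun τ => ‖g τ‖ ^ 2) := by
    simp_rw [gn]; exact X3.const_mul _
  have hprim : ∀ i, IsPrimitive (fun τ => logProfile u τ i) (fun τ => g τ i) := by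
    intro i
    have hc : Continuous fun τ => logProfile u τ i :=
      (EuclideanSpace.proj i : Space →L[ℝ] ℝ).continuous.comp (continuous_logProfile hu.continuous)
    refine isPrimitive_of_weak hc ((memLp_coord gm gs i).locallyIntegrable (by norm_num))
      fun ψ h1 h2 => ?_
    obtain ⟨ir, er⟩ := strip_radial hu hG h1 h2
    have e := congrArg (fun y : Space => y i) er
    simp only [PiLp.neg_apply] at e
    rw [strip_coord_fst (f := fun τ => deriv ψ τ • logProfile u τ) i ir,
      strip_coord mX sX i (integrable_strip_unrotated hG L h1 h2)] at e
    have e2 : ∫ t, ψ t * g t i = (2 * Real.pi)⁻¹ * ∫ t, ψ t * kX t i := by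
      rw [← integral_const_mul]
      refine integral_congr_ae (Eventually.of_forall fun t => ?_)
      simp [hg]; ring
    rw [e2]
    have e3 : ∫ t, deriv ψ t * logProfile u t i = ∫ τ, (deriv ψ τ • logProfile u τ) i := by
      simp
    rw [e3]
    field_simp
    linarith
  -- The average of the angular derivative is already known from the values of the profile. It is
  -- identified coordinate by coordinate through test functions, so only almost everywhere.
  have hrot : ∀ᵐ τ, kY τ = (2 * Real.pi) • ((m : ℝ) • rotGen (logProfile u τ)) := by
    have hco : ∀ i : Fin 3, ∀ᵐ τ, kY τ i = 2 * Real.pi * ((m : ℝ) • rotGen (logProfile u τ)) i := by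
      intro i
      have hc : Continuous fun τ => 2 * Real.pi * ((m : ℝ) • rotGen (logProfile u τ)) i := by
        have := (EuclideanSpace.proj i : Space →L[ℝ] ℝ).continuous.comp
          (((rotGen.continuous.comp (continuous_logProfile hu.continuous)).const_smul (m : ℝ)))
        exact this.const_mul _
      refine ae_eq_of_integral_contDiff_smul_eq
        ((memLp_coord Y1 Y3 i).locallyIntegrable (by norm_num)) hc.locallyIntegrable
        fun ψ h1 h2 => ?_
      obtain ⟨ir, er⟩ := strip_angular hu hG h1 h2
      have e := congrArg (fun y : Space => y i) er
      simp only at e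
      rw [strip_coord_fst (f := fun τ => ψ τ • ((m : ℝ) • rotGen (logProfile u τ))) i ir,
        strip_coord mY sY i (integrable_strip_unrotated hG perp h1 h2)] at e
      simp only [smul_eq_mul]
      rw [← e, ← integral_const_mul]
      refine integral_congr_ae (Eventually.of_forall fun t => ?_)
      simp; ring
    filter_upwards [hco 0, hco 1, hco 2] with τ h0 h1 h2
    ext i; fin_cases i <;> simpa using by assumption
  have rn : ∀ᵐ τ, ‖(m : ℝ) • rotGen (logProfile u τ)‖ ^ 2 = (2 * Real.pi)⁻¹ ^ 2 * ‖kY τ‖ ^ 2 := by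
    filter_upwards [hrot] with τ hτ
    rw [hτ, norm_smul (2 * Real.pi), mul_pow, Real.norm_of_nonneg (by positivity)]
    field_simp
  have rs : Integrable (fun τ => ‖(m : ℝ) • rotGen (logProfile u τ)‖ ^ 2) :=
    (Y3.const_mul ((2 * Real.pi)⁻¹ ^ 2)).congr (by filter_upwards [rn] with τ h using h.symm)
  refine ⟨g, gm, hprim, gs, rs, ?_, ?_⟩
  · have e0 : ∫ x, ∑ j, ‖G j x‖ ^ 2 = ∫ q, (‖X q‖ ^ 2 + ‖Y q‖ ^ 2) ∂stripMeasure := by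
      have h := integrable_sum_inner (fun j => (hG j).1) (fun j => (hG j).1)
      simp_rw [← real_inner_self_eq_norm_sq]
      rw [integral_plane h.aestronglyMeasurable]
      refine integral_congr_ae (Eventually.of_forall fun q => ?_)
      simp only [smul_eq_mul]
      rw [← unrotated_inner (m := m)]
    have sXY : Integrable (fun q => ‖X q‖ ^ 2 + ‖Y q‖ ^ 2) stripMeasure := sX.add sY
    rw [e0, integral_strip sXY, ← integral_const_mul]
    refine integral_mono_ae ((gs.add rs).const_mul _) sXY.integral_prod_left ?_
    filter_upwards [X2, Y2, rn, sX.prod_right_ae, sY.prod_right_ae] with τ a b c d e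
    rw [c, gn, integral_add d e]
    have a2 : (2 * Real.pi)⁻¹ * ‖kX τ‖ ^ 2 ≤ ∫ θ in Ioo (-Real.pi) Real.pi, ‖X (τ, θ)‖ ^ 2 := by
      rw [inv_mul_le_iff₀ (by positivity)]; exact a.2
    have b2 : (2 * Real.pi)⁻¹ * ‖kY τ‖ ^ 2 ≤ ∫ θ in Ioo (-Real.pi) Real.pi, ‖Y (τ, θ)‖ ^ 2 := by
      rw [inv_mul_le_iff₀ (by positivity)]; exact b.2
    calc _ = (2 * Real.pi)⁻¹ * ‖kX τ‖ ^ 2 + (2 * Real.pi)⁻¹ * ‖kY τ‖ ^ 2 := by field_simp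
      _ ≤ _ := add_le_add a2 b2
  · intro H a b hH hab
    have h := integrable_sum_inner (fun j => (hG j).1) hH
    have h' := h
    rw [integrable_plane_iff h.aestronglyMeasurable] at h'
    have e : (fun q : ℝ × ℝ => Real.exp (2 * q.1) •
        ∑ j, inner ℝ (G j (polarPt q)) (H j (polarPt q)))
        =ᵐ[stripMeasure] fun q => inner ℝ (X q) (a q.1) + inner ℝ (Y q) (b q.1) := by
      filter_upwards [ae_strip_mem] with q hq
      rw [smul_eq_mul, ← unrotated_inner (m := m), (hab q hq).1, (hab q hq).2]
    rw [integral_plane h.aestronglyMeasurable, integral_congr_ae e,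
      integral_strip (h'.congr e), ← integral_const_mul]
    refine integral_congr_ae ?_
    filter_upwards [X2, Y2, hrot] with τ h1 h2 h3
    have i1 : Integrable (fun θ => inner ℝ (X (τ, θ)) (a τ))
      (volume.restrict (Ioo (-Real.pi) Real.pi)) := h1.1.inner_const _
    have i2 : Integrable (fun θ => inner ℝ (Y (τ, θ)) (b τ))
      (volume.restrict (Ioo (-Real.pi) Real.pi)) := h2.1.inner_const _
    have j1 : ∫ θ in Ioo (-Real.pi) Real.pi, inner ℝ (X (τ, θ)) (a τ) = inner ℝ (kX τ) (a τ) := by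
      simp_rw [fun θ => real_inner_comm (a τ) (X (τ, θ))]
      rw [integral_inner h1.1, real_inner_comm]
    have j2 : ∫ θ in Ioo (-Real.pi) Real.pi, inner ℝ (Y (τ, θ)) (b τ) = inner ℝ (kY τ) (b τ) := by
      simp_rw [fun θ => real_inner_comm (b τ) (Y (τ, θ))]
      rw [integral_inner h2.1, real_inner_comm]
    rw [integral_add i1 i2, j1, j2, h3, hg]
    simp only [real_inner_smul_left]
    field_simp

end

end EquivariantMaps

namespace EquivariantMaps

/-! ### The homogeneous Sobolev distance -/

section

variable {u w : Plane → Space} {G H : Fin 2 → Plane → Space}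

theorem IsWeakGradient.ae_eq (hG : IsWeakGradient u G) (hH : IsWeakGradient u H) (j : Fin 2) :
    G j =ᵐ[volume] H j := by
  refine ae_eq_of_integral_contDiff_smul_eq ((hG j).1.locallyIntegrable (by norm_num))
    ((hH j).1.locallyIntegrable (by norm_num)) fun φ h1 h2 => ?_
  have a := (hG j).2 φ h1 h2
  have b := (hH j).2 φ h1 h2
  rw [a] at b
  exact neg_injective b

theorem isWeakGradient_weakGrad (h : MemHdot u) : IsWeakGradient u (weakGrad u) := by
  unfold weakGrad
  rw [dif_pos h.2]
  exact h.2.choose_spec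

theorem IsWeakGradient.memHdot (hu : Continuous u) (hG : IsWeakGradient u G) : MemHdot u :=
  ⟨hu.locallyIntegrable, G, hG⟩

theorem IsWeakGradient.dirichlet_eq (hu : Continuous u) (hG : IsWeakGradient u G) :
    dirichlet u = ∫ x, ∑ j, ‖G j x‖ ^ 2 := by
  have h := isWeakGradient_weakGrad (hG.memHdot hu)
  unfold dirichlet
  refine integral_congr_ae ?_
  filter_upwards [h.ae_eq hG 0, h.ae_eq hG 1] with x h0 h1
  rw [Fin.sum_univ_two, Fin.sum_univ_two, h0, h1]

theorem IsWeakGradient.sub (hu : Continuous u) (hw : Continuous w) (hG : IsWeakGradient u G)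
    (hH : IsWeakGradient w H) : IsWeakGradient (u - w) (fun j => G j - H j) := by
  intro j
  refine ⟨(hG j).1.sub (hH j).1, fun φ h1 h2 => ?_⟩
  have hd : Continuous fun x => fderiv ℝ φ x (EuclideanSpace.single j 1) :=
    (h1.continuous_fderiv (by simp)).clm_apply continuous_const
  have hdc : HasCompactSupport fun x => fderiv ℝ φ x (EuclideanSpace.single j 1) :=
    (h2.fderiv (𝕜 := ℝ)).comp_left (g := fun l : Plane →L[ℝ] ℝ =>
        l (EuclideanSpace.single j 1)) (by simp)
  have i1 := hu.locallyIntegrable.integrable_smul_left_of_hasCompactSupport (μ := volume) hd hdc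
  have i2 := hw.locallyIntegrable.integrable_smul_left_of_hasCompactSupport (μ := volume) hd hdc
  have i3 := ((hG j).1.locallyIntegrable (by norm_num)).integrable_smul_left_of_hasCompactSupport
    h1.continuous h2
  have i4 := ((hH j).1.locallyIntegrable (by norm_num)).integrable_smul_left_of_hasCompactSupport
    h1.continuous h2
  simp only [Pi.sub_apply, smul_sub]
  rw [integral_sub i1 i2, integral_sub i3 i4, (hG j).2 φ h1 h2, (hH j).2 φ h1 h2]
  abel

theorem integrable_sum_norm_sq (hG : IsWeakGradient u G) :
    Integrable fun x => ∑ j, ‖G j x‖ ^ 2 := by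
  have h := integrable_sum_inner (fun j => (hG j).1) (fun j => (hG j).1)
  simpa only [real_inner_self_eq_norm_sq] using h

theorem dirichlet_nonneg (u : Plane → Space) : 0 ≤ dirichlet u :=
  integral_nonneg fun _ => Finset.sum_nonneg fun _ _ => sq_nonneg _

theorem dirichlet_sub_eq (hu : Continuous u) (hw : Continuous w) (hG : IsWeakGradient u G)
    (hH : IsWeakGradient w H) : dirichlet (u - w) = dirichlet u + dirichlet w
      - 2 * ∫ x, ∑ j, inner ℝ (G j x) (H j x) := by
  rw [(hG.sub hu hw hH).dirichlet_eq (hu.sub hw), hG.dirichlet_eq hu, hH.dirichlet_eq hw]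
  have i1 := integrable_sum_norm_sq hG
  have i2 := integrable_sum_norm_sq hH
  have i3 := integrable_sum_inner (fun j => (hG j).1) (fun j => (hH j).1)
  rw [← integral_add i1 i2, ← integral_const_mul, ← integral_sub (i1.fun_add i2) (i3.const_mul 2)]
  refine integral_congr_ae (Eventually.of_forall fun x => ?_)
  simp only [Pi.sub_apply, Fin.sum_univ_two, norm_sub_sq_real]
  ring

theorem hdist_sq (u w : Plane → Space) : hdist u w ^ 2 = dirichlet (u - w) :=
  Real.sq_sqrt (dirichlet_nonneg _)

theorem hdist_nonneg (u w : Plane → Space) : 0 ≤ hdist u w := Real.sqrt_nonneg _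

/-- Cauchy-Schwarz for the Dirichlet form. -/
theorem integral_inner_le_sqrt (hu : Continuous u) (hw : Continuous w) (hG : IsWeakGradient u G)
    (hH : IsWeakGradient w H) : ∫ x, ∑ j, inner ℝ (G j x) (H j x)
      ≤ Real.sqrt (dirichlet u) * Real.sqrt (dirichlet w) := by
  set a := dirichlet u with ha
  set b := dirichlet w with hb
  set c := ∫ x, ∑ j, inner ℝ (G j x) (H j x) with hc
  have i1 := integrable_sum_norm_sq hG
  have i2 := integrable_sum_norm_sq hH
  have i3 := integrable_sum_inner (fun j => (hG j).1) (fun j => (hH j).1)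
  have i4 : ∀ t : ℝ, Integrable fun x => (∑ j, ‖G j x‖ ^ 2)
      - 2 * t * ∑ j, inner ℝ (G j x) (H j x) := fun t => i1.sub (i3.const_mul _)
  have key : ∀ t : ℝ, 0 ≤ a - 2 * t * c + t ^ 2 * b := by
    intro t
    have : a - 2 * t * c + t ^ 2 * b = ∫ x, ∑ j, ‖G j x - t • H j x‖ ^ 2 := by
      rw [ha, hb, hc, hG.dirichlet_eq hu, hH.dirichlet_eq hw, ← integral_const_mul,
        ← integral_const_mul, ← integral_sub i1 (i3.const_mul _),
        ← integral_add (i4 t) (i2.const_mul _)]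
      refine integral_congr_ae (Eventually.of_forall fun x => ?_)
      simp only [Fin.sum_univ_two, norm_sub_sq_real, real_inner_smul_right, norm_smul,
        mul_pow, Real.norm_eq_abs, sq_abs]
      ring
    rw [this]
    exact integral_nonneg fun _ => Finset.sum_nonneg fun _ _ => sq_nonneg _
  -- Nonnegativity for all `t` forces the discriminant to be nonpositive; this form also covers the
  -- degenerate case `b = 0`.
  have hd := discrim_le_zero (a := b) (b := -2 * c) (c := a) fun t => by
    have := key t
    nlinarith
  rw [discrim] at hd
  have ha0 : 0 ≤ a := dirichlet_nonneg u
  rw [← Real.sqrt_mul ha0]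
  refine Real.le_sqrt_of_sq_le ?_
  nlinarith

/-- The reverse triangle inequality for the Dirichlet seminorm; applied to two differences it yields
`hdist_triangle`. -/
theorem sqrt_dirichlet_sub_le (hu : Continuous u) (hw : Continuous w) (h1 : MemHdot u)
    (h2 : MemHdot w) :
    |Real.sqrt (dirichlet u) - Real.sqrt (dirichlet w)| ≤ hdist u w := by
  have hG := isWeakGradient_weakGrad h1
  have hH := isWeakGradient_weakGrad h2
  have e := dirichlet_sub_eq hu hw hG hH
  have c := integral_inner_le_sqrt hu hw hG hH
  refine abs_le_of_sq_le_sq ?_ (hdist_nonneg _ _)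
  rw [hdist_sq, e]
  have := Real.sq_sqrt (dirichlet_nonneg u)
  have := Real.sq_sqrt (dirichlet_nonneg w)
  nlinarith

theorem hdist_comm (u w : Plane → Space) (hu : Continuous u) (hw : Continuous w) (h1 : MemHdot u)
    (h2 : MemHdot w) : hdist u w = hdist w u := by
  have hG := isWeakGradient_weakGrad h1
  have hH := isWeakGradient_weakGrad h2
  rw [hdist, hdist, dirichlet_sub_eq hu hw hG hH, dirichlet_sub_eq hw hu hH hG]
  simp_rw [real_inner_comm]
  rw [add_comm (dirichlet w)]

theorem MemHdot.sub (hu : Continuous u) (hw : Continuous w) (h1 : MemHdot u)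
    (h2 : MemHdot w) : MemHdot (u - w) :=
  ((isWeakGradient_weakGrad h1).sub hu hw (isWeakGradient_weakGrad h2)).memHdot (hu.sub hw)

theorem hdist_triangle {v : Plane → Space} (hu : Continuous u) (hv : Continuous v)
    (hw : Continuous w) (h1 : MemHdot u) (h2 : MemHdot v) (h3 : MemHdot w) :
    hdist u w ≤ hdist u v + hdist v w := by
  have := sqrt_dirichlet_sub_le (hu.sub hw) (hu.sub hv) (h1.sub hu hw h3) (h1.sub hu hv h2)
  have e : hdist (u - w) (u - v) = hdist v w := by unfold hdist; congr 2; abel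
  rw [e] at this
  have := (abs_le.1 this).2
  unfold hdist at *
  linarith

theorem isWeakGradient_of_contDiff (hu : ContDiff ℝ 1 u)
    (hL : ∀ j : Fin 2, MemLp (fun x => fderiv ℝ u x (EuclideanSpace.single j 1)) 2 volume) :
    IsWeakGradient u (fun j x => fderiv ℝ u x (EuclideanSpace.single j 1)) := by
  intro j
  refine ⟨hL j, fun φ h1 h2 => ?_⟩
  have hd : Continuous fun x => fderiv ℝ φ x (EuclideanSpace.single j 1) :=
    (h1.continuous_fderiv (by simp)).clm_apply continuous_const
  have hdc : HasCompactSupport fun x => fderiv ℝ φ x (EuclideanSpace.single j 1) :=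
    (h2.fderiv (𝕜 := ℝ)).comp_left (g := fun l : Plane →L[ℝ] ℝ =>
        l (EuclideanSpace.single j 1)) (by simp)
  have huc := hu.continuous
  have hud : Continuous fun x => fderiv ℝ u x (EuclideanSpace.single j 1) :=
    (hu.continuous_fderiv (by simp)).clm_apply continuous_const
  have := integral_smul_fderiv_eq_neg_fderiv_smul_of_integrable (μ := volume) (f := φ) (g := u)
    (v := EuclideanSpace.single j 1)
    (huc.locallyIntegrable.integrable_smul_left_of_hasCompactSupport hd hdc)
    (hud.locallyIntegrable.integrable_smul_left_of_hasCompactSupport h1.continuous h2)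
    (huc.locallyIntegrable.integrable_smul_left_of_hasCompactSupport h1.continuous h2)
    (fun x _ => h1.differentiable (by simp) x) (fun x _ => hu.differentiable (by simp) x)
  rw [this, neg_neg]

end

/-! ### The harmonic profile in logarithmic coordinates -/

/-- `h₁` as a function of `log r`. -/
noncomputable def lh₁ (m : ℕ) (τ : ℝ) : ℝ := h₁ m (Real.exp τ)

/-- `h₃` as a function of `log r`. -/
noncomputable def lh₃ (m : ℕ) (τ : ℝ) : ℝ := h₃ m (Real.exp τ)

section

variable (m : ℕ) (τ : ℝ)

theorem exp_pow_eq : Real.exp τ ^ m = Real.exp (m * τ) := (Real.exp_nat_mul τ m).symm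

theorem lh₁_eq : lh₁ m τ = 2 * Real.exp (m * τ) / (Real.exp (m * τ) ^ 2 + 1) := by
  rw [lh₁, h₁, mul_comm 2 m, pow_mul, exp_pow_eq]

theorem lh₃_eq : lh₃ m τ = (Real.exp (m * τ) ^ 2 - 1) / (Real.exp (m * τ) ^ 2 + 1) := by
  rw [lh₃, h₃, mul_comm 2 m, pow_mul, exp_pow_eq]

theorem lh_sq_add : lh₁ m τ ^ 2 + lh₃ m τ ^ 2 = 1 := by
  rw [lh₁_eq, lh₃_eq]
  have : Real.exp (m * τ) ^ 2 + 1 ≠ 0 := by positivity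
  field_simp
  ring

theorem lh₁_pos : 0 < lh₁ m τ := by rw [lh₁_eq]; positivity

theorem lh₁_le_one : lh₁ m τ ≤ 1 := by
  nlinarith [lh_sq_add m τ, lh₁_pos m τ, sq_nonneg (lh₃ m τ)]

theorem abs_lh₃_le_one : |lh₃ m τ| ≤ 1 := by
  rw [← sq_le_one_iff_abs_le_one]
  nlinarith [lh_sq_add m τ, sq_nonneg (lh₁ m τ)]

theorem lh₁_neg : lh₁ m (-τ) = lh₁ m τ := by
  rw [lh₁_eq, lh₁_eq, mul_neg, Real.exp_neg]
  have := Real.exp_pos (m * τ)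
  field_simp
  ring

theorem lh₃_neg : lh₃ m (-τ) = -lh₃ m τ := by
  rw [lh₃_eq, lh₃_eq, mul_neg, Real.exp_neg]
  have := Real.exp_pos (m * τ)
  field_simp
  ring

theorem lh₁_le : lh₁ m τ ≤ 2 * Real.exp (-(m * |τ|)) := by
  have key : ∀ t : ℝ, lh₁ m t ≤ 2 * Real.exp (-(m * t)) := by
    intro t
    rw [lh₁_eq, Real.exp_neg, div_le_iff₀ (by positivity)]
    have := Real.exp_pos (m * t)
    field_simp
    linarith
  rcases abs_cases τ with h | h
  · rw [h.1]; exact key τ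
  · rw [h.1, ← lh₁_neg]; exact key (-τ)

/-- With `hasDerivAt_lh₃` this is the first-order system h₁' = −m h₁h₃, h₃' = m h₁² (derivatives in
log r). Together with h₁² + h₃² = 1, evenness of h₁ and oddness of h₃, it drives all later
identities for the harmonic profile. -/
theorem hasDerivAt_lh₁ : HasDerivAt (lh₁ m) (-(m * lh₁ m τ * lh₃ m τ)) τ := by
  have he : HasDerivAt (fun t : ℝ => Real.exp (m * t)) (Real.exp (m * τ) * m) τ := by
    simpa using ((hasDerivAt_id τ).const_mul (m : ℝ)).exp
  have h0 : Real.exp (m * τ) ^ 2 + 1 ≠ 0 := by positivity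
  have := (he.const_mul 2).fun_div ((he.fun_pow 2).add_const 1) h0
  rw [show lh₁ m = fun t => 2 * Real.exp (m * t) / (Real.exp (m * t) ^ 2 + 1) from
    funext (lh₁_eq m)]
  refine this.congr_deriv ?_
  rw [lh₃_eq]
  field_simp
  ring

theorem hasDerivAt_lh₃ : HasDerivAt (lh₃ m) (m * lh₁ m τ ^ 2) τ := by
  have he : HasDerivAt (fun t : ℝ => Real.exp (m * t)) (Real.exp (m * τ) * m) τ := by
    simpa using ((hasDerivAt_id τ).const_mul (m : ℝ)).exp
  have h0 : Real.exp (m * τ) ^ 2 + 1 ≠ 0 := by positivity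
  have := ((he.fun_pow 2).sub_const 1).fun_div ((he.fun_pow 2).add_const 1) h0
  rw [show lh₃ m = fun t => (Real.exp (m * t) ^ 2 - 1) / (Real.exp (m * t) ^ 2 + 1) from
    funext (lh₃_eq m)]
  refine this.congr_deriv ?_
  rw [lh₁_eq]
  field_simp
  ring

theorem continuous_lh₁ : Continuous (lh₁ m) :=
  continuous_iff_continuousAt.2 fun t => (hasDerivAt_lh₁ m t).continuousAt

theorem continuous_lh₃ : Continuous (lh₃ m) :=
  continuous_iff_continuousAt.2 fun t => (hasDerivAt_lh₃ m t).continuousAt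

theorem lh₃_zero : lh₃ m 0 = 0 := by rw [lh₃_eq]; simp

variable {m}

theorem tendsto_lh₃_atTop (hm : 1 ≤ m) : Tendsto (lh₃ m) atTop (𝓝 1) := by
  have h1 : Tendsto (fun t : ℝ => Real.exp (m * t) ^ 2) atTop atTop := by
    refine (tendsto_pow_atTop (by norm_num)).comp (Real.tendsto_exp_atTop.comp ?_)
    exact tendsto_id.const_mul_atTop (by positivity)
  have h2 : Tendsto (fun t : ℝ => 1 - 2 * (Real.exp (m * t) ^ 2 + 1)⁻¹) atTop (𝓝 (1 - 2 * 0)) :=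
    tendsto_const_nhds.sub
      ((tendsto_inv_atTop_zero.comp (tendsto_atTop_add_const_right _ 1 h1)).const_mul 2)
  simp only [mul_zero, sub_zero] at h2
  refine h2.congr fun t => ?_
  rw [lh₃_eq]
  have : Real.exp (m * t) ^ 2 + 1 ≠ 0 := by positivity
  field_simp
  ring

theorem tendsto_lh₃_atBot (hm : 1 ≤ m) : Tendsto (lh₃ m) atBot (𝓝 (-1)) := by
  have := ((tendsto_lh₃_atTop hm).comp tendsto_neg_atBot_atTop).neg
  refine this.congr fun t => ?_
  simp [lh₃_neg]

theorem integrable_exp_neg_abs {c : ℝ} (hc : 0 < c) :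
    Integrable fun t : ℝ => Real.exp (-(c * |t|)) := by
  rw [← integrableOn_univ, ← Iic_union_Ioi (a := (0 : ℝ))]
  refine IntegrableOn.union ?_ ?_
  · refine (integrableOn_exp_mul_Iic hc 0).congr_fun (fun t ht => ?_) measurableSet_Iic
    simp only
    rw [abs_of_nonpos (mem_Iic.1 ht)]
    ring_nf
  · refine (exp_neg_integrableOn_Ioi 0 hc).congr_fun (fun t ht => ?_) measurableSet_Ioi
    simp only
    rw [abs_of_pos (mem_Ioi.1 ht)]
    ring_nf

theorem integrable_of_exp_decay {f : ℝ → ℝ} (hf : Continuous f) {C c : ℝ} (hc : 0 < c)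
    (h : ∀ t, |f t| ≤ C * Real.exp (-(c * |t|))) : Integrable f := by
  refine ((integrable_exp_neg_abs hc).const_mul C).mono' hf.aestronglyMeasurable ?_
  exact Eventually.of_forall h

theorem lh₁_le_exp (hm : 1 ≤ m) : lh₁ m τ ≤ 2 * Real.exp (-(1 * |τ|)) := by
  refine (lh₁_le m τ).trans ?_
  have : (1 : ℝ) ≤ m := by exact_mod_cast hm
  gcongr

theorem lh₁_sq_le (hm : 1 ≤ m) : lh₁ m τ ^ 2 ≤ 2 * Real.exp (-(1 * |τ|)) := by
  refine le_trans ?_ (lh₁_le_exp τ hm)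
  nlinarith [lh₁_pos m τ, lh₁_le_one m τ]

theorem integrable_lh₁ (hm : 1 ≤ m) : Integrable (lh₁ m) :=
  integrable_of_exp_decay (continuous_lh₁ m) one_pos fun t => by
    rw [abs_of_pos (lh₁_pos m t)]; exact lh₁_le_exp t hm

theorem integrable_lh₁_sq (hm : 1 ≤ m) : Integrable fun t => lh₁ m t ^ 2 :=
  integrable_of_exp_decay ((continuous_lh₁ m).pow 2) one_pos fun t => by
    rw [abs_of_nonneg (sq_nonneg _)]; exact lh₁_sq_le t hm

/-- The integrand m h₁² is the derivative of h₃, which increases from −1 to 1. -/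
theorem integral_lh₁_sq (hm : 1 ≤ m) : (m : ℝ) * ∫ t, lh₁ m t ^ 2 = 2 := by
  have h : IsPrimitive (lh₃ m) (fun t => m * lh₁ m t ^ 2) :=
    IsPrimitive.of_hasDerivAt (hasDerivAt_lh₃ m) (((continuous_lh₁ m).pow 2).const_mul _)
  have := h.integral_eq ((integrable_lh₁_sq hm).const_mul _) (tendsto_lh₃_atBot hm)
    (tendsto_lh₃_atTop hm)
  rw [integral_const_mul] at this
  rw [this]; norm_num

theorem tendsto_lh₁_atTop (hm : 1 ≤ m) : Tendsto (lh₁ m) atTop (𝓝 0) := by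
  have h2 : Tendsto (fun t : ℝ => 2 * Real.exp (-(1 * |t|))) atTop (𝓝 (2 * 0)) := by
    refine (Real.tendsto_exp_atBot.comp ?_).const_mul 2
    simp only [one_mul]
    exact tendsto_neg_atTop_atBot.comp tendsto_abs_atTop_atTop
  rw [mul_zero] at h2
  exact squeeze_zero (fun t => (lh₁_pos m t).le) (fun t => lh₁_le_exp t hm) h2

theorem tendsto_lh₁_atBot (hm : 1 ≤ m) : Tendsto (lh₁ m) atBot (𝓝 0) := by
  have := (tendsto_lh₁_atTop hm).comp tendsto_neg_atBot_atTop
  refine this.congr fun t => ?_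
  simp [lh₁_neg]

end

end EquivariantMaps

namespace EquivariantMaps

/-! ### The weak gradient of the harmonic maps -/

/-- The profile of `Q` as a function of `log r`. -/
noncomputable def lh (m : ℕ) (τ : ℝ) : Space := !₂[lh₁ m τ, 0, lh₃ m τ]

/-- The derivative of `lh`. -/
noncomputable def lhDeriv (m : ℕ) (τ : ℝ) : Space :=
  !₂[-(m * lh₁ m τ * lh₃ m τ), 0, m * lh₁ m τ ^ 2]

section

variable (m : ℕ)

@[simp] theorem lh_zero (τ : ℝ) : lh m τ 0 = lh₁ m τ := rfl
@[simp] theorem lh_one (τ : ℝ) : lh m τ 1 = 0 := rfl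
@[simp] theorem lh_two (τ : ℝ) : lh m τ 2 = lh₃ m τ := rfl
@[simp] theorem lhDeriv_zero (τ : ℝ) : lhDeriv m τ 0 = -(m * lh₁ m τ * lh₃ m τ) := rfl
@[simp] theorem lhDeriv_one (τ : ℝ) : lhDeriv m τ 1 = 0 := rfl
@[simp] theorem lhDeriv_two (τ : ℝ) : lhDeriv m τ 2 = m * lh₁ m τ ^ 2 := rfl

theorem hasDerivAt_toLp_three {f g k : ℝ → ℝ} {f' g' k' t : ℝ} (hf : HasDerivAt f f' t)
    (hg : HasDerivAt g g' t) (hk : HasDerivAt k k' t) :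
    HasDerivAt (fun t => (!₂[f t, g t, k t] : Space)) !₂[f', g', k'] t := by
  have h : HasDerivAt (fun t => (![f t, g t, k t] : Fin 3 → ℝ)) ![f', g', k'] t := by
    rw [hasDerivAt_pi]; intro i; fin_cases i <;> simpa
  exact ((PiLp.continuousLinearEquiv 2 ℝ (fun _ : Fin 3 => ℝ)).symm.hasFDerivAt.comp_hasDerivAt t h)

theorem hasDerivAt_lh (τ : ℝ) : HasDerivAt (lh m) (lhDeriv m τ) τ :=
  hasDerivAt_toLp_three (hasDerivAt_lh₁ m τ) (hasDerivAt_const τ 0) (hasDerivAt_lh₃ m τ)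

theorem norm_lh (τ : ℝ) : ‖lh m τ‖ = 1 := by
  have : ‖lh m τ‖ ^ 2 = 1 ^ 2 := by
    rw [norm_sq_space]; simp; exact lh_sq_add m τ
  exact (sq_eq_sq₀ (norm_nonneg _) zero_le_one).1 this

theorem hProfile_exp (τ : ℝ) : hProfile m (Real.exp τ) = lh m τ := rfl

theorem cpow_plane (y : Plane) : ((y 0 : ℂ) + y 1 * Complex.I) ^ m
    = ((‖y‖ ^ m : ℝ) : ℂ) * (((m • polarAngle y).cos : ℝ) + ((m • polarAngle y).sin : ℝ) * Complex.I) := by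
  have hz : (⟨y 0, y 1⟩ : ℂ) = (y 0 : ℂ) + y 1 * Complex.I := by
    apply Complex.ext <;> simp
  have hn : ‖(⟨y 0, y 1⟩ : ℂ)‖ = ‖y‖ := by
    have : ‖(⟨y 0, y 1⟩ : ℂ)‖ ^ 2 = ‖y‖ ^ 2 := by
      rw [norm_sq_plane, Complex.sq_norm, Complex.normSq_mk]; ring
    exact (sq_eq_sq₀ (norm_nonneg _) (norm_nonneg _)).1 this
  have h := Complex.norm_mul_cos_add_sin_mul_I (⟨y 0, y 1⟩ : ℂ)
  rw [hn] at h
  have hm := Complex.cos_add_sin_mul_I_pow m (Complex.arg ⟨y 0, y 1⟩ : ℂ)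
  rw [← hz, ← h, mul_pow, hm, polarAngle, cos_nsmul, sin_nsmul]
  push_cast
  rfl

theorem rePow_eq (y : Plane) : rePow m y = ‖y‖ ^ m * (m • polarAngle y).cos := by
  rw [rePow, cpow_plane, Complex.re_ofReal_mul]; simp

theorem imPow_eq (y : Plane) : imPow m y = ‖y‖ ^ m * (m • polarAngle y).sin := by
  rw [imPow, cpow_plane, Complex.im_ofReal_mul]; simp

/-- In Cartesian coordinates Q is a quotient of polynomials with nowhere vanishing denominator; this
gives smoothness at the origin and across the cut of the polar angle, where the polar formula does
not. -/
theorem equivariantMap_hProfile (y : Plane) : equivariantMap m (hProfile m) y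
    = !₂[2 * rePow m y / ((y 0 ^ 2 + y 1 ^ 2) ^ m + 1),
        2 * imPow m y / ((y 0 ^ 2 + y 1 ^ 2) ^ m + 1),
        ((y 0 ^ 2 + y 1 ^ 2) ^ m - 1) / ((y 0 ^ 2 + y 1 ^ 2) ^ m + 1)] := by
  rw [rePow_eq, imPow_eq, ← norm_sq_plane, ← pow_mul]
  ext i; fin_cases i <;> simp [equivariantMap, hProfile, h₁, h₃] <;> ring

theorem contDiff_equivariantMap_hProfile :
    ContDiff ℝ ∞ (equivariantMap m (hProfile m)) := by
  have h0 : ∀ y : Plane, (y 0 ^ 2 + y 1 ^ 2) ^ m + 1 ≠ 0 := fun y => by positivity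
  have hd : ContDiff ℝ ∞ fun y : Plane => (y 0 ^ 2 + y 1 ^ 2) ^ m + 1 := by fun_prop
  have hd2 : ContDiff ℝ ∞ fun y : Plane => (y 0 ^ 2 + y 1 ^ 2) ^ m - 1 := by fun_prop
  rw [funext (equivariantMap_hProfile m), contDiff_euclidean]
  intro i
  fin_cases i
  · exact (contDiff_const.mul (contDiff_rePow m)).div hd h0
  · exact (contDiff_const.mul (contDiff_imPow m)).div hd h0
  · exact hd2.div hd h0

theorem contDiff_harmonicMap (s : ℝ) (α : Real.Angle) : ContDiff ℝ ∞ (harmonicMap m s α) := by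
  have : harmonicMap m s α = rotL α ∘ equivariantMap m (hProfile m) ∘ fun x => s⁻¹ • x := by
    funext x; simp [harmonicMap, rotL_apply]
  rw [this]
  exact (rotL α).contDiff.comp ((contDiff_equivariantMap_hProfile m).comp (contDiff_id.const_smul _))

theorem continuous_harmonicMap (s : ℝ) (α : Real.Angle) : Continuous (harmonicMap m s α) :=
  (contDiff_harmonicMap m s α).continuous

theorem smul_polarPt (σ : ℝ) (q : ℝ × ℝ) : (Real.exp σ)⁻¹ • polarPt q = polarPt (q.1 - σ, q.2) := by
  ext i; fin_cases i <;> simp [Real.exp_sub] <;> field_simp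

theorem harmonicMap_polarPt (σ : ℝ) (α : Real.Angle) {q : ℝ × ℝ}
    (hq : q.2 ∈ Ioo (-Real.pi) Real.pi) : harmonicMap m (Real.exp σ) α (polarPt q)
      = rot (m • (q.2 : Real.Angle)) (rot α (lh m (q.1 - σ))) := by
  rw [harmonicMap, smul_polarPt, equivariantMap, norm_polarPt, polarAngle_polarPt (by exact hq),
    hProfile_exp, rot_rot, rot_rot, add_comm]

/-- The gradient of the harmonic map. -/
noncomputable def harmonicGrad (s : ℝ) (α : Real.Angle) (j : Fin 2) (x : Plane) : Space :=
  fderiv ℝ (harmonicMap m s α) x (EuclideanSpace.single j 1)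

theorem fieldDeriv_harmonicGrad (s : ℝ) (α : Real.Angle) (L : Plane →L[ℝ] Plane) (x : Plane) :
    fieldDeriv L (harmonicGrad m s α) x = fderiv ℝ (harmonicMap m s α) x (L x) := by
  rw [fieldDeriv, harmonicGrad, harmonicGrad, ← map_smul, ← map_smul, ← map_add, ← plane_eq]

theorem rotL_nsmul_hasDerivAt (y : Space) (θ : ℝ) :
    HasDerivAt (fun θ : ℝ => rot (m • (θ : Real.Angle)) y)
      (rot (m • (θ : Real.Angle)) ((m : ℝ) • rotGen y)) θ := by
  have e : ∀ θ : ℝ, rot (m • (θ : Real.Angle)) y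
      = Real.cos (m * θ) • horiz y + Real.sin (m * θ) • rotGen y + vert y := fun θ => by
    rw [← rotL_apply, rotL]; simp [cos_nsmul, sin_nsmul]
  have dc : HasDerivAt (fun θ : ℝ => Real.cos (m * θ)) (-Real.sin (m * θ) * m) θ := by
    simpa using ((hasDerivAt_id θ).const_mul (m : ℝ)).cos
  have ds : HasDerivAt (fun θ : ℝ => Real.sin (m * θ)) (Real.cos (m * θ) * m) θ := by
    simpa using ((hasDerivAt_id θ).const_mul (m : ℝ)).sin
  rw [funext e]
  refine (((dc.smul_const (horiz y)).add (ds.smul_const (rotGen y))).add_const (vert y)).congr_deriv ?_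
  rw [← rotL_apply, rotL]
  ext i; fin_cases i <;> simp [cos_nsmul, sin_nsmul, horiz_apply, rotGen_apply, vert_apply] <;> ring

/-- Both components depend on τ alone, so harmonic gradients are admissible in `IsLogDeriv.pairing`.
-/
theorem unrotated_harmonicGrad (σ : ℝ) (α : Real.Angle) (q : ℝ × ℝ)
    (hq : q.2 ∈ Ioo (-Real.pi) Real.pi) :
    unrotated m (ContinuousLinearMap.id ℝ Plane) (harmonicGrad m (Real.exp σ) α) q
        = rot α (lhDeriv m (q.1 - σ)) ∧
    unrotated m perp (harmonicGrad m (Real.exp σ) α) q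
        = (m : ℝ) • rotGen (rot α (lh m (q.1 - σ))) := by
  have hd := ((contDiff_harmonicMap m (Real.exp σ) α).differentiable (by simp)
    (polarPt q)).hasFDerivAt
  constructor
  · have ha := hd.comp_hasDerivAt (f := fun t => polarPt (t, q.2)) q.1
      (hasDerivAt_polarPt_fst q.1 q.2)
    have hb : HasDerivAt (fun t => rotL (m • (q.2 : Real.Angle)) (rotL α (lh m (t - σ))))
        (rotL (m • (q.2 : Real.Angle)) (rotL α (lhDeriv m (q.1 - σ)))) q.1 :=
      (rotL _).hasFDerivAt.comp_hasDerivAt _ ((rotL _).hasFDerivAt.comp_hasDerivAt _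
        ((hasDerivAt_lh m (q.1 - σ)).comp_sub_const q.1 σ))
    have e : (harmonicMap m (Real.exp σ) α ∘ fun t => polarPt (t, q.2))
        = fun t => rotL (m • (q.2 : Real.Angle)) (rotL α (lh m (t - σ))) := by
      funext t
      simp only [Function.comp, rotL_apply]
      exact harmonicMap_polarPt m σ α (q := (t, q.2)) hq
    rw [e] at ha
    have := ha.unique hb
    rw [unrotated, fieldDeriv_harmonicGrad, ContinuousLinearMap.id_apply]
    rw [rotL_apply, rotL_apply] at this
    have e2 : polarPt q = polarPt (q.1, q.2) := rfl
    rw [e2] at this ⊢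
    rw [this, rot_neg_rot]
  · have ha := hd.comp_hasDerivAt (f := fun t => polarPt (q.1, t)) q.2
      (hasDerivAt_polarPt_snd q.1 q.2)
    have hb := rotL_nsmul_hasDerivAt m (rot α (lh m (q.1 - σ))) q.2
    -- The polar angle of the point equals `t` only inside (−π, π), so the two curves are compared
    -- as germs at the interior point `q.2`.
    have e : (harmonicMap m (Real.exp σ) α ∘ fun t => polarPt (q.1, t))
        =ᶠ[𝓝 q.2] fun t => rot (m • (t : Real.Angle)) (rot α (lh m (q.1 - σ))) := by
      filter_upwards [Ioo_mem_nhds hq.1 hq.2] with t ht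
      exact harmonicMap_polarPt m σ α (q := (q.1, t)) ht
    have := ha.unique (hb.congr_of_eventuallyEq e)
    rw [unrotated, fieldDeriv_harmonicGrad]
    have e2 : polarPt q = polarPt (q.1, q.2) := rfl
    rw [e2] at this ⊢
    rw [this, rot_neg_rot]

theorem norm_sq_lhDeriv (τ : ℝ) : ‖lhDeriv m τ‖ ^ 2 = m ^ 2 * lh₁ m τ ^ 2 := by
  rw [norm_sq_space]; simp
  linear_combination (m : ℝ) ^ 2 * lh₁ m τ ^ 2 * lh_sq_add m τ

theorem norm_sq_rotGen (y : Space) : ‖(m : ℝ) • rotGen y‖ ^ 2 = m ^ 2 * (y 0 ^ 2 + y 1 ^ 2) := by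
  rw [norm_sq_space]; simp [rotGen_apply]; ring

theorem norm_sq_rotGen_lh (α : Real.Angle) (τ : ℝ) :
    ‖(m : ℝ) • rotGen (rot α (lh m τ))‖ ^ 2 = m ^ 2 * lh₁ m τ ^ 2 := by
  rw [norm_sq_rotGen]
  simp only [rot_apply_zero, rot_apply_one, lh_zero, lh_one]
  linear_combination (m : ℝ) ^ 2 * lh₁ m τ ^ 2 * α.cos_sq_add_sin_sq

variable {m}

theorem integrable_strip_of_fst {f : ℝ → ℝ} (hf : Integrable f) :
    Integrable (fun q : ℝ × ℝ => f q.1) stripMeasure := by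
  unfold stripMeasure
  exact hf.comp_fst _

theorem harmonicGrad_strip_eq (σ : ℝ) (α : Real.Angle) :
    (fun q : ℝ × ℝ => Real.exp (2 * q.1) • ∑ j, ‖harmonicGrad m (Real.exp σ) α j (polarPt q)‖ ^ 2)
      =ᵐ[stripMeasure] fun q => 2 * m ^ 2 * lh₁ m (q.1 - σ) ^ 2 := by
  filter_upwards [ae_strip_mem] with q hq
  have := unrotated_inner (m := m) (harmonicGrad m (Real.exp σ) α) (harmonicGrad m (Real.exp σ) α) q
  rw [(unrotated_harmonicGrad m σ α q hq).1, (unrotated_harmonicGrad m σ α q hq).2] at this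
  simp only [real_inner_self_eq_norm_sq] at this
  rw [smul_eq_mul, ← this, rot_norm, norm_sq_lhDeriv, norm_sq_rotGen_lh]
  ring

theorem continuous_harmonicGrad (s : ℝ) (α : Real.Angle) (j : Fin 2) :
    Continuous (harmonicGrad m s α j) :=
  ((contDiff_harmonicMap m s α).continuous_fderiv (by simp)).clm_apply continuous_const

theorem integrable_harmonicGrad_sq (hm : 1 ≤ m) (σ : ℝ) (α : Real.Angle) :
    Integrable fun x => ∑ j, ‖harmonicGrad m (Real.exp σ) α j x‖ ^ 2 := by
  have hc : Continuous fun x => ∑ j, ‖harmonicGrad m (Real.exp σ) α j x‖ ^ 2 :=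
    continuous_finsetSum _ fun j _ => (continuous_harmonicGrad _ α j).norm.pow 2
  rw [integrable_plane_iff hc.aestronglyMeasurable, integrable_congr (harmonicGrad_strip_eq σ α)]
  exact integrable_strip_of_fst (f := fun τ => 2 * (m : ℝ) ^ 2 * lh₁ m (τ - σ) ^ 2)
    (((integrable_lh₁_sq hm).comp_sub_right σ).const_mul _)

theorem isWeakGradient_harmonicMap (hm : 1 ≤ m) (σ : ℝ) (α : Real.Angle) :
    IsWeakGradient (harmonicMap m (Real.exp σ) α) (harmonicGrad m (Real.exp σ) α) := by
  refine isWeakGradient_of_contDiff ((contDiff_harmonicMap m _ α).of_le (by simp)) fun j => ?_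
  have hc := continuous_harmonicGrad (m := m) (Real.exp σ) α j
  refine (memLp_two_iff_integrable_sq_norm hc.aestronglyMeasurable).2 ?_
  refine (integrable_harmonicGrad_sq hm σ α).mono' (hc.norm.pow 2).aestronglyMeasurable
    (Eventually.of_forall fun x => ?_)
  rw [Real.norm_of_nonneg (by positivity)]
  exact Finset.single_le_sum (f := fun j => ‖harmonicGrad m (Real.exp σ) α j x‖ ^ 2)
    (fun _ _ => sq_nonneg _) (Finset.mem_univ j)

theorem memHdot_harmonicMap (hm : 1 ≤ m) (σ : ℝ) (α : Real.Angle) :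
    MemHdot (harmonicMap m (Real.exp σ) α) :=
  (isWeakGradient_harmonicMap hm σ α).memHdot (continuous_harmonicMap m _ α)

/-- The radial and the angular part contribute the same density m²h₁², whose integral over the strip
is 4πm for each. -/
theorem dirichlet_harmonicMap (hm : 1 ≤ m) (σ : ℝ) (α : Real.Angle) :
    dirichlet (harmonicMap m (Real.exp σ) α) = 8 * Real.pi * m := by
  rw [(isWeakGradient_harmonicMap hm σ α).dirichlet_eq (continuous_harmonicMap m _ α),
    integral_plane (integrable_harmonicGrad_sq hm σ α).aestronglyMeasurable,
    integral_congr_ae (harmonicGrad_strip_eq σ α),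
    integral_strip_fst (f := fun τ => 2 * (m : ℝ) ^ 2 * lh₁ m (τ - σ) ^ 2)
    (integrable_strip_of_fst (((integrable_lh₁_sq hm).comp_sub_right σ).const_mul _)),
    integral_const_mul, integral_sub_right_eq_self (fun t => lh₁ m t ^ 2)]
  linear_combination 4 * Real.pi * m * integral_lh₁_sq hm

end

end EquivariantMaps

/-! ### The distance to a harmonic map as a weighted overlap of profiles. -/

namespace EquivariantMaps

section

variable {m : ℕ} {u : Plane → Space}

theorem IsSigma.isEquivariantHdot (hu : IsSigma m u) : IsEquivariantHdot m u :=
  ⟨hu.equivariant, hu.continuous, hu.memHdot⟩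

theorem norm_logProfile (hu : IsSigma m u) (τ : ℝ) : ‖logProfile u τ‖ = 1 := hu.sphere _

theorem sum_sq_logProfile (hu : IsSigma m u) (τ : ℝ) :
    logProfile u τ 0 ^ 2 + logProfile u τ 1 ^ 2 + logProfile u τ 2 ^ 2 = 1 := by
  rw [← norm_sq_space, norm_logProfile hu]; norm_num

theorem tendsto_logProfile_atBot (hu : IsSigma m u) :
    Tendsto (logProfile u) atBot (𝓝 (-kVec)) := by
  refine hu.limit_zero.comp ?_
  exact tendsto_nhdsWithin_iff.2 ⟨Real.tendsto_exp_atBot, Eventually.of_forall fun t => Real.exp_pos t⟩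

theorem tendsto_logProfile_atTop (hu : IsSigma m u) : Tendsto (logProfile u) atTop (𝓝 kVec) :=
  hu.limit_infty.comp Real.tendsto_exp_atTop

/-- The second derivative of `lh`. -/
noncomputable def lhDeriv₂ (m : ℕ) (τ : ℝ) : Space :=
  !₂[m ^ 2 * lh₁ m τ * (1 - 2 * lh₁ m τ ^ 2), 0, -(2 * m ^ 2 * lh₁ m τ ^ 2 * lh₃ m τ)]

theorem hasDerivAt_lhDeriv (τ : ℝ) : HasDerivAt (lhDeriv m) (lhDeriv₂ m τ) τ := by
  refine hasDerivAt_toLp_three ?_ (hasDerivAt_const τ 0) ?_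
  · refine (((hasDerivAt_lh₁ m τ).const_mul (m : ℝ)).fun_mul (hasDerivAt_lh₃ m τ)).fun_neg.congr_deriv ?_
    have := lh_sq_add m τ
    linear_combination (m : ℝ) ^ 2 * lh₁ m τ * this
  · refine (((hasDerivAt_lh₁ m τ).fun_pow 2).const_mul (m : ℝ)).congr_deriv ?_
    simp; ring

theorem continuous_toLp_three {X : Type*} [TopologicalSpace X] {f g k : X → ℝ} (hf : Continuous f) (hg : Continuous g)
    (hk : Continuous k) : Continuous fun t => (!₂[f t, g t, k t] : Space) := by
  refine (PiLp.continuous_toLp 2 _).comp (continuous_pi fun i => ?_)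
  fin_cases i <;> simpa

theorem continuous_lh : Continuous (lh m) :=
  continuous_toLp_three (continuous_lh₁ m) continuous_const (continuous_lh₃ m)

theorem continuous_lhDeriv : Continuous (lhDeriv m) :=
  continuous_iff_continuousAt.2 fun t => (hasDerivAt_lhDeriv t).continuousAt

theorem continuous_lhDeriv₂ : Continuous (lhDeriv₂ m) := by
  have := continuous_lh₁ m
  have := continuous_lh₃ m
  exact continuous_toLp_three (by fun_prop) continuous_const (by fun_prop)

/-- By h₁² + h₃² = 1 the two sides are in fact equal; only the decay of the second derivative
matters. -/
theorem norm_sq_lhDeriv₂_le (τ : ℝ) : ‖lhDeriv₂ m τ‖ ^ 2 ≤ (m ^ 2 * lh₁ m τ) ^ 2 := by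
  rw [norm_sq_space]
  simp only [lhDeriv₂]
  have h1 := lh_sq_add m τ
  have e : lh₃ m τ ^ 2 = 1 - lh₁ m τ ^ 2 := by linarith
  have : (m ^ 2 * lh₁ m τ * (1 - 2 * lh₁ m τ ^ 2)) ^ 2 + 0 ^ 2
      + (-(2 * m ^ 2 * lh₁ m τ ^ 2 * lh₃ m τ)) ^ 2 = (m ^ 2 * lh₁ m τ) ^ 2 := by
    linear_combination 4 * (m : ℝ) ^ 4 * lh₁ m τ ^ 4 * e
  simpa using this.le

theorem norm_lhDeriv₂_le (τ : ℝ) : ‖lhDeriv₂ m τ‖ ≤ m ^ 2 * lh₁ m τ :=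
  (sq_le_sq₀ (norm_nonneg _) (mul_nonneg (by positivity) (lh₁_pos m τ).le)).1 (norm_sq_lhDeriv₂_le τ)

/-- The product rule for the inner product of a locally absolutely continuous curve with a smooth
one. -/
theorem isPrimitive_inner {V g K K' : ℝ → Space}
    (hV : ∀ i, IsPrimitive (fun τ => V τ i) (fun τ => g τ i))
    (hK : ∀ τ, HasDerivAt K (K' τ) τ) (hK' : Continuous K') :
    IsPrimitive (fun τ => inner ℝ (V τ) (K τ))
      (fun τ => inner ℝ (g τ) (K τ) + inner ℝ (V τ) (K' τ)) := by
  have h : ∀ i : Fin 3, IsPrimitive (fun τ => K τ i) (fun τ => K' τ i) := fun i =>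
    IsPrimitive.of_hasDerivAt
      (fun τ => (EuclideanSpace.proj i : Space →L[ℝ] ℝ).hasFDerivAt.comp_hasDerivAt τ (hK τ))
      ((EuclideanSpace.proj i : Space →L[ℝ] ℝ).continuous.comp hK')
  have := (((hV 0).mul (h 0)).add ((hV 1).mul (h 1))).add ((hV 2).mul (h 2))
  simp only [inner_space]
  convert this using 2
  ring

/-- The weighted correlation of `u` with a harmonic map. -/
noncomputable def overlap (m : ℕ) (u : Plane → Space) (σ : ℝ) (α : Real.Angle) : ℝ :=
  ∫ τ, lh₁ m (τ - σ) ^ 2 * inner ℝ (logProfile u τ) (rot α (lh m (τ - σ)))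

theorem integrable_bounded_mul {f k : ℝ → ℝ} (hf : Continuous f) (hk : Integrable k) {C : ℝ}
    (h : ∀ τ, |f τ| ≤ C) : Integrable fun τ => k τ * f τ := by
  have := hk.bdd_mul hf.aestronglyMeasurable (c := C) (Eventually.of_forall h)
  exact this.congr (Eventually.of_forall fun τ => mul_comm _ _)

/-- Integration by parts moves the derivative from the profile of `u` to h, and the harmonic map
equation −h'' + m²(h₁, 0, 0) = 2m²h₁²h turns the Dirichlet pairing into a weighted L² pairing
without derivatives. -/
theorem integral_pairing_harmonicMap (hm : 1 ≤ m) (hu : IsSigma m u) {G : Fin 2 → Plane → Space}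
    {g : ℝ → Space} (hg : IsLogDeriv m u G g) (σ : ℝ) (α : Real.Angle) :
    ∫ τ, (inner ℝ (g τ) (rot α (lhDeriv m (τ - σ)))
      + inner ℝ ((m : ℝ) • rotGen (logProfile u τ)) ((m : ℝ) • rotGen (rot α (lh m (τ - σ)))))
    = 2 * m ^ 2 * overlap m u σ α := by
  have hV := continuous_logProfile hu.continuous
  have hK : ∀ τ, HasDerivAt (fun τ => rot α (lhDeriv m (τ - σ))) (rot α (lhDeriv₂ m (τ - σ))) τ := by
    intro τ
    simp only [← rotL_apply]
    exact (rotL _).hasFDerivAt.comp_hasDerivAt _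
        ((hasDerivAt_lhDeriv (m := m) (τ - σ)).comp_sub_const τ σ)
  have hK' : Continuous fun τ => rot α (lhDeriv₂ m (τ - σ)) := by
    simp only [← rotL_apply]
    exact (rotL _).continuous.comp (continuous_lhDeriv₂.comp (continuous_id.sub continuous_const))
  have hKc : Continuous fun τ => rot α (lhDeriv m (τ - σ)) :=
    continuous_iff_continuousAt.2 fun t => (hK t).continuousAt
  have hlc : Continuous fun τ => rot α (lh m (τ - σ)) := by
    simp only [← rotL_apply]
    exact (rotL _).continuous.comp (continuous_lh.comp (continuous_id.sub continuous_const))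
  have hp := isPrimitive_inner hg.primitive hK hK'
  have L1 : MemLp g 2 volume := (memLp_two_iff_integrable_sq_norm hg.meas).2 hg.integrable_sq
  have L2 : MemLp (fun τ => rot α (lhDeriv m (τ - σ))) 2 volume := by
    refine (memLp_two_iff_integrable_sq_norm hKc.aestronglyMeasurable).2 ?_
    simp only [rot_norm, norm_sq_lhDeriv]
    exact ((integrable_lh₁_sq hm).comp_sub_right σ).const_mul _
  have i1 : Integrable fun τ => inner ℝ (g τ) (rot α (lhDeriv m (τ - σ))) :=
    integrable_inner_of_memLp L1 L2
  have i2 : Integrable fun τ => inner ℝ (logProfile u τ) (rot α (lhDeriv₂ m (τ - σ))) := by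
    refine (((integrable_lh₁ hm).comp_sub_right σ).const_mul ((m : ℝ) ^ 2)).mono'
      (hV.inner hK').aestronglyMeasurable (Eventually.of_forall fun τ => ?_)
    refine (norm_inner_le_norm _ _).trans ?_
    rw [norm_logProfile hu, one_mul, rot_norm]
    exact norm_lhDeriv₂_le _
  have i3 : Integrable fun τ => inner ℝ ((m : ℝ) • rotGen (logProfile u τ))
      ((m : ℝ) • rotGen (rot α (lh m (τ - σ)))) := by
    refine integrable_inner_of_memLp ?_ ?_
    · exact (memLp_two_iff_integrable_sq_norm
        ((rotGen.continuous.comp hV).const_smul (m : ℝ)).aestronglyMeasurable).2 hg.integrable_rotGen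
    · refine (memLp_two_iff_integrable_sq_norm
        ((rotGen.continuous.comp hlc).const_smul (m : ℝ)).aestronglyMeasurable).2 ?_
      refine (((integrable_lh₁_sq hm).comp_sub_right σ).const_mul ((m : ℝ) ^ 2)).congr
        (Eventually.of_forall fun τ => ?_)
      exact (norm_sq_rotGen_lh ..).symm
  have i2n : Integrable fun τ => -inner ℝ (logProfile u τ) (rot α (lhDeriv₂ m (τ - σ))) := i2.neg
  have hb : ∀ τ, |inner ℝ (logProfile u τ) (rot α (lhDeriv m (τ - σ)))| ≤ m * lh₁ m (τ - σ) := by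
    intro τ
    refine (abs_real_inner_le_norm _ _).trans ?_
    rw [norm_logProfile hu, one_mul, rot_norm]
    refine (sq_le_sq₀ (norm_nonneg _) (mul_nonneg (by positivity) (lh₁_pos m _).le)).1 ?_
    rw [norm_sq_lhDeriv, mul_pow]
  have t1 : Tendsto (fun τ => (m : ℝ) * lh₁ m (τ - σ)) atTop (𝓝 0) := by
    have := ((tendsto_lh₁_atTop hm).comp (tendsto_atTop_add_const_right _ (-σ) tendsto_id)).const_mul
      (m : ℝ)
    simpa [sub_eq_add_neg, Function.comp_def] using this
  have t2 : Tendsto (fun τ => (m : ℝ) * lh₁ m (τ - σ)) atBot (𝓝 0) := by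
    have := ((tendsto_lh₁_atBot hm).comp (tendsto_atBot_add_const_right _ (-σ) tendsto_id)).const_mul
      (m : ℝ)
    simpa [sub_eq_add_neg, Function.comp_def] using this
  -- No boundary terms: the profile is bounded and the derivative of h decays at both ends.
  have hz := hp.integral_eq (i1.add i2) (squeeze_zero_norm hb t2) (squeeze_zero_norm hb t1)
  rw [integral_add i1 i2, sub_zero] at hz
  rw [integral_add i1 i3, eq_neg_of_add_eq_zero_left hz, ← integral_neg, ← integral_add i2n i3,
    overlap, ← integral_const_mul]
  refine integral_congr_ae (Eventually.of_forall fun τ => ?_)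
  simp only [inner_space, lhDeriv₂, rot_apply_zero, rot_apply_one, rot_apply_two, lh_zero, lh_one,
    lh_two, rotGen_apply, PiLp.smul_apply, smul_eq_mul]
  simp
  ring

theorem hdist_sq_harmonicMap (hm : 1 ≤ m) (hu : IsSigma m u) (σ : ℝ) (α : Real.Angle) :
    hdist u (harmonicMap m (Real.exp σ) α) ^ 2
      = dirichlet u + 8 * Real.pi * m - 8 * Real.pi * m ^ 2 * overlap m u σ α := by
  have hG := isWeakGradient_weakGrad hu.memHdot
  have hH := isWeakGradient_harmonicMap hm σ α
  obtain ⟨g, hg⟩ := exists_isLogDeriv hu.isEquivariantHdot hG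
  rw [hdist_sq, dirichlet_sub_eq hu.continuous (continuous_harmonicMap m _ α) hG hH,
    dirichlet_harmonicMap hm, hg.pairing _ (fun τ => rot α (lhDeriv m (τ - σ)))
      (fun τ => (m : ℝ) • rotGen (rot α (lh m (τ - σ)))) (fun j => (hH j).1)
      (unrotated_harmonicGrad m σ α), integral_pairing_harmonicMap hm hu hg]
  ring

end

end EquivariantMaps

/-! ### The energy lower bound and the deviation from the first-order equation. -/

namespace EquivariantMaps

section

variable {m : ℕ} {u : Plane → Space}

/-- `e` bounds the deviation of the profile of `u` from the first-order equation satisfied by the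
profiles of the harmonic maps. -/
structure IsDefect (m : ℕ) (u : Plane → Space) (e : ℝ → ℝ) : Prop where
  nonneg : ∀ τ, 0 ≤ e τ
  integrable : Integrable e
  le : Real.pi * ∫ τ, e τ ≤ energy u - 4 * Real.pi * m
  height : ∃ d, IsPrimitive (fun τ => logProfile u τ 2) d ∧ ∀ᵐ τ, -d τ ≤ e τ / (4 * m)
  deviation : ∀ (σ : ℝ) (α : Real.Angle), ∃ d,
    IsPrimitive (fun τ => 1 - inner ℝ (logProfile u τ) (rot α (lh m (τ - σ)))) d ∧
    ∀ᵐ τ, |d τ + m * (lh₃ m (τ - σ) + logProfile u τ 2)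
        * (1 - inner ℝ (logProfile u τ) (rot α (lh m (τ - σ))))|
      ≤ m / 2 * (1 - inner ℝ (logProfile u τ) (rot α (lh m (τ - σ)))) + e τ / m

/-- The deviation from the first-order equation. -/
noncomputable def defect (m : ℕ) (V g : Space) : Space := g - (m : ℝ) • (kVec - V 2 • V)

theorem defect_apply (V g : Space) (i : Fin 3) :
    defect m V g i = g i - m * (kVec i - V 2 * V i) := rfl

/-- Both the derivative of a curve on the sphere and the projection k − V₂V of k are tangent to the
sphere at V. -/
theorem inner_defect {V g : Space} (h0 : V 0 ^ 2 + V 1 ^ 2 + V 2 ^ 2 = 1)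
    (h1 : V 0 * g 0 + V 1 * g 1 + V 2 * g 2 = 0) : inner ℝ (defect m V g) V = 0 := by
  simp only [inner_space, defect_apply, kVec]
  simp
  linear_combination h1 + m * V 2 * h0

/-- The completed square: |k − V₂V|² equals V₀² + V₁² on the sphere, and the cross term ⟨V', k −
V₂V⟩ is the derivative of the height V₂. -/
theorem norm_sq_defect {V g : Space} (h0 : V 0 ^ 2 + V 1 ^ 2 + V 2 ^ 2 = 1)
    (h1 : V 0 * g 0 + V 1 * g 1 + V 2 * g 2 = 0) :
    ‖defect m V g‖ ^ 2 + 2 * m * g 2 = ‖g‖ ^ 2 + ‖(m : ℝ) • rotGen V‖ ^ 2 := by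
  rw [norm_sq_rotGen, norm_sq_space, norm_sq_space]
  simp only [defect_apply, kVec]
  simp
  linear_combination 2 * m * V 2 * h1 + m ^ 2 * (V 2 ^ 2 - 1) * h0

theorem ae_inner_logDeriv (hu : IsSigma m u) {g : ℝ → Space}
    (hg : ∀ i, IsPrimitive (fun τ => logProfile u τ i) (fun τ => g τ i)) :
    ∀ᵐ τ, logProfile u τ 0 * g τ 0 + logProfile u τ 1 * g τ 1 + logProfile u τ 2 * g τ 2 = 0 := by
  filter_upwards [(hg 0).ae_hasDerivAt, (hg 1).ae_hasDerivAt, (hg 2).ae_hasDerivAt] with τ h0 h1 h2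
  have h := ((h0.fun_pow 2).fun_add (h1.fun_pow 2)).fun_add (h2.fun_pow 2)
  simp only [sum_sq_logProfile hu] at h
  have := h.unique (hasDerivAt_const τ 1)
  norm_num at this
  linarith

theorem dirichlet_eq_excess (h : 0 ≤ energy u - 4 * Real.pi * m) :
    dirichlet u = 2 * excess m u ^ 2 + 8 * Real.pi * m := by
  rw [excess, Real.sq_sqrt h, energy]; ring

/-- The function is e = |E|², with E the `defect` of the profile along its derivative. Integrating
`norm_sq_defect`, the height rises from −1 to 1 and contributes exactly the topological energy. -/
theorem exists_isDefect (hm : 1 ≤ m) (hu : IsSigma m u) : ∃ e, IsDefect m u e := by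
  have hG := isWeakGradient_weakGrad hu.memHdot
  obtain ⟨g, hg⟩ := exists_isLogDeriv hu.isEquivariantHdot hG
  have hm0 : (0 : ℝ) < m := by exact_mod_cast hm
  have hV := continuous_logProfile hu.continuous
  have hz := ae_inner_logDeriv hu hg.primitive
  set V := logProfile u with hVd
  have hs : ∀ τ, V τ 0 ^ 2 + V τ 1 ^ 2 + V τ 2 ^ 2 = 1 := sum_sq_logProfile hu
  have hco : ∀ i : Fin 3, Continuous fun τ => V τ i := fun i =>
    (EuclideanSpace.proj i : Space →L[ℝ] ℝ).continuous.comp hV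
  have hw : Continuous fun τ => kVec - V τ 2 • V τ := continuous_const.sub ((hco 2).smul hV)
  have hwn : ∀ τ, ‖(m : ℝ) • (kVec - V τ 2 • V τ)‖ ^ 2 = ‖(m : ℝ) • rotGen (V τ)‖ ^ 2 := by
    intro τ
    rw [norm_sq_rotGen, norm_sq_space]
    simp [kVec]
    linear_combination (m : ℝ) ^ 2 * (V τ 2 ^ 2 - 1) * hs τ
  have L1 : MemLp g 2 volume := (memLp_two_iff_integrable_sq_norm hg.meas).2 hg.integrable_sq
  have L2 : MemLp (fun τ => (m : ℝ) • (kVec - V τ 2 • V τ)) 2 volume := by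
    refine (memLp_two_iff_integrable_sq_norm (hw.const_smul (m : ℝ)).aestronglyMeasurable).2 ?_
    exact hg.integrable_rotGen.congr (Eventually.of_forall fun τ => (hwn τ).symm)
  have LE : MemLp (fun τ => defect m (V τ) (g τ)) 2 volume := L1.sub L2
  have iE : Integrable fun τ => ‖defect m (V τ) (g τ)‖ ^ 2 :=
    (memLp_two_iff_integrable_sq_norm LE.1).1 LE
  have key : ∀ᵐ τ, ‖defect m (V τ) (g τ)‖ ^ 2 + 2 * m * g τ 2
      = ‖g τ‖ ^ 2 + ‖(m : ℝ) • rotGen (V τ)‖ ^ 2 := by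
    filter_upwards [hz] with τ hτ using norm_sq_defect (hs τ) hτ
  have iS : Integrable fun τ => ‖g τ‖ ^ 2 + ‖(m : ℝ) • rotGen (V τ)‖ ^ 2 :=
    hg.integrable_sq.add hg.integrable_rotGen
  have ig : Integrable fun τ => g τ 2 := by
    refine ((iS.sub iE).const_mul (2 * (m : ℝ))⁻¹).congr ?_
    filter_upwards [key] with τ hτ
    simp only [Pi.sub_apply]
    rw [← hτ]
    field_simp
    ring
  have lim : ∀ {l : Filter ℝ} {y : Space}, Tendsto V l (𝓝 y) →
      Tendsto (fun τ => V τ 2) l (𝓝 (y 2)) := fun h =>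
    ((EuclideanSpace.proj (2 : Fin 3) : Space →L[ℝ] ℝ).continuous.tendsto _).comp h
  have i2 : ∫ τ, g τ 2 = 2 := by
    rw [(hg.primitive 2).integral_eq ig (lim (tendsto_logProfile_atBot hu))
      (lim (tendsto_logProfile_atTop hu))]
    simp [kVec]; norm_num
  have ie : ∫ τ, (‖g τ‖ ^ 2 + ‖(m : ℝ) • rotGen (V τ)‖ ^ 2)
      = (∫ τ, ‖defect m (V τ) (g τ)‖ ^ 2) + 4 * m := by
    rw [← integral_congr_ae key, integral_add iE (ig.const_mul _), integral_const_mul, i2]; ring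
  refine ⟨fun τ => ‖defect m (V τ) (g τ)‖ ^ 2, fun τ => sq_nonneg _, iE, ?_, ?_, ?_⟩
  · have := hg.le
    rw [ie, ← (hG).dirichlet_eq hu.continuous] at this
    rw [energy]
    linarith
  · refine ⟨_, hg.primitive 2, ?_⟩
    filter_upwards [hz] with τ hτ
    have h1 := inner_defect (m := m) (hs τ) hτ
    have h2 : inner ℝ (defect m (V τ) (g τ)) (kVec - V τ 2 • V τ) = g τ 2 - m * (1 - V τ 2 ^ 2) := by
      rw [inner_sub_right, inner_smul_right, h1, inner_space, defect_apply, defect_apply,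
        defect_apply]
      simp [kVec]
      left; ring
    have h3 : ‖kVec - V τ 2 • V τ‖ ^ 2 = 1 - V τ 2 ^ 2 := by
      rw [norm_sq_space]
      simp [kVec]
      linear_combination V τ 2 ^ 2 * hs τ
    have h4 := neg_le_of_abs_le (abs_real_inner_le_norm (defect m (V τ) (g τ)) (kVec - V τ 2 • V τ))
    rw [le_div_iff₀ (by positivity)]
    rw [h2, ← h3] at h4
    -- With w = k − V₂V one has V₂' = m|w|² + ⟨E, w⟩, and |E||w| ≤ m|w|² + |E|²/(4m).
    nlinarith [sq_nonneg (‖defect m (V τ) (g τ)‖ - 2 * m * ‖kVec - V τ 2 • V τ‖),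
      mul_le_mul_of_nonneg_left h4 hm0.le]
  · intro σ α
    have hK : ∀ τ, HasDerivAt (fun τ => rot α (lh m (τ - σ))) (rot α (lhDeriv m (τ - σ))) τ := by
      intro τ
      simp only [← rotL_apply]
      exact (rotL _).hasFDerivAt.comp_hasDerivAt _ ((hasDerivAt_lh m (τ - σ)).comp_sub_const τ σ)
    have hK' : Continuous fun τ => rot α (lhDeriv m (τ - σ)) := by
      simp only [← rotL_apply]
      exact (rotL _).continuous.comp (continuous_lhDeriv.comp (continuous_id.sub continuous_const))
    refine ⟨_, (IsPrimitive.const 1).sub (isPrimitive_inner hg.primitive hK hK'), ?_⟩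
    filter_upwards [hz] with τ hτ
    set h := rot α (lh m (τ - σ)) with hh
    set n := 1 - inner ℝ (V τ) h with hn
    have hnorm : ‖h‖ = 1 := by rw [hh, rot_norm, norm_lh]
    have h1 := inner_defect (m := m) (hs τ) hτ
    -- The harmonic profile has zero defect; the rotation drops out since it fixes k.
    have hd : rot α (lhDeriv m (τ - σ)) = (m : ℝ) • (kVec - lh₃ m (τ - σ) • h) := by
      have e := lh_sq_add m (τ - σ)
      have e' : lh₁ m (τ - σ) ^ 2 = 1 - lh₃ m (τ - σ) ^ 2 := by linarith
      ext i
      fin_cases i <;> simp [hh, kVec, -mul_eq_mul_left_iff]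
      · ring
      · ring
      · linear_combination (m : ℝ) * e'
    have hd2 : inner ℝ (V τ) (rot α (lhDeriv m (τ - σ)))
        = m * (V τ 2 - lh₃ m (τ - σ) * (1 - n)) := by
      rw [hd, inner_smul_right, inner_sub_right, inner_smul_right]
      congr 2
      · rw [inner_space]; simp [kVec]
      · rw [hn]; ring
    have hg2 : inner ℝ (g τ) h = inner ℝ (defect m (V τ) (g τ)) h
        + m * (lh₃ m (τ - σ) - V τ 2 * (1 - n)) := by
      rw [defect, inner_sub_left, inner_smul_left, inner_sub_left, inner_smul_left]
      have : inner ℝ kVec h = lh₃ m (τ - σ) := by rw [inner_space]; simp [kVec, hh]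
      rw [this, hn]
      simp
    -- The terms without E collect into the coefficient m(h₃ + V₂) times the deviation n. Since E ⊥
    -- V, the remainder can be paired with h − V, which is small of order √n.
    have e1 : (0 - (inner ℝ (g τ) h + inner ℝ (V τ) (rot α (lhDeriv m (τ - σ)))))
        + m * (lh₃ m (τ - σ) + V τ 2) * n = -inner ℝ (defect m (V τ) (g τ)) (h - V τ) := by
      rw [inner_sub_right, h1, hg2, hd2]; ring
    have e2 : ‖h - V τ‖ ^ 2 = 2 * n := by
      rw [norm_sub_sq_real, hnorm, norm_logProfile hu, real_inner_comm, hn]; ring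
    rw [e1, abs_neg]
    refine (abs_real_inner_le_norm _ _).trans ?_
    -- Young's inequality with weights chosen to give exactly m/2 in front of n, since |h − V|² =
    -- 2n.
    have : m / 2 * n + ‖defect m (V τ) (g τ)‖ ^ 2 / m - ‖defect m (V τ) (g τ)‖ * ‖h - V τ‖
        = (2 * ‖defect m (V τ) (g τ)‖ - m * ‖h - V τ‖) ^ 2 / (4 * m) := by
      rw [show n = ‖h - V τ‖ ^ 2 / 2 by linarith]
      field_simp
      ring
    have : 0 ≤ (2 * ‖defect m (V τ) (g τ)‖ - m * ‖h - V τ‖) ^ 2 / (4 * m) := by positivity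
    linarith

theorem exists_angle {a b : ℝ} (h : a ^ 2 + b ^ 2 = 1) :
    ∃ α : Real.Angle, α.cos = a ∧ α.sin = b := by
  have hn : ‖(⟨a, b⟩ : ℂ)‖ = 1 := by
    rw [Complex.norm_def, Complex.normSq_mk, ← sq, ← sq, h, Real.sqrt_one]
  have h0 : (⟨a, b⟩ : ℂ) ≠ 0 := by
    intro h0; rw [h0, norm_zero] at hn; norm_num at hn
  refine ⟨(Complex.arg ⟨a, b⟩ : ℝ), ?_, ?_⟩
  · rw [Real.Angle.cos_coe, Complex.cos_arg h0, hn, div_one]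
  · rw [Real.Angle.sin_coe, Complex.sin_arg, hn, div_one]

theorem integral_interval_le_integral {e : ℝ → ℝ} (h0 : ∀ τ, 0 ≤ e τ) (hi : Integrable e) {a b : ℝ}
    (hab : a ≤ b) : ∫ x in a..b, e x ≤ ∫ x, e x := by
  rw [intervalIntegral.integral_of_le hab]
  exact setIntegral_le_integral hi (Eventually.of_forall h0)

/-- The height is nondecreasing up to a total error controlled by the defect. -/
theorem IsDefect.height_sub_le {e : ℝ → ℝ} (he : IsDefect m u e) {a b : ℝ}
    (hab : a ≤ b) : logProfile u a 2 - logProfile u b 2 ≤ (∫ τ, e τ) / (4 * m) := by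
  obtain ⟨d, hd, hle⟩ := he.height
  have h := hd.neg.sub_le hab (k := fun τ => e τ / (4 * m)) (he.integrable.div_const _)
    (by filter_upwards [hle] with τ h _ using h)
  have h2 := integral_interval_le_integral (fun τ => div_nonneg (he.nonneg τ) (by positivity))
    (he.integrable.div_const (4 * (m : ℝ))) hab
  rw [integral_div] at h2
  linarith

/-- A map of small excess is pointwise close to a harmonic map, up to an exponential weight. -/
theorem IsDefect.exists_deviation_le (hm : 1 ≤ m) (hu : IsSigma m u) {e : ℝ → ℝ}
    (he : IsDefect m u e) (hsmall : ∫ τ, e τ ≤ 2) :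
    ∃ (σ : ℝ) (α : Real.Angle), ∀ τ, 1 - inner ℝ (logProfile u τ) (rot α (lh m (τ - σ)))
      ≤ Real.exp (m * |τ - σ|) * ((∫ τ, e τ) / m) := by
  have hm0 : (0 : ℝ) < m := by exact_mod_cast hm
  have hm1 : (1 : ℝ) ≤ m := by exact_mod_cast hm
  have hV := continuous_logProfile hu.continuous
  have hc2 : Continuous fun τ => logProfile u τ 2 :=
    (EuclideanSpace.proj (2 : Fin 3) : Space →L[ℝ] ℝ).continuous.comp hV
  -- The centre is put where the curve crosses the equator, and the angle is that of the crossing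
  -- point; the harmonic profile with these parameters meets the curve there, so the deviation
  -- starts from zero.
  obtain ⟨σ, hσ⟩ : ∃ σ, logProfile u σ 2 = 0 := by
    have h1 : Tendsto (fun τ => logProfile u τ 2) atBot (𝓝 (-1)) := by
      have := ((EuclideanSpace.proj (2 : Fin 3) : Space →L[ℝ] ℝ).continuous.tendsto _).comp
        (tendsto_logProfile_atBot hu)
      simpa [kVec, Function.comp_def] using this
    have h2 : Tendsto (fun τ => logProfile u τ 2) atTop (𝓝 1) := by
      have := ((EuclideanSpace.proj (2 : Fin 3) : Space →L[ℝ] ℝ).continuous.tendsto _).comp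
        (tendsto_logProfile_atTop hu)
      simpa [kVec, Function.comp_def] using this
    obtain ⟨a, ha⟩ := (h1.eventually (gt_mem_nhds (by norm_num : (-1 : ℝ) < 0))).exists
    obtain ⟨b, hb⟩ := (h2.eventually (lt_mem_nhds (by norm_num : (0 : ℝ) < 1))).exists
    exact mem_range_of_exists_le_of_exists_ge hc2 ⟨a, ha.le⟩ ⟨b, hb.le⟩
  have hs := sum_sq_logProfile hu σ
  obtain ⟨α, hα0, hα1⟩ := exists_angle (a := logProfile u σ 0) (b := logProfile u σ 1)
    (by rw [hσ] at hs; linarith)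
  refine ⟨σ, α, ?_⟩
  obtain ⟨d, hd, hle⟩ := he.deviation σ α
  set n := fun τ => 1 - inner ℝ (logProfile u τ) (rot α (lh m (τ - σ))) with hn
  have n0 : n σ = 0 := by
    simp only [hn, sub_self, inner_space, rot_apply_zero, rot_apply_one, rot_apply_two, lh_zero,
      lh_one, lh_two, lh₃_zero, hα0, hα1]
    have : lh₁ m 0 = 1 := by
      have h1 := lh_sq_add m 0
      rw [lh₃_zero] at h1
      nlinarith [lh₁_pos m 0]
    rw [this, hσ] at *
    nlinarith
  have nn : ∀ τ, 0 ≤ n τ := by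
    intro τ
    have := real_inner_le_norm (logProfile u τ) (rot α (lh m (τ - σ)))
    rw [norm_logProfile hu, rot_norm, norm_lh] at this
    simp only [hn]; linarith
  have h3mono : Monotone (lh₃ m) := monotone_of_hasDerivAt_nonneg (hasDerivAt_lh₃ m)
    fun x => by simp only [Pi.zero_apply]; positivity
  set D := ∫ τ, e τ with hD
  -- This is where the smallness of the defect enters. The coefficient m(h₃ + V₂) has the wrong sign
  -- by at most 1/2, and m/2 + 1/2 ≤ m.
  have hD4 : m * (D / (4 * m)) ≤ 1 / 2 := by
    rw [show m * (D / (4 * m)) = D / 4 by field_simp]; linarith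
  intro τ
  change n τ ≤ _
  rcases le_total σ τ with h | h
  -- To the right of σ one has h₃ ≥ 0 and V₂ ≥ −D/(4m), so n' ≤ m n + e/m; this is integrated with
  -- the factor e^{−m(x−σ)}.
  · have hE : ∀ x, HasDerivAt (fun x : ℝ => Real.exp (-(m * (x - σ))))
        (-m * Real.exp (-(m * (x - σ)))) x := by
      intro x
      have := ((((hasDerivAt_id x).sub_const σ).const_mul (m : ℝ)).fun_neg).exp
      refine this.congr_deriv ?_
      simp; ring
    have hp := (IsPrimitive.of_hasDerivAt hE (by fun_prop)).mul hd
    have := hp.sub_le h (k := fun x => e x / m) (he.integrable.div_const _) (by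
      filter_upwards [hle] with x hx hmem
      have e1 : Real.exp (-(m * (x - σ))) ≤ 1 := by
        rw [Real.exp_le_one_iff]
        have := mul_nonneg hm0.le (sub_nonneg.2 hmem.1)
        linarith
      have h1 := (abs_le.1 hx).2
      have h2 : 0 ≤ lh₃ m (x - σ) := by
        rw [← lh₃_zero m]; exact h3mono (sub_nonneg.2 hmem.1)
      have h3 := he.height_sub_le hmem.1
      rw [hσ] at h3
      have h4 : d x ≤ m * n x + e x / m := by
        have : -(m * (lh₃ m (x - σ) + logProfile u x 2)) ≤ 1 / 2 := by nlinarith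
        have := mul_le_mul_of_nonneg_right this (nn x)
        simp only [hn] at this ⊢
        have hnx := nn x
        simp only [hn] at hnx
        nlinarith
      have h5 : 0 ≤ e x / m := div_nonneg (he.nonneg x) hm0.le
      have h6 := Real.exp_pos (-(m * (x - σ)))
      change -m * Real.exp (-(m * (x - σ))) * n x + Real.exp (-(m * (x - σ))) * d x ≤ e x / m
      nlinarith [mul_le_mul_of_nonneg_left h4 h6.le])
    have h7 := integral_interval_le_integral (fun τ => div_nonneg (he.nonneg τ) hm0.le)
      (he.integrable.div_const (m : ℝ)) h
    rw [integral_div] at h7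
    change Real.exp (-(m * (τ - σ))) * n τ - Real.exp (-(m * (σ - σ))) * n σ ≤ _ at this
    rw [n0, mul_zero, sub_zero, Real.exp_neg, inv_mul_le_iff₀ (Real.exp_pos _)] at this
    rw [abs_of_nonneg (sub_nonneg.2 h)]
    exact this.trans (mul_le_mul_of_nonneg_left h7 (Real.exp_pos _).le)
  -- To the left both signs are reversed, and the same argument runs backwards in τ.
  · have hE : ∀ x, HasDerivAt (fun x : ℝ => Real.exp (m * (x - σ)))
        (m * Real.exp (m * (x - σ))) x := by
      intro x
      have := (((hasDerivAt_id x).sub_const σ).const_mul (m : ℝ)).exp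
      refine this.congr_deriv ?_
      simp; ring
    have hp := ((IsPrimitive.of_hasDerivAt hE (by fun_prop)).mul hd).neg
    have := hp.sub_le h (k := fun x => e x / m) (he.integrable.div_const _) (by
      filter_upwards [hle] with x hx hmem
      have e1 : Real.exp (m * (x - σ)) ≤ 1 := by
        rw [Real.exp_le_one_iff]
        exact mul_nonpos_of_nonneg_of_nonpos hm0.le (sub_nonpos.2 hmem.2)
      have h1 := (abs_le.1 hx).1
      have h2 : lh₃ m (x - σ) ≤ 0 := by
        rw [← lh₃_zero m]; exact h3mono (sub_nonpos.2 hmem.2)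
      have h3 := he.height_sub_le hmem.2
      rw [hσ] at h3
      have h4 : -d x ≤ m * n x + e x / m := by
        have : m * (lh₃ m (x - σ) + logProfile u x 2) ≤ 1 / 2 := by nlinarith
        have := mul_le_mul_of_nonneg_right this (nn x)
        simp only [hn] at this ⊢
        have hnx := nn x
        simp only [hn] at hnx
        nlinarith
      have h5 : 0 ≤ e x / m := div_nonneg (he.nonneg x) hm0.le
      have h6 := Real.exp_pos (m * (x - σ))
      change -(m * Real.exp (m * (x - σ)) * n x + Real.exp (m * (x - σ)) * d x) ≤ e x / m
      nlinarith [mul_le_mul_of_nonneg_left h4 h6.le])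
    have h7 := integral_interval_le_integral (fun τ => div_nonneg (he.nonneg τ) hm0.le)
      (he.integrable.div_const (m : ℝ)) h
    rw [integral_div] at h7
    change -(Real.exp (m * (σ - σ)) * n σ) - -(Real.exp (m * (τ - σ)) * n τ) ≤ _ at this
    rw [n0, mul_zero, neg_zero, zero_sub, neg_neg] at this
    rw [abs_of_nonpos (sub_nonpos.2 h), mul_neg, Real.exp_neg, ← div_eq_inv_mul,
      le_div_iff₀ (Real.exp_pos _), mul_comm]
    exact this.trans h7

end

end EquivariantMaps

/-! ### Coercivity and existence of closest parameters. -/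

namespace EquivariantMaps

section

variable {m : ℕ} {u : Plane → Space}

/-- The weighted square distance between the profiles of `u` and of a harmonic map. -/
noncomputable def gap (m : ℕ) (u : Plane → Space) (σ : ℝ) (α : Real.Angle) : ℝ :=
  ∫ τ, lh₁ m (τ - σ) ^ 2 * ‖logProfile u τ - rot α (lh m (τ - σ))‖ ^ 2

theorem continuous_rot_lh (σ : ℝ) (α : Real.Angle) :
    Continuous fun τ => rot α (lh m (τ - σ)) := by
  simp only [← rotL_apply]
  exact (rotL _).continuous.comp (continuous_lh.comp (continuous_id.sub continuous_const))

theorem norm_rot_lh (τ : ℝ) (α : Real.Angle) : ‖rot α (lh m τ)‖ = 1 := by rw [rot_norm, norm_lh]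

theorem norm_sq_sub_rot_lh (hu : IsSigma m u) (τ σ : ℝ) (α : Real.Angle) :
    ‖logProfile u τ - rot α (lh m (τ - σ))‖ ^ 2
      = 2 * (1 - inner ℝ (logProfile u τ) (rot α (lh m (τ - σ)))) := by
  rw [norm_sub_sq_real, norm_rot_lh, norm_logProfile hu]; ring

theorem abs_inner_rot_lh_le (hu : IsSigma m u) (τ x : ℝ) (α : Real.Angle) :
    |inner ℝ (logProfile u τ) (rot α (lh m x))| ≤ 1 := by
  refine (abs_real_inner_le_norm _ _).trans ?_
  rw [norm_rot_lh, norm_logProfile hu, one_mul]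

theorem integrable_overlap (hm : 1 ≤ m) (hu : IsSigma m u) (σ : ℝ) (α : Real.Angle) :
    Integrable fun τ => lh₁ m (τ - σ) ^ 2 * inner ℝ (logProfile u τ) (rot α (lh m (τ - σ))) :=
  integrable_bounded_mul ((continuous_logProfile hu.continuous).inner (continuous_rot_lh σ α))
    ((integrable_lh₁_sq hm).comp_sub_right σ) fun τ => abs_inner_rot_lh_le hu τ _ α

/-- Unit vectors satisfy |V − h|² = 2 − 2⟨V, h⟩, and the weight h₁² has total mass 2/m. -/
theorem gap_eq (hm : 1 ≤ m) (hu : IsSigma m u) (σ : ℝ) (α : Real.Angle) :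
    gap m u σ α = 4 / m - 2 * overlap m u σ α := by
  have hm0 : (0 : ℝ) < m := by exact_mod_cast hm
  have h : ∫ τ, lh₁ m (τ - σ) ^ 2 = 2 / m := by
    rw [integral_sub_right_eq_self (fun τ => lh₁ m τ ^ 2), eq_div_iff hm0.ne', mul_comm]
    exact integral_lh₁_sq hm
  have hi := (integrable_lh₁_sq hm).comp_sub_right σ
  calc gap m u σ α = ∫ τ, (2 * lh₁ m (τ - σ) ^ 2
        - 2 * (lh₁ m (τ - σ) ^ 2 * inner ℝ (logProfile u τ) (rot α (lh m (τ - σ))))) := by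
        refine integral_congr_ae (Eventually.of_forall fun τ => ?_)
        simp only [norm_sq_sub_rot_lh hu]
        ring
    _ = _ := by
        rw [integral_sub (hi.const_mul 2) ((integrable_overlap hm hu σ α).const_mul 2),
          integral_const_mul, integral_const_mul, h, overlap]
        ring

theorem gap_nonneg (σ : ℝ) (α : Real.Angle) : 0 ≤ gap m u σ α :=
  integral_nonneg fun _ => by positivity

theorem energy_ge (hm : 1 ≤ m) (hu : IsSigma m u) : 0 ≤ energy u - 4 * Real.pi * m := by
  obtain ⟨e, he⟩ := exists_isDefect hm hu
  exact le_trans (mul_nonneg Real.pi_pos.le (integral_nonneg he.nonneg)) he.le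

/-- An identity, not an estimate: it makes minimizing the distance the same as minimizing the gap.
-/
theorem hdist_sq_eq_gap (hm : 1 ≤ m) (hu : IsSigma m u) (σ : ℝ) (α : Real.Angle) :
    hdist u (harmonicMap m (Real.exp σ) α) ^ 2
      = 2 * excess m u ^ 2 + 4 * Real.pi * m ^ 2 * gap m u σ α := by
  have hm0 : (0 : ℝ) < m := by exact_mod_cast hm
  rw [hdist_sq_harmonicMap hm hu, dirichlet_eq_excess (energy_ge hm hu), gap_eq hm hu]
  field_simp
  ring

/-- The constant in the coercivity estimate. -/
noncomputable def gapConst (m : ℕ) : ℝ := 8 / (Real.pi * m) * ∫ τ : ℝ, Real.exp (-(m * |τ|))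

theorem gapConst_nonneg : 0 ≤ gapConst m :=
  mul_nonneg (by positivity) (integral_nonneg fun _ => (Real.exp_pos _).le)

/-- A map of small excess is close to a harmonic map. -/
theorem exists_gap_le (hm : 1 ≤ m) (hu : IsSigma m u) (hs : excess m u ≤ 1) :
    ∃ (σ : ℝ) (α : Real.Angle), gap m u σ α ≤ gapConst m * excess m u ^ 2 := by
  have hm0 : (0 : ℝ) < m := by exact_mod_cast hm
  obtain ⟨e, he⟩ := exists_isDefect hm hu
  have hex : excess m u ^ 2 = energy u - 4 * Real.pi * m := Real.sq_sqrt (energy_ge hm hu)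
  have hD : (∫ τ, e τ) ≤ excess m u ^ 2 / Real.pi := by
    rw [hex, le_div_iff₀ Real.pi_pos, mul_comm]; exact he.le
  have h1 : excess m u ^ 2 ≤ 1 := by
    have : 0 ≤ excess m u := Real.sqrt_nonneg _
    nlinarith
  have hD2 : (∫ τ, e τ) ≤ 2 := by
    refine hD.trans ?_
    rw [div_le_iff₀ Real.pi_pos]
    linarith [Real.pi_gt_three]
  obtain ⟨σ, α, h⟩ := he.exists_deviation_le hm hu hD2
  refine ⟨σ, α, ?_⟩
  -- The weight h₁² decays like e^{−2m|x|}: one factor absorbs the growth of the pointwise bound and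
  -- the other is integrable.
  have hexp : ∀ x : ℝ, Real.exp (-(m * |x|)) ^ 2 * Real.exp (m * |x|) = Real.exp (-(m * |x|)) := by
    intro x
    rw [sq, mul_assoc, ← Real.exp_add]; simp
  set D := ∫ τ, e τ
  have hi : Integrable fun τ => 8 * D / m * Real.exp (-(m * |τ - σ|)) :=
    ((integrable_exp_neg_abs hm0).comp_sub_right σ).const_mul _
  calc gap m u σ α ≤ ∫ τ, 8 * D / m * Real.exp (-(m * |τ - σ|)) := by
        refine integral_mono_of_nonneg (Eventually.of_forall fun τ => by positivity) hi
          (Eventually.of_forall fun τ => ?_)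
        simp only [norm_sq_sub_rot_lh hu]
        have a := lh₁_le m (τ - σ)
        have a2 : lh₁ m (τ - σ) ^ 2 ≤ (2 * Real.exp (-(m * |τ - σ|))) ^ 2 :=
          pow_le_pow_left₀ (lh₁_pos m _).le a 2
        have b := h τ
        have b0 : 0 ≤ 1 - inner ℝ (logProfile u τ) (rot α (lh m (τ - σ))) := by
          linarith [(abs_le.1 (abs_inner_rot_lh_le hu τ (τ - σ) α)).2]
        refine (mul_le_mul a2 (mul_le_mul_of_nonneg_left b two_pos.le) (by positivity)
          (by positivity)).trans (le_of_eq ?_)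
        have := hexp (τ - σ)
        linear_combination 8 * D / m * this
    _ = 8 * D / m * ∫ τ : ℝ, Real.exp (-(m * |τ|)) := by
        rw [integral_const_mul, integral_sub_right_eq_self (fun τ => Real.exp (-(m * |τ|)))]
    _ ≤ _ := by
        have : 8 * D / m ≤ 8 / (Real.pi * m) * excess m u ^ 2 := by
          calc 8 * D / m ≤ 8 * (excess m u ^ 2 / Real.pi) / m := by gcongr
            _ = _ := by field_simp
        have h0 : 0 ≤ ∫ τ : ℝ, Real.exp (-(m * |τ|)) := integral_nonneg fun _ => (Real.exp_pos _).le
        calc _ ≤ 8 / (Real.pi * m) * excess m u ^ 2 * ∫ τ : ℝ, Real.exp (-(m * |τ|)) := by gcongr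
          _ = _ := by rw [gapConst]; ring

theorem overlap_eq_shift (σ : ℝ) (α : Real.Angle) : overlap m u σ α
    = ∫ x, lh₁ m x ^ 2 * inner ℝ (logProfile u (x + σ)) (rot α (lh m x)) := by
  rw [overlap, ← integral_add_right_eq_self _ σ]
  simp

theorem continuous_rot_angle (y : Space) : Continuous fun α => rot α y := by
  have h1 := Real.Angle.continuous_cos
  have h2 := Real.Angle.continuous_sin
  exact continuous_toLp_three (f := fun α : Real.Angle => α.cos * y 0 - α.sin * y 1)
    (g := fun α : Real.Angle => α.sin * y 0 + α.cos * y 1) (by fun_prop) (by fun_prop) continuous_const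

/-- The translation is moved onto the profile, so that the fixed integrable weight h₁² dominates. -/
theorem continuous_overlap (hm : 1 ≤ m) (hu : IsSigma m u) :
    Continuous fun p : ℝ × Real.Angle => overlap m u p.1 p.2 := by
  have hV := continuous_logProfile hu.continuous
  simp only [overlap_eq_shift]
  refine continuous_of_dominated (bound := fun x => lh₁ m x ^ 2) (fun p => ?_) (fun p => ?_)
    (integrable_lh₁_sq hm) (Eventually.of_forall fun x => ?_)
  · have hVs : Continuous fun x => logProfile u (x + p.1) :=
      hV.comp (continuous_id.add continuous_const)
    have := hVs.inner (𝕜 := ℝ) (continuous_rot_lh (m := m) 0 p.2)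
    simp only [sub_zero] at this
    exact (((continuous_lh₁ m).pow 2).mul this).aestronglyMeasurable
  · refine Eventually.of_forall fun x => ?_
    rw [norm_mul, Real.norm_of_nonneg (sq_nonneg (lh₁ m x))]
    exact mul_le_of_le_one_right (sq_nonneg _) (abs_inner_rot_lh_le hu _ _ _)
  · exact continuous_const.mul ((hV.comp (continuous_const.add continuous_fst)).inner
      ((continuous_rot_angle _).comp continuous_snd))

theorem integral_odd_eq_zero {f : ℝ → ℝ} (h : ∀ x, f (-x) = -f x) : ∫ x, f x = 0 := by
  have := integral_neg_eq_self f volume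
  simp only [h, integral_neg] at this
  linarith

theorem integral_lh₁_sq_mul_lh₃ : ∫ x, lh₁ m x ^ 2 * lh₃ m x = 0 :=
  integral_odd_eq_zero fun x => by rw [lh₁_neg, lh₃_neg]; ring

/-- The overlap vanishes, uniformly in the angle, in a limit in which the translated profile
becomes vertical. -/
theorem eventually_overlap_lt (hm : 1 ≤ m) (hu : IsSigma m u) {l : Filter ℝ}
    [l.IsCountablyGenerated] {c : ℝ} (hl : ∀ x : ℝ,
      Tendsto (fun σ => logProfile u (x + σ)) l (𝓝 (c • kVec))) {ε : ℝ} (hε : 0 < ε) :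
    ∀ᶠ σ in l, ∀ α, overlap m u σ α < ε := by
  have hV := continuous_logProfile hu.continuous
  have hi := integrable_lh₁_sq hm
  have hk : ‖kVec‖ = 1 := by
    have : ‖kVec‖ ^ 2 = 1 := by rw [norm_sq_space]; simp [kVec]
    nlinarith [norm_nonneg kVec]
  have ht : Tendsto (fun σ => ∫ x, lh₁ m x ^ 2 * ‖logProfile u (x + σ) - c • kVec‖) l
      (𝓝 (∫ x, lh₁ m x ^ 2 * ‖c • kVec - c • kVec‖)) := by
    refine tendsto_integral_filter_of_dominated_convergence
      (fun x => lh₁ m x ^ 2 * (1 + |c|)) (Eventually.of_forall fun σ => ?_)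
      (Eventually.of_forall fun σ => Eventually.of_forall fun x => ?_) (hi.mul_const _)
      (Eventually.of_forall fun x => ?_)
    · exact (((continuous_lh₁ m).pow 2).mul ((hV.comp (continuous_id.add continuous_const)).sub
        continuous_const).norm).aestronglyMeasurable
    · rw [Real.norm_of_nonneg (by positivity)]
      refine mul_le_mul_of_nonneg_left ((norm_sub_le _ _).trans ?_) (sq_nonneg _)
      rw [norm_logProfile hu, norm_smul, hk, Real.norm_eq_abs, mul_one]
    · exact ((hl x).sub_const _).norm.const_mul _
  simp only [sub_self, norm_zero, mul_zero, integral_zero] at ht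
  filter_upwards [ht.eventually (gt_mem_nhds hε)] with σ hσ α
  refine lt_of_le_of_lt ?_ hσ
  rw [overlap_eq_shift]
  have hco : Continuous fun x => rot α (lh m x) := by
    simpa using continuous_rot_lh (m := m) 0 α
  have hin : ∀ x, inner ℝ (c • kVec) (rot α (lh m x)) = c * lh₃ m x := by
    intro x; rw [inner_smul_left, inner_space]; simp [kVec]
  have hVs : Continuous fun x => logProfile u (x + σ) := hV.comp (continuous_id.add continuous_const)
  have i1 : Integrable fun x => lh₁ m x ^ 2 * inner ℝ (logProfile u (x + σ)) (rot α (lh m x)) :=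
    integrable_bounded_mul (hVs.inner hco) hi fun τ => abs_inner_rot_lh_le hu _ _ α
  have i2 : Integrable fun x => lh₁ m x ^ 2 * lh₃ m x :=
    integrable_bounded_mul (continuous_lh₃ m) hi (abs_lh₃_le_one m)
  have i3 : Integrable fun x => lh₁ m x ^ 2 * ‖logProfile u (x + σ) - c • kVec‖ := by
    refine integrable_bounded_mul (hVs.sub continuous_const).norm hi (C := 1 + |c|) fun x => ?_
    rw [abs_norm]
    refine (norm_sub_le _ _).trans ?_
    rw [norm_logProfile hu, norm_smul, hk, Real.norm_eq_abs, mul_one]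
  -- The limit c·k pairs with the rotated h to c·h₃, whose weighted integral vanishes by oddness.
  -- Subtracting it leaves an error bounded independently of the angle.
  have e : ∫ x, lh₁ m x ^ 2 * inner ℝ (logProfile u (x + σ)) (rot α (lh m x))
      = ∫ x, (lh₁ m x ^ 2 * inner ℝ (logProfile u (x + σ)) (rot α (lh m x))
        - c * (lh₁ m x ^ 2 * lh₃ m x)) := by
    rw [integral_sub i1 (i2.const_mul c), integral_const_mul, integral_lh₁_sq_mul_lh₃]; ring
  rw [e]
  refine integral_mono (i1.sub (i2.const_mul c)) i3 fun x => ?_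
  have : inner ℝ (logProfile u (x + σ) - c • kVec) (rot α (lh m x))
      ≤ ‖logProfile u (x + σ) - c • kVec‖ := by
    have := real_inner_le_norm (logProfile u (x + σ) - c • kVec) (rot α (lh m x))
    rwa [norm_rot_lh, mul_one] at this
  rw [inner_sub_left, hin] at this
  calc _ = lh₁ m x ^ 2 * (inner ℝ (logProfile u (x + σ)) (rot α (lh m x)) - c * lh₃ m x) := by
        ring
    _ ≤ _ := mul_le_mul_of_nonneg_left this (sq_nonneg _)

/-- If some harmonic map has positive overlap with `u`, the overlap attains its maximum. -/
theorem exists_overlap_max (hm : 1 ≤ m) (hu : IsSigma m u) {σ₀ : ℝ} {α₀ : Real.Angle}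
    (h0 : 0 < overlap m u σ₀ α₀) :
    ∃ σ α, ∀ σ' α', overlap m u σ' α' ≤ overlap m u σ α := by
  have h1 : ∀ᶠ σ in atTop, ∀ α, overlap m u σ α < overlap m u σ₀ α₀ := by
    refine eventually_overlap_lt hm hu (c := 1) (fun x => ?_) h0
    rw [one_smul]
    exact (tendsto_logProfile_atTop hu).comp (tendsto_atTop_add_const_left _ x tendsto_id)
  have h2 : ∀ᶠ σ in atBot, ∀ α, overlap m u σ α < overlap m u σ₀ α₀ := by
    refine eventually_overlap_lt hm hu (c := -1) (fun x => ?_) h0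
    rw [neg_one_smul]
    exact (tendsto_logProfile_atBot hu).comp (tendsto_atBot_add_const_left _ x tendsto_id)
  obtain ⟨b, hb⟩ := eventually_atTop.1 h1
  obtain ⟨a, ha⟩ := eventually_atBot.1 h2
  have hmem : σ₀ ∈ Icc a b := by
    constructor
    · by_contra h; exact lt_irrefl _ (ha σ₀ (not_le.1 h).le α₀)
    · by_contra h; exact lt_irrefl _ (hb σ₀ (not_le.1 h).le α₀)
  have : Fact (0 < 2 * Real.pi) := ⟨Real.two_pi_pos⟩
  -- The maximum over the angle uses the compactness of the circle, and only a compact interval of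
  -- translations competes.
  have : CompactSpace Real.Angle := inferInstanceAs (CompactSpace (AddCircle (2 * Real.pi)))
  obtain ⟨p, -, hp⟩ := (isCompact_Icc (a := a) (b := b)).prod (isCompact_univ (X := Real.Angle))
    |>.exists_isMaxOn ⟨(σ₀, α₀), hmem, mem_univ _⟩ (continuous_overlap hm hu).continuousOn
  refine ⟨p.1, p.2, fun σ' α' => ?_⟩
  have hp0 : overlap m u σ₀ α₀ ≤ overlap m u p.1 p.2 := hp (a := (σ₀, α₀)) ⟨hmem, mem_univ _⟩
  rcases le_or_gt σ' a with h | h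
  · exact (ha σ' h α').le.trans hp0
  rcases le_or_gt b σ' with h' | h'
  · exact (hb σ' h' α').le.trans hp0
  · exact hp (a := (σ', α')) ⟨⟨h.le, h'.le⟩, mem_univ _⟩

theorem distHarmonic_le {s : ℝ} (hs : 0 < s) (α : Real.Angle) :
    distHarmonic m u ≤ hdist u (harmonicMap m s α) :=
  csInf_le ⟨0, by rintro _ ⟨s, -, α, rfl⟩; exact hdist_nonneg _ _⟩ ⟨s, hs, α, rfl⟩

theorem gap_le_iff (hm : 1 ≤ m) (hu : IsSigma m u) {σ σ' : ℝ} {α α' : Real.Angle} :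
    hdist u (harmonicMap m (Real.exp σ) α) ≤ hdist u (harmonicMap m (Real.exp σ') α')
      ↔ gap m u σ α ≤ gap m u σ' α' := by
  have hm0 : (0 : ℝ) < m := by exact_mod_cast hm
  rw [← sq_le_sq₀ (hdist_nonneg _ _) (hdist_nonneg _ _), hdist_sq_eq_gap hm hu,
    hdist_sq_eq_gap hm hu, add_le_add_iff_left]
  exact mul_le_mul_iff_right₀ (by positivity)

/-- Closest parameters have the smallest gap, in particular not larger than that of the parameters
built from the equator crossing. -/
theorem IsClosest.gap_le (hm : 1 ≤ m) (hu : IsSigma m u) (hs : excess m u ≤ 1) {s : ℝ}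
    {α : Real.Angle} (h : IsClosest m u s α) :
    gap m u (Real.log s) α ≤ gapConst m * excess m u ^ 2 := by
  obtain ⟨σ₀, α₀, h0⟩ := exists_gap_le hm hu hs
  refine le_trans ((gap_le_iff hm hu).1 ?_) h0
  rw [Real.exp_log h.1, ← h.2]
  exact distHarmonic_le (Real.exp_pos _) _

/-- The bound `4 / m` is the gap at zero overlap, so the smallness assumption says that some overlap
is positive. -/
theorem exists_isClosest (hm : 1 ≤ m) (hu : IsSigma m u) (hs : excess m u ≤ 1)
    (hs' : gapConst m * excess m u ^ 2 < 4 / m) : ∃ s α, IsClosest m u s α := by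
  obtain ⟨σ₀, α₀, h0⟩ := exists_gap_le hm hu hs
  have h0' : 0 < overlap m u σ₀ α₀ := by
    have := gap_eq hm hu σ₀ α₀
    linarith
  obtain ⟨σ, α, h⟩ := exists_overlap_max hm hu h0'
  refine ⟨Real.exp σ, α, Real.exp_pos _, le_antisymm (distHarmonic_le (Real.exp_pos _) _) ?_⟩
  refine le_csInf ⟨_, 1, one_pos, 0, rfl⟩ ?_
  rintro _ ⟨s, hs, α', rfl⟩
  rw [← Real.exp_log hs, gap_le_iff hm hu, gap_eq hm hu, gap_eq hm hu]
  linarith [h (Real.log s) α']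

end

end EquivariantMaps

namespace EquivariantMaps

/-! ### The orthogonality condition in the variable `log r` -/

theorem integral_Ioi_exp {E : Type*} [NormedAddCommGroup E] [NormedSpace ℝ E] (f : ℝ → E) :
    ∫ r in Ioi (0 : ℝ), f r = ∫ τ, Real.exp τ • f (Real.exp τ) := by
  have := integral_image_eq_integral_abs_deriv_smul (s := univ) MeasurableSet.univ
    (f := Real.exp) (f' := Real.exp) (fun x _ => (Real.hasDerivAt_exp x).hasDerivWithinAt)
    Real.exp_injective.injOn f
  rw [image_univ, Real.range_exp] at this
  rw [this, Measure.restrict_univ]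
  simp [abs_of_pos (Real.exp_pos _)]

theorem integrableOn_Ioi_exp {E : Type*} [NormedAddCommGroup E] [NormedSpace ℝ E] (f : ℝ → E) :
    IntegrableOn f (Ioi (0 : ℝ)) ↔ Integrable fun τ => Real.exp τ • f (Real.exp τ) := by
  have := integrableOn_image_iff_integrableOn_abs_deriv_smul (s := univ) MeasurableSet.univ
    (f := Real.exp) (f' := Real.exp) (fun x _ => (Real.hasDerivAt_exp x).hasDerivWithinAt)
    Real.exp_injective.injOn f
  rw [image_univ, Real.range_exp] at this
  rw [this, integrableOn_univ]
  simp [abs_of_pos (Real.exp_pos _)]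

/-- No differentiability is assumed: the exponential is a local diffeomorphism, so both sides are
differentiable together, and otherwise both take the default value zero. -/
theorem deriv_comp_exp (f : ℝ → ℂ) (τ : ℝ) :
    deriv (fun t => f (Real.exp t)) τ = Real.exp τ • deriv f (Real.exp τ) := by
  by_cases h : DifferentiableAt ℝ f (Real.exp τ)
  · exact (h.hasDerivAt.scomp τ (Real.hasDerivAt_exp τ)).deriv
  · rw [deriv_zero_of_not_differentiableAt h, smul_zero]
    refine deriv_zero_of_not_differentiableAt fun h' => h ?_
    have h0 := Real.exp_pos τ
    have e : f =ᶠ[𝓝 (Real.exp τ)] (fun t => f (Real.exp t)) ∘ Real.log := by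
      filter_upwards [Ioi_mem_nhds h0] with r hr
      simp [Real.exp_log hr]
    refine DifferentiableAt.congr_of_eventuallyEq ?_ e
    refine DifferentiableAt.comp _ ?_ (Real.differentiableAt_log h0.ne')
    rwa [Real.log_exp]

theorem integral_complex_mk {f g : ℝ → ℝ} (hf : Integrable f) (hg : Integrable g) :
    ∫ τ, (⟨f τ, g τ⟩ : ℂ) = ⟨∫ τ, f τ, ∫ τ, g τ⟩ := by
  have e : ∀ τ, (⟨f τ, g τ⟩ : ℂ) = (f τ : ℂ) + (g τ : ℂ) * Complex.I := fun τ =>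
    Complex.mk_eq_add_mul_I _ _
  have h1 : Integrable fun τ => (f τ : ℂ) := hf.ofReal
  have h2 : Integrable fun τ => (g τ : ℂ) * Complex.I := hg.ofReal.mul_const _
  simp_rw [e]
  rw [integral_add h1 h2, integral_mul_const, integral_complex_ofReal, integral_complex_ofReal]
  exact (Complex.mk_eq_add_mul_I _ _).symm

section

variable {m : ℕ} {u : Plane → Space}

/-- The two components of `z` in the variable `log r`, for a profile `V`. -/
noncomputable def zRe (V : ℝ → Space) (σ : ℝ) (α : Real.Angle) (τ : ℝ) : ℝ :=
  α.cos * V (τ + σ) 1 - α.sin * V (τ + σ) 0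

/-- The second component of `z` in the variable `log r`. -/
noncomputable def zIm (m : ℕ) (V : ℝ → Space) (σ : ℝ) (α : Real.Angle) (τ : ℝ) : ℝ :=
  lh₁ m τ * V (τ + σ) 2 - lh₃ m τ * (α.cos * V (τ + σ) 0 + α.sin * V (τ + σ) 1)

theorem zCoord_exp (σ τ : ℝ) (α : Real.Angle) : zCoord m u (Real.exp σ) α (Real.exp τ)
    = ⟨zRe (logProfile u) σ α τ, zIm m (logProfile u) σ α τ⟩ := by
  have e : profile u (Real.exp σ * Real.exp τ) = logProfile u (τ + σ) := by
    rw [logProfile, Real.exp_add, mul_comm]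
  unfold zCoord
  rw [e]
  congr 1
  · rw [inner_space]; simp [jVec, zRe]; ring
  · rw [inner_space]; simp [JhjVec, zIm, lh₁, lh₃]; ring

theorem abs_zRe_le (hu : IsSigma m u) (σ τ : ℝ) (α : Real.Angle) :
    |zRe (logProfile u) σ α τ| ≤ 1 := by
  have h := sum_sq_logProfile hu (τ + σ)
  rw [← sq_le_one_iff_abs_le_one, zRe]
  have := α.cos_sq_add_sin_sq
  set V := logProfile u (τ + σ)
  have : (α.cos * V 1 - α.sin * V 0) ^ 2 + (α.cos * V 0 + α.sin * V 1) ^ 2 = V 0 ^ 2 + V 1 ^ 2 := by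
    linear_combination (V 0 ^ 2 + V 1 ^ 2) * this
  nlinarith [sq_nonneg (V 2), sq_nonneg (α.cos * V 0 + α.sin * V 1)]

theorem abs_zIm_le (hu : IsSigma m u) (σ τ : ℝ) (α : Real.Angle) :
    |zIm m (logProfile u) σ α τ| ≤ 1 := by
  have h := sum_sq_logProfile hu (τ + σ)
  rw [← sq_le_one_iff_abs_le_one, zIm]
  have h1 := α.cos_sq_add_sin_sq
  have h2 := lh_sq_add m τ
  set V := logProfile u (τ + σ)
  have h3 : (α.cos * V 1 - α.sin * V 0) ^ 2 + (α.cos * V 0 + α.sin * V 1) ^ 2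
      = V 0 ^ 2 + V 1 ^ 2 := by
    linear_combination (V 0 ^ 2 + V 1 ^ 2) * h1
  set w := α.cos * V 0 + α.sin * V 1
  have h4 : (lh₁ m τ * V 2 - lh₃ m τ * w) ^ 2 + (lh₁ m τ * w + lh₃ m τ * V 2) ^ 2
      = w ^ 2 + V 2 ^ 2 := by
    linear_combination (w ^ 2 + V 2 ^ 2) * h2
  nlinarith [sq_nonneg (α.cos * V 1 - α.sin * V 0), sq_nonneg (lh₁ m τ * w + lh₃ m τ * V 2)]

/-- A bounded function with a square integrable derivative, which is itself square integrable. -/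
structure IsH1 (a a' : ℝ → ℝ) : Prop where
  primitive : IsPrimitive a a'
  memLp : MemLp a 2 volume
  memLp' : MemLp a' 2 volume

theorem memLp_lh₁ (hm : 1 ≤ m) : MemLp (lh₁ m) 2 volume := by
  refine (memLp_two_iff_integrable_sq_norm (continuous_lh₁ m).aestronglyMeasurable).2 ?_
  simpa using integrable_lh₁_sq hm

theorem memLp_bdd_mul {k f : ℝ → ℝ} (hf : MemLp f 2 volume) (hk : Continuous k) {C : ℝ}
    (h : ∀ τ, |k τ| ≤ C) : MemLp (fun τ => k τ * f τ) 2 volume := by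
  refine hf.of_le_mul (c := C) (hk.aestronglyMeasurable.mul hf.1) (Eventually.of_forall fun τ => ?_)
  rw [norm_mul]
  exact mul_le_mul_of_nonneg_right (h τ) (norm_nonneg _)

/-- The horizontal components of the profile are square integrable by the angular part of the
energy. The height is not, but it enters z only multiplied by h₁ or h₁'. -/
theorem exists_isH1 (hm : 1 ≤ m) (hu : IsSigma m u) (σ : ℝ) (α : Real.Angle) :
    (∃ a', IsH1 (zRe (logProfile u) σ α) a') ∧ ∃ b', IsH1 (zIm m (logProfile u) σ α) b' := by
  have hm0 : (0 : ℝ) < m := by exact_mod_cast hm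
  have hG := isWeakGradient_weakGrad hu.memHdot
  obtain ⟨g, hg⟩ := exists_isLogDeriv hu.isEquivariantHdot hG
  have hV := continuous_logProfile hu.continuous
  set V := logProfile u with hVd
  have hs : ∀ i : Fin 3, IsPrimitive (fun τ => V (τ + σ) i) (fun τ => g (τ + σ) i) := fun i =>
    (hg.primitive i).shift σ
  have hco : ∀ i : Fin 3, Continuous fun τ => V (τ + σ) i := fun i => (hs i).continuous
  have hb : ∀ (i : Fin 3) τ, |V (τ + σ) i| ≤ 1 := fun i τ => by
    have := PiLp.norm_apply_le (V (τ + σ)) i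
    rwa [norm_logProfile hu] at this
  have hg2 : ∀ i : Fin 3, MemLp (fun τ => g (τ + σ) i) 2 volume := fun i =>
    (memLp_coord hg.meas hg.integrable_sq i).comp_measurePreserving
      (measurePreserving_add_right volume σ)
  have hV2 : ∀ i : Fin 3, i ≠ 2 → MemLp (fun τ => V (τ + σ) i) 2 volume := by
    intro i hi
    have h := ((hg.integrable_rotGen.comp_add_right σ).const_mul ((m : ℝ) ^ 2)⁻¹)
    refine (memLp_two_iff_integrable_sq_norm (hco i).aestronglyMeasurable).2 ?_
    refine h.mono' ((hco i).norm.pow 2).aestronglyMeasurable (Eventually.of_forall fun τ => ?_)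
    rw [norm_sq_rotGen, inv_mul_cancel_left₀ (by positivity), norm_pow, norm_norm, Real.norm_eq_abs,
      sq_abs]
    fin_cases i
    · simp only [Fin.zero_eta]; nlinarith [sq_nonneg (V (τ + σ) 1)]
    · simp only [Fin.mk_one]; nlinarith [sq_nonneg (V (τ + σ) 0)]
    · exact absurd rfl hi
  have h1 : IsPrimitive (lh₁ m) (fun τ => -(m * lh₁ m τ * lh₃ m τ)) :=
    IsPrimitive.of_hasDerivAt (hasDerivAt_lh₁ m)
      (((continuous_lh₁ m).const_mul (m : ℝ)).mul (continuous_lh₃ m)).neg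
  have h3 : IsPrimitive (lh₃ m) (fun t => m * lh₁ m t ^ 2) :=
    IsPrimitive.of_hasDerivAt (hasDerivAt_lh₃ m) (((continuous_lh₁ m).pow 2).const_mul _)
  have c1 := continuous_lh₁ m
  have c3 := continuous_lh₃ m
  have b1 : ∀ τ, |lh₁ m τ| ≤ 1 := fun τ => by
    rw [abs_of_pos (lh₁_pos m τ)]; exact lh₁_le_one m τ
  have b3 := abs_lh₃_le_one m
  have L1 := memLp_lh₁ hm
  have pw := ((hs 0).const_mul α.cos).add ((hs 1).const_mul α.sin)
  have mw : MemLp (fun τ => α.cos * V (τ + σ) 0 + α.sin * V (τ + σ) 1) 2 volume :=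
    ((hV2 0 (by decide)).const_mul _).add ((hV2 1 (by decide)).const_mul _)
  have mw' : MemLp (fun τ => α.cos * g (τ + σ) 0 + α.sin * g (τ + σ) 1) 2 volume :=
    ((hg2 0).const_mul _).add ((hg2 1).const_mul _)
  refine ⟨⟨_, ((hs 1).const_mul α.cos).sub ((hs 0).const_mul α.sin),
    ((hV2 1 (by decide)).const_mul _).sub ((hV2 0 (by decide)).const_mul _),
    ((hg2 1).const_mul _).sub ((hg2 0).const_mul _)⟩,
    ⟨_, (h1.mul (hs 2)).sub (h3.mul pw), ?_, ?_⟩⟩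
  · refine MemLp.sub ?_ (memLp_bdd_mul mw c3 b3)
    refine (memLp_bdd_mul L1 (hco 2) (hb 2)).congr_norm (c1.mul (hco 2)).aestronglyMeasurable
      (Eventually.of_forall fun τ => by simp only [mul_comm])
  · refine MemLp.sub (MemLp.add ?_ (memLp_bdd_mul (hg2 2) c1 b1)) (MemLp.add ?_
      (memLp_bdd_mul mw' c3 b3))
    · refine (memLp_bdd_mul (k := fun τ => -(lh₃ m τ * V (τ + σ) 2)) (L1.const_mul (m : ℝ))
        ((c3.mul (hco 2)).neg) (C := 1) fun τ => ?_).congr_norm ((((c1.const_mul (m : ℝ)).mul c3).neg).mul (hco 2)).aestronglyMeasurable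
        (Eventually.of_forall fun τ => ?_)
      · rw [abs_neg, abs_mul]
        exact mul_le_one₀ (b3 τ) (abs_nonneg _) (hb 2 τ)
      · congr 1; ring
    · refine (memLp_bdd_mul (k := fun τ => lh₁ m τ ^ 2) (mw.const_mul (m : ℝ)) (c1.pow 2)
        (C := 1) fun τ => ?_).congr_norm (((c1.pow 2).const_mul (m : ℝ)).mul pw.continuous).aestronglyMeasurable
        (Eventually.of_forall fun τ => ?_)
      · rw [abs_pow]
        exact pow_le_one₀ (abs_nonneg _) (b1 τ)
      · congr 1; ring

theorem ae_deriv_zCoord {σ : ℝ} {α : Real.Angle} {a' b' : ℝ → ℝ}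
    (ha : IsH1 (zRe (logProfile u) σ α) a') (hb : IsH1 (zIm m (logProfile u) σ α) b') :
    ∀ᵐ τ, Real.exp τ • deriv (zCoord m u (Real.exp σ) α) (Real.exp τ) = ⟨a' τ, b' τ⟩ := by
  filter_upwards [ha.primitive.ae_hasDerivAt, hb.primitive.ae_hasDerivAt] with τ h1 h2
  rw [← deriv_comp_exp]
  simp only [zCoord_exp, Complex.mk_eq_add_mul_I]
  exact (h1.ofReal_comp.add (h2.ofReal_comp.mul_const _)).deriv

theorem continuous_zLog {σ : ℝ} {α : Real.Angle} {a' b' : ℝ → ℝ}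
    (ha : IsH1 (zRe (logProfile u) σ α) a') (hb : IsH1 (zIm m (logProfile u) σ α) b') :
    Continuous fun τ => zCoord m u (Real.exp σ) α (Real.exp τ) := by
  simp only [zCoord_exp, Complex.mk_eq_add_mul_I]
  exact (Complex.continuous_ofReal.comp ha.primitive.continuous).add
    ((Complex.continuous_ofReal.comp hb.primitive.continuous).mul continuous_const)

theorem norm_sq_mk (a b : ℝ) : ‖(⟨a, b⟩ : ℂ)‖ ^ 2 = a ^ 2 + b ^ 2 := by
  rw [← Complex.normSq_eq_norm_sq, Complex.normSq_mk]; ring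

theorem memHe_zCoord (hm : 1 ≤ m) (hu : IsSigma m u) (σ : ℝ) (α : Real.Angle) :
    MemHe (zCoord m u (Real.exp σ) α) := by
  obtain ⟨⟨a', ha⟩, b', hb⟩ := exists_isH1 hm hu σ α
  have hd := ae_deriv_zCoord ha hb
  have hc := continuous_zLog ha hb
  have sq : ∀ {f : ℝ → ℝ}, MemLp f 2 volume → Integrable fun τ => f τ ^ 2 := fun h => by
    simpa using (memLp_two_iff_integrable_sq_norm h.1).1 h
  refine ⟨?_, ?_, ?_, ?_⟩
  · have h : ContinuousOn ((fun τ => zCoord m u (Real.exp σ) α (Real.exp τ)) ∘ Real.log) (Ioi 0) :=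
      hc.comp_continuousOn (Real.continuousOn_log.mono fun r hr => (ne_of_gt hr : r ≠ 0))
    refine h.congr fun r hr => ?_
    simp [Real.exp_log hr]
  · intro φ h1 h2 h3
    -- A test function supported in (0, ∞) becomes, in log r, a test function on the whole line.
    have hφe : ContDiff ℝ ∞ fun τ => φ (Real.exp τ) := h1.comp Real.contDiff_exp
    have hφc : HasCompactSupport fun τ => φ (Real.exp τ) := by
      have hK : IsCompact (Real.log '' tsupport φ) :=
        h2.isCompact.image_of_continuousOn (Real.continuousOn_log.mono fun r hr =>
          (ne_of_gt (h3 hr) : r ≠ 0))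
      refine HasCompactSupport.intro hK fun τ hτ => ?_
      by_contra h
      exact hτ ⟨_, subset_tsupport _ h, Real.log_exp τ⟩
    obtain ⟨p1, p2, p3⟩ := ha.primitive.integral_test hφe hφc
    obtain ⟨q1, q2, q3⟩ := hb.primitive.integral_test hφe hφc
    have hderiv : ∀ τ, deriv (fun τ => φ (Real.exp τ)) τ = Real.exp τ * deriv φ (Real.exp τ) := by
      intro τ
      rw [mul_comm]
      exact ((h1.differentiable (by simp) _).hasDerivAt.comp τ (Real.hasDerivAt_exp τ)).deriv
    rw [integral_Ioi_exp, integral_Ioi_exp]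
    calc _ = ∫ τ, (⟨deriv (fun τ => φ (Real.exp τ)) τ * zRe (logProfile u) σ α τ,
          deriv (fun τ => φ (Real.exp τ)) τ * zIm m (logProfile u) σ α τ⟩ : ℂ) := by
          refine integral_congr_ae (Eventually.of_forall fun τ => ?_)
          simp only [zCoord_exp, hderiv]
          rw [smul_smul]
          apply Complex.ext <;> simp only [Complex.smul_re, Complex.smul_im, smul_eq_mul]
      _ = -∫ τ, (⟨φ (Real.exp τ) * a' τ, φ (Real.exp τ) * b' τ⟩ : ℂ) := by
          rw [integral_complex_mk p1 q1, integral_complex_mk p2 q2, p3, q3]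
          rfl
      _ = _ := by
          congr 1
          refine integral_congr_ae ?_
          filter_upwards [hd] with τ hτ
          rw [smul_comm, hτ]
          apply Complex.ext <;> simp only [Complex.smul_re, Complex.smul_im, smul_eq_mul]
  · rw [integrableOn_Ioi_exp]
    refine ((sq ha.memLp').add (sq hb.memLp')).congr ?_
    filter_upwards [hd] with τ hτ
    have e := norm_sq_mk (a' τ) (b' τ)
    rw [← hτ, norm_smul, Real.norm_of_nonneg (Real.exp_pos _).le] at e
    simp only [Pi.add_apply, ← e, smul_eq_mul]
    ring
  · rw [integrableOn_Ioi_exp]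
    refine ((sq ha.memLp).add (sq hb.memLp)).congr (Eventually.of_forall fun τ => ?_)
    have := Real.exp_pos τ
    simp only [zCoord_exp, norm_sq_mk, Pi.add_apply, smul_eq_mul]
    field_simp

/-- From h₁'' = m²h₁(1 − 2h₁²), integration by parts turns a'h₁' + m²a h₁ into 2m²h₁³a. No
derivative of z survives in the orthogonality condition. -/
theorem integral_pairing_lh₁ (hm : 1 ≤ m) {a a' : ℝ → ℝ} (ha : IsH1 a a') {C : ℝ}
    (hC : ∀ τ, |a τ| ≤ C) :
    Integrable (fun τ => a' τ * -(m * lh₁ m τ * lh₃ m τ) + m ^ 2 * (a τ * lh₁ m τ)) ∧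
    ∫ τ, (a' τ * -(m * lh₁ m τ * lh₃ m τ) + m ^ 2 * (a τ * lh₁ m τ))
      = 2 * m ^ 2 * ∫ τ, lh₁ m τ ^ 3 * a τ := by
  have c1 := continuous_lh₁ m
  have c3 := continuous_lh₃ m
  have ca := ha.primitive.continuous
  have hk : ∀ τ, HasDerivAt (fun τ => -(m * lh₁ m τ * lh₃ m τ))
      (m ^ 2 * lh₁ m τ * (1 - 2 * lh₁ m τ ^ 2)) τ := fun τ => by
    refine (((hasDerivAt_lh₁ m τ).const_mul (m : ℝ)).fun_mul (hasDerivAt_lh₃ m τ)).fun_neg.congr_deriv ?_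
    have := lh_sq_add m τ
    linear_combination (m : ℝ) ^ 2 * lh₁ m τ * this
  have hp := ha.primitive.mul (IsPrimitive.of_hasDerivAt hk (by fun_prop))
  have Lk : MemLp (fun τ => -(m * lh₁ m τ * lh₃ m τ)) 2 volume := by
    refine (memLp_bdd_mul (k := fun τ => -lh₃ m τ) ((memLp_lh₁ hm).const_mul (m : ℝ)) c3.neg (C := 1) fun τ => ?_).congr_norm
      (((c1.const_mul (m : ℝ)).mul c3).neg).aestronglyMeasurable (Eventually.of_forall fun τ => ?_)
    · rw [abs_neg]; exact abs_lh₃_le_one m τ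
    · congr 1; ring
  have i1 : Integrable fun τ => a' τ * -(m * lh₁ m τ * lh₃ m τ) := ha.memLp'.integrable_mul Lk
  have i2 : Integrable fun τ => a τ * lh₁ m τ := ha.memLp.integrable_mul (memLp_lh₁ hm)
  have i3 : Integrable fun τ => lh₁ m τ ^ 3 * a τ := by
    have := integrable_bounded_mul (f := fun τ => lh₁ m τ * a τ) (c1.mul ca)
      (integrable_lh₁_sq hm) (C := 1 * C) fun τ => by
      rw [abs_mul, abs_of_pos (lh₁_pos m τ)]
      exact mul_le_mul (lh₁_le_one m τ) (hC τ) (abs_nonneg _) zero_le_one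
    refine this.congr (Eventually.of_forall fun τ => ?_)
    ring
  have i4 : Integrable fun τ => a τ * (m ^ 2 * lh₁ m τ * (1 - 2 * lh₁ m τ ^ 2)) := by
    refine ((i2.const_mul ((m : ℝ) ^ 2)).sub (i3.const_mul (2 * (m : ℝ) ^ 2))).congr
      (Eventually.of_forall fun τ => ?_)
    simp only [Pi.sub_apply]
    ring
  have lim : ∀ {l : Filter ℝ}, Tendsto (lh₁ m) l (𝓝 0) →
      Tendsto (fun τ => a τ * -(m * lh₁ m τ * lh₃ m τ)) l (𝓝 0) := by
    intro l hl
    refine squeeze_zero_norm (a := fun τ => C * m * lh₁ m τ) (fun τ => ?_) ?_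
    · rw [norm_mul, norm_neg, norm_mul, norm_mul, Real.norm_eq_abs, Real.norm_eq_abs,
        Real.norm_eq_abs, Real.norm_eq_abs, abs_of_pos (lh₁_pos m τ), Nat.abs_cast]
      have h3 := abs_lh₃_le_one m τ
      have h1 := (lh₁_pos m τ).le
      have h4 : m * lh₁ m τ * |lh₃ m τ| ≤ m * lh₁ m τ := mul_le_of_le_one_right (by positivity) h3
      calc |a τ| * (m * lh₁ m τ * |lh₃ m τ|) ≤ C * (m * lh₁ m τ) :=
            mul_le_mul (hC τ) h4 (by positivity) ((abs_nonneg _).trans (hC τ))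
        _ = _ := by ring
    · simpa using hl.const_mul (C * m)
  have i4n : Integrable fun τ => -(a τ * (m ^ 2 * lh₁ m τ * (1 - 2 * lh₁ m τ ^ 2))) := i4.neg
  have hz := hp.integral_eq (i1.add i4) (lim (tendsto_lh₁_atBot hm)) (lim (tendsto_lh₁_atTop hm))
  rw [integral_add i1 i4, sub_zero] at hz
  refine ⟨i1.add (i2.const_mul _), ?_⟩
  rw [integral_add i1 (i2.const_mul _), eq_neg_of_add_eq_zero_left hz, ← integral_const_mul,
    ← integral_neg, ← integral_add i4n (i2.const_mul _)]
  refine integral_congr_ae (Eventually.of_forall fun τ => ?_)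
  ring

/-- The orthogonality condition consists of two scalar equations. -/
theorem orthogonal_iff (hm : 1 ≤ m) (hu : IsSigma m u) (σ : ℝ) (α : Real.Angle) :
    Orthogonal m u (Real.exp σ) α ↔ ∫ τ, lh₁ m τ ^ 3 * zRe (logProfile u) σ α τ = 0 ∧
      ∫ τ, lh₁ m τ ^ 3 * zIm m (logProfile u) σ α τ = 0 := by
  have hm0 : (0 : ℝ) < m := by exact_mod_cast hm
  obtain ⟨⟨a', ha⟩, b', hb⟩ := exists_isH1 hm hu σ α
  have hd := ae_deriv_zCoord ha hb
  obtain ⟨i1, e1⟩ := integral_pairing_lh₁ hm ha (abs_zRe_le hu σ · α)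
  obtain ⟨i2, e2⟩ := integral_pairing_lh₁ hm hb (abs_zIm_le hu σ · α)
  have hh : ∀ τ, Real.exp τ • deriv (fun r => (h₁ m r : ℂ)) (Real.exp τ)
      = ((-(m * lh₁ m τ * lh₃ m τ) : ℝ) : ℂ) := fun τ => by
    rw [← deriv_comp_exp]
    exact (hasDerivAt_lh₁ m τ).ofReal_comp.deriv
  have key : innerHe m (zCoord m u (Real.exp σ) α) (fun r => (h₁ m r : ℂ))
      = ⟨2 * m ^ 2 * ∫ τ, lh₁ m τ ^ 3 * zRe (logProfile u) σ α τ,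
        2 * m ^ 2 * ∫ τ, lh₁ m τ ^ 3 * zIm m (logProfile u) σ α τ⟩ := by
    rw [← e1, ← e2, ← integral_complex_mk i1 i2, innerHe, integral_Ioi_exp]
    refine integral_congr_ae ?_
    filter_upwards [hd] with τ hτ
    have h0 : (Real.exp τ : ℂ) ≠ 0 := by exact_mod_cast (Real.exp_pos τ).ne'
    have hk := hh τ
    rw [Complex.real_smul] at hτ hk ⊢
    -- Each derivative in r costs a factor e^{−τ}. With the weight r and the Jacobian e^τ all such
    -- factors cancel, which is the scale invariance of the inner product.
    have e3 : deriv (zCoord m u (Real.exp σ) α) (Real.exp τ) = ⟨a' τ, b' τ⟩ / (Real.exp τ : ℂ) := by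
      rw [← hτ]; field_simp
    have e4 : deriv (fun r => (h₁ m r : ℂ)) (Real.exp τ)
        = ((-(m * lh₁ m τ * lh₃ m τ) : ℝ) : ℂ) / (Real.exp τ : ℂ) := by
      rw [← hk]; field_simp
    rw [e3, e4, zCoord_exp, map_div₀, Complex.conj_ofReal, Complex.conj_ofReal, Complex.conj_ofReal]
    change _ * ((_ + _ * (_ * ((lh₁ m τ : ℝ) : ℂ))) * _) = _
    calc _ = (⟨a' τ, b' τ⟩ : ℂ) * ((-(m * lh₁ m τ * lh₃ m τ) : ℝ) : ℂ)
          + (m : ℂ) ^ 2 * (⟨zRe (logProfile u) σ α τ, zIm m (logProfile u) σ α τ⟩ * (lh₁ m τ : ℂ)) := by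
          field_simp
      _ = _ := by
          rw [show (m : ℂ) ^ 2 = ((m ^ 2 : ℝ) : ℂ) by push_cast; rfl]
          apply Complex.ext
          · simp only [Complex.add_re, Complex.re_mul_ofReal, Complex.re_ofReal_mul]
          · simp only [Complex.add_im, Complex.im_mul_ofReal, Complex.im_ofReal_mul]
  rw [Orthogonal, key, Complex.ext_iff]
  simp [hm0.ne']

end

end EquivariantMaps

namespace EquivariantMaps

/-! ### Correlations with exponentially decaying kernels -/

section

variable {m : ℕ}

/-- In log r, h₁ is 1/cosh(mτ), which varies by at most the factor e^{m|σ|} under a translation by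
σ. -/
theorem lh₁_sub_le (τ σ : ℝ) : lh₁ m (τ - σ) ≤ Real.exp (m * |σ|) * lh₁ m τ := by
  have e : ∀ t, lh₁ m t = 2 / (Real.exp (m * t) + Real.exp (-(m * t))) := fun t => by
    rw [lh₁_eq, Real.exp_neg]
    have := Real.exp_pos (m * t)
    field_simp
  rw [e, e, mul_div_assoc', div_le_div_iff₀ (by positivity) (by positivity)]
  have h1 : Real.exp (m * τ) ≤ Real.exp (m * |σ|) * Real.exp (m * (τ - σ)) := by
    rw [← Real.exp_add, Real.exp_le_exp]
    nlinarith [le_abs_self σ, (Nat.cast_nonneg m : (0 : ℝ) ≤ m)]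
  have h2 : Real.exp (-(m * τ)) ≤ Real.exp (m * |σ|) * Real.exp (-(m * (τ - σ))) := by
    rw [← Real.exp_add, Real.exp_le_exp]
    nlinarith [neg_abs_le σ, (Nat.cast_nonneg m : (0 : ℝ) ≤ m)]
  nlinarith

/-- Continuous kernels decaying like the cube of `lh₁`. -/
structure IsDecaying (m : ℕ) (k : ℝ → ℝ) : Prop where
  cont : Continuous k
  le : ∀ τ, |k τ| ≤ 4 * m * lh₁ m τ ^ 3

/-- The constant in the estimates of translated kernels. -/
noncomputable def kernelConst (m : ℕ) : ℝ := 4 * m * Real.exp (3 * m)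

theorem kernelConst_nonneg : 0 ≤ kernelConst m := by unfold kernelConst; positivity

/-- Translations by at most one are dominated by a single integrable function. This is what
justifies all limits and derivatives under the integral sign. -/
theorem IsDecaying.abs_sub_le {k : ℝ → ℝ} (hk : IsDecaying m k) {σ : ℝ} (hσ : |σ| ≤ 1) (τ : ℝ) :
    |k (τ - σ)| ≤ kernelConst m * lh₁ m τ ^ 3 := by
  have h1 : lh₁ m (τ - σ) ≤ Real.exp m * lh₁ m τ := by
    refine (lh₁_sub_le τ σ).trans (mul_le_mul_of_nonneg_right ?_ (lh₁_pos m τ).le)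
    rw [Real.exp_le_exp]
    exact mul_le_of_le_one_right (Nat.cast_nonneg m) hσ
  refine (hk.le _).trans ?_
  calc 4 * m * lh₁ m (τ - σ) ^ 3 ≤ 4 * m * (Real.exp m * lh₁ m τ) ^ 3 := by
        have := (lh₁_pos m (τ - σ)).le
        gcongr
    _ = _ := by
        rw [kernelConst, mul_comm (3 : ℝ), Real.exp_mul, mul_pow]
        norm_cast
        ring

/-- A differentiable kernel, decaying together with its derivative. -/
structure IsKernel (m : ℕ) (k k' : ℝ → ℝ) : Prop where
  hasDerivAt : ∀ τ, HasDerivAt k (k' τ) τ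
  decay : IsDecaying m k
  decay' : IsDecaying m k'

theorem IsKernel.abs_sub_sub_le {k k' : ℝ → ℝ} (hk : IsKernel m k k') {σ σ' : ℝ} (hσ : |σ| ≤ 1)
    (hσ' : |σ'| ≤ 1) (τ : ℝ) :
    |k (τ - σ) - k (τ - σ')| ≤ kernelConst m * lh₁ m τ ^ 3 * |σ - σ'| := by
  have h := (convex_Icc (-1 : ℝ) 1).norm_image_sub_le_of_norm_hasDerivWithin_le
    (f := fun σ => k (τ - σ)) (f' := fun σ => -k' (τ - σ)) (C := kernelConst m * lh₁ m τ ^ 3)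
    (fun x _ => ((hk.hasDerivAt (τ - x)).comp_const_sub τ x).hasDerivWithinAt)
    (fun x hx => by
      rw [norm_neg, Real.norm_eq_abs]
      exact hk.decay'.abs_sub_le (abs_le.2 hx) τ) (abs_le.1 hσ') (abs_le.1 hσ)
  simpa using h

theorem isKernel_pow_three (hm : 1 ≤ m) :
    IsKernel m (fun τ => lh₁ m τ ^ 3) (fun τ => -(3 * m * lh₁ m τ ^ 3 * lh₃ m τ)) := by
  have hm1 : (1 : ℝ) ≤ m := by exact_mod_cast hm
  have c1 := continuous_lh₁ m
  have c3 := continuous_lh₃ m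
  refine ⟨fun τ => ?_, ⟨by fun_prop, fun τ => ?_⟩, ⟨by fun_prop, fun τ => ?_⟩⟩
  · refine ((hasDerivAt_lh₁ m τ).fun_pow 3).congr_deriv ?_
    simp; ring
  · have := pow_nonneg (lh₁_pos m τ).le 3
    rw [abs_of_nonneg this]
    nlinarith
  · have h := pow_nonneg (lh₁_pos m τ).le 3
    rw [abs_neg, abs_mul, abs_of_nonneg (by positivity)]
    have h3 := abs_lh₃_le_one m τ
    have : 0 ≤ (m : ℝ) * lh₁ m τ ^ 3 := by positivity
    nlinarith [abs_nonneg (lh₃ m τ)]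

theorem isKernel_pow_three_mul (hm : 1 ≤ m) :
    IsKernel m (fun τ => lh₁ m τ ^ 3 * lh₃ m τ)
      (fun τ => m * lh₁ m τ ^ 3 * (lh₁ m τ ^ 2 - 3 * lh₃ m τ ^ 2)) := by
  have hm1 : (1 : ℝ) ≤ m := by exact_mod_cast hm
  have c1 := continuous_lh₁ m
  have c3 := continuous_lh₃ m
  refine ⟨fun τ => ?_, ⟨by fun_prop, fun τ => ?_⟩, ⟨by fun_prop, fun τ => ?_⟩⟩
  · refine (((hasDerivAt_lh₁ m τ).fun_pow 3).fun_mul (hasDerivAt_lh₃ m τ)).congr_deriv ?_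
    simp; ring
  · have h := pow_nonneg (lh₁_pos m τ).le 3
    rw [abs_mul, abs_of_nonneg h]
    have h3 := abs_lh₃_le_one m τ
    nlinarith [abs_nonneg (lh₃ m τ)]
  · have h := pow_nonneg (lh₁_pos m τ).le 3
    have : 0 ≤ (m : ℝ) * lh₁ m τ ^ 3 := by positivity
    rw [abs_mul, abs_of_nonneg this]
    have hs := lh_sq_add m τ
    have h4 : |lh₁ m τ ^ 2 - 3 * lh₃ m τ ^ 2| ≤ 4 := by
      rw [abs_le]; constructor <;> nlinarith [sq_nonneg (lh₁ m τ), sq_nonneg (lh₃ m τ)]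
    nlinarith

theorem isKernel_pow_four (hm : 1 ≤ m) :
    IsKernel m (fun τ => lh₁ m τ ^ 4) (fun τ => -(4 * m * lh₁ m τ ^ 4 * lh₃ m τ)) := by
  have hm1 : (1 : ℝ) ≤ m := by exact_mod_cast hm
  have c1 := continuous_lh₁ m
  have c3 := continuous_lh₃ m
  have h43 : ∀ τ, lh₁ m τ ^ 4 ≤ lh₁ m τ ^ 3 := fun τ =>
    pow_le_pow_of_le_one (lh₁_pos m τ).le (lh₁_le_one m τ) (by norm_num)
  refine ⟨fun τ => ?_, ⟨by fun_prop, fun τ => ?_⟩, ⟨by fun_prop, fun τ => ?_⟩⟩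
  · refine ((hasDerivAt_lh₁ m τ).fun_pow 4).congr_deriv ?_
    simp; ring
  · have := pow_nonneg (lh₁_pos m τ).le 3
    rw [abs_of_nonneg (by positivity)]
    nlinarith [h43 τ]
  · have h := pow_nonneg (lh₁_pos m τ).le 4
    rw [abs_neg, abs_mul, abs_of_nonneg (by positivity)]
    have h3 := abs_lh₃_le_one m τ
    have : 4 * (m : ℝ) * lh₁ m τ ^ 4 * |lh₃ m τ| ≤ 4 * m * lh₁ m τ ^ 4 :=
      mul_le_of_le_one_right (by positivity) h3
    nlinarith [h43 τ]

theorem integrable_lh₁_cube (hm : 1 ≤ m) : Integrable fun τ => lh₁ m τ ^ 3 :=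
  (integrable_bounded_mul (continuous_lh₁ m) (integrable_lh₁_sq hm) (C := 1) fun τ => by
    rw [abs_of_pos (lh₁_pos m τ)]; exact lh₁_le_one m τ).congr
    (Eventually.of_forall fun τ => by ring)

/-- The correlation of `f` with the translates of a kernel. -/
noncomputable def corr (k f : ℝ → ℝ) (σ : ℝ) : ℝ := ∫ τ, k (τ - σ) * f τ

/-- Bounded continuous functions on the line. -/
structure IsBddCont (f : ℝ → ℝ) : Prop where
  cont : Continuous f
  bdd : ∃ B, ∀ τ, |f τ| ≤ B

theorem IsDecaying.integrable {k f : ℝ → ℝ} (hm : 1 ≤ m) (hk : IsDecaying m k) (hf : IsBddCont f)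
    (σ : ℝ) : Integrable fun τ => k (τ - σ) * f τ := by
  obtain ⟨B, hB⟩ := hf.bdd
  refine integrable_bounded_mul hf.cont (Integrable.comp_sub_right ?_ σ) hB
  refine ((integrable_lh₁_cube hm).const_mul (4 * (m : ℝ))).mono' hk.cont.aestronglyMeasurable
    (Eventually.of_forall fun τ => hk.le τ)

theorem integrable_cube_mul_abs (hm : 1 ≤ m) {f : ℝ → ℝ} (hf : IsBddCont f) :
    Integrable fun τ => lh₁ m τ ^ 3 * |f τ| := by
  obtain ⟨B, hB⟩ := hf.bdd
  exact integrable_bounded_mul hf.cont.abs (integrable_lh₁_cube hm) fun τ => by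
    rw [abs_abs]; exact hB τ

theorem IsDecaying.abs_corr_le {k f : ℝ → ℝ} (hm : 1 ≤ m) (hk : IsDecaying m k) (hf : IsBddCont f)
    {σ : ℝ} (hσ : |σ| ≤ 1) : |corr k f σ| ≤ kernelConst m * ∫ τ, lh₁ m τ ^ 3 * |f τ| := by
  rw [← integral_const_mul, ← Real.norm_eq_abs]
  refine norm_integral_le_of_norm_le ((integrable_cube_mul_abs hm hf).const_mul _)
    (Eventually.of_forall fun τ => ?_)
  rw [norm_mul, ← mul_assoc]
  exact mul_le_mul_of_nonneg_right (hk.abs_sub_le hσ τ) (abs_nonneg _)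

theorem IsKernel.abs_corr_sub_le {k k' f : ℝ → ℝ} (hm : 1 ≤ m) (hk : IsKernel m k k')
    (hf : IsBddCont f) {σ σ' : ℝ} (hσ : |σ| ≤ 1) (hσ' : |σ'| ≤ 1) :
    |corr k f σ - corr k f σ'| ≤ kernelConst m * (∫ τ, lh₁ m τ ^ 3 * |f τ|) * |σ - σ'| := by
  rw [corr, corr, ← integral_sub (hk.decay.integrable hm hf σ) (hk.decay.integrable hm hf σ'),
    ← integral_const_mul, ← integral_mul_const, ← Real.norm_eq_abs]
  refine norm_integral_le_of_norm_le (((integrable_cube_mul_abs hm hf).const_mul _).mul_const _)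
    (Eventually.of_forall fun τ => ?_)
  rw [← sub_mul, norm_mul]
  refine (mul_le_mul_of_nonneg_right (hk.abs_sub_sub_le hσ hσ' τ) (abs_nonneg (f τ))).trans ?_
  exact le_of_eq (by ring)

theorem corr_add (k f : ℝ → ℝ) (σ σ' : ℝ) :
    corr k f (σ + σ') = corr k (fun τ => f (τ + σ)) σ' := by
  rw [corr, corr, ← integral_add_right_eq_self _ σ]
  refine integral_congr_ae (Eventually.of_forall fun τ => ?_)
  simp only
  congr 2
  ring

theorem corr_eq_shift (k f : ℝ → ℝ) (σ : ℝ) :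
    corr k f σ = corr k (fun τ => f (τ + σ)) 0 := by
  rw [← corr_add, add_zero]

theorem IsBddCont.shift {f : ℝ → ℝ} (hf : IsBddCont f) (σ : ℝ) : IsBddCont fun τ => f (τ + σ) :=
  ⟨hf.cont.comp (continuous_id.add continuous_const), hf.bdd.imp fun _ h _ => h _⟩

/-- Domination is only available for translations near zero, so the translation σ is first moved
onto `f`. The same device proves `IsKernel.hasDerivAt_corr`. -/
theorem IsDecaying.continuous_corr {k f : ℝ → ℝ} (hm : 1 ≤ m) (hk : IsDecaying m k)
    (hf : IsBddCont f) : Continuous (corr k f) := by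
  rw [continuous_iff_continuousAt]
  intro σ
  have h0 : ContinuousAt (corr k fun τ => f (τ + σ)) 0 := by
    refine continuousAt_of_dominated (bound := fun τ => kernelConst m * (lh₁ m τ ^ 3 * |f (τ + σ)|))
      (Eventually.of_forall fun σ' => (hk.integrable hm (hf.shift σ) σ').1) ?_
      ((integrable_cube_mul_abs hm (hf.shift σ)).const_mul _)
      (Eventually.of_forall fun _ => ?_)
    · filter_upwards [Metric.closedBall_mem_nhds (0 : ℝ) one_pos] with σ' hσ'
      refine Eventually.of_forall fun τ => ?_
      rw [norm_mul, ← mul_assoc]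
      refine mul_le_mul_of_nonneg_right (hk.abs_sub_le ?_ τ) (abs_nonneg _)
      simpa using hσ'
    · exact ((hk.cont.comp (continuous_const.sub continuous_id)).mul continuous_const).continuousAt
  have e : corr k f = (corr k fun τ => f (τ + σ)) ∘ fun x => x - σ := by
    funext x
    rw [Function.comp, ← corr_add]; simp
  rw [e]
  refine ContinuousAt.comp ?_ (continuous_id.sub continuous_const).continuousAt
  simpa using h0

/-- The derivative falls on the kernel, so nothing beyond continuity and boundedness is needed of
the profile. -/
theorem IsKernel.hasDerivAt_corr {k k' f : ℝ → ℝ} (hm : 1 ≤ m) (hk : IsKernel m k k')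
    (hf : IsBddCont f) (σ : ℝ) : HasDerivAt (corr k f) (-corr k' f σ) σ := by
  have h0 : HasDerivAt (corr k fun τ => f (τ + σ)) (∫ τ, -k' (τ - 0) * f (τ + σ)) 0 := by
    refine (hasDerivAt_integral_of_dominated_loc_of_deriv_le (Metric.ball_mem_nhds (0 : ℝ) one_pos)
      (bound := fun τ => kernelConst m * (lh₁ m τ ^ 3 * |f (τ + σ)|))
      (F := fun σ' τ => k (τ - σ') * f (τ + σ)) (F' := fun σ' τ => -k' (τ - σ') * f (τ + σ))
      (Eventually.of_forall fun σ' => (hk.decay.integrable hm (hf.shift σ) σ').1)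
      (hk.decay.integrable hm (hf.shift σ) 0) ?_ ?_
      ((integrable_cube_mul_abs hm (hf.shift σ)).const_mul _) ?_).2
    · exact ((hk.decay'.integrable hm (hf.shift σ) 0).neg.congr
        (Eventually.of_forall fun τ => by simp)).1
    · refine Eventually.of_forall fun τ σ' hσ' => ?_
      rw [norm_mul, ← mul_assoc, norm_neg]
      refine mul_le_mul_of_nonneg_right (hk.decay'.abs_sub_le ?_ τ) (abs_nonneg _)
      simpa using (Metric.ball_subset_closedBall hσ')
    · exact Eventually.of_forall fun τ σ' _ =>
        (((hk.hasDerivAt (τ - σ')).comp_const_sub τ σ').mul_const (f (τ + σ)))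
  have e : corr k f = fun x => (corr k fun τ => f (τ + σ)) (x - σ) := by
    funext x
    rw [← corr_add]; simp
  have e2 : ∫ τ, -k' (τ - 0) * f (τ + σ) = -corr k' f σ := by
    have := corr_add k' f σ 0
    rw [add_zero] at this
    rw [this, corr, ← integral_neg]
    simp only [neg_mul]
  rw [← e2, e]
  refine HasDerivAt.comp_sub_const σ σ ?_
  simpa using h0

end

end EquivariantMaps

namespace EquivariantMaps

/-! ### The modulation map -/

section

variable {m : ℕ}

theorem IsBddCont.linear {f g : ℝ → ℝ} (hf : IsBddCont f) (hg : IsBddCont g) (a b : ℝ) :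
    IsBddCont fun τ => a * f τ + b * g τ := by
  obtain ⟨A, hA⟩ := hf.bdd
  obtain ⟨B, hB⟩ := hg.bdd
  have h1 := hf.cont
  have h2 := hg.cont
  refine ⟨by fun_prop, |a| * A + |b| * B, fun τ => (abs_add_le _ _).trans ?_⟩
  rw [abs_mul, abs_mul]
  exact add_le_add (mul_le_mul_of_nonneg_left (hA τ) (abs_nonneg _))
    (mul_le_mul_of_nonneg_left (hB τ) (abs_nonneg _))

theorem corr_linear (hm : 1 ≤ m) {k f g : ℝ → ℝ} (hk : IsDecaying m k) (hf : IsBddCont f)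
    (hg : IsBddCont g) (a b σ : ℝ) :
    corr k (fun τ => a * f τ + b * g τ) σ = a * corr k f σ + b * corr k g σ := by
  rw [corr, corr, corr, ← integral_const_mul, ← integral_const_mul,
    ← integral_add ((hk.integrable hm hf σ).const_mul a) ((hk.integrable hm hg σ).const_mul b)]
  refine integral_congr_ae (Eventually.of_forall fun τ => ?_)
  ring

/-- Bounded continuous curves in space. -/
structure IsBddCurve (V : ℝ → Space) : Prop where
  cont : Continuous V
  bdd : ∃ B, ∀ τ, ‖V τ‖ ≤ B

theorem IsBddCurve.coord {V : ℝ → Space} (hV : IsBddCurve V) (i : Fin 3) :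
    IsBddCont fun τ => V τ i :=
  ⟨(EuclideanSpace.proj i : Space →L[ℝ] ℝ).continuous.comp hV.cont,
    hV.bdd.imp fun _ h τ => (PiLp.norm_apply_le (V τ) i).trans (h τ)⟩

theorem IsBddCurve.sub {V W : ℝ → Space} (hV : IsBddCurve V) (hW : IsBddCurve W) :
    IsBddCurve fun τ => V τ - W τ := by
  obtain ⟨A, hA⟩ := hV.bdd
  obtain ⟨B, hB⟩ := hW.bdd
  exact ⟨hV.cont.sub hW.cont, A + B, fun τ => (norm_sub_le _ _).trans (add_le_add (hA τ) (hB τ))⟩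

theorem isBddCurve_lh : IsBddCurve (lh m) := ⟨continuous_lh, 1, fun τ => (norm_lh m τ).le⟩

theorem isBddCurve_logProfile {u : Plane → Space} (hu : IsSigma m u) :
    IsBddCurve (logProfile u) :=
  ⟨continuous_logProfile hu.continuous, 1, fun τ => (norm_logProfile hu τ).le⟩

/-- The integral of `lh₁ ^ 4`. -/
noncomputable def quartic (m : ℕ) : ℝ := ∫ τ, lh₁ m τ ^ 4

theorem integrable_lh₁_four (hm : 1 ≤ m) : Integrable fun τ => lh₁ m τ ^ 4 := by
  have h := (isKernel_pow_four hm).decay.integrable hm (f := fun _ => 1)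
    ⟨continuous_const, 1, fun _ => by simp⟩ 0
  simpa using h

theorem quartic_pos (hm : 1 ≤ m) : 0 < quartic m :=
  integral_pos_of_integrable_nonneg_nonzero (x := 0) ((continuous_lh₁ m).pow 4)
    (integrable_lh₁_four hm) (fun τ => pow_nonneg (lh₁_pos m τ).le 4)
    (pow_pos (lh₁_pos m 0) 4).ne'

theorem quartic_le_two (hm : 1 ≤ m) : quartic m ≤ 2 := by
  have hm1 : (1 : ℝ) ≤ m := by exact_mod_cast hm
  have h := integral_lh₁_sq hm
  have h0 : 0 ≤ ∫ τ, lh₁ m τ ^ 2 := integral_nonneg fun _ => sq_nonneg _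
  have : quartic m ≤ ∫ τ, lh₁ m τ ^ 2 :=
    integral_mono (integrable_lh₁_four hm) (integrable_lh₁_sq hm) fun τ =>
      pow_le_pow_of_le_one (lh₁_pos m τ).le (lh₁_le_one m τ) (by norm_num)
  nlinarith

/-- The left-hand sides of the two modulation equations, normalized to have derivative the identity
at the origin if `V` is the profile of the harmonic map. -/
noncomputable def modul (m : ℕ) (V : ℝ → Space) (p : ℝ × ℝ) : ℝ × ℝ :=
  ((corr (fun τ => lh₁ m τ ^ 4) (fun τ => V τ 2) p.1
      - Real.cos p.2 * corr (fun τ => lh₁ m τ ^ 3 * lh₃ m τ) (fun τ => V τ 0) p.1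
      - Real.sin p.2 * corr (fun τ => lh₁ m τ ^ 3 * lh₃ m τ) (fun τ => V τ 1) p.1)
    / (m * quartic m),
   (Real.sin p.2 * corr (fun τ => lh₁ m τ ^ 3) (fun τ => V τ 0) p.1
      - Real.cos p.2 * corr (fun τ => lh₁ m τ ^ 3) (fun τ => V τ 1) p.1) / quartic m)

theorem orthogonal_iff_modul (hm : 1 ≤ m) {u : Plane → Space} (hu : IsSigma m u) (σ β : ℝ) :
    Orthogonal m u (Real.exp σ) (β : Real.Angle) ↔ modul m (logProfile u) (σ, β) = 0 := by
  have hm0 : (0 : ℝ) < m := by exact_mod_cast hm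
  have hq := quartic_pos hm
  have hV := isBddCurve_logProfile hu
  have hc : ∀ i : Fin 3, IsBddCont fun τ => logProfile u (τ + σ) i := fun i => (hV.coord i).shift σ
  have e : ∀ (k : ℝ → ℝ) (i : Fin 3), corr k (fun τ => logProfile u τ i) σ
      = corr k (fun τ => logProfile u (τ + σ) i) 0 := fun k i =>
    corr_eq_shift k _ σ
  have e1 : ∫ τ, lh₁ m τ ^ 3 * zRe (logProfile u) σ β τ
      = Real.cos β * corr (fun τ => lh₁ m τ ^ 3) (fun τ => logProfile u τ 1) σ
        - Real.sin β * corr (fun τ => lh₁ m τ ^ 3) (fun τ => logProfile u τ 0) σ := by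
    rw [e, e, sub_eq_add_neg, ← neg_mul,
      ← corr_linear hm (isKernel_pow_three hm).decay (hc 1) (hc 0), corr]
    refine integral_congr_ae (Eventually.of_forall fun τ => ?_)
    simp only [zRe, Real.Angle.cos_coe, Real.Angle.sin_coe, sub_zero]
    ring
  have e2 : ∫ τ, lh₁ m τ ^ 3 * zIm m (logProfile u) σ β τ
      = corr (fun τ => lh₁ m τ ^ 4) (fun τ => logProfile u τ 2) σ
      - Real.cos β * corr (fun τ => lh₁ m τ ^ 3 * lh₃ m τ) (fun τ => logProfile u τ 0) σ
      - Real.sin β * corr (fun τ => lh₁ m τ ^ 3 * lh₃ m τ) (fun τ => logProfile u τ 1) σ := by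
    rw [e, e, e, sub_sub, ← corr_linear hm (isKernel_pow_three_mul hm).decay (hc 0) (hc 1), corr,
      corr, ← integral_sub ((isKernel_pow_four hm).decay.integrable hm (hc 2) 0)
        ((isKernel_pow_three_mul hm).decay.integrable hm ((hc 0).linear (hc 1) _ _) 0)]
    refine integral_congr_ae (Eventually.of_forall fun τ => ?_)
    simp only [zIm, Real.Angle.cos_coe, Real.Angle.sin_coe, sub_zero]
    ring
  rw [orthogonal_iff hm hu, e1, e2, Prod.ext_iff]
  simp only [modul, Prod.fst_zero, Prod.snd_zero, div_eq_zero_iff, hq.ne', hm0.ne', mul_eq_zero,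
    or_false]
  constructor
  · rintro ⟨h1, h2⟩; exact ⟨h2, by linarith⟩
  · rintro ⟨h1, h2⟩; exact ⟨by linarith, h1⟩

/-- The curve `V`, translated and rotated. -/
noncomputable def centered (V : ℝ → Space) (σ : ℝ) (α : Real.Angle) (τ : ℝ) : Space :=
  rot (-α) (V (τ + σ))

theorem IsBddCurve.centered {V : ℝ → Space} (hV : IsBddCurve V) (σ : ℝ) (α : Real.Angle) :
    IsBddCurve (centered V σ α) := by
  refine ⟨?_, hV.bdd.imp fun _ h τ => by rw [EquivariantMaps.centered, rot_norm]; exact h _⟩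
  have e : EquivariantMaps.centered V σ α = fun τ => rotL (-α) (V (τ + σ)) := by
    funext τ; rw [rotL_apply]; rfl
  rw [e]
  exact (rotL _).continuous.comp (hV.cont.comp (continuous_id.add continuous_const))

/-- Equivariance under scaling and rotation: moving the base point amounts to moving the curve. It
reduces every estimate near a harmonic map to one at the origin near `lh`. -/
theorem modul_add (hm : 1 ≤ m) {V : ℝ → Space} (hV : IsBddCurve V) (σ β : ℝ) (p : ℝ × ℝ) :
    modul m V ((σ, β) + p) = modul m (centered V σ β) p := by
  have hc : ∀ i : Fin 3, IsBddCont fun τ => V (τ + σ) i := fun i => (hV.coord i).shift σ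
  have c0 : (fun τ => centered V σ β τ 0)
      = fun τ => Real.cos β * V (τ + σ) 0 + Real.sin β * V (τ + σ) 1 := by
    funext τ; simp [centered]
  have c1 : (fun τ => centered V σ β τ 1)
      = fun τ => -Real.sin β * V (τ + σ) 0 + Real.cos β * V (τ + σ) 1 := by
    funext τ; simp [centered]
  have c2 : (fun τ => centered V σ β τ 2) = fun τ => V (τ + σ) 2 := by
    funext τ; simp [centered]
  have k1 := (isKernel_pow_three hm).decay
  have k2 := (isKernel_pow_three_mul hm).decay
  simp only [modul, c0, c1, c2, Prod.fst_add, Prod.snd_add, corr_add,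
    corr_linear hm k1 (hc 0) (hc 1), corr_linear hm k2 (hc 0) (hc 1), Real.cos_add, Real.sin_add]
  refine Prod.ext ?_ ?_
  · simp only; ring
  · simp only; ring

theorem modul_sub (hm : 1 ≤ m) {V W : ℝ → Space} (hV : IsBddCurve V) (hW : IsBddCurve W)
    (p : ℝ × ℝ) : modul m (fun τ => V τ - W τ) p = modul m V p - modul m W p := by
  have hl : ∀ {k : ℝ → ℝ} (_ : IsDecaying m k) (i : Fin 3),
      corr k (fun τ => (V τ - W τ) i) p.1
      = corr k (fun τ => V τ i) p.1 - corr k (fun τ => W τ i) p.1 := fun hk i => by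
    have := corr_linear hm hk (hV.coord i) (hW.coord i) 1 (-1) p.1
    simp only [one_mul, neg_mul, ← sub_eq_add_neg] at this
    exact this
  simp only [modul, hl (isKernel_pow_three hm).decay, hl (isKernel_pow_three_mul hm).decay,
    hl (isKernel_pow_four hm).decay]
  refine Prod.ext ?_ ?_
  · simp only [Prod.fst_sub]; ring
  · simp only [Prod.snd_sub]; ring

theorem cube_coord_le (hm : 1 ≤ m) {V : ℝ → Space} (hV : IsBddCurve V) (i : Fin 3) :
    ∫ τ, lh₁ m τ ^ 3 * |V τ i| ≤ ∫ τ, lh₁ m τ ^ 3 * ‖V τ‖ := by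
  have hn : IsBddCont fun τ => ‖V τ‖ :=
    ⟨hV.cont.norm, hV.bdd.imp fun _ h τ => by rw [abs_norm]; exact h τ⟩
  have := integrable_cube_mul_abs hm hn
  simp only [abs_norm] at this
  exact integral_mono (integrable_cube_mul_abs hm (hV.coord i)) this fun τ =>
    mul_le_mul_of_nonneg_left (PiLp.norm_apply_le (V τ) i) (pow_nonneg (lh₁_pos m τ).le 3)

theorem abs_mul_sub_mul_le {c c' x x' d e L : ℝ} (hc : |c| ≤ 1) (hcc : |c - c'| ≤ d) (hx : |x'| ≤ L)
    (hxx : |x - x'| ≤ L * e) (hd : d ≤ e) : |c * x - c' * x'| ≤ L * e + L * e := by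
  have hL : 0 ≤ L := (abs_nonneg _).trans hx
  have h1 : |c * (x - x')| ≤ L * e := by
    rw [abs_mul]
    exact (mul_le_of_le_one_left (abs_nonneg _) hc).trans hxx
  have h2 : |(c - c') * x'| ≤ L * e := by
    rw [abs_mul, mul_comm L]
    exact mul_le_mul (hcc.trans hd) hx (abs_nonneg _) ((abs_nonneg _).trans (hcc.trans hd))
  have : c * x - c' * x' = c * (x - x') + (c - c') * x' := by ring
  rw [this]
  exact (abs_add_le _ _).trans (add_le_add h1 h2)

/-- The Lipschitz constant of the modulation map, for curves of weighted norm one. -/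
noncomputable def modulConst (m : ℕ) : ℝ := 5 * kernelConst m / quartic m

theorem modulConst_nonneg (hm : 1 ≤ m) : 0 ≤ modulConst m :=
  div_nonneg (mul_nonneg (by norm_num) kernelConst_nonneg) (quartic_pos hm).le

/-- The factor 5 in `modulConst` counts the first component: one plain correlation and two products,
each of which varies through both of its factors. -/
theorem norm_modul_sub_le (hm : 1 ≤ m) {V : ℝ → Space} (hV : IsBddCurve V) {p p' : ℝ × ℝ}
    (hp : |p.1| ≤ 1) (hp' : |p'.1| ≤ 1) :
    ‖modul m V p - modul m V p'‖ ≤ modulConst m * (∫ τ, lh₁ m τ ^ 3 * ‖V τ‖) * ‖p - p'‖ := by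
  have hm1 : (1 : ℝ) ≤ m := by exact_mod_cast hm
  have hq := quartic_pos hm
  set N := ∫ τ, lh₁ m τ ^ 3 * ‖V τ‖ with hN
  set L := kernelConst m * N with hL
  have hd1 : |p.1 - p'.1| ≤ ‖p - p'‖ := norm_fst_le (p - p')
  have hd2 : |p.2 - p'.2| ≤ ‖p - p'‖ := norm_snd_le (p - p')
  have hL0 : 0 ≤ L := mul_nonneg kernelConst_nonneg
    (integral_nonneg fun τ => mul_nonneg (pow_nonneg (lh₁_pos m τ).le 3) (norm_nonneg _))
  have hi : ∀ i : Fin 3, kernelConst m * (∫ τ, lh₁ m τ ^ 3 * |V τ i|) ≤ L := fun i =>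
    mul_le_mul_of_nonneg_left (cube_coord_le hm hV i) kernelConst_nonneg
  have hlip : ∀ {k k' : ℝ → ℝ} (_ : IsKernel m k k') (i : Fin 3),
      |corr k (fun τ => V τ i) p.1 - corr k (fun τ => V τ i) p'.1| ≤ L * ‖p - p'‖ := fun hk i =>
    (hk.abs_corr_sub_le hm (hV.coord i) hp hp').trans
      (mul_le_mul (hi i) hd1 (abs_nonneg _) hL0)
  have hbd : ∀ {k k' : ℝ → ℝ} (_ : IsKernel m k k') (i : Fin 3),
      |corr k (fun τ => V τ i) p'.1| ≤ L := fun hk i =>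
    (hk.decay.abs_corr_le hm (hV.coord i) hp').trans (hi i)
  have hcos : |Real.cos p.2 - Real.cos p'.2| ≤ |p.2 - p'.2| :=
    Real.abs_cos_sub_cos_le _ _
  have hsin : |Real.sin p.2 - Real.sin p'.2| ≤ |p.2 - p'.2| :=
    Real.abs_sin_sub_sin_le _ _
  have k1 := isKernel_pow_three hm
  have k2 := isKernel_pow_three_mul hm
  have k3 := isKernel_pow_four hm
  have a1 := abs_mul_sub_mul_le (Real.abs_cos_le_one _) hcos (hbd k2 0) (hlip k2 0) hd2
  have a2 := abs_mul_sub_mul_le (Real.abs_sin_le_one _) hsin (hbd k2 1) (hlip k2 1) hd2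
  have a3 := hlip k3 2
  have b1 := abs_mul_sub_mul_le (Real.abs_sin_le_one _) hsin (hbd k1 0) (hlip k1 0) hd2
  have b2 := abs_mul_sub_mul_le (Real.abs_cos_le_one _) hcos (hbd k1 1) (hlip k1 1) hd2
  have hLd : 0 ≤ L * ‖p - p'‖ := mul_nonneg hL0 (norm_nonneg _)
  have e : modulConst m * N * ‖p - p'‖ = 5 * (L * ‖p - p'‖) / quartic m := by
    rw [modulConst, hL]; ring
  rw [e]
  rw [abs_le] at a1 a2 a3 b1 b2
  refine max_le ?_ ?_
  · simp only [modul, Prod.fst_sub]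
    rw [← sub_div, Real.norm_eq_abs, abs_div, abs_of_pos (by positivity : 0 < m * quartic m)]
    refine (div_le_div_of_nonneg_left (abs_nonneg _) hq ?_).trans
      (div_le_div_of_nonneg_right ?_ hq.le)
    · nlinarith
    · rw [abs_le]; constructor <;> linarith
  · simp only [modul, Prod.snd_sub]
    rw [← sub_div, Real.norm_eq_abs, abs_div, abs_of_pos hq]
    refine div_le_div_of_nonneg_right ?_ hq.le
    rw [abs_le]; constructor <;> linarith

theorem norm_modul_zero_le (hm : 1 ≤ m) {V : ℝ → Space} (hV : IsBddCurve V) :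
    ‖modul m V 0‖ ≤ modulConst m * ∫ τ, lh₁ m τ ^ 3 * ‖V τ‖ := by
  have hm1 : (1 : ℝ) ≤ m := by exact_mod_cast hm
  have hq := quartic_pos hm
  set N := ∫ τ, lh₁ m τ ^ 3 * ‖V τ‖ with hN
  set L := kernelConst m * N with hL
  have hL0 : 0 ≤ L := mul_nonneg kernelConst_nonneg
    (integral_nonneg fun τ => mul_nonneg (pow_nonneg (lh₁_pos m τ).le 3) (norm_nonneg _))
  have hbd : ∀ {k k' : ℝ → ℝ} (_ : IsKernel m k k') (i : Fin 3),
      |corr k (fun τ => V τ i) 0| ≤ L := fun hk i =>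
    (hk.decay.abs_corr_le hm (hV.coord i) (by simp)).trans
      (mul_le_mul_of_nonneg_left (cube_coord_le hm hV i) kernelConst_nonneg)
  have a1 := hbd (isKernel_pow_three hm) 1
  have a2 := hbd (isKernel_pow_three_mul hm) 0
  have a3 := hbd (isKernel_pow_four hm) 2
  have e : modulConst m * N = 5 * L / quartic m := by
    rw [modulConst, hL]; ring
  rw [e]
  rw [abs_le] at a1 a2 a3
  refine max_le ?_ ?_
  · simp only [modul, Prod.fst_zero, Prod.snd_zero, Real.cos_zero, Real.sin_zero]
    rw [Real.norm_eq_abs, abs_div, abs_of_pos (by positivity : 0 < m * quartic m)]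
    refine (div_le_div_of_nonneg_left (abs_nonneg _) hq ?_).trans
      (div_le_div_of_nonneg_right ?_ hq.le)
    · nlinarith
    · rw [abs_le]; constructor <;> linarith
  · simp only [modul, Prod.fst_zero, Prod.snd_zero, Real.cos_zero, Real.sin_zero]
    rw [Real.norm_eq_abs, abs_div, abs_of_pos hq]
    refine div_le_div_of_nonneg_right ?_ hq.le
    rw [abs_le]; constructor <;> linarith

/-- Cauchy–Schwarz with h₁³|V| = h₁² · h₁|V| and ∫h₁⁴ ≤ 2. -/
theorem cube_le_sqrt (hm : 1 ≤ m) {V : ℝ → Space} (hV : IsBddCurve V) :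
    ∫ τ, lh₁ m τ ^ 3 * ‖V τ‖ ≤ 2 * Real.sqrt (∫ τ, lh₁ m τ ^ 2 * ‖V τ‖ ^ 2) := by
  have hn : IsBddCont fun τ => ‖V τ‖ :=
    ⟨hV.cont.norm, hV.bdd.imp fun _ h τ => by rw [abs_norm]; exact h τ⟩
  have i1 := integrable_cube_mul_abs hm hn
  simp only [abs_norm] at i1
  obtain ⟨B, hB⟩ := hV.bdd
  have i2 : Integrable fun τ => lh₁ m τ ^ 2 * ‖V τ‖ ^ 2 :=
    integrable_bounded_mul (hV.cont.norm.pow 2) (integrable_lh₁_sq hm) (C := B ^ 2) fun τ => by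
      rw [abs_pow, abs_norm]
      exact pow_le_pow_left₀ (norm_nonneg _) (hB τ) 2
  set g := ∫ τ, lh₁ m τ ^ 2 * ‖V τ‖ ^ 2 with hg
  have hg0 : 0 ≤ g := integral_nonneg fun τ => by positivity
  -- Young's inequality is used with a parameter `y` larger than the bound, so that no division by a
  -- vanishing integral occurs.
  refine le_of_forall_gt_imp_ge_of_dense fun y hy => ?_
  have hy0 : 0 < y := lt_of_le_of_lt (by positivity) hy
  have hgy : g ≤ (y / 2) ^ 2 := by
    rw [← Real.sqrt_le_left (by positivity)]
    linarith
  have i4 := integrable_lh₁_four hm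
  calc ∫ τ, lh₁ m τ ^ 3 * ‖V τ‖ ≤ ∫ τ, (y / 4 * lh₁ m τ ^ 4 + 1 / y * (lh₁ m τ ^ 2 * ‖V τ‖ ^ 2)) := by
        refine integral_mono i1 ((i4.const_mul _).add (i2.const_mul _)) fun τ => ?_
        have : y / 4 * lh₁ m τ ^ 4 + 1 / y * (lh₁ m τ ^ 2 * ‖V τ‖ ^ 2) - lh₁ m τ ^ 3 * ‖V τ‖
            = lh₁ m τ ^ 2 / y * (y / 2 * lh₁ m τ - ‖V τ‖) ^ 2 := by
          field_simp; ring
        have : 0 ≤ lh₁ m τ ^ 2 / y * (y / 2 * lh₁ m τ - ‖V τ‖) ^ 2 := by positivity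
        simp only
        linarith
    _ = y / 4 * quartic m + 1 / y * g := by
        rw [integral_add (i4.const_mul _) (i2.const_mul _), integral_const_mul, integral_const_mul,
          quartic]
    _ ≤ y / 4 * 2 + 1 / y * (y / 2) ^ 2 := by
        have := quartic_le_two hm
        gcongr
    _ ≤ y := by field_simp; norm_num

theorem lh_moments : ∫ τ, lh₁ m τ ^ 4 * lh₃ m τ = 0 :=
  integral_odd_eq_zero fun x => by rw [lh₁_neg, lh₃_neg]; ring

/-- The harmonic profile is orthogonal to itself in the required sense because h₁⁴h₃ is odd and the
second component of h is zero. -/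
theorem modul_lh_zero : modul m (lh m) 0 = 0 := by
  have h := lh_moments (m := m)
  have e1 : corr (fun τ => lh₁ m τ ^ 4) (fun τ => lh m τ 2) 0 = 0 := by
    simpa [corr] using h
  have e2 : corr (fun τ => lh₁ m τ ^ 3 * lh₃ m τ) (fun τ => lh m τ 0) 0 = 0 := by
    refine Eq.trans (integral_congr_ae (Eventually.of_forall fun τ => ?_)) h
    simp; ring
  have e3 : ∀ k : ℝ → ℝ, corr k (fun τ => lh m τ 1) 0 = 0 := fun k => by simp [corr]
  simp only [modul, Prod.fst_zero, Prod.snd_zero, e1, e2, e3]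
  simp

theorem hasStrictDerivAt_corr (hm : 1 ≤ m) {k k' f : ℝ → ℝ} (hk : IsKernel m k k')
    (hf : IsBddCont f) (σ : ℝ) : HasStrictDerivAt (corr k f) (-corr k' f σ) σ :=
  hasStrictDerivAt_of_hasDerivAt_of_continuousAt
    (Eventually.of_forall fun σ => hk.hasDerivAt_corr hm hf σ)
    (hk.decay'.continuous_corr hm hf).neg.continuousAt

/-- The off-diagonal derivatives vanish, by the zero second component of h and the oddness of h₁⁴h₃.
The diagonal ones are m∫h₁⁴ and ∫h₁⁴, which are the normalizing denominators of `modul`. -/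
theorem hasStrictFDerivAt_modul_lh (hm : 1 ≤ m) :
    HasStrictFDerivAt (modul m (lh m)) (ContinuousLinearMap.id ℝ (ℝ × ℝ)) 0 := by
  have hm0 : (0 : ℝ) < m := by exact_mod_cast hm
  have hq := quartic_pos hm
  have hl := isBddCurve_lh (m := m)
  have c1 := continuous_lh₁ m
  have c3 := continuous_lh₃ m
  have hF : ∀ {k k' : ℝ → ℝ} (_ : IsKernel m k k') (i : Fin 3),
      HasStrictFDerivAt (fun p : ℝ × ℝ => corr k (fun τ => lh m τ i) p.1)
        ((-corr k' (fun τ => lh m τ i) 0) • ContinuousLinearMap.fst ℝ ℝ ℝ) 0 := fun hk i =>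
    (hasStrictDerivAt_corr hm hk (hl.coord i) (0 : ℝ × ℝ).1).comp_hasStrictFDerivAt
      (0 : ℝ × ℝ) hasStrictFDerivAt_fst
  have hcos : HasStrictFDerivAt (fun p : ℝ × ℝ => Real.cos p.2)
      ((-Real.sin 0) • ContinuousLinearMap.snd ℝ ℝ ℝ) 0 :=
    (Real.hasStrictDerivAt_cos (0 : ℝ × ℝ).2).comp_hasStrictFDerivAt (0 : ℝ × ℝ)
      hasStrictFDerivAt_snd
  have hsin : HasStrictFDerivAt (fun p : ℝ × ℝ => Real.sin p.2)
      ((Real.cos 0) • ContinuousLinearMap.snd ℝ ℝ ℝ) 0 :=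
    (Real.hasStrictDerivAt_sin (0 : ℝ × ℝ).2).comp_hasStrictFDerivAt (0 : ℝ × ℝ)
      hasStrictFDerivAt_snd
  have k1 := isKernel_pow_three hm
  have k2 := isKernel_pow_three_mul hm
  have k3 := isKernel_pow_four hm
  have hA := ((((hF k3 2).sub (hcos.mul (hF k2 0))).sub (hsin.mul (hF k2 1))).mul_const
    (m * quartic m)⁻¹).prodMk (((hsin.mul (hF k1 0)).sub (hcos.mul (hF k1 1))).mul_const
      (quartic m)⁻¹)
  refine (hA.congr_fderiv ?_)
  have v1 : ∀ k : ℝ → ℝ, corr k (fun τ => lh m τ 1) 0 = 0 := fun k => by simp [corr]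
  have v2 : corr (fun τ => lh₁ m τ ^ 3 * lh₃ m τ) (fun τ => lh m τ 0) 0 = 0 := by
    refine Eq.trans (integral_congr_ae (Eventually.of_forall fun τ => ?_)) (lh_moments (m := m))
    simp; ring
  have v3 : corr (fun τ => lh₁ m τ ^ 3) (fun τ => lh m τ 0) 0 = quartic m := by
    rw [corr, quartic]
    refine integral_congr_ae (Eventually.of_forall fun τ => ?_)
    simp; ring
  -- The integrands add up to m h₁⁴(4h₃² + h₁² − 3h₃²), and h₁² + h₃² = 1.
  have v4 : -corr (fun τ => -(4 * m * lh₁ m τ ^ 4 * lh₃ m τ)) (fun τ => lh m τ 2) 0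
      + corr (fun τ => m * lh₁ m τ ^ 3 * (lh₁ m τ ^ 2 - 3 * lh₃ m τ ^ 2)) (fun τ => lh m τ 0) 0
      = m * quartic m := by
    have i3 := (k3.decay'.integrable hm (hl.coord 2) 0).fun_neg
    rw [corr, corr, ← integral_neg, ← integral_add i3 (k2.decay'.integrable hm (hl.coord 0) 0),
      quartic, ← integral_const_mul]
    refine integral_congr_ae (Eventually.of_forall fun τ => ?_)
    simp
    linear_combination m * lh₁ m τ ^ 4 * lh_sq_add m τ
  have v5 : (-corr (fun τ => -(4 * m * lh₁ m τ ^ 4 * lh₃ m τ)) (fun τ => lh m τ 2) 0)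
      = m * quartic m - corr (fun τ => m * lh₁ m τ ^ 3 * (lh₁ m τ ^ 2 - 3 * lh₃ m τ ^ 2))
        (fun τ => lh m τ 0) 0 := by linarith
  refine ContinuousLinearMap.ext fun q => Prod.ext ?_ ?_
  · simp only [ContinuousLinearMap.prod_apply, smul_apply,
      sub_apply, add_apply, ContinuousLinearMap.coe_fst',
      ContinuousLinearMap.coe_snd', smul_eq_mul, Prod.fst_zero, Prod.snd_zero, v1, v2, v5,
      Real.cos_zero, Real.sin_zero, ContinuousLinearMap.id_apply]
    field_simp
    ring
  · simp only [ContinuousLinearMap.prod_apply, smul_apply,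
      sub_apply, add_apply, ContinuousLinearMap.coe_fst',
      ContinuousLinearMap.coe_snd', smul_eq_mul, Prod.fst_zero, Prod.snd_zero, v1, v3,
      Real.cos_zero, Real.sin_zero, ContinuousLinearMap.id_apply]
    field_simp
    ring

end

end EquivariantMaps

/-! ### The distance on the circle of angles. -/

namespace EquivariantMaps

section

variable {m : ℕ}

theorem norm_angle_coe {x : ℝ} (hx : |x| ≤ Real.pi) : ‖(x : Real.Angle)‖ = |x| := by
  have h := (AddCircle.norm_coe_eq_abs_iff (p := 2 * Real.pi) (x := x) Real.two_pi_pos.ne').2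
    (by rw [abs_of_pos Real.two_pi_pos]; linarith)
  exact h

theorem norm_angle (θ : Real.Angle) : ‖θ‖ = |θ.toReal| := by
  conv_lhs => rw [← θ.coe_toReal]
  exact norm_angle_coe θ.abs_toReal_le_pi

theorem norm_angle_coe_le (x : ℝ) : ‖(x : Real.Angle)‖ ≤ |x| := by
  rcases le_total |x| Real.pi with h | h
  · exact (norm_angle_coe h).le
  · rw [norm_angle]
    exact (Real.Angle.abs_toReal_le_pi _).trans h

/-! ### Harmonic maps as elements of the class -/

theorem h_sq_add (r : ℝ) : h₁ m r ^ 2 + h₃ m r ^ 2 = 1 := by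
  rw [h₁, h₃, mul_comm 2 m, pow_mul]
  have : (r ^ m) ^ 2 + 1 ≠ 0 := by positivity
  field_simp
  ring

theorem norm_hProfile (r : ℝ) : ‖hProfile m r‖ = 1 := by
  have : ‖hProfile m r‖ ^ 2 = 1 := by
    rw [norm_sq_space]; simp [hProfile]; exact h_sq_add r
  nlinarith [norm_nonneg (hProfile m r)]

theorem profile_harmonicMap {s r : ℝ} (hs : 0 < s) (hr : 0 ≤ r) (α : Real.Angle) :
    profile (harmonicMap m s α) r = rot α (hProfile m (r / s)) := by
  have e : s⁻¹ • (!₂[r, 0] : Plane) = !₂[r / s, 0] := by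
    ext i; fin_cases i <;> simp [div_eq_inv_mul]
  have hrs : 0 ≤ r / s := div_nonneg hr hs.le
  have ha : polarAngle !₂[r / s, 0] = 0 := by
    have : (⟨r / s, 0⟩ : ℂ) = ((r / s : ℝ) : ℂ) := rfl
    simp only [polarAngle, Matrix.cons_val_zero, Matrix.cons_val_one, this]
    rw [Complex.arg_ofReal_of_nonneg hrs, Real.Angle.coe_zero]
  have hn : ‖(!₂[r / s, 0] : Plane)‖ = r / s := by
    have : ‖(!₂[r / s, 0] : Plane)‖ ^ 2 = (r / s) ^ 2 := by rw [norm_sq_plane]; simp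
    exact (sq_eq_sq₀ (norm_nonneg _) hrs).1 this
  rw [profile, harmonicMap, e, equivariantMap, ha, hn, smul_zero, rot_zero]

theorem logProfile_harmonicMap (σ τ : ℝ) (α : Real.Angle) :
    logProfile (harmonicMap m (Real.exp σ) α) τ = rot α (lh m (τ - σ)) := by
  rw [logProfile, profile_harmonicMap (Real.exp_pos σ) (Real.exp_pos τ).le, ← Real.exp_sub,
    hProfile_exp]

theorem polarAngle_smul {c : ℝ} (hc : 0 < c) (x : Plane) : polarAngle (c • x) = polarAngle x := by
  unfold polarAngle
  congr 1
  have : (⟨(c • x) 0, (c • x) 1⟩ : ℂ) = (c : ℂ) * ⟨x 0, x 1⟩ := by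
    apply Complex.ext <;> simp
  rw [this, Complex.arg_real_mul _ hc]

theorem tendsto_lh_atTop (hm : 1 ≤ m) : Tendsto (lh m) atTop (𝓝 kVec) := by
  have h : Tendsto (fun τ => (WithLp.toLp 2 ![lh₁ m τ, 0, lh₃ m τ] : Space)) atTop
      (𝓝 (WithLp.toLp 2 ![0, 0, 1])) := by
    refine ((PiLp.continuous_toLp 2 _).tendsto _).comp (tendsto_pi_nhds.2 fun i => ?_)
    fin_cases i
    · exact tendsto_lh₁_atTop hm
    · exact tendsto_const_nhds
    · exact tendsto_lh₃_atTop hm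
  exact h

theorem isSigma_harmonicMap (hm : 1 ≤ m) (σ : ℝ) (α : Real.Angle) :
    IsSigma m (harmonicMap m (Real.exp σ) α) := by
  have hs := Real.exp_pos σ
  have hc := continuous_harmonicMap m (Real.exp σ) α
  refine ⟨fun x => ?_, ?_, hc, memHdot_harmonicMap hm σ α, ?_, ?_⟩
  · rw [harmonicMap, equivariantMap, rot_norm, rot_norm, norm_hProfile]
  · funext x
    rw [equivariantMap, profile_harmonicMap hs (norm_nonneg x), harmonicMap, equivariantMap,
      polarAngle_smul (inv_pos.2 hs), norm_smul, Real.norm_of_nonneg (inv_pos.2 hs).le, rot_rot,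
      rot_rot, add_comm, div_eq_inv_mul]
  · have h0 : profile (harmonicMap m (Real.exp σ) α) 0 = -kVec := by
      rw [profile_harmonicMap hs le_rfl]
      have h : hProfile m (0 / Real.exp σ) = -kVec := by
        have : m ≠ 0 := by omega
        ext i; fin_cases i <;> simp [hProfile, h₁, h₃, kVec, this]
      rw [h]
      ext i; fin_cases i <;> simp [kVec]
    have hp : Continuous (profile (harmonicMap m (Real.exp σ) α)) := by
      refine hc.comp ((PiLp.continuous_toLp 2 _).comp (continuous_pi fun i => ?_))
      fin_cases i
      · exact continuous_id
      · exact continuous_const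
    rw [← h0]
    exact hp.continuousWithinAt
  · have h1 : Tendsto (fun r => rot α (lh m (Real.log r - σ))) atTop (𝓝 (rot α kVec)) := by
      simp only [← rotL_apply]
      exact ((rotL α).continuous.tendsto _).comp ((tendsto_lh_atTop hm).comp
        (tendsto_atTop_add_const_right _ (-σ) Real.tendsto_log_atTop))
    have h2 : rot α kVec = kVec := by ext i; fin_cases i <;> simp [kVec]
    rw [h2] at h1
    refine h1.congr' ?_
    filter_upwards [eventually_gt_atTop 0] with r hr
    rw [← logProfile_harmonicMap, logProfile, Real.exp_log hr]

theorem excess_harmonicMap (hm : 1 ≤ m) (σ : ℝ) (α : Real.Angle) :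
    excess m (harmonicMap m (Real.exp σ) α) = 0 := by
  rw [excess, energy, dirichlet_harmonicMap hm, Real.sqrt_eq_zero']
  linarith

/-! ### Separation of the harmonic maps -/

/-- The weighted height difference of two harmonic maps. -/
noncomputable def heightGap (m : ℕ) (a : ℝ) : ℝ :=
  ∫ τ, lh₁ m τ ^ 2 * (lh₃ m (τ + a) - lh₃ m τ) ^ 2

theorem strictMono_lh₃ (hm : 1 ≤ m) : StrictMono (lh₃ m) := by
  have hm0 : (0 : ℝ) < m := by exact_mod_cast hm
  refine strictMono_of_hasDerivAt_pos (hasDerivAt_lh₃ m) fun τ => ?_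
  have := lh₁_pos m τ
  positivity

theorem continuous_heightGap_integrand (a : ℝ) :
    Continuous fun τ => (lh₃ m (τ + a) - lh₃ m τ) ^ 2 := by
  have := continuous_lh₃ m
  fun_prop

theorem integrable_heightGap (hm : 1 ≤ m) (a : ℝ) :
    Integrable fun τ => lh₁ m τ ^ 2 * (lh₃ m (τ + a) - lh₃ m τ) ^ 2 := by
  refine integrable_bounded_mul (continuous_heightGap_integrand a) (integrable_lh₁_sq hm) (C := 4)
    fun τ => ?_
  have h1 := abs_le.1 (abs_lh₃_le_one m τ)
  have h2 := abs_le.1 (abs_lh₃_le_one m (τ + a))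
  rw [abs_of_nonneg (sq_nonneg _)]
  nlinarith

theorem heightGap_pos (hm : 1 ≤ m) {a : ℝ} (ha : a ≠ 0) : 0 < heightGap m a := by
  refine integral_pos_of_integrable_nonneg_nonzero (x := 0)
    (((continuous_lh₁ m).pow 2).mul (continuous_heightGap_integrand a))
    (integrable_heightGap hm a) (fun τ => by simp only [Pi.zero_apply]; positivity) ?_
  have h : lh₃ m (0 + a) - lh₃ m 0 ≠ 0 := by
    rw [sub_ne_zero, zero_add]
    exact (strictMono_lh₃ hm).injective.ne ha
  have := lh₁_pos m 0
  positivity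

/-- h₃ is increasing, so for every τ the height difference grows with the translation. A lower bound
at ±r therefore serves all larger translations, with no compactness argument. -/
theorem heightGap_mono (hm : 1 ≤ m) {a b : ℝ} (h : (0 ≤ a ∧ a ≤ b) ∨ (b ≤ a ∧ a ≤ 0)) :
    heightGap m a ≤ heightGap m b := by
  refine integral_mono (integrable_heightGap hm a) (integrable_heightGap hm b) fun τ => ?_
  refine mul_le_mul_of_nonneg_left ?_ (sq_nonneg _)
  have mono := (strictMono_lh₃ hm).monotone
  rcases h with ⟨h1, h2⟩ | ⟨h1, h2⟩
  · have a1 := mono (show τ ≤ τ + a by linarith)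
    have a2 := mono (show τ + a ≤ τ + b by linarith)
    exact pow_le_pow_left₀ (by linarith) (by linarith) 2
  · have a1 := mono (show τ + a ≤ τ by linarith)
    have a2 := mono (show τ + b ≤ τ + a by linarith)
    rw [← neg_sq, ← neg_sq (lh₃ m (τ + b) - lh₃ m τ)]
    exact pow_le_pow_left₀ (by linarith) (by linarith) 2

theorem gap_harmonicMap (σ σ' : ℝ) (α α' : Real.Angle) :
    gap m (harmonicMap m (Real.exp σ) α) σ' α'
      = ∫ τ, lh₁ m τ ^ 2 * ‖lh m (τ + (σ' - σ)) - rot (α' - α) (lh m τ)‖ ^ 2 := by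
  rw [gap, ← integral_add_right_eq_self _ σ']
  refine integral_congr_ae (Eventually.of_forall fun τ => ?_)
  simp only [logProfile_harmonicMap, add_sub_cancel_right]
  rw [show τ + σ' - σ = τ + (σ' - σ) by ring,
    ← rot_norm α (lh m (τ + (σ' - σ)) - rot (α' - α) (lh m τ)), rot_sub, rot_rot,
    add_sub_cancel]

theorem integrable_gap_harmonicMap (hm : 1 ≤ m) (a : ℝ) (b : Real.Angle) :
    Integrable fun τ => lh₁ m τ ^ 2 * ‖lh m (τ + a) - rot b (lh m τ)‖ ^ 2 := by
  have h1 : Continuous fun τ => lh m (τ + a) :=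
    continuous_lh.comp (continuous_id.add continuous_const)
  have h2 : Continuous fun τ => rot b (lh m τ) := by
    simpa using continuous_rot_lh (m := m) 0 b
  refine integrable_bounded_mul ((h1.sub h2).norm.pow 2) (integrable_lh₁_sq hm) (C := 2 ^ 2)
    fun τ => ?_
  rw [abs_pow, abs_norm]
  refine pow_le_pow_left₀ (norm_nonneg _) ((norm_sub_le _ _).trans ?_) 2
  rw [norm_rot_lh, norm_lh]
  norm_num

/-- Only the third component is kept; it ignores the angle. -/
theorem heightGap_le_gap (hm : 1 ≤ m) (σ σ' : ℝ) (α α' : Real.Angle) :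
    heightGap m (σ' - σ) ≤ gap m (harmonicMap m (Real.exp σ) α) σ' α' := by
  rw [gap_harmonicMap]
  refine integral_mono (integrable_heightGap hm _) (integrable_gap_harmonicMap hm _ _) fun τ => ?_
  refine mul_le_mul_of_nonneg_left ?_ (sq_nonneg _)
  rw [norm_sq_space]
  simp
  positivity

/-- Only the horizontal components are kept, with x = h₁(τ) and y the translated value, both
positive. For cos ≥ 0 the sine part alone gives the bound; for cos ≤ 0 the difference y − x cos is
at least |x cos|, so the sum of squares is at least x². The bound is uniform in the translation. -/
theorem one_sub_cos_le_gap (hm : 1 ≤ m) (σ σ' : ℝ) (α α' : Real.Angle) :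
    quartic m * ((1 - (α' - α).cos) / 2) ≤ gap m (harmonicMap m (Real.exp σ) α) σ' α' := by
  rw [gap_harmonicMap, quartic, ← integral_mul_const]
  refine integral_mono ((integrable_lh₁_four hm).mul_const _) (integrable_gap_harmonicMap hm _ _)
    fun τ => ?_
  set b := α' - α
  have hp := lh₁_pos m τ
  have hq := lh₁_pos m (τ + (σ' - σ))
  have hcs := b.cos_sq_add_sin_sq
  have key : lh₁ m τ ^ 2 * ((1 - b.cos) / 2) ≤ ‖lh m (τ + (σ' - σ)) - rot b (lh m τ)‖ ^ 2 := by
    rw [norm_sq_space]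
    simp only [PiLp.sub_apply, rot_apply_zero, rot_apply_one, rot_apply_two, lh_zero, lh_one, lh_two]
    set x := lh₁ m τ
    set y := lh₁ m (τ + (σ' - σ))
    set c := b.cos
    set s := b.sin
    have h3 := sq_nonneg (lh₃ m (τ + (σ' - σ)) - lh₃ m τ)
    have hc1 : -1 ≤ c := by nlinarith [sq_nonneg s]
    have hc2 : c ≤ 1 := by nlinarith [sq_nonneg s]
    have e : s ^ 2 = 1 - c ^ 2 := by linarith
    have : x ^ 2 * ((1 - c) / 2) ≤ (y - c * x) ^ 2 + (s * x) ^ 2 := by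
      rw [mul_pow, e]
      rcases le_total 0 c with h | h
      · nlinarith [sq_nonneg (y - c * x), mul_nonneg (sq_nonneg x) (sub_nonneg.2 hc2),
          mul_nonneg (mul_nonneg (sq_nonneg x) (sub_nonneg.2 hc2)) h]
      · have h1 : 0 ≤ -c * x := mul_nonneg (by linarith) hp.le
        have h2 : (c * x) ^ 2 ≤ (y - c * x) ^ 2 := by nlinarith
        nlinarith [mul_nonneg (sq_nonneg x) (by linarith : 0 ≤ 1 + c)]
    nlinarith
  calc _ = lh₁ m τ ^ 2 * (lh₁ m τ ^ 2 * ((1 - b.cos) / 2)) := by ring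
    _ ≤ _ := mul_le_mul_of_nonneg_left key (sq_nonneg _)

theorem norm_sq_le_cos (θ : Real.Angle) : 2 / Real.pi ^ 2 * ‖θ‖ ^ 2 ≤ 1 - θ.cos := by
  have h := Real.cos_le_one_sub_mul_cos_sq θ.abs_toReal_le_pi
  rw [Real.Angle.cos_toReal] at h
  rw [norm_angle, sq_abs]
  linarith

/-- Harmonic maps that are close to each other have close parameters. -/
theorem exists_separation (hm : 1 ≤ m) {r : ℝ} (hr : 0 < r) :
    ∃ ε > 0, ∀ (σ σ' : ℝ) (α α' : Real.Angle),
      hdist (harmonicMap m (Real.exp σ) α) (harmonicMap m (Real.exp σ') α') ≤ ε →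
      |σ' - σ| ≤ r ∧ ‖α' - α‖ ≤ r := by
  have hm1 : (1 : ℝ) ≤ m := by exact_mod_cast hm
  have hq := quartic_pos hm
  have hr' : 0 < quartic m / Real.pi ^ 2 * r ^ 2 := by positivity
  set κ := min (min (heightGap m r) (heightGap m (-r))) (quartic m / Real.pi ^ 2 * r ^ 2) with hκ
  have hκ0 : 0 < κ := lt_min (lt_min (heightGap_pos hm hr.ne')
    (heightGap_pos hm (neg_ne_zero.2 hr.ne'))) hr'
  -- Taking κ/2 under the root makes the gap strictly smaller than the threshold κ.
  refine ⟨Real.sqrt (κ / 2), Real.sqrt_pos.2 (by positivity), fun σ σ' α α' h => ?_⟩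
  have hS := isSigma_harmonicMap hm σ α
  have h2 : gap m (harmonicMap m (Real.exp σ) α) σ' α' < κ := by
    have e := hdist_sq_eq_gap hm hS σ' α'
    rw [excess_harmonicMap hm] at e
    have h3 := pow_le_pow_left₀ (hdist_nonneg _ _) h 2
    rw [Real.sq_sqrt (by positivity), e] at h3
    have h4 := gap_nonneg (m := m) (u := harmonicMap m (Real.exp σ) α) σ' α'
    have h5 : (1 : ℝ) ≤ 4 * Real.pi * m ^ 2 := by nlinarith [Real.pi_gt_three]
    nlinarith
  have a1 := (heightGap_le_gap hm σ σ' α α').trans_lt h2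
  have a2 := (one_sub_cos_le_gap hm σ σ' α α').trans_lt h2
  refine ⟨?_, ?_⟩
  · by_contra hc
    rw [not_le, lt_abs] at hc
    rcases hc with hc | hc
    · have := heightGap_mono hm (a := r) (b := σ' - σ) (Or.inl ⟨hr.le, hc.le⟩)
      have := (min_le_left _ _).trans (min_le_left _ _) |>.trans this (a := κ)
      linarith
    · have := heightGap_mono hm (a := -r) (b := σ' - σ) (Or.inr ⟨by linarith, by linarith⟩)
      have := (min_le_left _ _).trans (min_le_right _ _) |>.trans this (a := κ)
      linarith
  · have a3 := norm_sq_le_cos (α' - α)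
    have a4 : quartic m / Real.pi ^ 2 * ‖α' - α‖ ^ 2 < quartic m / Real.pi ^ 2 * r ^ 2 := by
      refine lt_of_le_of_lt ?_ (a2.trans_le (min_le_right _ _))
      calc _ = quartic m * ((2 / Real.pi ^ 2 * ‖α' - α‖ ^ 2) / 2) := by ring
        _ ≤ _ := by gcongr
    have a5 := lt_of_mul_lt_mul_left a4 (by positivity)
    exact (lt_of_pow_lt_pow_left₀ 2 hr.le a5).le

end

end EquivariantMaps

namespace EquivariantMaps

section

variable {m : ℕ}

/-! ### Zeros of perturbations of the identity -/

/-- A map that differs from the identity by a contraction has a zero near any approximate zero. -/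
theorem exists_zero_of_contraction {E : Type*} [NormedAddCommGroup E] [CompleteSpace E]
    {Φ : E → E} {ρ : ℝ} (h : ∀ p ∈ Metric.closedBall (0 : E) ρ, ∀ p' ∈ Metric.closedBall (0 : E) ρ,
      ‖Φ p - Φ p' - (p - p')‖ ≤ 1 / 2 * ‖p - p'‖) (h0 : ‖Φ 0‖ ≤ ρ / 2) :
    ∃ p, ‖p‖ ≤ 2 * ‖Φ 0‖ ∧ Φ p = 0 := by
  have hρ : 0 ≤ ρ := by linarith [norm_nonneg (Φ 0)]
  have hz : (0 : E) ∈ Metric.closedBall (0 : E) ρ := by simpa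
  have hle : ∀ p ∈ Metric.closedBall (0 : E) ρ, ‖p - Φ p‖ ≤ 1 / 2 * ‖p‖ + ‖Φ 0‖ := by
    intro p hp
    have h1 := h p hp 0 hz
    rw [sub_zero] at h1
    calc ‖p - Φ p‖ = ‖(Φ p - Φ 0 - p) + Φ 0‖ := by rw [← norm_neg]; congr 1; abel
      _ ≤ _ := (norm_add_le _ _).trans (add_le_add_left h1 _)
  have hmaps : MapsTo (fun p => p - Φ p) (Metric.closedBall (0 : E) ρ)
      (Metric.closedBall (0 : E) ρ) := by
    intro p hp
    have h1 := hle p hp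
    rw [mem_closedBall_zero_iff] at hp ⊢
    linarith
  have hcon : ContractingWith (1 / 2) (hmaps.restrict (fun p => p - Φ p) _ _) := by
    refine ⟨by norm_num, LipschitzWith.of_dist_le_mul fun p p' => ?_⟩
    have h1 := h p p.2 p' p'.2
    rw [Subtype.dist_eq, Subtype.dist_eq, dist_eq_norm, dist_eq_norm]
    simp only [MapsTo.val_restrict_apply]
    calc _ = ‖Φ p - Φ p' - (p - p')‖ := by rw [← norm_neg]; congr 1; abel
      _ ≤ _ := by simpa using h1
  obtain ⟨p, hp, hfix, -⟩ := hcon.exists_fixedPoint' Metric.isClosed_closedBall.isComplete hmaps hz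
    (edist_ne_top _ _)
  have hΦ : Φ p = 0 := by
    have : p - Φ p = p := hfix
    simpa using this
  refine ⟨p, ?_, hΦ⟩
  have := hle p hp
  rw [hΦ, sub_zero] at this
  linarith

/-! ### The modulation map near a harmonic map -/

/-- Strict differentiability with constant 1/4; the other 1/4 of the final contraction constant is
left for the difference between the profile of `u` and the harmonic one. -/
theorem exists_radius (hm : 1 ≤ m) : ∃ ρ > 0, ρ ≤ 1 ∧
    ∀ p ∈ Metric.closedBall (0 : ℝ × ℝ) ρ, ∀ p' ∈ Metric.closedBall (0 : ℝ × ℝ) ρ,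
      ‖modul m (lh m) p - modul m (lh m) p' - (p - p')‖ ≤ 1 / 4 * ‖p - p'‖ := by
  obtain ⟨s, hs, h⟩ := (hasStrictFDerivAt_modul_lh hm).approximates_deriv_on_nhds (c := 1 / 4)
    (Or.inr (by norm_num))
  obtain ⟨r, hr, hrs⟩ := Metric.nhds_basis_closedBall.mem_iff.1 hs
  refine ⟨min r 1, lt_min hr one_pos, min_le_right _ _, fun p hp p' hp' => ?_⟩
  have := h p (hrs (Metric.closedBall_subset_closedBall (min_le_left _ _) hp)) p'
    (hrs (Metric.closedBall_subset_closedBall (min_le_left _ _) hp'))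
  simpa using this

theorem gap_eq_centered (V : ℝ → Space) (σ : ℝ) (α : Real.Angle) :
    ∫ τ, lh₁ m (τ - σ) ^ 2 * ‖V τ - rot α (lh m (τ - σ))‖ ^ 2
      = ∫ τ, lh₁ m τ ^ 2 * ‖centered V σ α τ - lh m τ‖ ^ 2 := by
  rw [← integral_add_right_eq_self _ σ]
  refine integral_congr_ae (Eventually.of_forall fun τ => ?_)
  simp only [centered, add_sub_cancel_right]
  rw [← rot_norm α (rot (-α) (V (τ + σ)) - lh m τ), rot_sub, rot_rot_neg]

theorem sqrt_gap_le_hdist (hm : 1 ≤ m) {u : Plane → Space} (hu : IsSigma m u) (σ : ℝ)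
    (α : Real.Angle) : Real.sqrt (gap m u σ α) ≤ hdist u (harmonicMap m (Real.exp σ) α) := by
  have hm1 : (1 : ℝ) ≤ m := by exact_mod_cast hm
  rw [Real.sqrt_le_left (hdist_nonneg _ _), hdist_sq_eq_gap hm hu]
  have h4 := gap_nonneg (m := m) (u := u) σ α
  have h5 : (1 : ℝ) ≤ 4 * Real.pi * m ^ 2 := by nlinarith [Real.pi_gt_three]
  nlinarith [sq_nonneg (excess m u)]

/-- Controls the weighted norm in the estimates of `modul` by the Sobolev distance to the harmonic
map, through the gap. -/
theorem cube_centered_le (hm : 1 ≤ m) {u : Plane → Space} (hu : IsSigma m u) (σ : ℝ)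
    (α : Real.Angle) :
    ∫ τ, lh₁ m τ ^ 3 * ‖centered (logProfile u) σ α τ - lh m τ‖
      ≤ 2 * hdist u (harmonicMap m (Real.exp σ) α) := by
  have hV := ((isBddCurve_logProfile hu).centered σ α).sub (isBddCurve_lh (m := m))
  refine (cube_le_sqrt hm hV).trans ?_
  rw [← gap_eq_centered]
  exact mul_le_mul_of_nonneg_left (sqrt_gap_le_hdist hm hu σ α) two_pos.le

theorem modul_contraction (hm : 1 ≤ m) {ρ : ℝ} (hρ : ρ ≤ 1)
    (hlh : ∀ p ∈ Metric.closedBall (0 : ℝ × ℝ) ρ, ∀ p' ∈ Metric.closedBall (0 : ℝ × ℝ) ρ,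
      ‖modul m (lh m) p - modul m (lh m) p' - (p - p')‖ ≤ 1 / 4 * ‖p - p'‖)
    {u : Plane → Space} (hu : IsSigma m u) (σ β : ℝ)
    (hd : modulConst m * (2 * hdist u (harmonicMap m (Real.exp σ) β)) ≤ 1 / 4) :
    ∀ p ∈ Metric.closedBall (0 : ℝ × ℝ) ρ, ∀ p' ∈ Metric.closedBall (0 : ℝ × ℝ) ρ,
      ‖modul m (logProfile u) ((σ, β) + p) - modul m (logProfile u) ((σ, β) + p') - (p - p')‖
        ≤ 1 / 2 * ‖p - p'‖ := by
  intro p hp p' hp'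
  have hV := isBddCurve_logProfile hu
  have hW := hV.centered σ (β : Real.Angle)
  have hX := hW.sub (isBddCurve_lh (m := m))
  have hle : ∀ q ∈ Metric.closedBall (0 : ℝ × ℝ) ρ, |q.1| ≤ 1 := fun q hq =>
    (norm_fst_le q).trans ((mem_closedBall_zero_iff.1 hq).trans hρ)
  have h1 := norm_modul_sub_le hm hX (hle p hp) (hle p' hp')
  rw [modul_sub hm hW isBddCurve_lh, modul_sub hm hW isBddCurve_lh] at h1
  have h2 := hlh p hp p' hp'
  have h3 : modulConst m * (∫ τ, lh₁ m τ ^ 3 * ‖centered (logProfile u) σ β τ - lh m τ‖) ≤ 1 / 4 :=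
    (mul_le_mul_of_nonneg_left (cube_centered_le hm hu σ β) (modulConst_nonneg hm)).trans hd
  rw [modul_add hm hV, modul_add hm hV]
  set a := modul m (centered (logProfile u) σ β) p
  set a' := modul m (centered (logProfile u) σ β) p'
  set b := modul m (lh m) p
  set b' := modul m (lh m) p'
  calc ‖a - a' - (p - p')‖ = ‖(a - b - (a' - b')) + (b - b' - (p - p'))‖ := by congr 1; abel
    _ ≤ 1 / 4 * ‖p - p'‖ + 1 / 4 * ‖p - p'‖ := by
        refine (norm_add_le _ _).trans (add_le_add (h1.trans ?_) h2)
        exact mul_le_mul_of_nonneg_right h3 (norm_nonneg _)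
    _ = _ := by ring

theorem norm_modul_le (hm : 1 ≤ m) {u : Plane → Space} (hu : IsSigma m u) (σ β : ℝ) :
    ‖modul m (logProfile u) (σ, β)‖
      ≤ modulConst m * (2 * hdist u (harmonicMap m (Real.exp σ) β)) := by
  have hV := isBddCurve_logProfile hu
  have hW := hV.centered σ (β : Real.Angle)
  have h := norm_modul_zero_le hm (hW.sub (isBddCurve_lh (m := m)))
  rw [modul_sub hm hW isBddCurve_lh, modul_lh_zero, sub_zero] at h
  have e := modul_add hm hV σ β 0
  rw [add_zero] at e
  rw [e]
  exact h.trans (mul_le_mul_of_nonneg_left (cube_centered_le hm hu σ β) (modulConst_nonneg hm))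

/-- Constants for the modulation argument: on balls of radius `ρ` about parameters of a harmonic
map that is `ε`-close to `u`, the modulation map of `u` is close to a translation, and any two such
parameters differ by at most `ρ / 2`. -/
structure IsModulScale (m : ℕ) (ρ ε κ : ℝ) : Prop where
  ρ_pos : 0 < ρ
  ρ_le : ρ ≤ 1
  ε_pos : 0 < ε
  κ_pos : 0 < κ
  contraction : ∀ u : Plane → Space, IsSigma m u → ∀ σ β : ℝ,
    hdist u (harmonicMap m (Real.exp σ) β) ≤ ε →
    ∀ p ∈ Metric.closedBall (0 : ℝ × ℝ) ρ, ∀ p' ∈ Metric.closedBall (0 : ℝ × ℝ) ρ,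
      ‖modul m (logProfile u) ((σ, β) + p) - modul m (logProfile u) ((σ, β) + p') - (p - p')‖
        ≤ 1 / 2 * ‖p - p'‖
  zero : ∀ u : Plane → Space, IsSigma m u → ∀ σ β : ℝ,
    hdist u (harmonicMap m (Real.exp σ) β) ≤ ε →
    ∃ p : ℝ × ℝ, ‖p‖ ≤ ρ / 2 ∧ ‖p‖ ≤ κ * hdist u (harmonicMap m (Real.exp σ) β) ∧
      modul m (logProfile u) ((σ, β) + p) = 0
  separation : ∀ u : Plane → Space, IsSigma m u → ∀ (σ σ' : ℝ) (α α' : Real.Angle),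
    hdist u (harmonicMap m (Real.exp σ) α) ≤ ε → hdist u (harmonicMap m (Real.exp σ') α') ≤ ε →
    |σ' - σ| ≤ ρ / 2 ∧ ‖α' - α‖ ≤ ρ / 2

theorem exists_isModulScale (hm : 1 ≤ m) : ∃ ρ ε κ, IsModulScale m ρ ε κ := by
  obtain ⟨ρ, hρ0, hρ1, hlh⟩ := exists_radius hm
  obtain ⟨ε₁, hε₁, hsep⟩ := exists_separation hm (r := ρ / 2) (by positivity)
  -- The zero lies within twice the value at the centre, which is at most 2 · `modulConst` ·
  -- distance; the summand 1 makes `κ` positive.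
  set κ := 4 * modulConst m + 1 with hκ
  have hM := modulConst_nonneg hm
  have hκ0 : 0 < κ := by positivity
  -- The first bound lets two harmonic maps near `u` be compared through `u`; the second keeps the
  -- zero within ρ/2 of the centre.
  set ε := min (ε₁ / 2) (ρ / (2 * κ)) with hε
  have hε0 : 0 < ε := lt_min (by positivity) (by positivity)
  have hκε : κ * ε ≤ ρ / 2 := by
    calc κ * ε ≤ κ * (ρ / (2 * κ)) := mul_le_mul_of_nonneg_left (min_le_right _ _) hκ0.le
      _ = _ := by field_simp
  have hsmall : ∀ d : ℝ, 0 ≤ d → d ≤ ε → modulConst m * (2 * d) ≤ ρ / 4 ∧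
      2 * (modulConst m * (2 * d)) ≤ κ * d := by
    intro d h0 h
    constructor
    · nlinarith
    · rw [hκ]; nlinarith
  have hcon : ∀ u : Plane → Space, IsSigma m u → ∀ σ β : ℝ,
      hdist u (harmonicMap m (Real.exp σ) β) ≤ ε → _ := fun u hu σ β h =>
    modul_contraction hm hρ1 hlh hu σ β
      ((hsmall _ (hdist_nonneg _ _) h).1.trans (by linarith))
  refine ⟨ρ, ε, κ, hρ0, hρ1, hε0, hκ0, hcon, fun u hu σ β h => ?_, fun u hu σ σ' α α' h h' => ?_⟩
  · have h1 := norm_modul_le hm hu σ β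
    have h2 := hsmall _ (hdist_nonneg _ _) h
    have e0 : ((σ, β) : ℝ × ℝ) + 0 = (σ, β) := add_zero _
    obtain ⟨p, hp, hz⟩ := exists_zero_of_contraction
      (Φ := fun p => modul m (logProfile u) ((σ, β) + p)) (hcon u hu σ β h)
      (by simp only [e0]; linarith)
    simp only [e0] at hp
    exact ⟨p, by linarith, by linarith, hz⟩
  · refine hsep σ σ' α α' ?_
    have hS := isSigma_harmonicMap hm σ α
    have hS' := isSigma_harmonicMap hm σ' α'
    have h1 := hdist_triangle hS.continuous hu.continuous hS'.continuous hS.memHdot hu.memHdot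
      hS'.memHdot
    rw [hdist_comm _ _ hS.continuous hu.continuous hS.memHdot hu.memHdot] at h1
    have : ε ≤ ε₁ / 2 := min_le_left _ _
    linarith

/-- Two zeros in the ball satisfy |p₁ − p₂| ≤ ½|p₁ − p₂|. Angles are represented by their principal
differences from the centre. -/
theorem IsModulScale.unique {ρ ε κ : ℝ} (hS : IsModulScale m ρ ε κ) (hm : 1 ≤ m)
    {u : Plane → Space} (hu : IsSigma m u) {σ σ₁ σ₂ : ℝ} {α α₁ α₂ : Real.Angle}
    (h : hdist u (harmonicMap m (Real.exp σ) α) ≤ ε) (hσ₁ : |σ₁ - σ| ≤ ρ) (hσ₂ : |σ₂ - σ| ≤ ρ)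
    (hα₁ : ‖α₁ - α‖ ≤ ρ) (hα₂ : ‖α₂ - α‖ ≤ ρ) (h1 : Orthogonal m u (Real.exp σ₁) α₁)
    (h2 : Orthogonal m u (Real.exp σ₂) α₂) : σ₁ = σ₂ ∧ α₁ = α₂ := by
  rw [← α.coe_toReal] at h
  have key : ∀ {σ' : ℝ} {α' : Real.Angle}, |σ' - σ| ≤ ρ → ‖α' - α‖ ≤ ρ →
      Orthogonal m u (Real.exp σ') α' →
      ((σ' - σ, (α' - α).toReal) : ℝ × ℝ) ∈ Metric.closedBall (0 : ℝ × ℝ) ρ ∧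
      modul m (logProfile u) ((σ, α.toReal) + (σ' - σ, (α' - α).toReal)) = 0 := by
    intro σ' α' a b c
    rw [norm_angle] at b
    refine ⟨mem_closedBall_zero_iff.2 (max_le a b), ?_⟩
    rw [Prod.mk_add_mk, ← orthogonal_iff_modul hm hu]
    simpa using c
  obtain ⟨b1, z1⟩ := key hσ₁ hα₁ h1
  obtain ⟨b2, z2⟩ := key hσ₂ hα₂ h2
  have hc := hS.contraction u hu σ α.toReal h _ b1 _ b2
  rw [z1, z2, sub_self, zero_sub, norm_neg] at hc
  have h0 : ‖((σ₁ - σ, (α₁ - α).toReal) : ℝ × ℝ) - (σ₂ - σ, (α₂ - α).toReal)‖ = 0 := by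
    have := norm_nonneg (((σ₁ - σ, (α₁ - α).toReal) : ℝ × ℝ) - (σ₂ - σ, (α₂ - α).toReal))
    linarith
  rw [norm_eq_zero, sub_eq_zero, Prod.mk_inj] at h0
  exact ⟨by linarith [h0.1], sub_left_inj.1 (Real.Angle.toReal_injective h0.2)⟩

/-- `(σ, α)` are the modulation parameters of `u`, with `σ` the logarithm of the scale. -/
structure IsModulParam (m : ℕ) (ρ ε κ : ℝ) (u : Plane → Space) (σ : ℝ) (α : Real.Angle) : Prop where
  orthogonal : Orthogonal m u (Real.exp σ) α
  near : ∀ (σ' : ℝ) (α' : Real.Angle), hdist u (harmonicMap m (Real.exp σ') α') ≤ ε →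
    |σ - σ'| ≤ ρ / 2 ∧ ‖α - α'‖ ≤ ρ / 2 ∧
    |σ - σ'| ≤ κ * hdist u (harmonicMap m (Real.exp σ') α') ∧
    ‖α - α'‖ ≤ κ * hdist u (harmonicMap m (Real.exp σ') α')

/-- Each nearby harmonic map produces its own zero, within ρ/2 of its parameters. By separation two
such zeros lie in a common ball of radius ρ, where uniqueness identifies them; so one pair satisfies
the estimates relative to all nearby harmonic maps. -/
theorem IsModulScale.exists_isModulParam {ρ ε κ : ℝ} (hS : IsModulScale m ρ ε κ) (hm : 1 ≤ m)
    {u : Plane → Space} (hu : IsSigma m u) {σ₀ : ℝ} {α₀ : Real.Angle}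
    (h₀ : hdist u (harmonicMap m (Real.exp σ₀) α₀) ≤ ε) :
    ∃ σ α, IsModulParam m ρ ε κ u σ α := by
  have key : ∀ (σ' : ℝ) (α' : Real.Angle), hdist u (harmonicMap m (Real.exp σ') α') ≤ ε →
      ∃ (σ : ℝ) (α : Real.Angle), Orthogonal m u (Real.exp σ) α ∧
      |σ - σ'| ≤ ρ / 2 ∧ ‖α - α'‖ ≤ ρ / 2 ∧
      |σ - σ'| ≤ κ * hdist u (harmonicMap m (Real.exp σ') α') ∧
      ‖α - α'‖ ≤ κ * hdist u (harmonicMap m (Real.exp σ') α') := by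
    intro σ' α' h
    rw [← α'.coe_toReal] at h
    obtain ⟨p, hp1, hp2, hz⟩ := hS.zero u hu σ' α'.toReal h
    refine ⟨σ' + p.1, ((α'.toReal + p.2 : ℝ) : Real.Angle), ?_, ?_⟩
    · rw [orthogonal_iff_modul hm hu]
      exact hz
    · have e : ((α'.toReal + p.2 : ℝ) : Real.Angle) - α' = (p.2 : Real.Angle) := by simp
      rw [e, add_sub_cancel_left]
      rw [α'.coe_toReal] at hp2
      have a1 : |p.1| ≤ ‖p‖ := norm_fst_le p
      have a2 : ‖(p.2 : Real.Angle)‖ ≤ ‖p‖ := (norm_angle_coe_le _).trans (norm_snd_le p)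
      exact ⟨a1.trans hp1, a2.trans hp1, a1.trans hp2, a2.trans hp2⟩
  obtain ⟨σ, α, ho, hn⟩ := key σ₀ α₀ h₀
  refine ⟨σ, α, ho, fun σ' α' h' => ?_⟩
  obtain ⟨σ'', α'', ho', hn'⟩ := key σ' α' h'
  obtain ⟨s1, s2⟩ := hS.separation u hu σ₀ σ' α₀ α' h₀ h'
  have hρ := hS.ρ_pos
  have t1 : |σ'' - σ₀| ≤ ρ := by
    have := abs_sub_le σ'' σ' σ₀
    linarith [hn'.1]
  have t2 : ‖α'' - α₀‖ ≤ ρ := by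
    have := norm_sub_le_norm_sub_add_norm_sub α'' α' α₀
    linarith [hn'.2.1]
  obtain ⟨e1, e2⟩ := hS.unique hm hu h₀ (by linarith [hn.1]) t1 (by linarith [hn.2.1]) t2 ho ho'
  rw [e1, e2]
  exact hn'

theorem IsModulParam.eq {ρ ε κ : ℝ} (hS : IsModulScale m ρ ε κ) (hm : 1 ≤ m)
    {u : Plane → Space} (hu : IsSigma m u) {σ : ℝ} {α : Real.Angle}
    (hp : IsModulParam m ρ ε κ u σ α) {σ' : ℝ} {α' : Real.Angle}
    (h' : hdist u (harmonicMap m (Real.exp σ') α') ≤ ε) {σ₁ : ℝ} {α₁ : Real.Angle}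
    (h1 : |σ₁ - σ'| ≤ ρ) (h2 : ‖α₁ - α'‖ ≤ ρ) (ho : Orthogonal m u (Real.exp σ₁) α₁) :
    σ₁ = σ ∧ α₁ = α := by
  have hρ := hS.ρ_pos
  obtain ⟨a, b, -⟩ := hp.near σ' α' h'
  exact hS.unique hm hu h' h1 (by linarith) h2 (by linarith) ho hp.orthogonal

end

end EquivariantMaps

/-! ### The constants δ₀ and C. -/

namespace EquivariantMaps

section

variable {m : ℕ}

/-- The constant comparing the distance to the closest harmonic map with the excess. -/
noncomputable def closestConst (m : ℕ) : ℝ := Real.sqrt (2 + 4 * Real.pi * m ^ 2 * gapConst m)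

theorem IsClosest.hdist_le (hm : 1 ≤ m) {u : Plane → Space} (hu : IsSigma m u)
    (hs : excess m u ≤ 1) {s : ℝ} {α : Real.Angle} (h : IsClosest m u s α) :
    hdist u (harmonicMap m (Real.exp (Real.log s)) α) ≤ closestConst m * excess m u := by
  have h0 : 0 ≤ excess m u := Real.sqrt_nonneg _
  have hg := gapConst_nonneg (m := m)
  refine (sq_le_sq₀ (hdist_nonneg _ _) (mul_nonneg
    (show 0 ≤ closestConst m from Real.sqrt_nonneg _) h0)).1 ?_
  have hsq : closestConst m ^ 2 = 2 + 4 * Real.pi * m ^ 2 * gapConst m :=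
    Real.sq_sqrt (by positivity)
  rw [hdist_sq_eq_gap hm hu, mul_pow, hsq]
  have := h.gap_le hm hu hs
  calc _ ≤ 2 * excess m u ^ 2 + 4 * Real.pi * m ^ 2 * (gapConst m * excess m u ^ 2) := by gcongr
    _ = _ := by ring

theorem abs_log_le {y r : ℝ} (h : |y - 1| ≤ r) (hr : r ≤ 1 / 4) : |Real.log y| ≤ 2 * r := by
  obtain ⟨h1, h2⟩ := abs_le.1 h
  have hy : 0 < y := by linarith
  rw [abs_le]
  constructor
  · have := Real.one_sub_inv_le_log_of_pos hy
    have h3 : y⁻¹ ≤ 1 + 2 * r := by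
      rw [inv_le_comm₀ hy (by linarith), inv_le_iff_one_le_mul₀ (by linarith)]
      nlinarith
    linarith
  · linarith [Real.log_le_sub_one_of_pos hy]

/-- The modulation parameters have all the required stationary properties. -/
theorem exists_modulation (hm : 1 ≤ m) {ρ ε κ : ℝ} (hS : IsModulScale m ρ ε κ) :
    ∃ δ₀ > 0, ∃ C > 0, ∀ u : Plane → Space, IsSigma m u → excess m u < δ₀ →
      (∃ s α, IsClosest m u s α) ∧
      (∃ (σ : ℝ) (α : Real.Angle), hdist u (harmonicMap m (Real.exp σ) α) ≤ ε / 2) ∧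
      ∀ (σ : ℝ) (α : Real.Angle), IsModulParam m ρ ε κ u σ α →
        ∀ sStar αStar, IsClosest m u sStar αStar →
          |Real.exp σ / sStar - 1| + ‖α - αStar‖ ≤ C * excess m u ∧
          ∀ (s' : ℝ) (α' : Real.Angle), 0 < s' → Orthogonal m u s' α' →
            |s' / sStar - 1| + ‖α' - αStar‖ ≤ C * δ₀ → s' = Real.exp σ ∧ α' = α := by
  have hm0 : (0 : ℝ) < m := by exact_mod_cast hm
  have hκ := hS.κ_pos
  have hε := hS.ε_pos
  have hρ := hS.ρ_pos
  set K := closestConst m + 1 with hK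
  have hK0 : 0 < K := by have := Real.sqrt_nonneg (2 + 4 * Real.pi * m ^ 2 * gapConst m); positivity
  have hg := gapConst_nonneg (m := m)
  -- The bound |e^x − 1| ≤ 2|x| contributes 2 for the ratio of the scales, and the angle contributes
  -- 1.
  set C := 3 * (κ * K) with hC
  have hC0 : 0 < C := by positivity
  -- In order: the coercivity estimate applies; closest harmonic maps are within ε/2; the
  -- neighbourhood of size Cδ₀ fits into the uniqueness ball; the overlap is positive, so closest
  -- parameters exist.
  set δ₀ := min (min 1 (ε / (2 * K))) (min (ρ / (4 * C)) (4 / (m * (gapConst m + 1)))) with hδ₀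
  have hδ0 : 0 < δ₀ := by
    refine lt_min (lt_min one_pos (by positivity)) (lt_min (by positivity) (by positivity))
  have d1 : δ₀ ≤ 1 := (min_le_left _ _).trans (min_le_left _ _)
  have d2 : K * δ₀ ≤ ε / 2 := by
    calc K * δ₀ ≤ K * (ε / (2 * K)) :=
          mul_le_mul_of_nonneg_left ((min_le_left _ _).trans (min_le_right _ _)) hK0.le
      _ = _ := by field_simp
  have d3 : C * δ₀ ≤ ρ / 4 := by
    calc C * δ₀ ≤ C * (ρ / (4 * C)) :=
          mul_le_mul_of_nonneg_left ((min_le_right _ _).trans (min_le_left _ _)) hC0.le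
      _ = _ := by field_simp
  have d4 : (gapConst m + 1) * δ₀ ≤ 4 / m := by
    calc (gapConst m + 1) * δ₀ ≤ (gapConst m + 1) * (4 / (m * (gapConst m + 1))) :=
          mul_le_mul_of_nonneg_left ((min_le_right _ _).trans (min_le_right _ _)) (by positivity)
      _ = _ := by field_simp
  refine ⟨δ₀, hδ0, C, hC0, fun u hu hex => ?_⟩
  have h0 : 0 ≤ excess m u := Real.sqrt_nonneg _
  have h1 : excess m u ≤ 1 := hex.le.trans d1
  have hcl : ∀ {s : ℝ} {α : Real.Angle}, IsClosest m u s α →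
      hdist u (harmonicMap m (Real.exp (Real.log s)) α) ≤ K * excess m u := fun h => by
    refine (h.hdist_le hm hu h1).trans (mul_le_mul_of_nonneg_right ?_ h0)
    linarith
  have hclε : ∀ {s : ℝ} {α : Real.Angle}, IsClosest m u s α →
      hdist u (harmonicMap m (Real.exp (Real.log s)) α) ≤ ε / 2 := fun h =>
    (hcl h).trans ((mul_le_mul_of_nonneg_left hex.le hK0.le).trans d2)
  have hsmall : gapConst m * excess m u ^ 2 < 4 / m := by
    rcases h0.eq_or_lt with h | h
    · rw [← h]; norm_num; exact hm
    · have e1 : excess m u ^ 2 ≤ excess m u := by nlinarith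
      have e2 := mul_le_mul_of_nonneg_left e1 hg
      have e3 := mul_lt_mul_of_pos_left hex (by positivity : 0 < gapConst m + 1)
      linarith
  obtain ⟨s, α, hc⟩ := exists_isClosest hm hu h1 hsmall
  refine ⟨⟨s, α, hc⟩, ⟨_, _, hclε hc⟩, fun σ α hp sStar αStar hc => ?_⟩
  have hs := hc.1
  have hd := hclε hc
  obtain ⟨n1, -, n3, n4⟩ := hp.near _ _ (hd.trans (by linarith))
  have hκd := mul_le_mul_of_nonneg_left (hcl hc) hκ.le
  constructor
  · have e : Real.exp σ / sStar = Real.exp (σ - Real.log sStar) := by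
      rw [Real.exp_sub, Real.exp_log hs]
    have := Real.abs_exp_sub_one_le (x := σ - Real.log sStar) (by linarith [hS.ρ_le])
    rw [e, hC]
    nlinarith
  · intro s' α' hs' ho hle
    have a1 : |s' / sStar - 1| ≤ ρ / 4 := by linarith [norm_nonneg (α' - αStar)]
    have a2 : ‖α' - αStar‖ ≤ ρ := by linarith [abs_nonneg (s' / sStar - 1)]
    -- Uniqueness holds in log s, so the bound ρ/4 on the ratio of the scales becomes ρ/2 there.
    have a3 := abs_log_le a1 (by linarith [hS.ρ_le])
    rw [Real.log_div hs'.ne' hs.ne'] at a3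
    rw [← Real.exp_log hs'] at ho
    obtain ⟨e1, e2⟩ := hp.eq hS hm hu (hd.trans (by linarith)) (by linarith) a2 ho
    exact ⟨by rw [← e1, Real.exp_log hs'], e2⟩

end

end EquivariantMaps

namespace EquivariantMaps

/-! ### Coefficients of the profile as pairings in the square-integrable functions on the plane -/

section

variable {m : ℕ}

/-- The equivariant vector field on the plane which represents the pairing of the `i`-th component
of the profile with `q`. -/
noncomputable def planeKernel (m : ℕ) (q : ℝ → ℝ) (i : Fin 3) (x : Plane) : Space :=
  ((‖x‖ ^ 2)⁻¹ * q (Real.log ‖x‖)) • rot (m • polarAngle x) (EuclideanSpace.single i 1)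

theorem measurable_rot_polarAngle (y : Space) :
    Measurable fun x : Plane => rot (m • polarAngle x) y := by
  have hz : Measurable fun x : Plane => (⟨x 0, x 1⟩ : ℂ) := by
    have h : (fun x : Plane => (⟨x 0, x 1⟩ : ℂ)) = fun x : Plane => (x 0 : ℂ) + x 1 * Complex.I := by
      funext x; apply Complex.ext <;> simp
    rw [h]
    fun_prop
  have ha : Measurable fun x : Plane => Complex.arg ⟨x 0, x 1⟩ := Complex.measurable_arg.comp hz
  have hc : Continuous fun c : ℝ => (!₂[Real.cos (m * c) * y 0 - Real.sin (m * c) * y 1,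
      Real.sin (m * c) * y 0 + Real.cos (m * c) * y 1, y 2] : Space) :=
    continuous_toLp_three (by fun_prop) (by fun_prop) continuous_const
  have e : (fun x : Plane => rot (m • polarAngle x) y) = (fun c : ℝ => (!₂[Real.cos (m * c) * y 0
      - Real.sin (m * c) * y 1, Real.sin (m * c) * y 0 + Real.cos (m * c) * y 1, y 2] : Space)) ∘
      fun x => Complex.arg ⟨x 0, x 1⟩ := by
    funext x
    simp only [Function.comp, rot, polarAngle, cos_nsmul, sin_nsmul]
  rw [e]
  exact hc.measurable.comp ha

theorem planeKernel_polarPt (q : ℝ → ℝ) (i : Fin 3) {p : ℝ × ℝ}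
    (hp : p.2 ∈ Ioo (-Real.pi) Real.pi) : planeKernel m q i (polarPt p)
      = ((Real.exp (2 * p.1))⁻¹ * q p.1) • rot (m • (p.2 : Real.Angle)) (EuclideanSpace.single i 1) := by
  rw [planeKernel, polarAngle_polarPt hp, norm_polarPt, Real.log_exp, ← Real.exp_nat_mul]
  norm_cast

theorem aestronglyMeasurable_planeKernel {q : ℝ → ℝ} (hq : Continuous q) (i : Fin 3) :
    AEStronglyMeasurable (planeKernel m q i) volume := by
  have h : Measurable fun x : Plane => (‖x‖ ^ 2)⁻¹ * q (Real.log ‖x‖) :=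
    (measurable_norm.pow_const 2).inv.mul (hq.measurable.comp (Real.measurable_log.comp measurable_norm))
  exact (h.smul (measurable_rot_polarAngle _)).aestronglyMeasurable

theorem norm_sq_planeKernel_ae (q : ℝ → ℝ) (i : Fin 3) :
    (fun p : ℝ × ℝ => Real.exp (2 * p.1) • ‖planeKernel m q i (polarPt p)‖ ^ 2)
      =ᵐ[stripMeasure] fun p => Real.exp (-(2 * p.1)) * q p.1 ^ 2 := by
  filter_upwards [ae_strip_mem] with p hp
  rw [planeKernel_polarPt q i hp, norm_smul, rot_norm, PiLp.norm_single, norm_one, mul_one,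
    Real.norm_eq_abs, sq_abs, smul_eq_mul, Real.exp_neg]
  have := Real.exp_pos (2 * p.1)
  field_simp

/-- For m ≥ 1 the function h₁ is at most 2e^τ, so h₁² absorbs the weight e^{−2τ} near r = 0. This is
what makes the kernels square integrable on the plane. -/
theorem exp_mul_lh₁_pow_le (hm : 1 ≤ m) (τ : ℝ) :
    Real.exp (-(2 * τ)) * lh₁ m τ ^ 6 ≤ 4 * lh₁ m τ ^ 4 := by
  have hm1 : (1 : ℝ) ≤ m := by exact_mod_cast hm
  have h := lh₁_le m τ
  have h2 : lh₁ m τ ≤ 2 * Real.exp τ := h.trans <| by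
    refine mul_le_mul_of_nonneg_left (Real.exp_le_exp.2 ?_) two_pos.le
    nlinarith [neg_abs_le τ, abs_nonneg τ]
  have h3 : lh₁ m τ ^ 2 ≤ 4 * Real.exp (2 * τ) := by
    have := pow_le_pow_left₀ (lh₁_pos m τ).le h2 2
    rw [mul_pow, ← Real.exp_nat_mul] at this
    norm_num at this
    exact this
  have h4 : Real.exp (-(2 * τ)) * Real.exp (2 * τ) = 1 := by rw [← Real.exp_add]; simp
  have h5 : Real.exp (-(2 * τ)) * lh₁ m τ ^ 2 ≤ 4 := by
    nlinarith [Real.exp_pos (-(2 * τ))]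
  nlinarith [pow_pos (lh₁_pos m τ) 4]

/-- Translating by σ rescales the weight: a kernel concentrated at scale e^σ has norm proportional
to e^{−σ}. This factor is the origin of the different regularity of scale and angle. -/
theorem integrable_weighted_sq (hm : 1 ≤ m) {q : ℝ → ℝ} (hq : Continuous q) {c σ : ℝ}
    (h : ∀ τ, |q τ| ≤ c * lh₁ m (τ - σ) ^ 3) :
    Integrable (fun τ => Real.exp (-(2 * τ)) * q τ ^ 2) ∧
      ∫ τ, Real.exp (-(2 * τ)) * q τ ^ 2 ≤ 8 * (c * Real.exp (-σ)) ^ 2 := by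
  have hb : ∀ τ, Real.exp (-(2 * τ)) * q τ ^ 2
      ≤ 4 * (c * Real.exp (-σ)) ^ 2 * lh₁ m (τ - σ) ^ 4 := by
    intro τ
    have h1 : q τ ^ 2 ≤ c ^ 2 * lh₁ m (τ - σ) ^ 6 := by
      rw [← sq_abs]
      refine (pow_le_pow_left₀ (abs_nonneg _) (h τ) 2).trans (le_of_eq (by ring))
    have h2 := exp_mul_lh₁_pow_le hm (τ - σ)
    have h3 : Real.exp (-(2 * τ)) = Real.exp (-σ) ^ 2 * Real.exp (-(2 * (τ - σ))) := by
      rw [← Real.exp_nat_mul, ← Real.exp_add]; congr 1; push_cast; ring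
    rw [h3]
    calc _ ≤ Real.exp (-σ) ^ 2 * Real.exp (-(2 * (τ - σ))) * (c ^ 2 * lh₁ m (τ - σ) ^ 6) :=
          mul_le_mul_of_nonneg_left h1 (by positivity)
      _ = (c * Real.exp (-σ)) ^ 2 * (Real.exp (-(2 * (τ - σ))) * lh₁ m (τ - σ) ^ 6) := by ring
      _ ≤ (c * Real.exp (-σ)) ^ 2 * (4 * lh₁ m (τ - σ) ^ 4) :=
          mul_le_mul_of_nonneg_left h2 (sq_nonneg _)
      _ = _ := by ring
  have hi : Integrable fun τ => 4 * (c * Real.exp (-σ)) ^ 2 * lh₁ m (τ - σ) ^ 4 :=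
    ((integrable_lh₁_four hm).comp_sub_right σ).const_mul _
  have hint : Integrable (fun τ => Real.exp (-(2 * τ)) * q τ ^ 2) :=
    hi.mono' (by fun_prop) (Eventually.of_forall fun τ => by
      rw [Real.norm_of_nonneg (by positivity)]; exact hb τ)
  refine ⟨hint, (integral_mono hint hi hb).trans ?_⟩
  rw [integral_const_mul, integral_sub_right_eq_self (fun τ => lh₁ m τ ^ 4) σ]
  have := quartic_le_two hm
  change _ * quartic m ≤ _
  nlinarith [sq_nonneg (c * Real.exp (-σ))]

theorem memLp_planeKernel (hm : 1 ≤ m) {q : ℝ → ℝ} (hq : Continuous q) {c σ : ℝ}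
    (h : ∀ τ, |q τ| ≤ c * lh₁ m (τ - σ) ^ 3) (i : Fin 3) : MemLp (planeKernel m q i) 2 volume := by
  have hmeas := aestronglyMeasurable_planeKernel (m := m) hq i
  refine (memLp_two_iff_integrable_sq_norm hmeas).2 ?_
  have hn : AEStronglyMeasurable (fun x => ‖planeKernel m q i x‖ ^ 2) volume := hmeas.norm.pow 2
  rw [integrable_plane_iff hn]
  exact (integrable_strip_of_fst (integrable_weighted_sq hm hq h).1).congr
    (norm_sq_planeKernel_ae q i).symm

theorem norm_toLp_planeKernel_le (hm : 1 ≤ m) {q : ℝ → ℝ} (hq : Continuous q) {c σ : ℝ}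
    (h : ∀ τ, |q τ| ≤ c * lh₁ m (τ - σ) ^ 3) (hc : 0 ≤ c) (i : Fin 3)
    (hL : MemLp (planeKernel m q i) 2 volume) : ‖hL.toLp‖ ≤ 8 * (c * Real.exp (-σ)) := by
  refine abs_le_of_sq_le_sq' ?_ (by positivity) |>.2
  have hn : AEStronglyMeasurable (fun x => ‖planeKernel m q i x‖ ^ 2) volume := hL.1.norm.pow 2
  have e : ‖hL.toLp‖ ^ 2 = ∫ x, ‖planeKernel m q i x‖ ^ 2 := by
    rw [← real_inner_self_eq_norm_sq, L2.inner_def]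
    refine integral_congr_ae ?_
    filter_upwards [hL.coeFn_toLp] with x hx
    rw [hx, real_inner_self_eq_norm_sq]
  have hw := integrable_weighted_sq hm hq h
  rw [e, integral_plane hn, integral_congr_ae (norm_sq_planeKernel_ae q i),
    integral_strip_fst (f := fun τ => Real.exp (-(2 * τ)) * q τ ^ 2) (integrable_strip_of_fst hw.1)]
  -- The squared norm is at most 2π · 8 times the square of c·e^{−σ}, and 16π ≤ 64.
  nlinarith [Real.pi_le_four, Real.pi_pos, sq_nonneg (c * Real.exp (-σ))]

theorem rot_single_inner (α : Real.Angle) (i : Fin 3) (y : Space) :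
    inner ℝ (rot α (EuclideanSpace.single i 1)) (rot α y) = y i := by
  rw [rot_inner, EuclideanSpace.inner_single_left]; simp

/-- The factor r^{−2} in the kernel cancels the area weight, and the rotation by mθ is common to
kernel and map, so the plane integral is 2π times an integral over the line. -/
theorem inner_planeKernel {q : ℝ → ℝ} {i : Fin 3}
    (hL : MemLp (planeKernel m q i) 2 volume) {u w : Plane → Space} (hu : IsSigma m u)
    (hw : IsSigma m w) {f : Lp Space 2 (volume : Measure Plane)}
    (hf : (fun x => u x - w x) =ᵐ[volume] f) :
    inner ℝ hL.toLp f = 2 * Real.pi * ∫ τ, q τ * (logProfile u τ i - logProfile w τ i) := by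
  have hi := integrable_inner_of_memLp hL (Lp.memLp f)
  have e : inner ℝ hL.toLp f = ∫ x, inner ℝ (planeKernel m q i x) (f x) := by
    rw [L2.inner_def]
    refine integral_congr_ae ?_
    filter_upwards [hL.coeFn_toLp] with x hx
    rw [hx]
  have ae : (fun p : ℝ × ℝ => Real.exp (2 * p.1) •
      inner ℝ (planeKernel m q i (polarPt p)) (f (polarPt p)))
      =ᵐ[stripMeasure] fun p => q p.1 * (logProfile u p.1 i - logProfile w p.1 i) := by
    filter_upwards [ae_strip_mem, ae_comp_polarPt hf] with p hp hfp
    rw [← hfp, planeKernel_polarPt q i hp, apply_polarPt hu.equivariant hp,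
      apply_polarPt hw.equivariant hp, ← rot_sub, real_inner_smul_left, rot_single_inner, smul_eq_mul]
    have := Real.exp_pos (2 * p.1)
    simp only [PiLp.sub_apply]
    field_simp
  rw [e, integral_plane hi.1, integral_congr_ae ae]
  exact integral_strip_fst (f := fun τ => q τ * (logProfile u τ i - logProfile w τ i))
    (((integrable_plane_iff hi.1).1 hi).congr ae)

theorem IsDecaying.memLp (hm : 1 ≤ m) {k : ℝ → ℝ} (hk : IsDecaying m k) (i : Fin 3) (σ : ℝ) :
    MemLp (planeKernel m (fun τ => k (τ - σ)) i) 2 volume :=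
  memLp_planeKernel hm (hk.cont.comp (continuous_id.sub continuous_const))
    (fun τ => hk.le (τ - σ)) i

/-- The square-integrable vector field which represents the correlation with a kernel. -/
noncomputable def kernelLp (hm : 1 ≤ m) {k : ℝ → ℝ} (hk : IsDecaying m k) (i : Fin 3) (σ : ℝ) :
    Lp Space 2 (volume : Measure Plane) := (hk.memLp hm i σ).toLp

theorem norm_kernelLp_le (hm : 1 ≤ m) {k : ℝ → ℝ} (hk : IsDecaying m k) (i : Fin 3) (σ : ℝ) :
    ‖kernelLp hm hk i σ‖ ≤ 32 * m * Real.exp (-σ) :=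
  (norm_toLp_planeKernel_le hm (hk.cont.comp (continuous_id.sub continuous_const))
    (fun τ => hk.le (τ - σ)) (by positivity) i _).trans (le_of_eq (by ring))

theorem norm_kernelLp_sub_le (hm : 1 ≤ m) {k k' : ℝ → ℝ} (hk : IsKernel m k k') (i : Fin 3)
    (σ₀ : ℝ) {σ σ' : ℝ} (hσ : |σ - σ₀| ≤ 1) (hσ' : |σ' - σ₀| ≤ 1) :
    ‖kernelLp hm hk.decay i σ - kernelLp hm hk.decay i σ'‖
      ≤ 8 * (kernelConst m * Real.exp (-σ₀)) * |σ - σ'| := by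
  have hc : ∀ s, Continuous fun τ => k (τ - s) := fun s =>
    hk.decay.cont.comp (continuous_id.sub continuous_const)
  have hb : ∀ τ, |k (τ - σ) - k (τ - σ')|
      ≤ (kernelConst m * |σ - σ'|) * lh₁ m (τ - σ₀) ^ 3 := by
    intro τ
    have h := hk.abs_sub_sub_le hσ hσ' (τ - σ₀)
    rw [sub_sub_sub_cancel_right, sub_sub, sub_sub] at h
    simp only [add_sub_cancel] at h
    exact h.trans (le_of_eq (by ring))
  have hs : planeKernel m (fun τ => k (τ - σ) - k (τ - σ')) i
      = planeKernel m (fun τ => k (τ - σ)) i - planeKernel m (fun τ => k (τ - σ')) i := by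
    funext x
    simp only [planeKernel, Pi.sub_apply, mul_sub, sub_smul]
  have hL := memLp_planeKernel hm ((hc σ).sub (hc σ')) hb i
  have h := norm_toLp_planeKernel_le hm ((hc σ).sub (hc σ')) hb
    (mul_nonneg kernelConst_nonneg (abs_nonneg _)) i hL
  have e : hL.toLp = kernelLp hm hk.decay i σ - kernelLp hm hk.decay i σ' := by
    rw [kernelLp, kernelLp, ← MemLp.toLp_sub]
    exact MemLp.toLp_congr _ _ (Eventually.of_forall fun x => congrFun hs x)
  rw [e] at h
  exact h.trans (le_of_eq (by ring))

theorem corr_sub_eq_inner (hm : 1 ≤ m) {k : ℝ → ℝ} (hk : IsDecaying m k) (i : Fin 3)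
    {u w : Plane → Space} (hu : IsSigma m u) (hw : IsSigma m w)
    {f : Lp Space 2 (volume : Measure Plane)} (hf : (fun x => u x - w x) =ᵐ[volume] f) (σ : ℝ) :
    corr k (fun τ => logProfile u τ i) σ - corr k (fun τ => logProfile w τ i) σ
      = (2 * Real.pi)⁻¹ * inner ℝ (kernelLp hm hk i σ) f := by
  rw [kernelLp, inner_planeKernel _ hu hw hf, inv_mul_cancel_left₀ (by positivity), corr, corr,
    ← integral_sub (hk.integrable hm ((isBddCurve_logProfile hu).coord i) σ)
      (hk.integrable hm ((isBddCurve_logProfile hw).coord i) σ)]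
  simp only [mul_sub]

theorem abs_corr_sub_corr_le (hm : 1 ≤ m) {k : ℝ → ℝ} (hk : IsDecaying m k) (i : Fin 3)
    {u w : Plane → Space} (hu : IsSigma m u) (hw : IsSigma m w)
    {f : Lp Space 2 (volume : Measure Plane)} (hf : (fun x => u x - w x) =ᵐ[volume] f) (σ : ℝ) :
    |corr k (fun τ => logProfile u τ i) σ - corr k (fun τ => logProfile w τ i) σ|
      ≤ 32 * m * Real.exp (-σ) * ‖f‖ := by
  rw [corr_sub_eq_inner hm hk i hu hw hf, abs_mul, abs_of_pos (by positivity)]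
  have h1 : |inner ℝ (kernelLp hm hk i σ) f| ≤ 32 * m * Real.exp (-σ) * ‖f‖ :=
    (abs_real_inner_le_norm _ _).trans
      (mul_le_mul_of_nonneg_right (norm_kernelLp_le hm hk i σ) (norm_nonneg _))
  have h2 : (2 * Real.pi)⁻¹ ≤ 1 := inv_le_one_of_one_le₀ (by linarith [Real.pi_gt_three])
  exact (mul_le_mul h2 h1 (abs_nonneg _) one_pos.le).trans (by simp)

/-- The modulation maps of two maps differ by at most the distance of the maps in `L²`. -/
theorem norm_modul_sub_modul_le (hm : 1 ≤ m) {u w : Plane → Space} (hu : IsSigma m u)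
    (hw : IsSigma m w) {f : Lp Space 2 (volume : Measure Plane)}
    (hf : (fun x => u x - w x) =ᵐ[volume] f) (p : ℝ × ℝ) :
    ‖modul m (logProfile u) p - modul m (logProfile w) p‖
      ≤ 96 * m / quartic m * Real.exp (-p.1) * ‖f‖ := by
  have hm1 : (1 : ℝ) ≤ m := by exact_mod_cast hm
  have hq := quartic_pos hm
  set d := 32 * m * Real.exp (-p.1) * ‖f‖ with hd
  have hd0 : 0 ≤ d := by positivity
  have a1 := abs_corr_sub_corr_le hm (isKernel_pow_four hm).decay 2 hu hw hf p.1
  have a2 := abs_corr_sub_corr_le hm (isKernel_pow_three_mul hm).decay 0 hu hw hf p.1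
  have a3 := abs_corr_sub_corr_le hm (isKernel_pow_three_mul hm).decay 1 hu hw hf p.1
  have b1 := abs_corr_sub_corr_le hm (isKernel_pow_three hm).decay 0 hu hw hf p.1
  have b2 := abs_corr_sub_corr_le hm (isKernel_pow_three hm).decay 1 hu hw hf p.1
  have mk : ∀ {c x : ℝ}, |c| ≤ 1 → |x| ≤ d → |c * x| ≤ d := fun hc hx => by
    rw [abs_mul]
    exact (mul_le_mul hc hx (abs_nonneg _) one_pos.le).trans (one_mul d).le
  have hcos := Real.abs_cos_le_one p.2
  have hsin := Real.abs_sin_le_one p.2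
  have A2 := mk hcos a2
  have A3 := mk hsin a3
  have B1 := mk hsin b1
  have B2 := mk hcos b2
  have e : 96 * m / quartic m * Real.exp (-p.1) * ‖f‖ = 3 * d / quartic m := by rw [hd]; ring
  rw [e]
  rw [← hd] at a1
  rw [abs_le] at a1 A2 A3 B1 B2
  refine max_le ?_ ?_
  · simp only [modul, Prod.fst_sub]
    rw [← sub_div, Real.norm_eq_abs, abs_div, abs_of_pos (by positivity : 0 < m * quartic m)]
    refine (div_le_div_of_nonneg_left (abs_nonneg _) hq ?_).trans
      (div_le_div_of_nonneg_right ?_ hq.le)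
    · nlinarith
    · rw [abs_le]; constructor <;> linarith
  · simp only [modul, Prod.snd_sub]
    rw [← sub_div, Real.norm_eq_abs, abs_div, abs_of_pos hq]
    refine div_le_div_of_nonneg_right ?_ hq.le
    rw [abs_le]; constructor <;> linarith

end

end EquivariantMaps

namespace EquivariantMaps

/-! ### Convergence of the profiles -/

section

variable {m : ℕ}

theorem logProfile_sub (u w : Plane → Space) (τ : ℝ) :
    logProfile (u - w) τ = logProfile u τ - logProfile w τ := rfl

theorem isEquivariantHdot_sub {u w : Plane → Space} (hu : IsSigma m u) (hw : IsSigma m w) :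
    IsEquivariantHdot m (u - w) := by
  refine ⟨?_, hu.continuous.sub hw.continuous, hu.memHdot.sub hu.continuous hw.continuous hw.memHdot⟩
  funext x
  have h1 := congrFun hu.equivariant x
  have h2 := congrFun hw.equivariant x
  simp only [equivariantMap] at h1 h2 ⊢
  rw [Pi.sub_apply, h1, h2, ← rot_sub]
  rfl

/-- The profiles of two maps at a small distance: the difference of the profiles has a derivative
of small norm. -/
theorem exists_logDeriv_sub {u w : Plane → Space} (hu : IsSigma m u) (hw : IsSigma m w) :
    ∃ g : ℝ → Space, (∀ i, IsPrimitive (fun τ => logProfile (u - w) τ i) (fun τ => g τ i)) ∧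
      Integrable (fun τ => ‖g τ‖ ^ 2) ∧
      Integrable (fun τ => ‖g τ‖ ^ 2 + ‖(m : ℝ) • rotGen (logProfile (u - w) τ)‖ ^ 2) ∧
      ∫ τ, (‖g τ‖ ^ 2 + ‖(m : ℝ) • rotGen (logProfile (u - w) τ)‖ ^ 2) ≤ hdist u w ^ 2 := by
  have hE := isEquivariantHdot_sub hu hw
  have hG := isWeakGradient_weakGrad hE.memHdot
  obtain ⟨g, hg⟩ := exists_isLogDeriv hE hG
  refine ⟨g, hg.primitive, hg.integrable_sq, hg.integrable_sq.add hg.integrable_rotGen, ?_⟩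
  have h := hg.le
  rw [← hG.dirichlet_eq hE.continuous, ← hdist_sq] at h
  have h0 : 0 ≤ ∫ τ, (‖g τ‖ ^ 2 + ‖(m : ℝ) • rotGen (logProfile (u - w) τ)‖ ^ 2) :=
    integral_nonneg fun τ => by positivity
  nlinarith [Real.pi_gt_three]

theorem tendsto_logProfile_sub_atBot {u w : Plane → Space} (hu : IsSigma m u) (hw : IsSigma m w)
    (i : Fin 3) : Tendsto (fun τ => logProfile (u - w) τ i) atBot (𝓝 0) := by
  have h := (tendsto_logProfile_atBot hu).sub (tendsto_logProfile_atBot hw)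
  rw [sub_self] at h
  exact ((EuclideanSpace.proj i : Space →L[ℝ] ℝ).continuous.tendsto 0).comp h

/-- With W the difference of the profiles, (Wᵢ²)' ≤ |W'|² + Wᵢ², and the right side is at most the
energy density of W since m ≥ 1. Integrate from −∞, where W vanishes. -/
theorem abs_logProfile_sub_horizontal_le (hm : 1 ≤ m) {u w : Plane → Space} (hu : IsSigma m u)
    (hw : IsSigma m w) {i : Fin 3} (hi : i ≠ 2) (τ : ℝ) :
    |logProfile (u - w) τ i| ≤ hdist u w := by
  have hm1 : (1 : ℝ) ≤ m := by exact_mod_cast hm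
  obtain ⟨g, hp, -, hint, hle⟩ := exists_logDeriv_sub hu hw
  set W := logProfile (u - w) with hW
  refine abs_le_of_sq_le_sq ?_ (hdist_nonneg _ _)
  have key : ∀ a ≤ τ, W τ i ^ 2 - W a i ^ 2 ≤ hdist u w ^ 2 := by
    intro a ha
    have h := ((hp i).mul (hp i)).sub_le ha hint (Eventually.of_forall fun x _ => ?_)
    · have h2 := integral_interval_le_integral (fun τ => by positivity) hint ha
      have e : ∀ x, W x i ^ 2 = W x i * W x i := fun x => sq _
      rw [e, e]
      exact h.trans (h2.trans hle)
    · have h1 := coord_sq_le (g x) i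
      have h2 : W x i ^ 2 ≤ ‖(m : ℝ) • rotGen (W x)‖ ^ 2 := by
        rw [norm_sq_rotGen]
        have : W x i ^ 2 ≤ W x 0 ^ 2 + W x 1 ^ 2 := by
          fin_cases i
          · exact le_add_of_nonneg_right (sq_nonneg _)
          · exact le_add_of_nonneg_left (sq_nonneg _)
          · exact absurd rfl hi
        exact this.trans (le_mul_of_one_le_left (by positivity) (one_le_pow₀ hm1))
      nlinarith [sq_nonneg (g x i - W x i)]
  have h0 := ((tendsto_logProfile_sub_atBot hu hw i).pow 2).const_sub (W τ i ^ 2)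
  have := le_of_tendsto h0 (eventually_atBot.2 ⟨τ, key⟩)
  simpa using this

/-- The height carries no angular energy, so only its oscillation is controlled: |W'| ≤ d + |W'|²/d
is integrated over the interval. -/
theorem abs_logProfile_sub_sub_le {u w : Plane → Space} (hu : IsSigma m u) (hw : IsSigma m w)
    {d : ℝ} (hd : 0 < d) (h : hdist u w ≤ d) (i : Fin 3) (τ T : ℝ) :
    |logProfile (u - w) τ i - logProfile (u - w) T i| ≤ (|τ - T| + 1) * d := by
  obtain ⟨g, hp, hg, hint, hle⟩ := exists_logDeriv_sub hu hw
  set W := logProfile (u - w) with hW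
  have hgd : ∫ τ, ‖g τ‖ ^ 2 ≤ d ^ 2 :=
    (integral_mono hg hint fun τ => le_add_of_nonneg_right (sq_nonneg _)).trans
      (hle.trans (pow_le_pow_left₀ (hdist_nonneg _ _) h 2))
  have key : ∀ a b, a ≤ b → |W b i - W a i| ≤ (b - a + 1) * d := by
    intro a b hab
    rw [(hp i).sub_eq a b, ← Real.norm_eq_abs]
    have hb : IntervalIntegrable (fun τ => d + d⁻¹ * ‖g τ‖ ^ 2) volume a b :=
      intervalIntegrable_const.add (hg.const_mul _).intervalIntegrable
    refine (intervalIntegral.norm_integral_le_of_norm_le hab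
      (Eventually.of_forall fun x _ => ?_) hb).trans ?_
    · rw [Real.norm_eq_abs]
      have h1 := abs_le_of_sq_le_sq (coord_sq_le (g x) i) (norm_nonneg _)
      have h2 : d + d⁻¹ * ‖g x‖ ^ 2 - ‖g x‖ = d⁻¹ * ((‖g x‖ - d / 2) ^ 2 + 3 / 4 * d ^ 2) := by
        field_simp; ring
      have h3 : 0 ≤ d⁻¹ * ((‖g x‖ - d / 2) ^ 2 + 3 / 4 * d ^ 2) := by positivity
      linarith
    · rw [intervalIntegral.integral_add intervalIntegrable_const
        (hg.const_mul _).intervalIntegrable, intervalIntegral.integral_const,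
        intervalIntegral.integral_const_mul, smul_eq_mul]
      have h1 := (integral_interval_le_integral (fun τ => by positivity) hg hab).trans hgd
      have h2 : d⁻¹ * (∫ τ in a..b, ‖g τ‖ ^ 2) ≤ d⁻¹ * d ^ 2 :=
        mul_le_mul_of_nonneg_left h1 (by positivity)
      have h3 : d⁻¹ * d ^ 2 = d := by field_simp
      linarith
  rcases le_total T τ with hT | hT
  · rw [abs_of_nonneg (sub_nonneg.2 hT)]
    exact key T τ hT
  · rw [abs_sub_comm, abs_sub_comm τ, abs_of_nonneg (sub_nonneg.2 hT)]
    exact key τ T hT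

/-- Small horizontal components keep the height away from zero on [T, ∞), and it tends to 1; the
intermediate value theorem fixes its sign. -/
theorem logProfile_two_pos {u : Plane → Space} (hu : IsSigma m u) {T : ℝ}
    (h : ∀ τ ≥ T, |logProfile u τ 0| ≤ 1 / 2 ∧ |logProfile u τ 1| ≤ 1 / 2) :
    0 < logProfile u T 2 := by
  have hne : ∀ τ ≥ T, logProfile u τ 2 ≠ 0 := by
    intro τ hτ h0
    have hs := sum_sq_logProfile hu τ
    obtain ⟨a, b⟩ := h τ hτ
    rw [h0] at hs
    have := pow_le_pow_left₀ (abs_nonneg _) a 2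
    have := pow_le_pow_left₀ (abs_nonneg _) b 2
    rw [sq_abs] at *
    linarith
  have hc : Continuous fun τ => logProfile u τ 2 :=
    ((isBddCurve_logProfile hu).coord 2).cont
  have ht : Tendsto (fun τ => logProfile u τ 2) atTop (𝓝 1) :=
    ((EuclideanSpace.proj 2 : Space →L[ℝ] ℝ).continuous.tendsto kVec).comp
      (tendsto_logProfile_atTop hu)
  obtain ⟨τ, hτ, h1⟩ := ((ht.eventually_const_lt (u := 0) one_pos).and
    (eventually_ge_atTop T)).exists
  by_contra hneg
  obtain ⟨x, hx, hx0⟩ := intermediate_value_Icc h1 hc.continuousOn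
    (show (0 : ℝ) ∈ Icc (logProfile u T 2) (logProfile u τ 2) from ⟨not_lt.1 hneg, hτ.le⟩)
  exact hne x hx.1 hx0

/-- The horizontal components are uniformly close. The height is compared at one point T near the
north pole, where the sphere constraint determines it once its sign is known, and then propagated by
the oscillation bound. The constant 11 is 1 + 1 + (8 + 1). -/
theorem exists_norm_logProfile_sub_le (hm : 1 ≤ m) {w : Plane → Space} (hw : IsSigma m w) :
    ∃ T : ℝ, ∀ u : Plane → Space, IsSigma m u → ∀ d : ℝ, 0 < d → d ≤ 1 / 4 → hdist u w ≤ d →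
      ∀ τ, ‖logProfile u τ - logProfile w τ‖ ≤ (11 + |τ - T|) * d := by
  have hco : ∀ i : Fin 3, Tendsto (fun τ => logProfile w τ i) atTop (𝓝 (kVec i)) := fun i =>
    ((EuclideanSpace.proj i : Space →L[ℝ] ℝ).continuous.tendsto kVec).comp
      (tendsto_logProfile_atTop hw)
  have e0 : ∀ᶠ τ in atTop, |logProfile w τ 0| < 1 / 4 :=
    ((hco 0).abs).eventually_lt_const (by norm_num [kVec])
  have e1 : ∀ᶠ τ in atTop, |logProfile w τ 1| < 1 / 4 :=
    ((hco 1).abs).eventually_lt_const (by norm_num [kVec])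
  have e2 : ∀ᶠ τ in atTop, 1 / 2 < logProfile w τ 2 :=
    (hco 2).eventually_const_lt (by simp [kVec]; norm_num)
  obtain ⟨T, hT⟩ := eventually_atTop.1 (e0.and (e1.and e2))
  refine ⟨T, fun u hu d hd hd4 h τ => ?_⟩
  have hh : ∀ τ (i : Fin 3), i ≠ 2 → |logProfile u τ i - logProfile w τ i| ≤ d := fun τ i hi =>
    (abs_logProfile_sub_horizontal_le hm hu hw hi τ).trans h
  have hpos : 0 < logProfile u T 2 := by
    refine logProfile_two_pos hu fun s hs => ?_
    obtain ⟨a, b, -⟩ := hT s hs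
    have a' := hh s 0 (by decide)
    have b' := hh s 1 (by decide)
    rw [abs_le] at a' b' ⊢
    rw [abs_le]
    rw [abs_lt] at a b
    exact ⟨⟨by linarith, by linarith⟩, ⟨by linarith, by linarith⟩⟩
  -- The difference of the squared heights is at most 4d, and the sum of the heights exceeds 1/2.
  have hT2 : |logProfile u T 2 - logProfile w T 2| ≤ 8 * d := by
    have s1 := sum_sq_logProfile hu T
    have s2 := sum_sq_logProfile hw T
    obtain ⟨-, -, c⟩ := hT T le_rfl
    have q : ∀ i : Fin 3, i ≠ 2 → |logProfile w T i ^ 2 - logProfile u T i ^ 2| ≤ 2 * d := by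
      intro i hi
      have h1 := (PiLp.norm_apply_le (logProfile u T) i).trans (norm_logProfile hu T).le
      have h2 := (PiLp.norm_apply_le (logProfile w T) i).trans (norm_logProfile hw T).le
      rw [Real.norm_eq_abs] at h1 h2
      have e : logProfile w T i ^ 2 - logProfile u T i ^ 2
        = (logProfile w T i + logProfile u T i) * (logProfile w T i - logProfile u T i) := by ring
      rw [e, abs_mul]
      refine mul_le_mul ((abs_add_le _ _).trans (by linarith)) ?_ (abs_nonneg _) two_pos.le
      rw [abs_sub_comm]
      exact hh T i hi
    have q0 := abs_le.1 (q 0 (by decide))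
    have q1 := abs_le.1 (q 1 (by decide))
    have e : (logProfile u T 2 - logProfile w T 2) * (logProfile u T 2 + logProfile w T 2)
        = (logProfile w T 0 ^ 2 - logProfile u T 0 ^ 2)
          + (logProfile w T 1 ^ 2 - logProfile u T 1 ^ 2) := by
      linear_combination s1 - s2
    have h3 : |logProfile u T 2 - logProfile w T 2| * (logProfile u T 2 + logProfile w T 2)
        ≤ 4 * d := by
      rw [← abs_of_pos (by linarith : 0 < logProfile u T 2 + logProfile w T 2), ← abs_mul,
        e, abs_le]
      constructor <;> linarith
    nlinarith [abs_nonneg (logProfile u T 2 - logProfile w T 2)]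
  have h2 : |logProfile u τ 2 - logProfile w τ 2| ≤ (9 + |τ - T|) * d := by
    have h4 := abs_logProfile_sub_sub_le hu hw hd h 2 τ T
    simp only [logProfile_sub, PiLp.sub_apply] at h4
    have := abs_le.1 h4
    have := abs_le.1 hT2
    rw [abs_le]; constructor <;> linarith
  set X := logProfile u τ - logProfile w τ with hX
  have hn : ‖X‖ ≤ |X 0| + |X 1| + |X 2| := by
    refine abs_le_of_sq_le_sq' ?_ (by positivity) |>.2
    rw [norm_sq_space]
    have := abs_nonneg (X 0)
    have := abs_nonneg (X 1)
    have := abs_nonneg (X 2)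
    rw [← sq_abs (X 0), ← sq_abs (X 1), ← sq_abs (X 2)]
    nlinarith [mul_nonneg (abs_nonneg (X 0)) (abs_nonneg (X 1)),
      mul_nonneg (abs_nonneg (X 0)) (abs_nonneg (X 2)),
      mul_nonneg (abs_nonneg (X 1)) (abs_nonneg (X 2))]
  have a0 := hh τ 0 (by decide)
  have a1 := hh τ 1 (by decide)
  have b0 : |X 0| ≤ d := a0
  have b1 : |X 1| ≤ d := a1
  have b2 : |X 2| ≤ (9 + |τ - T|) * d := h2
  linarith

theorem tendsto_logProfile_of_hdist (hm : 1 ≤ m) {X : Type*} {l : Filter X} {u : X → Plane → Space}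
    {w : Plane → Space} (hw : IsSigma m w) (hu : ∀ᶠ t in l, IsSigma m (u t))
    (h : Tendsto (fun t => hdist (u t) w) l (𝓝 0)) (τ : ℝ) :
    Tendsto (fun t => logProfile (u t) τ) l (𝓝 (logProfile w τ)) := by
  obtain ⟨T, hT⟩ := exists_norm_logProfile_sub_le hm hw
  rw [Metric.tendsto_nhds]
  intro e he
  have hA : 0 < 11 + |τ - T| := by positivity
  set d := min (1 / 4) (e / (2 * (11 + |τ - T|))) with hd
  have hd0 : 0 < d := lt_min (by norm_num) (by positivity)
  filter_upwards [hu, h.eventually_le_const hd0] with t h1 h2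
  rw [dist_eq_norm]
  refine (hT (u t) h1 d hd0 (min_le_left _ _) h2 τ).trans_lt ?_
  calc (11 + |τ - T|) * d ≤ (11 + |τ - T|) * (e / (2 * (11 + |τ - T|))) :=
        mul_le_mul_of_nonneg_left (min_le_right _ _) hA.le
    _ = e / 2 := by field_simp
    _ < e := by linarith

theorem tendsto_corr_of_hdist (hm : 1 ≤ m) {X : Type*} {l : Filter X} [l.IsCountablyGenerated]
    {u : X → Plane → Space} {w : Plane → Space} (hw : IsSigma m w)
    (hu : ∀ᶠ t in l, IsSigma m (u t)) (h : Tendsto (fun t => hdist (u t) w) l (𝓝 0)) {k : ℝ → ℝ}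
    (hk : IsDecaying m k) (i : Fin 3) (σ : ℝ) :
    Tendsto (fun t => corr k (fun τ => logProfile (u t) τ i) σ) l
      (𝓝 (corr k (fun τ => logProfile w τ i) σ)) := by
  have h1 : Integrable fun τ => k (τ - σ) * 1 :=
    hk.integrable hm ⟨continuous_const, 1, fun _ => by simp⟩ σ
  refine tendsto_integral_filter_of_dominated_convergence (fun τ => ‖k (τ - σ) * 1‖) ?_ ?_ h1.norm
    (Eventually.of_forall fun τ => ?_)
  · filter_upwards [hu] with t ht
    exact (hk.integrable hm ((isBddCurve_logProfile ht).coord i) σ).1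
  · filter_upwards [hu] with t ht
    refine Eventually.of_forall fun τ => ?_
    rw [norm_mul, norm_mul, norm_one]
    exact mul_le_mul_of_nonneg_left ((PiLp.norm_apply_le _ i).trans (norm_logProfile ht τ).le)
      (norm_nonneg _)
  · exact (((EuclideanSpace.proj i : Space →L[ℝ] ℝ).continuous.tendsto _).comp
      (tendsto_logProfile_of_hdist hm hw hu h τ)).const_mul _

theorem tendsto_modul_of_hdist (hm : 1 ≤ m) {X : Type*} {l : Filter X} [l.IsCountablyGenerated]
    {u : X → Plane → Space} {w : Plane → Space} (hw : IsSigma m w)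
    (hu : ∀ᶠ t in l, IsSigma m (u t)) (h : Tendsto (fun t => hdist (u t) w) l (𝓝 0)) (p : ℝ × ℝ) :
    Tendsto (fun t => modul m (logProfile (u t)) p) l (𝓝 (modul m (logProfile w) p)) := by
  have c := fun {k : ℝ → ℝ} (hk : IsDecaying m k) (i : Fin 3) =>
    tendsto_corr_of_hdist hm hw hu h hk i p.1
  have k1 := (isKernel_pow_three hm).decay
  have k2 := (isKernel_pow_three_mul hm).decay
  have k3 := (isKernel_pow_four hm).decay
  exact ((((c k3 2).sub ((c k2 0).const_mul _)).sub ((c k2 1).const_mul _)).div_const _).prodMk_nhds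
    ((((c k1 0).const_mul _).sub ((c k1 1).const_mul _)).div_const _)

end

end EquivariantMaps

namespace EquivariantMaps

/-! ### Continuity of the modulation parameters -/

section

/-- A continuous angle on an open interval has a continuous real-valued lift. -/
theorem exists_continuous_lift {I : Set ℝ} (hI : IsOpen I) (hc : I.OrdConnected)
    {α : ℝ → Real.Angle} (hα : ContinuousOn α I) :
    ∃ a : ℝ → ℝ, ContinuousOn a I ∧ ∀ t ∈ I, (a t : Real.Angle) = α t := by
  rcases I.eq_empty_or_nonempty with rfl | ⟨t₀, ht₀⟩
  · exact ⟨0, continuousOn_empty _, fun t ht => ht.elim⟩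
  -- Real-valued lifting along the covering of the circle by the line needs a simply connected,
  -- locally path-connected base.
  have : ContractibleSpace I := hc.convex.contractibleSpace ⟨t₀, ht₀⟩
  have : LocallyPathConnectedSpace I := hI.locallyPathConnectedSpace
  have hcov : IsCoveringMap ((↑) : ℝ → Real.Angle) := AddCircle.isCoveringMap_coe (2 * Real.pi)
  obtain ⟨f, ⟨-, hf⟩, -⟩ := hcov.existsUnique_continuousMap_lifts ⟨I.domRestrict α, hα.domRestrict⟩
    ⟨t₀, ht₀⟩ (α t₀).toReal (Real.Angle.coe_toReal _)
  refine ⟨Function.extend Subtype.val f 0, ?_, fun t ht => ?_⟩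
  · rw [continuousOn_iff_continuous_domRestrict]
    refine f.continuous.congr fun t => ?_
    rw [domRestrict_apply, Subtype.val_injective.extend_apply]
  · have e : Function.extend Subtype.val f 0 t = f ⟨t, ht⟩ :=
      Subtype.val_injective.extend_apply f 0 ⟨t, ht⟩
    rw [e]
    exact congrFun hf ⟨t, ht⟩

variable {m : ℕ} {ρ ε κ : ℝ} {I : Set ℝ} {u : ℝ → Plane → Space}

/-- The modulation parameters along a curve of maps near the harmonic maps. -/
structure IsModulCurve (m : ℕ) (ρ ε κ : ℝ) (I : Set ℝ) (u : ℝ → Plane → Space) (σ : ℝ → ℝ)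
    (α : ℝ → Real.Angle) : Prop where
  sigma : ContInSigma m I u
  near : ∀ t ∈ I, ∃ σ₀ α₀, hdist (u t) (harmonicMap m (Real.exp σ₀) α₀) ≤ ε / 2
  param : ∀ t ∈ I, IsModulParam m ρ ε κ (u t) (σ t) (α t)

variable {σ : ℝ → ℝ} {α : ℝ → Real.Angle}

theorem IsModulCurve.exists_chart (hS : IsModulScale m ρ ε κ) (hm : 1 ≤ m)
    (h : IsModulCurve m ρ ε κ I u σ α) {t₀ : ℝ} (ht₀ : t₀ ∈ I) :
    ∃ σ₀ α₀, ∀ᶠ t in 𝓝[I] t₀, hdist (u t) (harmonicMap m (Real.exp σ₀) α₀) ≤ ε ∧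
      |σ t - σ₀| ≤ ρ / 2 ∧ ‖α t - α₀‖ ≤ ρ / 2 := by
  obtain ⟨σ₀, α₀, h₀⟩ := h.near t₀ ht₀
  have hε := hS.ε_pos
  refine ⟨σ₀, α₀, ?_⟩
  filter_upwards [self_mem_nhdsWithin,
    (h.sigma.2 t₀ ht₀).eventually_le_const (by positivity : 0 < ε / 2)] with t ht hd
  have h1 := h.sigma.1 t ht
  have h2 := h.sigma.1 t₀ ht₀
  have h3 := isSigma_harmonicMap hm σ₀ α₀
  have hle := hdist_triangle h1.continuous h2.continuous h3.continuous h1.memHdot h2.memHdot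
    h3.memHdot
  have hle : hdist (u t) (harmonicMap m (Real.exp σ₀) α₀) ≤ ε := by linarith
  have hp := (h.param t ht).near σ₀ α₀ hle
  exact ⟨hle, hp.1, hp.2.1⟩

/-- Near `t₀` one harmonic map serves as the centre. The contraction inequality at time `t`, between
the zero at `t` and the old zero, bounds their distance by twice the residual of the old zero in the
new equations. The residual tends to zero because the coefficients of `modul` converge. -/
theorem IsModulCurve.tendsto (hS : IsModulScale m ρ ε κ) (hm : 1 ≤ m)
    (h : IsModulCurve m ρ ε κ I u σ α) {t₀ : ℝ} (ht₀ : t₀ ∈ I) :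
    Tendsto σ (𝓝[I] t₀) (𝓝 (σ t₀)) ∧ Tendsto α (𝓝[I] t₀) (𝓝 (α t₀)) := by
  obtain ⟨σ₀, α₀, h₀⟩ := h.exists_chart hS hm ht₀
  have hρ := hS.ρ_pos
  set c : ℝ × ℝ := (σ₀, α₀.toReal) with hc
  set p : ℝ → ℝ × ℝ := fun t => (σ t - σ₀, (α t - α₀).toReal) with hp
  have hcp : ∀ t, c + p t = (σ t, α₀.toReal + (α t - α₀).toReal) := fun t => by
    simp [hc, hp]
  have hz : ∀ t ∈ I, modul m (logProfile (u t)) (c + p t) = 0 := fun t ht => by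
    rw [hcp, ← orthogonal_iff_modul hm (h.sigma.1 t ht)]
    simpa using (h.param t ht).orthogonal
  have hball : ∀ t, |σ t - σ₀| ≤ ρ / 2 ∧ ‖α t - α₀‖ ≤ ρ / 2 →
      p t ∈ Metric.closedBall (0 : ℝ × ℝ) ρ := fun t hb => by
    rw [norm_angle] at hb
    exact mem_closedBall_zero_iff.2 (max_le (hb.1.trans (by linarith)) (hb.2.trans (by linarith)))
  have hb₀ := hball t₀ (h₀.self_of_nhdsWithin ht₀).2
  have hle : ∀ᶠ t in 𝓝[I] t₀, ‖p t - p t₀‖ ≤ 2 * ‖modul m (logProfile (u t)) (c + p t₀)‖ := by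
    filter_upwards [self_mem_nhdsWithin, h₀] with t ht hd
    have h1 := hS.contraction (u t) (h.sigma.1 t ht) σ₀ α₀.toReal (by simpa using hd.1)
      (p t) (hball t hd.2) (p t₀) hb₀
    rw [← hc, hz t ht] at h1
    have h2 : p t - p t₀ = -(0 - modul m (logProfile (u t)) (c + p t₀) - (p t - p t₀))
        - modul m (logProfile (u t)) (c + p t₀) := by abel
    have h3 := norm_sub_le (-(0 - modul m (logProfile (u t)) (c + p t₀) - (p t - p t₀)))
      (modul m (logProfile (u t)) (c + p t₀))
    rw [← h2, norm_neg] at h3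
    linarith
  have hlim : Tendsto (fun t => 2 * ‖modul m (logProfile (u t)) (c + p t₀)‖) (𝓝[I] t₀) (𝓝 0) := by
    have h1 := tendsto_modul_of_hdist hm (h.sigma.1 t₀ ht₀)
      (by filter_upwards [self_mem_nhdsWithin] with t ht using h.sigma.1 t ht)
      (h.sigma.2 t₀ ht₀) (c + p t₀)
    rw [hz t₀ ht₀] at h1
    simpa using h1.norm.const_mul 2
  have hpt : Tendsto p (𝓝[I] t₀) (𝓝 (p t₀)) :=
    tendsto_iff_norm_sub_tendsto_zero.2 (squeeze_zero' (Eventually.of_forall fun _ => norm_nonneg _)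
      hle hlim)
  constructor
  · have := ((continuous_fst.tendsto _).comp hpt).add_const σ₀
    simpa [hp, Function.comp_def] using this
  · have := ((Real.Angle.continuous_coe.tendsto _).comp
      ((continuous_snd.tendsto _).comp hpt)).add_const α₀
    simpa [hp, Function.comp_def] using this

/-- A continuous curve of solutions of the modulation equations, near which the modulation map is
close to a translation. -/
structure IsModulLift (m : ℕ) (I : Set ℝ) (u : ℝ → Plane → Space) (P : ℝ → ℝ × ℝ) : Prop where
  sigma : ∀ t ∈ I, IsSigma m (u t)
  cont : ContinuousOn P I
  zero : ∀ t ∈ I, modul m (logProfile (u t)) (P t) = 0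
  chart : ∀ t₀ ∈ I, ∃ r > 0, ∀ᶠ t in 𝓝[I] t₀, ∀ p ∈ Metric.ball (P t₀) r,
    ∀ p' ∈ Metric.ball (P t₀) r,
    ‖modul m (logProfile (u t)) p - modul m (logProfile (u t)) p' - (p - p')‖ ≤ 1 / 2 * ‖p - p'‖

theorem IsModulCurve.exists_lift (hS : IsModulScale m ρ ε κ) (hm : 1 ≤ m)
    (h : IsModulCurve m ρ ε κ I u σ α) (hI : IsOpen I) (hc : I.OrdConnected) :
    ∃ a : ℝ → ℝ, (∀ t ∈ I, (a t : Real.Angle) = α t) ∧ IsModulLift m I u fun t => (σ t, a t) := by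
  obtain ⟨a, hac, ha⟩ := exists_continuous_lift hI hc (α := α)
    fun t ht => (h.tendsto hS hm ht).2
  have hσ : ContinuousOn σ I := fun t ht => (h.tendsto hS hm ht).1
  have hρ := hS.ρ_pos
  refine ⟨a, ha, h.sigma.1, hσ.prodMk hac, fun t ht => ?_, fun t₀ ht₀ => ?_⟩
  · rw [← orthogonal_iff_modul hm (h.sigma.1 t ht), ha t ht]
    exact (h.param t ht).orthogonal
  · obtain ⟨σ₀, α₀, h₀⟩ := h.exists_chart hS hm ht₀
    -- Among the real representatives of `α₀`, this is the one within ρ/2 of the chosen lift, so the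
    -- chart of the contraction can be used on the line.
    set b := a t₀ - (α t₀ - α₀).toReal with hb
    have hbα : (b : Real.Angle) = α₀ := by
      rw [hb, Real.Angle.coe_sub, ha t₀ ht₀]; simp
    have hself := (h₀.self_of_nhdsWithin ht₀).2
    rw [norm_angle] at hself
    have hmem : ∀ p ∈ Metric.ball ((σ t₀, a t₀) : ℝ × ℝ) (ρ / 2),
        p - (σ₀, b) ∈ Metric.closedBall (0 : ℝ × ℝ) ρ := by
      intro p hp
      rw [mem_ball_iff_norm] at hp
      have h1 : ‖((σ t₀, a t₀) : ℝ × ℝ) - (σ₀, b)‖ ≤ ρ / 2 := by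
        refine max_le hself.1 ?_
        simpa [hb] using hself.2
      have h2 := norm_sub_le_norm_sub_add_norm_sub p ((σ t₀, a t₀) : ℝ × ℝ) (σ₀, b)
      exact mem_closedBall_zero_iff.2 (by linarith)
    refine ⟨ρ / 2, by positivity, ?_⟩
    filter_upwards [self_mem_nhdsWithin, h₀] with t ht hd p hp p' hp'
    have h1 := hS.contraction (u t) (h.sigma.1 t ht) σ₀ b (by rw [hbα]; exact hd.1)
      _ (hmem p hp) _ (hmem p' hp')
    simpa using h1

variable {P : ℝ → ℝ × ℝ}

/-- The modulation parameters depend on the map in a Lipschitz continuous way. -/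
theorem IsModulLift.exists_norm_sub_le (hm : 1 ≤ m) (h : IsModulLift m I u P) {w : Plane → Space}
    {F : ℝ → Lp Space 2 (volume : Measure Plane)} (hF : RepresentsL2 I u w F) {t₀ : ℝ}
    (ht₀ : t₀ ∈ I) : ∃ r > 0, ∀ t ∈ I ∩ Metric.ball t₀ r, ∀ t' ∈ I ∩ Metric.ball t₀ r,
      ‖P t - P t'‖ ≤ 192 * m / quartic m * Real.exp (-(P t').1) * ‖F t - F t'‖ := by
  obtain ⟨r, hr, hc⟩ := h.chart t₀ ht₀
  have hP := (h.cont t₀ ht₀).eventually (Metric.ball_mem_nhds _ hr)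
  obtain ⟨s, hs, hs'⟩ := Metric.mem_nhdsWithin_iff.1 (hc.and hP)
  refine ⟨s, hs, fun t ht t' ht' => ?_⟩
  obtain ⟨c1, b1⟩ := hs' ht.symm
  obtain ⟨-, b2⟩ := hs' ht'.symm
  have h1 := c1 _ b1 _ b2
  rw [h.zero t ht.1] at h1
  have hf : (fun x => u t x - u t' x) =ᵐ[volume] (F t - F t' : Lp Space 2 volume) := by
    filter_upwards [hF t ht.1, hF t' ht'.1, Lp.coeFn_sub (F t) (F t')] with x a b c
    rw [c, Pi.sub_apply, ← a, ← b]; abel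
  have h2 := norm_modul_sub_modul_le hm (h.sigma t ht.1) (h.sigma t' ht'.1) hf (P t')
  rw [h.zero t' ht'.1, sub_zero] at h2
  have h3 : P t - P t' = -(0 - modul m (logProfile (u t)) (P t') - (P t - P t'))
      - modul m (logProfile (u t)) (P t') := by abel
  have h4 := norm_sub_le (-(0 - modul m (logProfile (u t)) (P t') - (P t - P t')))
    (modul m (logProfile (u t)) (P t'))
  rw [← h3, norm_neg] at h4
  have e : 192 * m / quartic m * Real.exp (-(P t').1) * ‖F t - F t'‖
    = 2 * (96 * m / quartic m * Real.exp (-(P t').1) * ‖F t - F t'‖) := by ring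
  rw [e]
  linarith

end

end EquivariantMaps

namespace EquivariantMaps

/-! ### Continuously differentiable curves -/

section

variable {E : Type*} [NormedAddCommGroup E] [NormedSpace ℝ E]

/-- The derivative of a function with strict derivatives at all points is continuous. -/
theorem contDiffOn_one_of_hasStrictDerivAt {f f' : ℝ → E} {I : Set ℝ} (hI : IsOpen I)
    (h : ∀ t ∈ I, HasStrictDerivAt f (f' t) t) : ContDiffOn ℝ 1 f I := by
  have h1 : ContDiffOn ℝ (0 + 1) f I := by
    refine (contDiffOn_succ_iff_deriv_of_isOpen hI).2
      ⟨fun t ht => (h t ht).hasDerivAt.differentiableAt.differentiableWithinAt, by simp, ?_⟩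
    rw [contDiffOn_zero]
    refine ContinuousOn.congr (f := f') (fun t₀ ht₀ => ContinuousAt.continuousWithinAt ?_)
      fun t ht => (h t ht).hasDerivAt.deriv
    rw [Metric.continuousAt_iff']
    intro e he
    have hs := (h t₀ ht₀).hasStrictFDerivAt.isLittleO.def (half_pos he)
    rw [nhds_prod_eq] at hs
    obtain ⟨U, hU, hUs⟩ := eventually_prod_self_iff'.1 hs
    have hU' := eventually_eventually_nhds.2 hU
    filter_upwards [hU', hI.mem_nhds ht₀] with t ht htI
    -- Strict differentiability makes f minus its linear part Lipschitz with a small constant near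
    -- `t₀`, which bounds its derivative at all nearby points.
    have hd : HasDerivAt (fun x => f x - x • f' t₀) (f' t - (1 : ℝ) • f' t₀) t :=
      (h t htI).hasDerivAt.fun_sub ((hasDerivAt_id t).smul_const _)
    have hle := hd.le_of_lip' (half_pos he).le (ht.mono fun x hx => ?_)
    · rw [one_smul] at hle
      rw [dist_eq_norm]; linarith
    · have := hUs x hx t ht.self_of_nhds
      simp only at this
      rw [ContinuousLinearMap.toSpanSingleton_apply] at this
      have e : f x - x • f' t₀ - (f t - t • f' t₀) = f x - f t - (x - t) • f' t₀ := by
        rw [sub_smul]; abel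
      rw [e]
      exact this
  simpa using h1

/-- The pairing of a Lipschitz continuous curve with a strictly differentiable curve through the
origin is strictly differentiable. -/
theorem hasStrictFDerivAt_inner {H : Type*} [NormedAddCommGroup H] [InnerProductSpace ℝ H]
    {κ : ℝ → H} {f : ℝ → H} {f' : H} {t₀ σ₀ L : ℝ}
    (hκ : ∀ σ σ', |σ - σ₀| ≤ 1 → |σ' - σ₀| ≤ 1 → ‖κ σ - κ σ'‖ ≤ L * |σ - σ'|)
    (hf : HasStrictDerivAt f f' t₀) (h0 : f t₀ = 0) :
    ∃ D : ℝ × ℝ →L[ℝ] ℝ, HasStrictFDerivAt (fun x : ℝ × ℝ => inner ℝ (κ x.2) (f x.1)) D (t₀, σ₀) := by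
  have hL : 0 ≤ L := by
    have := (norm_nonneg _).trans (hκ (σ₀ + 1) σ₀ (by simp) (by simp))
    simpa using this
  -- The variation of κ is paired with f, which vanishes at `t₀`; both factors are small and
  -- Lipschitz, so this part has strict derivative zero although κ is not assumed differentiable.
  have h1 : HasStrictFDerivAt (fun x : ℝ × ℝ => inner ℝ (κ x.2 - κ σ₀) (f x.1))
      (0 : ℝ × ℝ →L[ℝ] ℝ) (t₀, σ₀) := by
    obtain ⟨K, s, hs, hK⟩ := hf.hasStrictFDerivAt.exists_lipschitzOnWith
    rw [hasStrictFDerivAt_iff_isLittleO, Asymptotics.isLittleO_iff]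
    intro c hc
    set η := min 1 (c / (2 * (L * (1 + K)) + 1)) with hη
    have hA : 0 ≤ L * (1 + K) := by positivity
    have hη0 : 0 < η := lt_min one_pos (by positivity)
    have hηc : 2 * (L * (1 + K)) * η ≤ c := by
      have : η ≤ c / (2 * (L * (1 + K)) + 1) := min_le_right _ _
      rw [le_div_iff₀ (by positivity)] at this
      nlinarith
    have e1 : ∀ᶠ t in 𝓝 t₀, t ∈ s ∧ ‖f t‖ < η := by
      have : Tendsto (fun t => ‖f t‖) (𝓝 t₀) (𝓝 0) := by
        simpa [h0] using hf.hasDerivAt.continuousAt.norm.tendsto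
      exact (eventually_mem_set.2 hs).and (this.eventually_lt_const hη0)
    have e2 : ∀ᶠ σ in 𝓝 σ₀, |σ - σ₀| < η := Metric.ball_mem_nhds σ₀ hη0
    have e3 : ∀ᶠ x : ℝ × ℝ in 𝓝 (t₀, σ₀), (x.1 ∈ s ∧ ‖f x.1‖ < η) ∧ |x.2 - σ₀| < η := by
      rw [nhds_prod_eq]; exact e1.prod_mk e2
    rw [nhds_prod_eq]
    filter_upwards [e3.prod_mk e3] with y hy
    obtain ⟨⟨⟨a1, a2⟩, a3⟩, ⟨⟨b1, b2⟩, b3⟩⟩ := hy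
    have hη1 : η ≤ 1 := min_le_left _ _
    have d1 : |y.1.1 - y.2.1| ≤ ‖y.1 - y.2‖ := norm_fst_le (y.1 - y.2)
    have d2 : |y.1.2 - y.2.2| ≤ ‖y.1 - y.2‖ := norm_snd_le (y.1 - y.2)
    have k1 := hκ y.1.2 y.2.2 (by linarith) (by linarith)
    have k2 := hκ y.2.2 σ₀ (by linarith) (by simp)
    have l1 : ‖f y.1.1 - f y.2.1‖ ≤ K * |y.1.1 - y.2.1| := by
      have := hK.dist_le_mul _ a1 _ b1
      rwa [dist_eq_norm, Real.dist_eq] at this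
    have e : inner ℝ (κ y.1.2 - κ σ₀) (f y.1.1) - inner ℝ (κ y.2.2 - κ σ₀) (f y.2.1)
        - (0 : ℝ × ℝ →L[ℝ] ℝ) (y.1 - y.2)
        = inner ℝ (κ y.1.2 - κ y.2.2) (f y.1.1) + inner ℝ (κ y.2.2 - κ σ₀) (f y.1.1 - f y.2.1) := by
      simp only [inner_sub_left, inner_sub_right, zero_apply]
      ring
    rw [e]
    have n1 : ‖inner ℝ (κ y.1.2 - κ y.2.2) (f y.1.1)‖ ≤ L * ‖y.1 - y.2‖ * η :=
      (norm_inner_le_norm _ _).trans (mul_le_mul (k1.trans (mul_le_mul_of_nonneg_left d2 hL))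
        a2.le (norm_nonneg _) (by positivity))
    have n2 : ‖inner ℝ (κ y.2.2 - κ σ₀) (f y.1.1 - f y.2.1)‖ ≤ L * η * (K * ‖y.1 - y.2‖) :=
      (norm_inner_le_norm _ _).trans (mul_le_mul (k2.trans (mul_le_mul_of_nonneg_left b3.le hL))
        (l1.trans (mul_le_mul_of_nonneg_left d1 K.2)) (norm_nonneg _) (by positivity))
    refine (norm_add_le _ _).trans ((add_le_add n1 n2).trans ?_)
    have : L * ‖y.1 - y.2‖ * η + L * η * (K * ‖y.1 - y.2‖) = L * (1 + K) * η * ‖y.1 - y.2‖ := by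
      ring
    rw [this]
    refine mul_le_mul_of_nonneg_right ?_ (norm_nonneg _)
    nlinarith
  have h2 : HasStrictFDerivAt (fun x : ℝ × ℝ => inner ℝ (κ σ₀) (f x.1)) _ (t₀, σ₀) :=
    (innerSL ℝ (κ σ₀)).hasStrictFDerivAt.comp (t₀, σ₀)
      (hf.hasStrictFDerivAt.comp (t₀, σ₀) hasStrictFDerivAt_fst)
  refine ⟨_, (h1.fun_add h2).congr_of_eventuallyEq (Eventually.of_forall fun x => ?_)⟩
  simp only [← inner_add_left, sub_add_cancel]

/-- A linear endomorphism at distance less than one from the identity is invertible. -/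
theorem isInvertible_of_norm_sub_id_lt {F : Type*} [NormedAddCommGroup F] [NormedSpace ℝ F]
    [FiniteDimensional ℝ F] {B : F →L[ℝ] F} (h : ‖B - ContinuousLinearMap.id ℝ F‖ < 1) :
    B.IsInvertible := by
  have hinj : Function.Injective (B : F →ₗ[ℝ] F) := by
    rw [← LinearMap.ker_eq_bot, LinearMap.ker_eq_bot']
    intro p hp
    have hp : B p = 0 := hp
    by_contra hne
    have h1 := (B - ContinuousLinearMap.id ℝ F).le_opNorm p
    rw [sub_apply, hp, ContinuousLinearMap.id_apply, zero_sub, norm_neg] at h1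
    have h2 := norm_pos_iff.2 hne
    nlinarith
  exact ⟨(LinearEquiv.ofInjectiveEndo (B : F →ₗ[ℝ] F) hinj).toContinuousLinearEquiv, by ext; rfl⟩

end

section

variable {m : ℕ} {I : Set ℝ} {u : ℝ → Plane → Space} {P : ℝ → ℝ × ℝ}
  {F : ℝ → Lp Space 2 (volume : Measure Plane)} {w : Plane → Space}

/-- The correlation is split into that of the fixed map at `t₀`, smooth in σ through the kernel, and
a pairing with F(t) − F(t₀), which vanishes at `t₀`. -/
theorem exists_hasStrictFDerivAt_corr (hm : 1 ≤ m) (hI : IsOpen I)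
    (hu : ∀ t ∈ I, IsSigma m (u t)) (hF : RepresentsL2 I u w F) {t₀ : ℝ} (ht₀ : t₀ ∈ I)
    {F' : Lp Space 2 (volume : Measure Plane)} (hF' : HasStrictDerivAt F F' t₀) {k k' : ℝ → ℝ}
    (hk : IsKernel m k k') (i : Fin 3) (p : ℝ × ℝ) :
    ∃ D : ℝ × (ℝ × ℝ) →L[ℝ] ℝ, HasStrictFDerivAt (fun x : ℝ × (ℝ × ℝ) =>
      corr k (fun τ => logProfile (u x.1) τ i) x.2.1) D (t₀, p) := by
  obtain ⟨D, hD⟩ := hasStrictFDerivAt_inner (κ := kernelLp hm hk.decay i) (σ₀ := p.1)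
    (fun σ σ' h h' => norm_kernelLp_sub_le hm hk i p.1 h h') (hF'.sub_const (F t₀)) (sub_self _)
  have hpr : HasStrictFDerivAt (fun x : ℝ × (ℝ × ℝ) => (x.1, x.2.1)) _ (t₀, p) :=
    hasStrictFDerivAt_fst.prodMk
      (ContinuousLinearMap.fst ℝ ℝ ℝ ∘L ContinuousLinearMap.snd ℝ ℝ (ℝ × ℝ)).hasStrictFDerivAt
  have h1 := hD.comp (t₀, p) hpr
  have h2 := (hasStrictDerivAt_corr hm hk ((isBddCurve_logProfile (hu t₀ ht₀)).coord i)
    p.1).hasStrictFDerivAt.comp (t₀, p)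
      (ContinuousLinearMap.fst ℝ ℝ ℝ ∘L ContinuousLinearMap.snd ℝ ℝ (ℝ × ℝ)).hasStrictFDerivAt
  refine ⟨_, (h2.fun_add (h1.const_mul (2 * Real.pi)⁻¹)).congr_of_eventuallyEq ?_⟩
  have he : ∀ᶠ x : ℝ × (ℝ × ℝ) in 𝓝 (t₀, p), x.1 ∈ I :=
    continuous_fst.continuousAt (hI.mem_nhds ht₀)
  filter_upwards [he] with x hx
  have hf : (fun y => u x.1 y - u t₀ y) =ᵐ[volume] (F x.1 - F t₀ : Lp Space 2 volume) := by
    filter_upwards [hF x.1 hx, hF t₀ ht₀, Lp.coeFn_sub (F x.1) (F t₀)] with y a b c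
    rw [c, Pi.sub_apply, ← a, ← b]; abel
  have := corr_sub_eq_inner hm hk.decay i (hu x.1 hx) (hu t₀ ht₀) hf x.2.1
  rw [← this]
  exact add_sub_cancel _ _

theorem exists_hasStrictFDerivAt_modul (hm : 1 ≤ m) (hI : IsOpen I)
    (hu : ∀ t ∈ I, IsSigma m (u t)) (hF : RepresentsL2 I u w F) {t₀ : ℝ} (ht₀ : t₀ ∈ I)
    {F' : Lp Space 2 (volume : Measure Plane)} (hF' : HasStrictDerivAt F F' t₀) (p : ℝ × ℝ) :
    ∃ D : ℝ × (ℝ × ℝ) →L[ℝ] ℝ × ℝ,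
      HasStrictFDerivAt (fun x : ℝ × (ℝ × ℝ) => modul m (logProfile (u x.1)) x.2) D (t₀, p) := by
  obtain ⟨D1, h1⟩ := exists_hasStrictFDerivAt_corr hm hI hu hF ht₀ hF' (isKernel_pow_four hm) 2 p
  obtain ⟨D2, h2⟩ := exists_hasStrictFDerivAt_corr hm hI hu hF ht₀ hF' (isKernel_pow_three_mul hm) 0 p
  obtain ⟨D3, h3⟩ := exists_hasStrictFDerivAt_corr hm hI hu hF ht₀ hF' (isKernel_pow_three_mul hm) 1 p
  obtain ⟨D4, h4⟩ := exists_hasStrictFDerivAt_corr hm hI hu hF ht₀ hF' (isKernel_pow_three hm) 0 p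
  obtain ⟨D5, h5⟩ := exists_hasStrictFDerivAt_corr hm hI hu hF ht₀ hF' (isKernel_pow_three hm) 1 p
  have hp : HasStrictFDerivAt (fun x : ℝ × (ℝ × ℝ) => x.2.2) _ (t₀, p) :=
    (ContinuousLinearMap.snd ℝ ℝ ℝ ∘L ContinuousLinearMap.snd ℝ ℝ (ℝ × ℝ)).hasStrictFDerivAt
  have hc := (Real.hasStrictDerivAt_cos p.2).hasStrictFDerivAt.comp (t₀, p) hp
  have hs := (Real.hasStrictDerivAt_sin p.2).hasStrictFDerivAt.comp (t₀, p) hp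
  refine ⟨_, (((((h1.fun_sub (hc.mul h2)).fun_sub (hs.mul h3)).const_mul (m * quartic m)⁻¹).prodMk
    (((hs.mul h4).fun_sub (hc.mul h5)).const_mul (quartic m)⁻¹))).congr_of_eventuallyEq
    (Eventually.of_forall fun x => ?_)⟩
  simp only [modul, Pi.mul_apply, div_eq_inv_mul]

/-- The contraction estimate puts the partial derivative in the parameters within 1/2 of the
identity, so it is invertible. Continuity of `P` identifies it locally with the implicit function.
-/
theorem IsModulLift.exists_hasStrictDerivAt (hm : 1 ≤ m) (hI : IsOpen I)
    (h : IsModulLift m I u P) (hF : RepresentsL2 I u w F) (hC : ContDiffOn ℝ 1 F I) {t₀ : ℝ}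
    (ht₀ : t₀ ∈ I) : ∃ P', HasStrictDerivAt P P' t₀ := by
  have hF' := (hC.contDiffAt (hI.mem_nhds ht₀)).hasStrictDerivAt (by simp)
  obtain ⟨D, hD⟩ := exists_hasStrictFDerivAt_modul hm hI h.sigma hF ht₀ hF' (P t₀)
  set B := D ∘L .inr ℝ ℝ (ℝ × ℝ) with hB
  have hBd : HasFDerivAt (fun p => modul m (logProfile (u t₀)) p) B (P t₀) :=
    hD.hasFDerivAt.comp (P t₀) (hasFDerivAt_prodMk_right t₀ (P t₀))
  obtain ⟨r, hr, hc⟩ := h.chart t₀ ht₀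
  have hc₀ := hc.self_of_nhdsWithin ht₀
  have hinv : B.IsInvertible := by
    refine isInvertible_of_norm_sub_id_lt (lt_of_le_of_lt ?_ (by norm_num : (1 / 2 : ℝ) < 1))
    refine (hBd.fun_sub (hasFDerivAt_id (P t₀))).le_of_lip' (by norm_num) ?_
    filter_upwards [Metric.ball_mem_nhds (P t₀) hr] with p hp
    have e : ∀ a b : ℝ × ℝ, a - p - (b - P t₀) = a - b - (p - P t₀) := fun a b => by abel
    rw [id, id, e]
    exact hc₀ p hp (P t₀) (Metric.mem_ball_self hr)
  have he := hD.eventually_apply_eq_iff_implicitFunctionOfProdDomain hinv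
  have hs := hD.hasStrictFDerivAt_implicitFunctionOfProdDomain hinv
  have hP : ContinuousAt P t₀ := (h.cont t₀ ht₀).continuousAt (hI.mem_nhds ht₀)
  have hmap : Tendsto (fun t => (t, P t)) (𝓝 t₀) (𝓝 (t₀, P t₀)) := continuousAt_id.prodMk hP
  refine ⟨_, (hs.congr_of_eventuallyEq ?_).hasStrictDerivAt⟩
  filter_upwards [hmap.eventually he, hI.mem_nhds ht₀] with t ht htI
  exact ht.1 (by simp only [h.zero t htI, h.zero t₀ ht₀])

theorem IsModulLift.contDiffOn (hm : 1 ≤ m) (hI : IsOpen I) (h : IsModulLift m I u P)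
    (hF : RepresentsL2 I u w F) (hC : ContDiffOn ℝ 1 F I) : ContDiffOn ℝ 1 P I := by
  have := fun t (ht : t ∈ I) => h.exists_hasStrictDerivAt hm hI hF hC ht
  choose! P' hP' using this
  exact contDiffOn_one_of_hasStrictDerivAt hI hP'

end

end EquivariantMaps

namespace EquivariantMaps

/-! ### Lipschitz functions of one variable -/

section

/-- An inequality between continuous functions on an open set need only be verified almost
everywhere. -/
theorem le_of_ae_le_of_continuousOn {f g : ℝ → ℝ} {U N : Set ℝ} (hU : IsOpen U)
    (hf : ContinuousOn f U) (hg : ContinuousOn g U) (hN : volume N = 0)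
    (h : ∀ t ∈ U, t ∉ N → f t ≤ g t) : ∀ t ∈ U, f t ≤ g t := by
  intro t ht
  by_contra hlt
  have h1 : ∀ᶠ x in 𝓝 t, g x < f x :=
    ((hg t ht).continuousAt (hU.mem_nhds ht)).eventually_lt
      ((hf t ht).continuousAt (hU.mem_nhds ht)) (not_le.1 hlt)
  have h2 : N ∈ 𝓝 t := by
    filter_upwards [h1, hU.mem_nhds ht] with x hx hxU
    by_contra hxN
    exact (h x hxU hxN).not_gt hx
  exact (Measure.measure_pos_of_mem_nhds volume h2).ne' hN

/-- A function on an interval that is Lipschitz continuous at each point with a fixed constant is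
Lipschitz continuous. -/
theorem abs_sub_le_of_locally {f : ℝ → ℝ} {I : Set ℝ} (hc : I.OrdConnected) {C : ℝ}
    (h : ∀ t₀ ∈ I, ∀ᶠ t in 𝓝 t₀, |f t - f t₀| ≤ C * |t - t₀|) :
    ∀ t ∈ I, ∀ t' ∈ I, |f t - f t'| ≤ C * |t - t'| := by
  have hcont : ContinuousOn f I := fun t₀ ht₀ => by
    refine ContinuousAt.continuousWithinAt (tendsto_iff_norm_sub_tendsto_zero.2 ?_)
    refine squeeze_zero' (Eventually.of_forall fun _ => norm_nonneg _) (h t₀ ht₀) ?_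
    have : Continuous fun t => C * |t - t₀| := by fun_prop
    simpa using this.tendsto t₀
  have key : ∀ g : ℝ → ℝ, ContinuousOn g I →
      (∀ t₀ ∈ I, ∀ᶠ t in 𝓝 t₀, g t - g t₀ ≤ C * |t - t₀|) →
      ∀ a ∈ I, ∀ b ∈ I, a ≤ b → g b ≤ g a + C * (b - a) := by
    intro g hg hloc a ha b hb hab
    have hsub : Icc a b ⊆ I := hc.out ha hb
    refine image_le_of_liminf_slope_right_le_deriv_boundary (B := fun x => g a + C * (x - a))
      (B' := fun _ => C) (hg.mono hsub) (by simp) (by fun_prop) (fun x _ => ?_) (fun x hx r hr => ?_)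
      (right_mem_Icc.2 hab)
    · have := (((hasDerivAt_id x).sub_const a).const_mul C).const_add (g a)
      simpa using this.hasDerivWithinAt
    · refine Eventually.frequently ?_
      filter_upwards [(hloc x (hsub ⟨hx.1, hx.2.le⟩)).filter_mono nhdsWithin_le_nhds,
        self_mem_nhdsWithin] with z hz hxz
      have hxz : 0 < z - x := sub_pos.2 hxz
      rw [abs_of_pos hxz] at hz
      rw [slope_def_field, div_lt_iff₀ hxz]
      nlinarith
  have main : ∀ a ∈ I, ∀ b ∈ I, a ≤ b → |f b - f a| ≤ C * (b - a) := by
    intro a ha b hb hab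
    have h1 := key f hcont (fun t₀ ht₀ => (h t₀ ht₀).mono fun t ht => (le_abs_self _).trans ht)
      a ha b hb hab
    have h2 := key (fun t => -f t) hcont.neg (fun t₀ ht₀ => (h t₀ ht₀).mono fun t ht => by
      have := (neg_le_abs _).trans ht
      linarith) a ha b hb hab
    rw [abs_le]; constructor <;> linarith
  intro t ht t' ht'
  rcases le_total t t' with hle | hle
  · rw [abs_sub_comm, abs_sub_comm t, abs_of_nonneg (sub_nonneg.2 hle)]
    exact main t ht t' ht' hle
  · rw [abs_of_nonneg (sub_nonneg.2 hle)]
    exact main t' ht' t ht hle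

theorem isPrimitive_of_lipschitzWith {f : ℝ → ℝ} {K : NNReal} (hf : LipschitzWith K f) :
    IsPrimitive f (deriv f) :=
  IsPrimitive.of_ac (fun a b => (hf.lipschitzOnWith (s := uIcc a b)).absolutelyContinuousOnInterval)
    (by filter_upwards [hf.ae_differentiableAt_real] with x hx using hx.hasDerivAt)

/-- A Lipschitz extension to the line is a primitive of its bounded derivative, and test functions
supported in `I` do not see the extension. -/
theorem hasBoundedWeakDeriv_of_lipschitz {f : ℝ → ℝ} {I : Set ℝ} {C : ℝ}
    (h : ∀ t ∈ I, ∀ t' ∈ I, |f t - f t'| ≤ C * |t - t'|) : HasBoundedWeakDeriv I f := by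
  have hL : LipschitzOnWith C.toNNReal f I := LipschitzOnWith.of_dist_le_mul fun t ht t' ht' =>
    (h t ht t' ht').trans (mul_le_mul_of_nonneg_right (Real.le_coe_toNNReal C) (abs_nonneg _))
  obtain ⟨g, hg, hfg⟩ := hL.extend_real
  refine ⟨deriv g, memLp_top_of_bound (measurable_deriv g).aestronglyMeasurable C.toNNReal
    (Eventually.of_forall fun t => norm_deriv_le_of_lipschitz hg), fun φ h1 h2 h3 => ?_⟩
  obtain ⟨-, -, e⟩ := (isPrimitive_of_lipschitzWith hg).integral_test h1 h2
  have z1 : ∀ t, t ∉ I → deriv φ t • f t = 0 := fun t ht => by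
    rw [image_eq_zero_of_notMem_tsupport fun hh => ht (h3 (tsupport_deriv_subset hh)), zero_smul]
  have z2 : ∀ t, t ∉ I → φ t • deriv g t = 0 := fun t ht => by
    rw [image_eq_zero_of_notMem_tsupport fun hh => ht (h3 hh), zero_smul]
  rw [setIntegral_eq_integral_of_forall_compl_eq_zero z1,
    setIntegral_eq_integral_of_forall_compl_eq_zero z2]
  simp only [smul_eq_mul] at z1 ⊢
  rw [← e]
  refine integral_congr_ae (Eventually.of_forall fun t => ?_)
  by_cases ht : t ∈ I
  · simp only [hfg ht]
  · have hz : deriv φ t = 0 :=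
      image_eq_zero_of_notMem_tsupport fun hh => ht (h3 (tsupport_deriv_subset hh))
    simp only [hz, zero_mul]

theorem memW1Inf_of_lipschitz {f : ℝ → ℝ} {I : Set ℝ} (hI : IsOpen I)
    (hb : Bornology.IsBounded I) {C : ℝ} (h : ∀ t ∈ I, ∀ t' ∈ I, |f t - f t'| ≤ C * |t - t'|)
    (hf : ContinuousOn f I) : MemW1Inf I f := by
  refine ⟨?_, hasBoundedWeakDeriv_of_lipschitz h⟩
  have hm := hf.aestronglyMeasurable hI.measurableSet (μ := volume)
  rcases I.eq_empty_or_nonempty with rfl | ⟨t₀, ht₀⟩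
  · simp
  obtain ⟨B, hB⟩ := Metric.isBounded_iff.1 hb
  refine memLp_top_of_bound hm (|f t₀| + |C| * B) ((ae_restrict_iff' hI.measurableSet).2
    (Eventually.of_forall fun t ht => ?_))
  have h1 := h t ht t₀ ht₀
  have h2 : C * |t - t₀| ≤ |C| * B := mul_le_mul (le_abs_self C) (hB ht ht₀) (abs_nonneg _)
    (abs_nonneg _)
  have h3 := abs_sub_abs_le_abs_sub (f t) (f t₀)
  rw [Real.norm_eq_abs]
  linarith

theorem MemLp.exists_ae_norm_le {α E : Type*} [MeasurableSpace α] {μ : Measure α}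
    [NormedAddCommGroup E] {f : α → E} (hf : MemLp f ∞ μ) : ∃ B : ℝ, 0 ≤ B ∧ ∀ᵐ t ∂μ, ‖f t‖ ≤ B := by
  have hlt := hf.2
  rw [eLpNorm_exponent_top] at hlt
  refine ⟨(eLpNormEssSup f μ).toReal, ENNReal.toReal_nonneg, ?_⟩
  filter_upwards [ae_le_eLpNormEssSup (f := f) (μ := μ)] with t ht
  have := ENNReal.toReal_mono hlt.ne ht
  rwa [toReal_enorm] at this

/-- A curve in `W^{1,∞}` on an open interval is bounded and Lipschitz continuous off a null set. -/
theorem MemW1Inf.exists_lipschitz {E : Type*} [NormedAddCommGroup E] [NormedSpace ℝ E]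
    [CompleteSpace E] {F : ℝ → E} {I : Set ℝ} (hI : IsOpen I) (hc : I.OrdConnected)
    (h : MemW1Inf I F) : ∃ (N : Set ℝ) (K : ℝ), volume N = 0 ∧ 0 ≤ K ∧
      (∀ t ∈ I, t ∉ N → ‖F t‖ ≤ K) ∧
      ∀ t ∈ I, t ∉ N → ∀ t' ∈ I, t' ∉ N → ‖F t - F t'‖ ≤ K * |t - t'| := by
  obtain ⟨hF, G, hG, hw⟩ := h
  obtain ⟨K₁, hK₁, h1⟩ := MemLp.exists_ae_norm_le hF
  obtain ⟨K₂, hK₂, h2⟩ := MemLp.exists_ae_norm_le hG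
  have hloc : LocallyIntegrable (I.indicator F) :=
    ((memLp_indicator_iff_restrict hI.measurableSet).2 hF).locallyIntegrable (by simp)
  obtain ⟨N, hN, h3⟩ := lipschitz_ae_of_hasWeakDerivOn hI hc hloc h2 hw
  rw [ae_restrict_iff' hI.measurableSet] at h1
  refine ⟨N ∪ {t | ¬(t ∈ I → ‖F t‖ ≤ K₁)}, max K₁ K₂, measure_union_null hN h1,
    le_max_of_le_left hK₁, fun t ht hn => ?_, fun t ht hn t' ht' hn' => ?_⟩
  · by_contra hlt
    exact hn (Or.inr fun h => hlt ((h ht).trans (le_max_left _ _)))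
  · exact (h3 t ht (fun h => hn (Or.inl h)) t' ht' (fun h => hn' (Or.inl h))).trans
      (mul_le_mul_of_nonneg_right (le_max_right _ _) (abs_nonneg _))

end

end EquivariantMaps

namespace EquivariantMaps

/-! ### Lipschitz continuity of the modulation parameters -/

section

variable {m : ℕ} {I : Set ℝ} {u : ℝ → Plane → Space} {P : ℝ → ℝ × ℝ}
  {F : ℝ → Lp Space 2 (volume : Measure Plane)} {w : Plane → Space}

/-- The curve `F` is Lipschitz only off a null set. Since `P` is continuous, the resulting
inequality extends to all times, one variable at a time. The factor e^{−σ} is kept explicit for the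
use in the scale and the phase. -/
theorem IsModulLift.exists_locally_lipschitz (hm : 1 ≤ m) (hI : IsOpen I) (hc : I.OrdConnected)
    (h : IsModulLift m I u P) (hF : RepresentsL2 I u w F) (hW : MemW1Inf I F) :
    ∃ K ≥ 0, ∀ t₀ ∈ I, ∃ r > 0, ∀ t ∈ Metric.ball t₀ r, ∀ t' ∈ Metric.ball t₀ r,
      ‖P t - P t'‖ ≤ K * Real.exp (-(P t').1) * |t - t'| := by
  obtain ⟨N, K, hN, hK, -, hL⟩ := MemW1Inf.exists_lipschitz hI hc hW
  have hA : 0 ≤ 192 * m / quartic m := div_nonneg (by positivity) (quartic_pos hm).le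
  refine ⟨192 * m / quartic m * K, by positivity, fun t₀ ht₀ => ?_⟩
  obtain ⟨r₁, hr₁, hl⟩ := h.exists_norm_sub_le hm hF ht₀
  obtain ⟨r₂, hr₂, hsub⟩ := Metric.isOpen_iff.1 hI t₀ ht₀
  set r := min r₁ r₂ with hr
  have hU : IsOpen (Metric.ball t₀ r) := Metric.isOpen_ball
  have hUI : Metric.ball t₀ r ⊆ I ∩ Metric.ball t₀ r₁ :=
    subset_inter ((Metric.ball_subset_ball (min_le_right _ _)).trans hsub)
      (Metric.ball_subset_ball (min_le_left _ _))
  have hP : ContinuousOn P (Metric.ball t₀ r) := h.cont.mono (hUI.trans inter_subset_left)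
  refine ⟨r, lt_min hr₁ hr₂, ?_⟩
  have step : ∀ t ∈ Metric.ball t₀ r, t ∉ N → ∀ t' ∈ Metric.ball t₀ r,
      ‖P t - P t'‖ ≤ 192 * m / quartic m * K * Real.exp (-(P t').1) * |t - t'| := by
    intro t ht htN
    refine le_of_ae_le_of_continuousOn hU (by fun_prop) (by fun_prop) hN fun t' ht' htN' => ?_
    refine (hl t (hUI ht) t' (hUI ht')).trans ?_
    have := hL t (hUI ht).1 htN t' (hUI ht').1 htN'
    calc _ ≤ 192 * m / quartic m * Real.exp (-(P t').1) * (K * |t - t'|) :=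
          mul_le_mul_of_nonneg_left this (mul_nonneg hA (Real.exp_pos _).le)
      _ = _ := by ring
  intro t ht t' ht'
  exact le_of_ae_le_of_continuousOn (f := fun t => ‖P t - P t'‖)
    (g := fun t => 192 * m / quartic m * K * Real.exp (-(P t').1) * |t - t'|) hU (by fun_prop)
    (by fun_prop) hN (fun s hs hsN => step s hs hsN t' ht') t ht

/-- The scale of the nearby harmonic map is Lipschitz continuous in time. -/
theorem IsModulLift.exists_lipschitz_scale (hm : 1 ≤ m) (hI : IsOpen I) (hc : I.OrdConnected)
    (h : IsModulLift m I u P) (hF : RepresentsL2 I u w F) (hW : MemW1Inf I F) :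
    ∃ K, ∀ t ∈ I, ∀ t' ∈ I, |Real.exp (P t).1 - Real.exp (P t').1| ≤ K * |t - t'| := by
  obtain ⟨K, hK, hl⟩ := h.exists_locally_lipschitz hm hI hc hF hW
  refine ⟨2 * K, abs_sub_le_of_locally hc fun t₀ ht₀ => ?_⟩
  obtain ⟨r, hr, hb⟩ := hl t₀ ht₀
  have hP : ContinuousAt P t₀ := (h.cont t₀ ht₀).continuousAt (hI.mem_nhds ht₀)
  filter_upwards [Metric.ball_mem_nhds t₀ hr, hP (Metric.ball_mem_nhds _ one_pos)] with t ht h1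
  have h2 : |(P t).1 - (P t₀).1| ≤ ‖P t - P t₀‖ := norm_fst_le (P t - P t₀)
  have h1 : ‖P t - P t₀‖ < 1 := by rw [← dist_eq_norm]; exact h1
  have h3 := Real.abs_exp_sub_one_le (h2.trans h1.le)
  have h4 := hb t ht t₀ (Metric.mem_ball_self hr)
  -- The factor e^{σ} from differentiating s = e^σ cancels the factor e^{−σ}, so the constant does
  -- not depend on the scale.
  have e : Real.exp (P t).1 - Real.exp (P t₀).1
      = Real.exp (P t₀).1 * (Real.exp ((P t).1 - (P t₀).1) - 1) := by
    rw [mul_sub, ← Real.exp_add]; simp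
  have e0 := Real.exp_pos (P t₀).1
  rw [e, abs_mul, abs_of_pos e0]
  calc Real.exp (P t₀).1 * |Real.exp ((P t).1 - (P t₀).1) - 1|
      ≤ Real.exp (P t₀).1 * (2 * (K * Real.exp (-(P t₀).1) * |t - t₀|)) :=
        mul_le_mul_of_nonneg_left (h3.trans (by linarith)) e0.le
    _ = 2 * K * |t - t₀| * (Real.exp (P t₀).1 * Real.exp (-(P t₀).1)) := by ring
    _ = 2 * K * |t - t₀| := by rw [← Real.exp_add]; simp

/-- The phase of the nearby harmonic map is Lipschitz continuous in time as long as the scale is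
bounded from below. -/
theorem IsModulLift.exists_lipschitz_phase (hm : 1 ≤ m) (hI : IsOpen I) (hc : I.OrdConnected)
    (h : IsModulLift m I u P) (hF : RepresentsL2 I u w F) (hW : MemW1Inf I F) {J : Set ℝ}
    (hJI : J ⊆ I) (hJ : J.OrdConnected) {c : ℝ} (hc0 : 0 < c)
    (hle : ∀ t ∈ J, c ≤ Real.exp (P t).1) :
    ∃ K, ∀ t ∈ J, ∀ t' ∈ J, |(P t).2 - (P t').2| ≤ K * |t - t'| := by
  obtain ⟨K, hK, hl⟩ := h.exists_locally_lipschitz hm hI hc hF hW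
  refine ⟨K * c⁻¹, abs_sub_le_of_locally (f := fun t => (P t).2) hJ fun t₀ ht₀ => ?_⟩
  obtain ⟨r, hr, hb⟩ := hl t₀ (hJI ht₀)
  filter_upwards [Metric.ball_mem_nhds t₀ hr] with t ht
  have h2 : |(P t).2 - (P t₀).2| ≤ ‖P t - P t₀‖ := norm_snd_le (P t - P t₀)
  refine (h2.trans (hb t ht t₀ (Metric.mem_ball_self hr))).trans ?_
  have : Real.exp (-(P t₀).1) ≤ c⁻¹ := by
    rw [Real.exp_neg]
    exact inv_anti₀ hc0 (hle t₀ ht₀)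
  gcongr

theorem tendsto_corr_atTop (hm : 1 ≤ m) (hw : IsSigma m w) {k : ℝ → ℝ} (hk : IsDecaying m k)
    (i : Fin 3) :
    Tendsto (corr k fun τ => logProfile w τ i) atTop (𝓝 (kVec i * ∫ τ, k τ)) := by
  have h1 : Integrable fun τ => k (τ - 0) * 1 :=
    hk.integrable hm ⟨continuous_const, 1, fun _ => by simp⟩ 0
  have e : (corr k fun τ => logProfile w τ i)
      = fun σ => ∫ τ, k (τ - 0) * logProfile w (τ + σ) i := by
    funext σ
    rw [corr_eq_shift]; rfl
  have e2 : kVec i * ∫ τ, k τ = ∫ τ, k (τ - 0) * kVec i := by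
    rw [integral_mul_const, mul_comm]; simp
  rw [e, e2]
  refine tendsto_integral_filter_of_dominated_convergence (fun τ => ‖k (τ - 0) * 1‖) ?_ ?_ h1.norm
    (Eventually.of_forall fun τ => ?_)
  · exact Eventually.of_forall fun σ =>
      (hk.integrable hm (((isBddCurve_logProfile hw).coord i).shift σ) 0).1
  · refine Eventually.of_forall fun σ => Eventually.of_forall fun τ => ?_
    rw [norm_mul, norm_mul, norm_one]
    exact mul_le_mul_of_nonneg_left ((PiLp.norm_apply_le _ i).trans (norm_logProfile hw _).le)
      (norm_nonneg _)
  · have := (tendsto_logProfile_atTop hw).comp (tendsto_atTop_add_const_left _ τ tendsto_id)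
    exact (((EuclideanSpace.proj i : Space →L[ℝ] ℝ).continuous.tendsto _).comp this).const_mul _

/-- The modulation equations of a fixed map have no solutions at large scales, and not even
approximate ones. -/
theorem exists_le_norm_modul (hm : 1 ≤ m) (hw : IsSigma m w) :
    ∃ S : ℝ, ∀ σ ≥ S, ∀ β, 1 / (2 * m) ≤ ‖modul m (logProfile w) (σ, β)‖ := by
  have hm0 : (0 : ℝ) < m := by exact_mod_cast hm
  have hq := quartic_pos hm
  have t1 := tendsto_corr_atTop hm hw (isKernel_pow_four hm).decay 2
  have t2 := tendsto_corr_atTop hm hw (isKernel_pow_three_mul hm).decay 0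
  have t3 := tendsto_corr_atTop hm hw (isKernel_pow_three_mul hm).decay 1
  have e1 : (kVec 2 : ℝ) * ∫ τ, lh₁ m τ ^ 4 = quartic m := one_mul _
  have e2 : (kVec 0 : ℝ) * ∫ τ, lh₁ m τ ^ 3 * lh₃ m τ = 0 := zero_mul _
  have e3 : (kVec 1 : ℝ) * ∫ τ, lh₁ m τ ^ 3 * lh₃ m τ = 0 := zero_mul _
  rw [e1] at t1
  rw [e2] at t2
  rw [e3] at t3
  have t := (t1.sub t2.abs).sub t3.abs
  rw [abs_zero, sub_zero, sub_zero] at t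
  -- At large scales the profile looks constantly vertical: the first numerator tends to ∫h₁⁴,
  -- uniformly in the angle, so the first component of `modul` tends to 1/m and is eventually at
  -- least half of it.
  obtain ⟨S, hS⟩ := eventually_atTop.1 (t.eventually_const_le (half_lt_self hq))
  refine ⟨S, fun σ hσ β => le_trans ?_ (norm_fst_le _)⟩
  have h := hS σ hσ
  have mk : ∀ {c x : ℝ}, |c| ≤ 1 → c * x ≤ |x| := fun hc => (le_abs_self _).trans <| by
    rw [abs_mul]; exact mul_le_of_le_one_left (abs_nonneg _) hc
  have a1 := mk (x := corr (fun τ => lh₁ m τ ^ 3 * lh₃ m τ) (fun τ => logProfile w τ 0) σ)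
    (Real.abs_cos_le_one β)
  have a2 := mk (x := corr (fun τ => lh₁ m τ ^ 3 * lh₃ m τ) (fun τ => logProfile w τ 1) σ)
    (Real.abs_sin_le_one β)
  refine le_trans ?_ (le_abs_self _)
  simp only [modul]
  rw [div_le_div_iff₀ (by positivity) (by positivity)]
  nlinarith

/-- The scale of the nearby harmonic map is bounded if the curve is bounded in `L²`. -/
theorem IsModulLift.exists_scale_le (hm : 1 ≤ m) (h : IsModulLift m I u P)
    (hF : RepresentsL2 I u w F) {N : Set ℝ} {K : ℝ} (hK : ∀ t ∈ I, t ∉ N → ‖F t‖ ≤ K) :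
    ∃ B, ∀ t ∈ I, t ∉ N → Real.exp (P t).1 ≤ B := by
  by_cases hne : ∃ t₁ ∈ I, t₁ ∉ N
  · obtain ⟨t₁, ht₁, hn₁⟩ := hne
    have hm0 : (0 : ℝ) < m := by exact_mod_cast hm
    have hq := quartic_pos hm
    -- The map at one time is used as a reference: a zero for u(t) at a large scale is an
    -- approximate zero for it, up to O(e^{−σ}) times the L² distance, which is at most 2K.
    obtain ⟨S, hS⟩ := exists_le_norm_modul hm (h.sigma t₁ ht₁)
    set A := 96 * m / quartic m * (2 * K) with hA
    refine ⟨max (Real.exp S) (2 * m * A), fun t ht hn => ?_⟩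
    rcases le_total S (P t).1 with hle | hle
    · refine le_max_of_le_right ?_
      have hf : (fun x => u t₁ x - u t x) =ᵐ[volume] (F t₁ - F t : Lp Space 2 volume) := by
        filter_upwards [hF t ht, hF t₁ ht₁, Lp.coeFn_sub (F t₁) (F t)] with x a b c
        rw [c, Pi.sub_apply, ← a, ← b]; abel
      have h1 := norm_modul_sub_modul_le hm (h.sigma t₁ ht₁) (h.sigma t ht) hf (P t)
      rw [h.zero t ht, sub_zero] at h1
      have h2 := (hS (P t).1 hle (P t).2).trans h1
      have h3 : ‖F t₁ - F t‖ ≤ 2 * K :=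
        (norm_sub_le _ _).trans (by linarith [hK t ht hn, hK t₁ ht₁ hn₁])
      have h4 : 96 * m / quartic m * Real.exp (-(P t).1) * ‖F t₁ - F t‖ ≤ A * (Real.exp (P t).1)⁻¹ := by
        rw [hA, Real.exp_neg]
        calc _ ≤ 96 * m / quartic m * (Real.exp (P t).1)⁻¹ * (2 * K) :=
              mul_le_mul_of_nonneg_left h3 (by positivity)
          _ = _ := by ring
      have h5 := h2.trans h4
      have := Real.exp_pos (P t).1
      rw [← div_eq_mul_inv, div_le_div_iff₀ (by positivity) this] at h5
      linarith
    · exact le_max_of_le_left (Real.exp_le_exp.2 hle)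
  · exact ⟨0, fun t ht hn => absurd ⟨t, ht, hn⟩ hne⟩

theorem IsModulLift.memW1Inf_scale (hm : 1 ≤ m) (hI : IsOpen I) (hc : I.OrdConnected)
    (h : IsModulLift m I u P) (hF : RepresentsL2 I u w F) (hW : MemW1Inf I F) :
    MemW1Inf I fun t => Real.exp (P t).1 := by
  obtain ⟨N, K, hN, -, hK, -⟩ := MemW1Inf.exists_lipschitz hI hc hW
  obtain ⟨C, hC⟩ := h.exists_lipschitz_scale hm hI hc hF hW
  obtain ⟨B, hB⟩ := h.exists_scale_le hm hF hK
  have hcont : ContinuousOn (fun t => Real.exp (P t).1) I := by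
    have := h.cont
    fun_prop
  refine ⟨memLp_top_of_bound (hcont.aestronglyMeasurable hI.measurableSet) B ?_,
    hasBoundedWeakDeriv_of_lipschitz hC⟩
  rw [ae_restrict_iff' hI.measurableSet]
  filter_upwards [measure_eq_zero_iff_ae_notMem.1 hN] with t hn ht
  rw [Real.norm_of_nonneg (Real.exp_pos _).le]
  exact hB t ht hn

end

end EquivariantMaps

/-! ### Assembly of the proposition. -/

theorem proposition3p3 (m : ℕ) (hm : 1 ≤ m) :
    ∃ δ₀ > (0 : ℝ), ∃ C > (0 : ℝ),
    ∃ (s : (Plane → Space) → ℝ) (α : (Plane → Space) → Real.Angle),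
      -- closest parameters exist; existence, orthogonality, closeness and local uniqueness
      (∀ u : Plane → Space, IsSigma m u → excess m u < δ₀ →
        (∃ s' α', IsClosest m u s' α') ∧
        0 < s u ∧
        MemHe (zCoord m u (s u) (α u)) ∧
        Orthogonal m u (s u) (α u) ∧
        ∀ sStar αStar, IsClosest m u sStar αStar →
          |s u / sStar - 1| + ‖α u - αStar‖ ≤ C * excess m u ∧
          ∀ (s' : ℝ) (α' : Real.Angle), 0 < s' → Orthogonal m u s' α' →
            |s' / sStar - 1| + ‖α' - αStar‖ ≤ C * δ₀ → s' = s u ∧ α' = α u) ∧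
      -- regularity in time
      (∀ (I : Set ℝ) (u : ℝ → Plane → Space), IsOpen I → I.OrdConnected →
        ContInSigma m I u → (∀ t ∈ I, excess m (u t) < δ₀) →
        (IsC1L2 I u →
          ContDiffOn ℝ 1 (fun t => s (u t)) I ∧
          ∃ a : ℝ → ℝ, (∀ t ∈ I, (a t : Real.Angle) = α (u t)) ∧ ContDiffOn ℝ 1 a I) ∧
        (IsW1InfL2 I u →
          ContinuousOn (fun t => s (u t)) I ∧ MemW1Inf I (fun t => s (u t)) ∧
          ∃ a : ℝ → ℝ, (∀ t ∈ I, (a t : Real.Angle) = α (u t)) ∧ ContinuousOn a I ∧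
            ∀ J ⊆ I, IsOpen J → J.OrdConnected → (∃ c > 0, ∀ t ∈ J, c ≤ s (u t)) →
              HasBoundedWeakDeriv J a ∧ (Bornology.IsBounded J → MemW1Inf J a))) := by
  obtain ⟨ρ, ε, κ, hS⟩ := exists_isModulScale hm
  obtain ⟨δ₀, hδ, C, hC, hmod⟩ := exists_modulation hm hS
  -- The parameters are made total functions of the map; outside the neighbourhood they take an
  -- arbitrary value.
  have hex : ∀ u : Plane → Space, ∃ (σ : ℝ) (α : Real.Angle), IsSigma m u → excess m u < δ₀ →
      IsModulParam m ρ ε κ u σ α := by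
    intro u
    by_cases h : IsSigma m u ∧ excess m u < δ₀
    · obtain ⟨-, ⟨σ₀, α₀, h₀⟩, -⟩ := hmod u h.1 h.2
      obtain ⟨σ, α, hp⟩ := hS.exists_isModulParam hm h.1 (h₀.trans (by linarith [hS.ε_pos]))
      exact ⟨σ, α, fun _ _ => hp⟩
    · exact ⟨0, 0, fun h1 h2 => absurd ⟨h1, h2⟩ h⟩
  choose σ α hpar using hex
  refine ⟨δ₀, hδ, C, hC, fun u => Real.exp (σ u), α, fun u hu hlt => ?_, ?_⟩
  · obtain ⟨hclosest, -, huniq⟩ := hmod u hu hlt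
    exact ⟨hclosest, Real.exp_pos _, memHe_zCoord hm hu _ _, (hpar u hu hlt).orthogonal,
      huniq _ _ (hpar u hu hlt)⟩
  · intro I u hI hc hu hlt
    have hcurve : IsModulCurve m ρ ε κ I u (fun t => σ (u t)) fun t => α (u t) :=
      ⟨hu, fun t ht => (hmod (u t) (hu.1 t ht) (hlt t ht)).2.1,
        fun t ht => hpar (u t) (hu.1 t ht) (hlt t ht)⟩
    -- A single lift of the angle, obtained from continuity alone, serves both regularity
    -- statements.
    obtain ⟨a, ha, hlift⟩ := hcurve.exists_lift hS hm hI hc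
    constructor
    · rintro ⟨w, F, hF, hF1⟩
      have hP := hlift.contDiffOn hm hI hF hF1
      exact ⟨Real.contDiff_exp.comp_contDiffOn (contDiff_fst.comp_contDiffOn hP), a, ha,
        contDiff_snd.comp_contDiffOn hP⟩
    · rintro ⟨w, F, hF, hW⟩
      have hac : ContinuousOn a I := continuous_snd.comp_continuousOn hlift.cont
      refine ⟨Real.continuous_exp.comp_continuousOn (continuous_fst.comp_continuousOn hlift.cont),
        hlift.memW1Inf_scale hm hI hc hF hW, a, ha, hac, ?_⟩
      rintro J hJI hJo hJc ⟨c, hc0, hle⟩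
      obtain ⟨K, hK⟩ := hlift.exists_lipschitz_phase hm hI hc hF hW hJI hJc hc0 hle
      exact ⟨hasBoundedWeakDeriv_of_lipschitz hK,
        fun hb => memW1Inf_of_lipschitz hJo hb hK (hac.mono hJI)⟩
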